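/- **Setting.** Let $a_-<a_+$, $t_0<T$, $P_-\le P_+$, and put $S=\mathbb R\times[t_0,T]\times[P_-,P_+]$. Let $H(x,t,\rho)$ be a $C^2$ function which is increasing and convex in $\rho$ on $S$. Let $b(x,t,\rho)$ be a bounded $C^1$ function with $b\le 0$ and $$b_t+H_xb_\rho-H_\rho b_x=H_{\rho\rho}b^2+2H_{\rho x}b+H_{xx}\qquad\text{on } S .$$ (Outside $S$, $H$ and $b$ are arbitrary extensions: $H$ of class $C^2$, and $b$ of class $C^1$ and bounded for $t\in[t_0,T]$.) Let $f(x,t,\rho_-,\rho_+)\ge 0$ be a kernel that is continuous on $\{t_0\le t\le T,\ P_-\le\rho_-\le\rho_+\le P_+\}$ and vanishes unless $P_-\le\rho_-\le\rho_+\le P_+$. Write $$v(x,t,\rho_-,\rho_+)=\frac{H(x,t,\rho_-)-H(x,t,\rho_+)}{\rho_--\rho_+}\ \ (=H_\rho \text{ if } \rho_-=\rho_+),\qquad \beta=H_x+bH_\rho,$$ $$K(x,t,\rho_+,\rho_-)=b(x,t,\rho_+)\,v(x,t,\rho_-,\rho_+)-\beta(x,t,\rho_+),\qquad f^2=vf,$$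 and let $\phi_a^x(m;t)$ be the value at $x$ of the solution of $d\rho/dx=b(x,t,\rho)$ with $\rho(a)=m$. **Particle system.** A configuration is $\mathbf q=((x_0,\rho_0),\dots,(x_n,\rho_n))$ with $a_-=x_0<x_1<\dots<x_n\le a_+$. It defines the profile $\rho(x,t;\mathbf q)=\phi_{x_i}^x(\rho_i;t)$ for $x_i\le x<x_{i+1}$, $0\le i<n$, and $\rho(x,t;\mathbf q)=\phi_{x_n}^x(\rho_n;t)$ for $x_n\le x\le a_+$. Put $\hat\rho_{i-1}=\phi_{x_{i-1}}^{x_i}(\rho_{i-1};t)$ for $1\le i\le n$ and $\hat\rho_n=\phi_{x_n}^{a_+}(\rho_n;t)$. A *particle path* is a path $\mathbf q(t)$, $t\in[t_0,T)$, such that: - at $t=t_0$, $x_n<a_+$ and $\hat\rho_{i-1}<\rho_i$ for $1\le i\le n$; - there are finitely many event times; strictly between events $a_-=x_0<\dots<x_n<a_+$ and $$\dot\rho_0=\beta(a_-,t,\rho_0),\qquad \dot x_i=-v(x_i,t,\hat\rho_{i-1},\rho_i),\qquad \dot\rho_i=-K(x_i,t,\rho_i,\hat\rho_{i-1})\quad(1\le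 i\le n);$$ - at an event, whenever $x_i=x_{i+1}$ (for $i=0$: $x_1$ reaches $a_-$) the particle $(x_i,\rho_i)$ is removed and the particles to its right are relabelled; moreover a new last particle $(a_+,m)$ with $m>\hat\rho_n$ may enter; apart from this $\mathbf q$ is continuous; - $\rho(x,t;\mathbf q(t))\in[P_-,P_+]$ for all $x\in[a_-,a_+]$, $t\in[t_0,T)$. The *random particle system* is a process $\mathbf q(t)$, adapted to a filtration $(\mathcal F_t)_{t\in[t_0,T)}$ on a probability space, whose paths are particle paths and for which particles $(a_+,\rho_{n+1})$ enter with rate $f^2(a_+,t,\hat\rho_n,\rho_{n+1})\,d\rho_{n+1}$. That is, for each Borel set $B$, the number of entries in $(t_0,t]$ with value in $B$, minus $\int_{t_0}^t\int_B f^2(a_+,\theta,\hat\rho_n(\theta),r)\,dr\,d\theta$, is an $(\mathcal F_t)$-martingale. An *entropy solution* of $\rho_t=H(x,t,\rho)_x$ in $(a_-,a_+)\times(t_0,T)$ is a measurable $[P_-,P_+]$-valued function that solves the equation in the weak sense and satisfies, in the weak sense and for every $c\in[P_-,P_+]$, $$|\rho-c|_t\le\big(\mathrm{sgn}(\rho-c)(H(x,t,\rho)-H(x,t,c))\big)_x+\mathrm{sgn}(\rho-c)H_x(x,t,c).$$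 A function on $[a_-,a_+]\times[t_0,T)$ is *piecewise $C^1$* if it is $C^1$ (up to the boundary) off the graphs of finitely many continuous curves $x=\gamma_j(t)$, $t\in[\alpha_j,\delta_j]$, where $\gamma_j$ is $C^1$ on $(\alpha_j,\delta_j)$ with values there in $(a_-,a_+)$. **Proposition 2.1.** (i) For every particle path $\mathbf q$ (hence for every realization of the random particle system), $\rho(x,t)=\rho(x,t;\mathbf q(t))$ is an entropy solution of $\rho_t=H(x,t,\rho)_x$ in $(a_-,a_+)\times(t_0,T)$. (ii) For the random particle system, $m(t)=\rho(a_+,t;\mathbf q(t))$, $t\in[t_0,T)$, is a Markov process with respect to $(\mathcal F_t)$ with generator $$(\mathcal A^2_{a_+,t}\psi)(\rho)=\beta(a_+,t,\rho)\psi'(\rho)+\int_\rho^\infty f^2(a_+,t,\rho,\rho_+)\big(\psi(\rho_+)-\psi(\rho)\big)\,d\rho_+ .$$ That is, $m$ is adapted and has the Markov property, and $\psi(m(t))-\int_{t_0}^t(\mathcal A^2_{a_+,\theta}\psi)(m(\theta))\,d\theta$ is an $(\mathcal F_t)$-martingale for every compactly supported $C^1$ function $\psi$. (iii) Let $\rho,\rho':[a_-,a_+]\times[t_0,T)\to[P_-,P_+]$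 be two piecewise $C^1$ entropy solutions of $\rho_t=H(x,t,\rho)_x$ in $(a_-,a_+)\times(t_0,T)$, and let $t_0\le s\le t<T$. Then $$\int_{a_-}^{a_+}|\rho'(x,t)-\rho(x,t)|\,dx\le e^{C_0(t-s)}\int_{a_-}^{a_+}|\rho'(x,s)-\rho(x,s)|\,dx+e^{C_0(t-s)}\int_s^t\big|H(a_+,\theta,\rho'(a_+,\theta))-H(a_+,\theta,\rho(a_+,\theta))\big|\,d\theta,$$ where $C_0=\max\{|H_{x\rho}(x,t,\rho)|:\ x\in[a_-,a_+],\ t\in[t_0,T],\ \rho\in[P_-,P_+]\}$. (Part (iii) uses only the assumptions on $H$.) -/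

import Mathlib

open MeasureTheory ProbabilityTheory Set
open scoped ContDiff

universe u

namespace ShockParticles

noncomputable section

/-! ### The Hamiltonian, the drift and the jump kernel

A function of `(x, t, ρ)` is written in curried form. -/

/-- Partial derivative in `x` of `G (x, t, ρ)`. -/
def dX (G : ℝ → ℝ → ℝ → ℝ) (x t r : ℝ) : ℝ := deriv (fun y => G y t r) x

/-- Partial derivative in `t` of `G (x, t, ρ)`. -/
def dT (G : ℝ → ℝ → ℝ → ℝ) (x t r : ℝ) : ℝ := deriv (fun s => G x s r) t

/-- Partial derivative in `ρ` of `G (x, t, ρ)`. -/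
def dR (G : ℝ → ℝ → ℝ → ℝ) (x t r : ℝ) : ℝ := deriv (fun p => G x t p) r

/-- The standing assumptions on the Hamiltonian: it is of class `C²`, and on the slab
`ℝ × [t₀, T] × [PL, PR]` it is increasing and convex in `ρ`.
(A `C²` function on this closed convex slab extends to a `C²` function on the whole space; `H`
stands for such an extension, and nothing else is required of it outside the slab.) -/
structure IsHamiltonian (H : ℝ → ℝ → ℝ → ℝ) (t₀ T PL PR : ℝ) : Prop where
  smooth : ContDiff ℝ 2 (fun z : ℝ × ℝ × ℝ => H z.1 z.2.1 z.2.2)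
  mono : ∀ x, ∀ t ∈ Icc t₀ T, MonotoneOn (H x t) (Icc PL PR)
  convex : ∀ x, ∀ t ∈ Icc t₀ T, ConvexOn ℝ (Icc PL PR) (H x t)

/-- The standing assumptions on the drift: `b` is a bounded `C¹` function, and on the slab
`ℝ × [t₀, T] × [PL, PR]` it is nonpositive and solves
`b_t + H_x b_ρ - H_ρ b_x = H_ρρ b² + 2 H_ρx b + H_xx`.
(As for `H`, outside of the slab `b` is an arbitrary bounded `C¹` extension.) -/
structure IsDrift (H b : ℝ → ℝ → ℝ → ℝ) (t₀ T PL PR : ℝ) : Prop where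
  smooth : ContDiff ℝ 1 (fun z : ℝ × ℝ × ℝ => b z.1 z.2.1 z.2.2)
  bounded : ∃ B : ℝ, ∀ x, ∀ t ∈ Icc t₀ T, ∀ r, |b x t r| ≤ B
  nonpos : ∀ x, ∀ t ∈ Icc t₀ T, ∀ r ∈ Icc PL PR, b x t r ≤ 0
  pde : ∀ x, ∀ t ∈ Icc t₀ T, ∀ r ∈ Icc PL PR,
    dT b x t r + dX H x t r * dR b x t r - dR H x t r * dX b x t r
      = dR (dR H) x t r * (b x t r) ^ 2 + 2 * dX (dR H) x t r * b x t r + dX (dX H) x t r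

/-- The assumptions on the jump kernel `f (x, t, ρ₋, ρ₊)`: it is nonnegative, continuous on the
closed set `PL ≤ ρ₋ ≤ ρ₊ ≤ PR`, `t₀ ≤ t ≤ T`, and it vanishes off `PL ≤ ρ₋ ≤ ρ₊ ≤ PR`. -/
structure IsKernel (f : ℝ → ℝ → ℝ → ℝ → ℝ) (t₀ T PL PR : ℝ) : Prop where
  nonneg : ∀ x, ∀ t ∈ Icc t₀ T, ∀ r r', 0 ≤ f x t r r'
  cont : ContinuousOn (fun z : ℝ × ℝ × ℝ × ℝ => f z.1 z.2.1 z.2.2.1 z.2.2.2)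
    {z | z.2.1 ∈ Icc t₀ T ∧ PL ≤ z.2.2.1 ∧ z.2.2.1 ≤ z.2.2.2 ∧ z.2.2.2 ≤ PR}
  support : ∀ x, ∀ t ∈ Icc t₀ T, ∀ r r', ¬ (PL ≤ r ∧ r ≤ r' ∧ r' ≤ PR) → f x t r r' = 0

/-- The divided difference `v (x, t, ρ₋, ρ₊) = (H (ρ₋) - H (ρ₊)) / (ρ₋ - ρ₊)`, with its limit
`H_ρ` on the diagonal.  A shock between `ρ₋` and `ρ₊` moves with velocity `- v`. -/
def speed (H : ℝ → ℝ → ℝ → ℝ) (x t rm rp : ℝ) : ℝ := dslope (H x t) rm rp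

/-- `β = H_x + b H_ρ`. -/
def driftT (H b : ℝ → ℝ → ℝ → ℝ) (x t r : ℝ) : ℝ := dX H x t r + b x t r * dR H x t r

/-- `K (x, t, ρ₊, ρ₋) = b (x, t, ρ₊) v (x, t, ρ₋, ρ₊) - β (x, t, ρ₊)`. -/
def kay (H b : ℝ → ℝ → ℝ → ℝ) (x t rp rm : ℝ) : ℝ :=
  b x t rp * speed H x t rm rp - driftT H b x t rp

open Classical in
/-- `driftFlow b t a m x` is `φ_a^x (m; t)`: the value at `x` of the solution on `ℝ` of
`dρ/dx = b (x, t, ρ)` with `ρ (a) = m`.  For a bounded `C¹` drift it exists and is unique. -/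
def driftFlow (b : ℝ → ℝ → ℝ → ℝ) (t a m : ℝ) : ℝ → ℝ :=
  if h : ∃ r : ℝ → ℝ, r a = m ∧ ∀ x, HasDerivAt r (b x t (r x)) x then h.choose else fun _ => m

/-! ### Configurations and the particle dynamics -/

/-- Configurations `((x₀, ρ₀), …, (xₙ, ρₙ))`. -/
abbrev Config : Type := Σ n : ℕ, Fin (n + 1) → ℝ × ℝ

open Classical in
/-- The profile `ρ (x, t; q)`: on `[xᵢ, xᵢ₊₁)` it is `φ_{xᵢ}^x (ρᵢ; t)`; the last interval is
`[xₙ, a₊]`, so that the value at the right end point `a₊` is `φ_{xₙ}^{a₊} (ρₙ; t)`. -/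
def profile (b : ℝ → ℝ → ℝ → ℝ) (q : Config) (t x : ℝ) : ℝ :=
  ∑ i : Fin (q.1 + 1),
    if (q.2 i).1 ≤ x ∧ ∀ j, i < j → x < (q.2 j).1 then driftFlow b t (q.2 i).1 (q.2 i).2 x else 0

/-- `ρ̂_{i}`: the value just to the left of the particle number `i + 1`. -/
def leftValue (b : ℝ → ℝ → ℝ → ℝ) {n : ℕ} (c : Fin (n + 1) → ℝ × ℝ) (t : ℝ) (i : Fin n) : ℝ :=
  driftFlow b t (c i.castSucc).1 (c i.castSucc).2 (c i.succ).1

/-- Admissible initial configurations: `a₋ = x₀ < x₁ < … < xₙ < a₊`, with upward jumps at the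
positions `x₁, …, xₙ`. -/
def IsAdmissible (b : ℝ → ℝ → ℝ → ℝ) (aL aR t : ℝ) (q : Config) : Prop :=
  (q.2 0).1 = aL ∧ StrictMono (fun i => (q.2 i).1) ∧ (q.2 (Fin.last q.1)).1 < aR ∧
    ∀ i : Fin q.1, leftValue b q.2 t i < (q.2 i.succ).2

/-- Between two events, i.e. for times in `[s, s']`, the `n + 1` particles `c` stay ordered in
`[a₋, a₊)` and solve
`x₀ = a₋`, `ρ₀' = β (x₀, t, ρ₀)`, `xᵢ' = - v (xᵢ, t, ρ̂ᵢ₋₁, ρᵢ)`,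
`ρᵢ' = - K (xᵢ, t, ρᵢ, ρ̂ᵢ₋₁)`.  The value `c s'` is the configuration just before the next
event; at time `s` a particle may sit at `a₊`. -/
structure IsFlowPiece (H b : ℝ → ℝ → ℝ → ℝ) (aL aR s s' : ℝ) {n : ℕ}
    (c : ℝ → Fin (n + 1) → ℝ × ℝ) : Prop where
  cont : ContinuousOn c (Icc s s')
  left : ∀ t ∈ Ioo s s', (c t 0).1 = aL
  order : ∀ t ∈ Ioo s s', StrictMono (fun i => (c t i).1)
  right : ∀ t ∈ Ioo s s', (c t (Fin.last n)).1 < aR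
  first : ∀ t ∈ Ioo s s', HasDerivAt (fun τ => (c τ 0).2) (driftT H b (c t 0).1 t (c t 0).2) t
  position : ∀ t ∈ Ioo s s', ∀ i : Fin n,
    HasDerivAt (fun τ => (c τ i.succ).1)
      (-speed H (c t i.succ).1 t (leftValue b (c t) t i) (c t i.succ).2) t
  value : ∀ t ∈ Ioo s s', ∀ i : Fin n,
    HasDerivAt (fun τ => (c τ i.succ).2)
      (-kay H b (c t i.succ).1 t (c t i.succ).2 (leftValue b (c t) t i)) t

/-- One collision `xᵢ = xᵢ₊₁`: the particle `(xᵢ, ρᵢ)` is removed and the particles to its right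
are relabelled.  For `i = 0` this is the arrival of `x₁` at `a₋`. -/
def MergeStep (q q' : Config) : Prop :=
  ∃ (n : ℕ) (c : Fin (n + 2) → ℝ × ℝ) (i : Fin (n + 1)),
    (c i.castSucc).1 = (c i.succ).1 ∧ q = ⟨n + 1, c⟩ ∧
      q' = ⟨n, fun j => c (i.castSucc.succAbove j)⟩

/-- All collisions are resolved, one after the other. -/
def Merged (q q' : Config) : Prop :=
  Relation.ReflTransGen MergeStep q q' ∧ StrictMono (fun i => (q'.2 i).1)

/-- A new particle is added at the right end of the configuration. -/
def addLast (q : Config) (p : ℝ × ℝ) : Config :=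
  ⟨q.1 + 1, Fin.snoc (α := fun _ => ℝ × ℝ) q.2 p⟩

/-- The configuration just before an event at time `t` is `q`, and just after it is `q'`:
collisions are resolved, and possibly a new particle `(a₊, m)` enters, where `m` is larger than
the value at `a₊` before the entry. -/
def IsEvent (b : ℝ → ℝ → ℝ → ℝ) (aR t : ℝ) (q q' : Config) : Prop :=
  Merged q q' ∨ ∃ (r : Config) (m : ℝ), Merged q r ∧ profile b r t aR < m ∧ q' = addLast r (aR, m)

/-- A path `q (t)`, `t₀ ≤ t < T`, of the particle system: it starts from an admissible
configuration, there are finitely many events, between events it follows the differential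
equations, at an event particles collide or a particle enters at `a₊`; the
values of the associated profile are in `[PL, PR]`, where `H` and `b` live. -/
structure IsParticlePath (H b : ℝ → ℝ → ℝ → ℝ) (aL aR t₀ T PL PR : ℝ) (q : ℝ → Config) :
    Prop where
  initial : IsAdmissible b aL aR t₀ (q t₀)
  evolution : ∃ (N : ℕ) (s : ℕ → ℝ), s 0 = t₀ ∧ s (N + 1) = T ∧
    ∀ k ≤ N, s k < s (k + 1) ∧
      ∃ (n : ℕ) (c : ℝ → Fin (n + 1) → ℝ × ℝ),
        IsFlowPiece H b aL aR (s k) (s (k + 1)) c ∧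
        (∀ t ∈ Ico (s k) (s (k + 1)), q t = ⟨n, c t⟩) ∧
        (k < N → IsEvent b aR (s (k + 1)) ⟨n, c (s (k + 1))⟩ (q (s (k + 1))))
  range : ∀ t ∈ Ico t₀ T, ∀ x ∈ Icc aL aR, profile b (q t) t x ∈ Icc PL PR

/-- The number of particles that enter at `a₊` during `(t₀, t]` with a value in `B`. -/
def entries (aR t₀ : ℝ) (q : ℝ → Config) (B : Set ℝ) (t : ℝ) : ℕ :=
  Set.ncard {s | s ∈ Ioc t₀ t ∧ ((q s).2 (Fin.last (q s).1)).1 = aR ∧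
    ((q s).2 (Fin.last (q s).1)).2 ∈ B}

/-- The random particle system, as an adapted process on a filtered probability space.
Its paths are paths of the particle system, and particles enter at `a₊` with rate
`f² (a₊, t, ρ̂ₙ, ρₙ₊₁) dρₙ₊₁`, `f² = v f`, where `ρ̂ₙ` is the value of the profile at `a₊`:
for every Borel set `B` the number of entries with value in `B`, minus the time integral of the
rate of `B`, is a martingale (i.e. `f²` is the stochastic intensity of the entries). -/
structure IsParticleProcess (H b : ℝ → ℝ → ℝ → ℝ) (f : ℝ → ℝ → ℝ → ℝ → ℝ)
    (aL aR t₀ T PL PR : ℝ) {Ω : Type u} [mΩ : MeasurableSpace Ω] (μ : Measure Ω)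
    (F : Filtration (Ico t₀ T) mΩ) (q : ℝ → Ω → Config) : Prop where
  adapted : ∀ t : Ico t₀ T, Measurable[F t] (q t)
  path : ∀ w, IsParticlePath H b aL aR t₀ T PL PR (fun t => q t w)
  rate : ∀ B : Set ℝ, MeasurableSet B →
    Martingale (fun (t : Ico t₀ T) w =>
      (entries aR t₀ (fun s => q s w) B t : ℝ) -
        ∫ s in t₀..t, ∫ r in B,
          speed H aR s (profile b (q s w) s aR) r * f aR s (profile b (q s w) s aR) r) F μ

/-! ### Markov processes with a given generator -/

/-- The operator `A²` at `(x, t)`: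
`(A² ψ) (ρ) = β (x, t, ρ) ψ' (ρ) + ∫_ρ^∞ f² (x, t, ρ, r) (ψ (r) - ψ (ρ)) dr` with `f² = v f`. -/
def genTwo (H b : ℝ → ℝ → ℝ → ℝ) (f : ℝ → ℝ → ℝ → ℝ → ℝ) (x t : ℝ) (ψ : ℝ → ℝ) (ρ : ℝ) : ℝ :=
  driftT H b x t ρ * deriv ψ ρ +
    ∫ r in Ioi ρ, speed H x t ρ r * f x t ρ r * (ψ r - ψ ρ)

/-- The real process `(m_t)`, `t₀ ≤ t < T`, is a Markov process for the filtration `F` with the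
time dependent generator `A_t`: it is adapted, has the Markov property, and solves the martingale
problem for `A`, with compactly supported `C¹` test functions. -/
structure IsMarkovWithGenerator {t₀ T : ℝ} (A : ℝ → (ℝ → ℝ) → ℝ → ℝ)
    {Ω : Type u} [mΩ : MeasurableSpace Ω] (μ : Measure Ω)
    (F : Filtration (Ico t₀ T) mΩ) (m : ℝ → Ω → ℝ) : Prop where
  adapted : ∀ t : Ico t₀ T, Measurable[F t] (m t)
  markov : ∀ s t : Ico t₀ T, s ≤ t → ∀ B : Set ℝ, MeasurableSet B →
    μ[(m t ⁻¹' B).indicator (fun _ => (1 : ℝ)) | F s] =ᵐ[μ]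
      μ[(m t ⁻¹' B).indicator (fun _ => (1 : ℝ)) | MeasurableSpace.comap (m s) inferInstance]
  generator : ∀ ψ : ℝ → ℝ, ContDiff ℝ 1 ψ → HasCompactSupport ψ →
    Martingale (fun (t : Ico t₀ T) w => ψ (m t w) - ∫ s in t₀..t, A s ψ (m s w)) F μ

/-! ### Entropy solutions -/

/-- Test functions: smooth with compact support in `(a₋, a₊) × (t₀, T)`. -/
def IsTest (aL aR t₀ T : ℝ) (φ : ℝ × ℝ → ℝ) : Prop :=
  ContDiff ℝ ∞ φ ∧ HasCompactSupport φ ∧ tsupport φ ⊆ Ioo aL aR ×ˢ Ioo t₀ T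

/-- `[PL, PR]`-valued entropy solutions of `ρ_t = H (x, t, ρ)_x` in `(a₋, a₊) × (t₀, T)`: weak
solutions with the Kruzhkov inequalities
`|ρ - c|_t ≤ (sgn (ρ - c) (H (x, t, ρ) - H (x, t, c)))_x + sgn (ρ - c) H_x (x, t, c)`
in the weak sense for all constants `c ∈ [PL, PR]`. -/
structure IsEntropySolution (H : ℝ → ℝ → ℝ → ℝ) (aL aR t₀ T PL PR : ℝ) (ρ : ℝ → ℝ → ℝ) :
    Prop where
  measurable : AEStronglyMeasurable (fun z : ℝ × ℝ => ρ z.1 z.2)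
    (volume.restrict (Ioo aL aR ×ˢ Ioo t₀ T))
  range : ∀ x ∈ Ioo aL aR, ∀ t ∈ Ioo t₀ T, ρ x t ∈ Icc PL PR
  weak : ∀ φ : ℝ × ℝ → ℝ, IsTest aL aR t₀ T φ →
    ∫ z in Ioo aL aR ×ˢ Ioo t₀ T,
      (ρ z.1 z.2 * fderiv ℝ φ z (0, 1) - H z.1 z.2 (ρ z.1 z.2) * fderiv ℝ φ z (1, 0)) = 0
  entropy : ∀ φ : ℝ × ℝ → ℝ, IsTest aL aR t₀ T φ → (∀ z, 0 ≤ φ z) → ∀ c ∈ Icc PL PR,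
    0 ≤ ∫ z in Ioo aL aR ×ˢ Ioo t₀ T,
      (|ρ z.1 z.2 - c| * fderiv ℝ φ z (0, 1)
        - Real.sign (ρ z.1 z.2 - c) * (H z.1 z.2 (ρ z.1 z.2) - H z.1 z.2 c) * fderiv ℝ φ z (1, 0)
        + Real.sign (ρ z.1 z.2 - c) * dX H z.1 z.2 c * φ z)

/-- Piecewise `C¹` functions on `[a₋, a₊] × [t₀, T)`: off the graphs of finitely many `C¹` curves
`x = γⱼ (t)`, `t ∈ [αⱼ, δⱼ]`, which touch the lines `x = a₋` and `x = a₊` at most at their end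
points, the function is `C¹` (up to the boundary of the rectangle). -/
def IsPiecewiseC1 (aL aR t₀ T : ℝ) (ρ : ℝ → ℝ → ℝ) : Prop :=
  ∃ (J : ℕ) (α δ : Fin J → ℝ) (γ : Fin J → ℝ → ℝ),
    (∀ j, α j ≤ δ j ∧ ContinuousOn (γ j) (Icc (α j) (δ j)) ∧
      ContDiffOn ℝ 1 (γ j) (Ioo (α j) (δ j)) ∧ ∀ t ∈ Ioo (α j) (δ j), γ j t ∈ Ioo aL aR) ∧
    ContDiffOn ℝ 1 (fun z : ℝ × ℝ => ρ z.1 z.2)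
      ((Icc aL aR ×ˢ Ico t₀ T) \ ⋃ j, {z | z.2 ∈ Icc (α j) (δ j) ∧ z.1 = γ j z.2})

/-- `C₀`, the maximum of `|H_xρ|` over `[a₋, a₊] × [t₀, T] × [PL, PR]`. -/
def stabConst (H : ℝ → ℝ → ℝ → ℝ) (aL aR t₀ T PL PR : ℝ) : ℝ :=
  sSup ((fun z : ℝ × ℝ × ℝ => |dX (dR H) z.1 z.2.1 z.2.2|) ''
    (Icc aL aR ×ˢ Icc t₀ T ×ˢ Icc PL PR))

end

end ShockParticles

/-!
Along a particle path, the profile between two particles is a solution of `ρ_x = b (x, t, ρ)`.  The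
equation for `b` is the compatibility condition which makes this solution evolve by
`ρ_t = β (x, t, ρ) = H (x, t, ρ)_x`, as long as its end point moves as prescribed by `v` and `K`
(`hasFDerivAt_driftFlow_curve`).

**Entropy solution.**  The particles carry upward jumps that move with the Rankine-Hugoniot speed
`- v`.  An upward jump stays an upward jump (`IsGoodPiece.jump`), and as `H` is convex in `ρ` such
jumps satisfy the entropy condition (`kruzhkov_jump_nonpos`).  Collisions do not change the profile,
so it is enough to differentiate `∫ η (ρ) φ dx` for a smooth `η` between two events
(`IsGoodPiece.hasDerivAt_entropy`), to add over the events, and to let `η` tend to `|· - c|`.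

**Markov process.**  Between entries, `m (t) = ρ (a₊, t)` solves `m' = β (a₊, t, m)`, and at an entry
it jumps to the value of the new particle (`IsParticlePath.exists_isJumpPath`).  The assumption on
the rates compensates the number of jumps into a Borel set.  By linearity and
approximation on time grids it compensates the jumps of `W (t, m (t))` for continuous `W`
(`IsJumpProcess.compensation`), which gives Dynkin's formula and the martingale problem.  For the
Markov property, let `Y` be known at time `s` and orthogonal to all functions of `m (s)`.  Dynkin's
formula for `W (τ, ·) = h ∘ Φ`, where `Φ` is the flow of `β` from `τ` to `t`, has no drift term, and
it writes `E [Y h (m (t))]` as a time integral of `E [Y k (τ, m (τ))]` with `|k| ≤ A |h|`.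
Iterating, `|E [Y h (m (t))]|` is at most a multiple of `(A (t - s))ⁿ / n!` for all `n`, so that it
vanishes (`IsJumpProcess.integral_mul_comp_eq_zero`).

**Stability.**  Kruzhkov's doubling of variables, with two solutions that are continuous off finitely
many curves (`kruzhkov_contraction`), gives `∂_t |ρ' - ρ| ≤ ∂_x |H (ρ') - H (ρ)|` in the weak
sense; the zero order terms cancel.  Tested with cutoffs of the rectangle this is the claimed bound,
even with `C₀ = 0`: the flux through `a₋` has the good sign because `H` is increasing in `ρ`.
-/

open Filter Topology
open scoped Interval

namespace ShockParticles

/-! ### Scalar differential equations with a bounded, locally Lipschitz right-hand side -/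

theorem gronwallBound_le_mul_exp {δ K ε x : ℝ} (hK : 0 ≤ K) (hε : 0 ≤ ε) :
    gronwallBound δ K ε x ≤ (δ + ε * x) * Real.exp (K * x) := by
  rcases hK.eq_or_lt with h | h
  · subst h
    simp [gronwallBound_K0]
  · rw [gronwallBound_of_K_ne_0 h.ne', add_mul]
    have h1 : Real.exp (K * x) - 1 ≤ K * x * Real.exp (K * x) := by
      have h2 := Real.add_one_le_exp (-(K * x))
      have h3 : Real.exp (-(K * x)) * Real.exp (K * x) = 1 := by
        rw [← Real.exp_add]; simp
      nlinarith [Real.exp_pos (K * x)]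
    have h4 : ε / K * (Real.exp (K * x) - 1) ≤ ε / K * (K * x * Real.exp (K * x)) :=
      mul_le_mul_of_nonneg_left h1 (by positivity)
    have h5 : ε / K * (K * x * Real.exp (K * x)) = ε * x * Real.exp (K * x) := by
      field_simp
    linarith

/-- Grönwall's inequality for a function that is only differentiable in the open interval. -/
theorem abs_right_le_of_abs_deriv_le {d d' : ℝ → ℝ} {a b K ε : ℝ} (hK : 0 ≤ K) (hε : 0 ≤ ε)
    (hab : a ≤ b) (hc : ContinuousOn d (Icc a b)) (hd : ∀ y ∈ Ioo a b, HasDerivAt d (d' y) y)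
    (hb : ∀ y ∈ Ioo a b, |d' y| ≤ K * |d y| + ε) :
    |d b| ≤ (|d a| + ε * (b - a)) * Real.exp (K * (b - a)) := by
  rcases hab.eq_or_lt with h | h
  · subst h; simp
  have key : ∀ c ∈ Ioo a b, |d b| ≤ (|d c| + ε * (b - c)) * Real.exp (K * (b - c)) := by
    intro c hcm
    have := norm_le_gronwallBound_of_norm_deriv_right_le (f := d) (f' := d') (δ := |d c|)
      (K := K) (ε := ε) (a := c) (b := b) (hc.mono (Icc_subset_Icc_left hcm.1.le))
      (fun x hx => (hd x ⟨hcm.1.trans_le hx.1, hx.2⟩).hasDerivWithinAt) le_rfl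
      (fun x hx => hb x ⟨hcm.1.trans_le hx.1, hx.2⟩) b ⟨hcm.2.le, le_rfl⟩
    exact this.trans (gronwallBound_le_mul_exp hK hε)
  have hlim : Tendsto (fun c => (|d c| + ε * (b - c)) * Real.exp (K * (b - c))) (𝓝[>] a)
      (𝓝 ((|d a| + ε * (b - a)) * Real.exp (K * (b - a)))) := by
    have h1 : Tendsto d (𝓝[>] a) (𝓝 (d a)) := by
      have := (hc a ⟨le_rfl, h.le⟩)
      exact (this.mono_left (nhdsWithin_le_of_mem (mem_of_superset (Ioo_mem_nhdsGT h)
        Ioo_subset_Icc_self)))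
    have h2 : Tendsto (fun c : ℝ => c) (𝓝[>] a) (𝓝 a) := nhdsWithin_le_nhds
    exact ((h1.abs).add ((h2.const_sub b).const_mul ε)).mul
      ((Real.continuous_exp.tendsto _).comp ((h2.const_sub b).const_mul K))
  exact ge_of_tendsto hlim (mem_of_superset (Ioo_mem_nhdsGT h) key)

theorem abs_left_le_of_abs_deriv_le {d d' : ℝ → ℝ} {a b K ε : ℝ} (hK : 0 ≤ K) (hε : 0 ≤ ε)
    (hab : a ≤ b) (hc : ContinuousOn d (Icc a b)) (hd : ∀ y ∈ Ioo a b, HasDerivAt d (d' y) y)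
    (hb : ∀ y ∈ Ioo a b, |d' y| ≤ K * |d y| + ε) :
    |d a| ≤ (|d b| + ε * (b - a)) * Real.exp (K * (b - a)) := by
  have hm : ∀ y ∈ Ioo (-b) (-a), -y ∈ Ioo a b := fun y hy =>
    ⟨by linarith [hy.2], by linarith [hy.1]⟩
  have := abs_right_le_of_abs_deriv_le (d := fun y => d (-y)) (d' := fun y => -d' (-y)) hK hε
    (neg_le_neg hab)
    (hc.comp continuous_neg.continuousOn fun y hy => ⟨by linarith [hy.2], by linarith [hy.1]⟩)
    (fun y hy => ((hd (-y) (hm y hy)).comp y (hasDerivAt_neg y)).congr_deriv (by simp))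
    (fun y hy => by simpa using hb (-y) (hm y hy))
  simpa [neg_add_eq_sub] using this

/-- Two-sided Grönwall inequality between two points of an interval of differentiability. -/
theorem abs_le_of_abs_deriv_le {d d' : ℝ → ℝ} {a b K ε x y : ℝ} (hK : 0 ≤ K) (hε : 0 ≤ ε)
    (hc : ContinuousOn d (Icc a b)) (hd : ∀ y ∈ Ioo a b, HasDerivAt d (d' y) y)
    (hb : ∀ y ∈ Ioo a b, |d' y| ≤ K * |d y| + ε) (hx : x ∈ Icc a b) (hy : y ∈ Icc a b) :
    |d y| ≤ (|d x| + ε * |y - x|) * Real.exp (K * |y - x|) := by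
  rcases le_total x y with h | h
  · rw [abs_of_nonneg (sub_nonneg.2 h)]
    exact abs_right_le_of_abs_deriv_le hK hε h (hc.mono (Icc_subset_Icc hx.1 hy.2))
      (fun z hz => hd z ⟨hx.1.trans_lt hz.1, hz.2.trans_le hy.2⟩)
      (fun z hz => hb z ⟨hx.1.trans_lt hz.1, hz.2.trans_le hy.2⟩)
  · rw [abs_sub_comm, abs_of_nonneg (sub_nonneg.2 h)]
    exact abs_left_le_of_abs_deriv_le hK hε h (hc.mono (Icc_subset_Icc hy.1 hx.2))
      (fun z hz => hd z ⟨hy.1.trans_lt hz.1, hz.2.trans_le hx.2⟩)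
      (fun z hz => hb z ⟨hy.1.trans_lt hz.1, hz.2.trans_le hx.2⟩)

/-- A scalar vector field `g (x, r)` for which `r' = g (x, r)` has unique global solutions: it is
continuous, bounded by `B`, and Lipschitz in `r` on bounded sets. -/
structure IsField (g : ℝ → ℝ → ℝ) (B : ℝ) : Prop where
  cont : Continuous (fun z : ℝ × ℝ => g z.1 z.2)
  bdd : ∀ x r, |g x r| ≤ B
  lip : ∀ M : ℝ, ∃ K : ℝ, 0 ≤ K ∧ ∀ x r r', |x| ≤ M → |r| ≤ M → |r'| ≤ M →
    |g x r - g x r'| ≤ K * |r - r'|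

theorem IsField.nonneg {g : ℝ → ℝ → ℝ} {B : ℝ} (hg : IsField g B) : 0 ≤ B :=
  (abs_nonneg _).trans (hg.bdd 0 0)

theorem IsField.eqOn {g : ℝ → ℝ → ℝ} {B : ℝ} (hg : IsField g B) {r₁ r₂ : ℝ → ℝ} {a b c : ℝ}
    (hc₁ : ContinuousOn r₁ (Icc a b)) (hd₁ : ∀ x ∈ Ioo a b, HasDerivAt r₁ (g x (r₁ x)) x)
    (hc₂ : ContinuousOn r₂ (Icc a b)) (hd₂ : ∀ x ∈ Ioo a b, HasDerivAt r₂ (g x (r₂ x)) x)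
    (hc : c ∈ Icc a b) (h : r₁ c = r₂ c) : EqOn r₁ r₂ (Icc a b) := by
  obtain ⟨M₁, hM₁⟩ := isCompact_Icc.exists_bound_of_continuousOn hc₁
  obtain ⟨M₂, hM₂⟩ := isCompact_Icc.exists_bound_of_continuousOn hc₂
  obtain ⟨M₃, hM₃⟩ := (isCompact_Icc (a := a) (b := b)).exists_bound_of_continuousOn
    continuousOn_id
  obtain ⟨K, hK, hL⟩ := hg.lip (max M₁ (max M₂ M₃))
  intro y hy
  have := abs_le_of_abs_deriv_le (d := fun x => r₁ x - r₂ x)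
    (d' := fun x => g x (r₁ x) - g x (r₂ x)) (ε := 0) hK le_rfl (hc₁.sub hc₂)
    (fun x hx => (hd₁ x hx).sub (hd₂ x hx))
    (fun x hx => by
      have hx' := Ioo_subset_Icc_self hx
      rw [add_zero]
      exact hL _ _ _ ((hM₃ x hx').trans (by simp)) ((hM₁ x hx').trans (by simp))
        ((hM₂ x hx').trans (by simp))) hc hy
  simp only [h, sub_self, abs_zero, zero_mul, add_zero] at this
  exact sub_eq_zero.1 (abs_nonpos_iff.1 this)

theorem IsField.exists_solution_Icc {g : ℝ → ℝ → ℝ} {B : ℝ} (hg : IsField g B) (a m : ℝ) {n : ℝ}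
    (hn : 0 ≤ n) : ∃ r : ℝ → ℝ, r a = m ∧
      ∀ x ∈ Icc (a - n) (a + n), HasDerivWithinAt r (g x (r x)) (Icc (a - n) (a + n)) x := by
  have hB := hg.nonneg
  obtain ⟨K, hK, hL⟩ := hg.lip (|a| + |m| + n + B * n)
  have hBn : 0 ≤ B * n := mul_nonneg hB hn
  have hpl : IsPicardLindelof g (tmin := a - n) (tmax := a + n)
      ⟨a, by constructor <;> linarith⟩ m (B * n).toNNReal 0 B.toNNReal K.toNNReal := by
    constructor
    · intro x hx
      refine LipschitzOnWith.of_dist_le_mul fun r hr r' hr' => ?_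
      rw [Metric.mem_closedBall, Real.dist_eq] at hr hr'
      rw [Real.coe_toNNReal _ hBn] at hr hr'
      have h1 : |x| ≤ |a| + n := by
        rw [abs_le]; constructor <;> linarith [hx.1, hx.2, neg_abs_le a, le_abs_self a]
      have h2 : |r| ≤ |m| + B * n := by
        have := abs_sub_abs_le_abs_sub r m; linarith
      have h3 : |r'| ≤ |m| + B * n := by
        have := abs_sub_abs_le_abs_sub r' m; linarith
      rw [Real.coe_toNNReal _ hK]
      exact hL _ _ _ (by linarith [abs_nonneg m]) (by linarith [abs_nonneg a])
        (by linarith [abs_nonneg a])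
    · intro x _
      exact (hg.cont.comp (by fun_prop : Continuous fun y : ℝ => (y, x))).continuousOn
    · intro x _ r _
      rw [Real.coe_toNNReal _ hB]
      exact hg.bdd x r
    · simp [Real.coe_toNNReal _ hB, Real.coe_toNNReal _ hBn]
  exact hpl.exists_eq_forall_mem_Icc_hasDerivWithinAt₀

theorem IsField.exists_solution {g : ℝ → ℝ → ℝ} {B : ℝ} (hg : IsField g B) (a m : ℝ) :
    ∃ r : ℝ → ℝ, r a = m ∧ ∀ x, HasDerivAt r (g x (r x)) x := by
  choose r hra hr using fun n : ℕ => hg.exists_solution_Icc a m (n := (n : ℝ) + 1) (by positivity)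
  have hcont : ∀ n : ℕ, ContinuousOn (r n) (Icc (a - (n + 1)) (a + (n + 1))) := fun n x hx =>
    (hr n x hx).continuousWithinAt
  have hder : ∀ n : ℕ, ∀ x ∈ Ioo (a - ((n : ℝ) + 1)) (a + (n + 1)), HasDerivAt (r n) (g x (r n x)) x :=
    fun n x hx => (hr n x (Ioo_subset_Icc_self hx)).hasDerivAt (Icc_mem_nhds hx.1 hx.2)
  have hagree : ∀ n k : ℕ, n ≤ k → EqOn (r n) (r k) (Icc (a - (n + 1)) (a + (n + 1))) := by
    intro n k hnk
    have hnk' : (n : ℝ) ≤ k := by exact_mod_cast hnk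
    have hn0 : (0 : ℝ) ≤ n := by positivity
    exact hg.eqOn (hcont n) (hder n)
      ((hcont k).mono (Icc_subset_Icc (by linarith) (by linarith)))
      (fun x hx => hder k x ⟨by linarith [hx.1], by linarith [hx.2]⟩)
      (c := a) ⟨by linarith, by linarith⟩ (by rw [hra, hra])
  -- the local solutions agree, so that their diagonal is a global solution
  have hloc : ∀ n : ℕ, ∀ x ∈ Ioo (a - ((n : ℝ) + 1)) (a + (n + 1)),
      r ⌈|x - a|⌉₊ x = r n x := by
    intro n x hx
    have h1 : |x - a| ≤ ⌈|x - a|⌉₊ := Nat.le_ceil _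
    rcases le_total ⌈|x - a|⌉₊ n with h | h
    · exact hagree _ _ h ⟨by linarith [neg_abs_le (x - a)], by linarith [le_abs_self (x - a)]⟩
    · exact (hagree _ _ h (Ioo_subset_Icc_self hx)).symm
  refine ⟨fun x => r ⌈|x - a|⌉₊ x, by simp [hra], fun x => ?_⟩
  have hx : x ∈ Ioo (a - ((⌈|x - a|⌉₊ : ℝ) + 1)) (a + (⌈|x - a|⌉₊ + 1)) := by
    have h1 : |x - a| ≤ ⌈|x - a|⌉₊ := Nat.le_ceil _
    exact ⟨by linarith [neg_abs_le (x - a)], by linarith [le_abs_self (x - a)]⟩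
  refine (hder _ x hx).congr_of_eventuallyEq ?_
  filter_upwards [Ioo_mem_nhds hx.1 hx.2] with y hy
  exact hloc _ y hy

theorem IsField.eq_of_hasDerivAt {g : ℝ → ℝ → ℝ} {B : ℝ} (hg : IsField g B) {r₁ r₂ : ℝ → ℝ}
    (h₁ : ∀ x, HasDerivAt r₁ (g x (r₁ x)) x) (h₂ : ∀ x, HasDerivAt r₂ (g x (r₂ x)) x) {c : ℝ}
    (h : r₁ c = r₂ c) : r₁ = r₂ := by
  funext x
  exact hg.eqOn (a := min c x) (b := max c x) (c := c)
    (fun y _ => (h₁ y).continuousAt.continuousWithinAt) (fun y _ => h₁ y)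
    (fun y _ => (h₂ y).continuousAt.continuousWithinAt) (fun y _ => h₂ y)
    ⟨min_le_left _ _, le_max_left _ _⟩ h ⟨min_le_right _ _, le_max_right _ _⟩

theorem IsField.abs_sub_le {g : ℝ → ℝ → ℝ} {B : ℝ} (hg : IsField g B) {r : ℝ → ℝ}
    (hr : ∀ x, HasDerivAt r (g x (r x)) x) (x y : ℝ) : |r x - r y| ≤ B * |x - y| := by
  have := convex_univ.norm_image_sub_le_of_norm_hasDerivWithin_le (f := r)
    (fun z _ => (hr z).hasDerivWithinAt) (fun z _ => hg.bdd z (r z)) (mem_univ y) (mem_univ x)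
  simpa using this

/-! ### Calculus for functions of `(x, t, ρ)` -/

/-- The uncurried form of a function of `(x, t, ρ)`. -/
def unc (G : ℝ → ℝ → ℝ → ℝ) (z : ℝ × ℝ × ℝ) : ℝ := G z.1 z.2.1 z.2.2

theorem fderiv_unc {G : ℝ → ℝ → ℝ → ℝ} (hG : ContDiff ℝ 1 (unc G)) (z v : ℝ × ℝ × ℝ) :
    fderiv ℝ (unc G) z v = dX G z.1 z.2.1 z.2.2 * v.1 + dT G z.1 z.2.1 z.2.2 * v.2.1
      + dR G z.1 z.2.1 z.2.2 * v.2.2 := by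
  have hd : HasFDerivAt (unc G) (fderiv ℝ (unc G) z) z :=
    ((hG.differentiable one_ne_zero) z).hasFDerivAt
  have h1 : dX G z.1 z.2.1 z.2.2 = fderiv ℝ (unc G) z (1, 0, 0) := by
    have h : HasDerivAt (fun y : ℝ => ((y, z.2.1, z.2.2) : ℝ × ℝ × ℝ)) (1, 0, 0) z.1 :=
      (hasDerivAt_id _).prodMk ((hasDerivAt_const _ _).prodMk (hasDerivAt_const _ _))
    exact (HasFDerivAt.comp_hasDerivAt_of_eq z.1 hd h rfl).deriv
  have h2 : dT G z.1 z.2.1 z.2.2 = fderiv ℝ (unc G) z (0, 1, 0) := by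
    have h : HasDerivAt (fun y : ℝ => ((z.1, y, z.2.2) : ℝ × ℝ × ℝ)) (0, 1, 0) z.2.1 :=
      (hasDerivAt_const _ _).prodMk ((hasDerivAt_id _).prodMk (hasDerivAt_const _ _))
    exact (HasFDerivAt.comp_hasDerivAt_of_eq z.2.1 hd h rfl).deriv
  have h3 : dR G z.1 z.2.1 z.2.2 = fderiv ℝ (unc G) z (0, 0, 1) := by
    have h : HasDerivAt (fun y : ℝ => ((z.1, z.2.1, y) : ℝ × ℝ × ℝ)) (0, 0, 1) z.2.2 :=
      (hasDerivAt_const _ _).prodMk ((hasDerivAt_const _ _).prodMk (hasDerivAt_id _))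
    exact (HasFDerivAt.comp_hasDerivAt_of_eq z.2.2 hd h rfl).deriv
  rw [h1, h2, h3]
  have : v = v.1 • ((1, 0, 0) : ℝ × ℝ × ℝ) + v.2.1 • ((0, 1, 0) : ℝ × ℝ × ℝ)
      + v.2.2 • ((0, 0, 1) : ℝ × ℝ × ℝ) := by
    ext <;> simp
  conv_lhs => rw [this]
  simp only [map_add, map_smul, smul_eq_mul]
  ring

theorem unc_dX {G : ℝ → ℝ → ℝ → ℝ} (hG : ContDiff ℝ 1 (unc G)) :
    unc (dX G) = fun z => fderiv ℝ (unc G) z (1, 0, 0) := by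
  funext z
  simp [fderiv_unc hG, unc]

theorem unc_dR {G : ℝ → ℝ → ℝ → ℝ} (hG : ContDiff ℝ 1 (unc G)) :
    unc (dR G) = fun z => fderiv ℝ (unc G) z (0, 0, 1) := by
  funext z
  simp [fderiv_unc hG, unc]

theorem continuous_unc_dX {G : ℝ → ℝ → ℝ → ℝ} (hG : ContDiff ℝ 1 (unc G)) :
    Continuous (unc (dX G)) := by
  rw [unc_dX hG]
  exact (hG.continuous_fderiv one_ne_zero).clm_apply continuous_const

theorem continuous_unc_dR {G : ℝ → ℝ → ℝ → ℝ} (hG : ContDiff ℝ 1 (unc G)) :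
    Continuous (unc (dR G)) := by
  rw [unc_dR hG]
  exact (hG.continuous_fderiv one_ne_zero).clm_apply continuous_const

theorem contDiff_unc_dX {G : ℝ → ℝ → ℝ → ℝ} (hG : ContDiff ℝ 2 (unc G)) :
    ContDiff ℝ 1 (unc (dX G)) := by
  rw [unc_dX (hG.of_le one_le_two)]
  exact (hG.fderiv_right (m := 1) le_rfl).clm_apply contDiff_const

theorem contDiff_unc_dR {G : ℝ → ℝ → ℝ → ℝ} (hG : ContDiff ℝ 2 (unc G)) :
    ContDiff ℝ 1 (unc (dR G)) := by
  rw [unc_dR (hG.of_le one_le_two)]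
  exact (hG.fderiv_right (m := 1) le_rfl).clm_apply contDiff_const

/-- The chain rule along a curve. -/
theorem hasDerivAt_unc_comp {G : ℝ → ℝ → ℝ → ℝ} (hG : ContDiff ℝ 1 (unc G)) {X S R : ℝ → ℝ}
    {X' S' R' τ : ℝ} (hX : HasDerivAt X X' τ) (hS : HasDerivAt S S' τ) (hR : HasDerivAt R R' τ) :
    HasDerivAt (fun τ => G (X τ) (S τ) (R τ))
      (dX G (X τ) (S τ) (R τ) * X' + dT G (X τ) (S τ) (R τ) * S'
        + dR G (X τ) (S τ) (R τ) * R') τ := by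
  have hd : HasFDerivAt (unc G) (fderiv ℝ (unc G) (X τ, S τ, R τ)) (X τ, S τ, R τ) :=
    ((hG.differentiable one_ne_zero) _).hasFDerivAt
  have := HasFDerivAt.comp_hasDerivAt_of_eq τ hd (hX.prodMk (hS.prodMk hR)) rfl
  rw [fderiv_unc hG] at this
  exact this

theorem dR_dX_comm {G : ℝ → ℝ → ℝ → ℝ} (hG : ContDiff ℝ 2 (unc G)) (x t r : ℝ) :
    dR (dX G) x t r = dX (dR G) x t r := by
  have hG1 := hG.of_le one_le_two
  have hd : HasFDerivAt (fderiv ℝ (unc G)) (fderiv ℝ (fderiv ℝ (unc G)) (x, t, r)) (x, t, r) :=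
    (((hG.fderiv_right (m := 1) le_rfl).differentiable one_ne_zero) _).hasFDerivAt
  have hsym : IsSymmSndFDerivAt ℝ (unc G) (x, t, r) :=
    hG.contDiffAt.isSymmSndFDerivAt (by simp)
  have e1 : dR (dX G) x t r = fderiv ℝ (unc (dX G)) (x, t, r) (0, 0, 1) := by
    rw [fderiv_unc (contDiff_unc_dX hG)]; simp
  have e2 : dX (dR G) x t r = fderiv ℝ (unc (dR G)) (x, t, r) (1, 0, 0) := by
    rw [fderiv_unc (contDiff_unc_dR hG)]; simp
  rw [e1, e2, unc_dX hG1, unc_dR hG1, (hd.clm_apply (hasFDerivAt_const _ _)).fderiv,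
    (hd.clm_apply (hasFDerivAt_const _ _)).fderiv]
  simpa using hsym (0, 0, 1) (1, 0, 0)

theorem exists_lipschitz_closedBall {E : Type*} [NormedAddCommGroup E] [NormedSpace ℝ E]
    [ProperSpace E] {g : E → ℝ} (hg : ContDiff ℝ 1 g) (M : ℝ) :
    ∃ K : ℝ, 0 ≤ K ∧ ∀ p q : E, ‖p‖ ≤ M → ‖q‖ ≤ M → |g p - g q| ≤ K * ‖p - q‖ := by
  obtain ⟨K, hK⟩ := (isCompact_closedBall (0 : E) M).exists_bound_of_continuousOn
    (hg.continuous_fderiv one_ne_zero).continuousOn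
  refine ⟨max K 0, le_max_right _ _, fun p q hp hq => ?_⟩
  refine (convex_closedBall (0 : E) M).norm_image_sub_le_of_norm_fderiv_le
    (fun x _ => (hg.differentiable one_ne_zero) x) (fun x hx => (hK x hx).trans (le_max_left _ _))
    ?_ ?_
  · simpa using hq
  · simpa using hp

/-- The first order Taylor remainder of a `C¹` function is small uniformly on bounded sets. -/
theorem exists_uniform_remainder {E : Type*} [NormedAddCommGroup E] [NormedSpace ℝ E]
    [ProperSpace E] {g : E → ℝ} (hg : ContDiff ℝ 1 g) (M : ℝ) {ε : ℝ} (hε : 0 < ε) :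
    ∃ δ > 0, ∀ p v : E, ‖p‖ ≤ M → ‖v‖ ≤ δ → |g (p + v) - g p - fderiv ℝ g p v| ≤ ε * ‖v‖ := by
  have huc := (isCompact_closedBall (0 : E) (M + 1)).uniformContinuousOn_of_continuous
    (hg.continuous_fderiv one_ne_zero).continuousOn
  obtain ⟨δ, hδ, h⟩ := Metric.uniformContinuousOn_iff.1 huc ε hε
  refine ⟨min (δ / 2) 1, by positivity, fun p v hp hv => ?_⟩
  have hball : ∀ x ∈ Metric.closedBall p ‖v‖, ‖fderiv ℝ g x - fderiv ℝ g p‖ ≤ ε := by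
    intro x hx
    rw [Metric.mem_closedBall, dist_eq_norm] at hx
    have h1 : ‖x‖ ≤ M + 1 := by
      have := norm_le_norm_add_norm_sub' x p
      linarith [hv.trans (min_le_right _ _)]
    have := h x (by simpa using h1) p (by simp; linarith)
      (by rw [dist_eq_norm]; linarith [hv.trans (min_le_left _ _)])
    rw [dist_eq_norm] at this
    exact this.le
  have := (convex_closedBall p ‖v‖).norm_image_sub_le_of_norm_hasFDerivWithin_le'
    (fun x _ => ((hg.differentiable one_ne_zero) x).hasFDerivAt.hasFDerivWithinAt) hball
    (Metric.mem_closedBall_self (norm_nonneg v)) (y := p + v) (by simp)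
  simpa using this

/-! ### The flow of the drift in space -/

section Drift

variable {H b : ℝ → ℝ → ℝ → ℝ} {t₀ T PL PR : ℝ}

theorem IsHamiltonian.contDiff_one (hH : IsHamiltonian H t₀ T PL PR) : ContDiff ℝ 1 (unc H) :=
  hH.smooth.of_le one_le_two

theorem contDiff_unc_driftT (hH : IsHamiltonian H t₀ T PL PR) (hb : IsDrift H b t₀ T PL PR) :
    ContDiff ℝ 1 (unc (driftT H b)) :=
  (contDiff_unc_dX hH.smooth).add (hb.smooth.mul (contDiff_unc_dR hH.smooth))

/-- The drift equation says that the equations `ρ_x = b` and `ρ_t = β` are compatible. -/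
theorem drift_compatible (hH : IsHamiltonian H t₀ T PL PR) (hb : IsDrift H b t₀ T PL PR)
    {x t r : ℝ} (ht : t ∈ Icc t₀ T) (hr : r ∈ Icc PL PR) :
    dT b x t r + dR b x t r * driftT H b x t r
      = dX (driftT H b) x t r + dR (driftT H b) x t r * b x t r := by
  have hX := contDiff_unc_dX hH.smooth
  have hR := contDiff_unc_dR hH.smooth
  have e1 : dX (driftT H b) x t r = dX (dX H) x t r
      + (dX b x t r * dR H x t r + b x t r * dX (dR H) x t r) := by
    have h (G : ℝ → ℝ → ℝ → ℝ) (hG : ContDiff ℝ 1 (unc G)) :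
        HasDerivAt (fun y => G y t r) (dX G x t r) x := by
      simpa using hasDerivAt_unc_comp hG (hasDerivAt_id x) (hasDerivAt_const x t)
        (hasDerivAt_const x r)
    exact ((h _ hX).add ((h _ hb.smooth).mul (h _ hR))).deriv
  have e2 : dR (driftT H b) x t r = dR (dX H) x t r
      + (dR b x t r * dR H x t r + b x t r * dR (dR H) x t r) := by
    have h (G : ℝ → ℝ → ℝ → ℝ) (hG : ContDiff ℝ 1 (unc G)) :
        HasDerivAt (fun y => G x t y) (dR G x t r) r := by
      simpa using hasDerivAt_unc_comp hG (hasDerivAt_const r x) (hasDerivAt_const r t)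
        (hasDerivAt_id r)
    exact ((h _ hX).add ((h _ hb.smooth).mul (h _ hR))).deriv
  rw [e1, e2, dR_dX_comm hH.smooth, driftT]
  linear_combination hb.pde x t ht r hr

theorem IsDrift.exists_isField (hb : IsDrift H b t₀ T PL PR) :
    ∃ B : ℝ, ∀ t ∈ Icc t₀ T, IsField (fun x r => b x t r) B := by
  obtain ⟨B, hB⟩ := hb.bounded
  refine ⟨B, fun t ht => ⟨?_, fun x r => hB x t ht r, fun M => ?_⟩⟩
  · exact hb.smooth.continuous.comp (by fun_prop : Continuous fun z : ℝ × ℝ => (z.1, t, z.2))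
  · obtain ⟨K, hK, h⟩ := exists_lipschitz_closedBall hb.smooth (max M |t|)
    refine ⟨K, hK, fun x r r' hx hr hr' => ?_⟩
    have := h (x, t, r) (x, t, r') 
      (max_le (hx.trans (le_max_left _ _)) (max_le (le_max_right _ _) (hr.trans (le_max_left _ _))))
      (max_le (hx.trans (le_max_left _ _)) (max_le (le_max_right _ _) (hr'.trans (le_max_left _ _))))
    simpa [Prod.norm_def] using this

theorem driftFlow_spec (hb : IsDrift H b t₀ T PL PR) {t : ℝ} (ht : t ∈ Icc t₀ T) (a m : ℝ) :
    driftFlow b t a m a = m ∧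
      ∀ x, HasDerivAt (driftFlow b t a m) (b x t (driftFlow b t a m x)) x := by
  obtain ⟨B, hB⟩ := hb.exists_isField
  have h := (hB t ht).exists_solution a m
  rw [driftFlow, dif_pos h]
  exact h.choose_spec

theorem driftFlow_self (hb : IsDrift H b t₀ T PL PR) {t : ℝ} (ht : t ∈ Icc t₀ T) (a m : ℝ) :
    driftFlow b t a m a = m :=
  (driftFlow_spec hb ht a m).1

theorem hasDerivAt_driftFlow (hb : IsDrift H b t₀ T PL PR) {t : ℝ} (ht : t ∈ Icc t₀ T)
    (a m x : ℝ) : HasDerivAt (driftFlow b t a m) (b x t (driftFlow b t a m x)) x :=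
  (driftFlow_spec hb ht a m).2 x

theorem exists_lipschitz_driftFlow (hb : IsDrift H b t₀ T PL PR) (M : ℝ) :
    ∃ C : ℝ, 0 ≤ C ∧ ∀ t ∈ Icc t₀ T, ∀ t' ∈ Icc t₀ T, ∀ a a' m m' x x' : ℝ,
      |a| ≤ M → |a'| ≤ M → |m| ≤ M → |m'| ≤ M → |x| ≤ M → |x'| ≤ M →
      |driftFlow b t a m x - driftFlow b t' a' m' x'| ≤
        C * (|t - t'| + |a - a'| + |m - m'| + |x - x'|) := by
  obtain ⟨B, hB⟩ := hb.exists_isField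
  rcases lt_or_ge M 0 with hM | hM
  · exact ⟨0, le_rfl, fun t _ t' _ a a' m m' x x' h => absurd ((abs_nonneg _).trans h) hM.not_ge⟩
  rcases (Icc t₀ T).eq_empty_or_nonempty with he | ⟨t₁, ht₁⟩
  · exact ⟨0, le_rfl, fun t ht => by simp [he] at ht⟩
  have hB0 : 0 ≤ B := (hB t₁ ht₁).nonneg
  set M' := max (max |t₀| |T|) (M + B * (2 * M)) with hM'
  obtain ⟨K, hK, hL⟩ := exists_lipschitz_closedBall hb.smooth M'
  have hE : 1 ≤ Real.exp (K * (2 * M)) := Real.one_le_exp (by positivity)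
  refine ⟨(1 + B + K * (2 * M)) * Real.exp (K * (2 * M)), by positivity, ?_⟩
  intro t ht t' ht' a a' m m' x x' ha ha' hm hm' hx hx'
  have key : ∀ t ∈ Icc t₀ T, ∀ a m y, |a| ≤ M → |m| ≤ M → |y| ≤ M →
      ‖((y, t, driftFlow b t a m y) : ℝ × ℝ × ℝ)‖ ≤ M' := by
    intro t ht a m y ha hm hy
    have h1 := (hB t ht).abs_sub_le (hasDerivAt_driftFlow hb ht a m) y a
    rw [driftFlow_self hb ht] at h1
    have h2 : |y - a| ≤ 2 * M := by
      have := abs_sub y a; linarith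
    have h3 : |driftFlow b t a m y| ≤ M + B * (2 * M) := by
      have := abs_sub_abs_le_abs_sub (driftFlow b t a m y) m
      have := mul_le_mul_of_nonneg_left h2 hB0
      linarith
    have h4 : |t| ≤ max |t₀| |T| := abs_le_max_abs_abs ht.1 ht.2
    have h5 : 0 ≤ B * (2 * M) := by positivity
    simp only [Prod.norm_def, Real.norm_eq_abs, max_le_iff]
    exact ⟨(by linarith : |y| ≤ M + B * (2 * M)).trans (le_max_right _ _),
      h4.trans (le_max_left _ _), h3.trans (le_max_right _ _)⟩
  set d : ℝ → ℝ := fun y => driftFlow b t a m y - driftFlow b t' a' m' y with hd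
  have hda : |d a| ≤ |m - m'| + B * |a - a'| := by
    have h1 := (hB t' ht').abs_sub_le (hasDerivAt_driftFlow hb ht' a' m') a' a
    rw [driftFlow_self hb ht', abs_sub_comm a'] at h1
    calc |d a| = |(m - m') + (m' - driftFlow b t' a' m' a)| := by
          simp [hd, driftFlow_self hb ht]
      _ ≤ _ := (abs_add_le _ _).trans (by linarith)
  have hder : ∀ y, HasDerivAt d (b y t (driftFlow b t a m y) - b y t' (driftFlow b t' a' m' y)) y :=
    fun y => (hasDerivAt_driftFlow hb ht a m y).sub (hasDerivAt_driftFlow hb ht' a' m' y)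
  have hdx := abs_le_of_abs_deriv_le (d := d) (a := -M) (b := M) (x := a) (y := x)
    (ε := K * |t - t'|) hK (by positivity)
    (fun y _ => (hder y).continuousAt.continuousWithinAt) (fun y _ => hder y)
    (fun y hy => by
      have hy' : |y| ≤ M := abs_le.2 ⟨hy.1.le, hy.2.le⟩
      refine (hL _ _ (key t ht a m y ha hm hy') (key t' ht' a' m' y ha' hm' hy')).trans ?_
      rw [← mul_add]
      refine mul_le_mul_of_nonneg_left ?_ hK
      simp only [Prod.norm_def, Real.norm_eq_abs, Prod.fst_sub, Prod.snd_sub, sub_self, abs_zero]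
      refine max_le (by positivity) (max_le ?_ ?_)
      · linarith [abs_nonneg (d y)]
      · linarith [abs_nonneg (t - t')])
    (abs_le.1 ha) (abs_le.1 hx)
  have h2 : |x - a| ≤ 2 * M := by
    have := abs_sub x a; linarith
  have h3 : |d x| ≤ (|m - m'| + B * |a - a'| + K * |t - t'| * (2 * M))
      * Real.exp (K * (2 * M)) := by
    refine hdx.trans ?_
    gcongr
  have h4 := (hB t' ht').abs_sub_le (hasDerivAt_driftFlow hb ht' a' m') x x'
  have h5 : B * |x - x'| ≤ B * |x - x'| * Real.exp (K * (2 * M)) :=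
    le_mul_of_one_le_right (by positivity) hE
  calc |driftFlow b t a m x - driftFlow b t' a' m' x'|
      = |d x + (driftFlow b t' a' m' x - driftFlow b t' a' m' x')| := by simp [hd]
    _ ≤ (|m - m'| + B * |a - a'| + K * |t - t'| * (2 * M) + B * |x - x'|)
        * Real.exp (K * (2 * M)) := (abs_add_le _ _).trans (by linarith)
    _ ≤ ((1 + B + K * (2 * M)) * (|t - t'| + |a - a'| + |m - m'| + |x - x'|))
        * Real.exp (K * (2 * M)) := by
      refine mul_le_mul_of_nonneg_right ?_ (Real.exp_pos _).le
      have e1 := abs_nonneg (t - t')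
      have e2 := abs_nonneg (a - a')
      have e3 := abs_nonneg (m - m')
      have e4 := abs_nonneg (x - x')
      have hKM : 0 ≤ K * (2 * M) := by positivity
      nlinarith [mul_nonneg hB0 e1, mul_nonneg hB0 e3, mul_nonneg hKM e2, mul_nonneg hKM e3,
        mul_nonneg hKM e4]
    _ = _ := by ring

theorem continuousOn_driftFlow (hb : IsDrift H b t₀ T PL PR) :
    ContinuousOn (fun z : ℝ × ℝ × ℝ × ℝ => driftFlow b z.1 z.2.1 z.2.2.1 z.2.2.2)
      {z | z.1 ∈ Icc t₀ T} := by
  intro z hz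
  obtain ⟨C, hC, h⟩ := exists_lipschitz_driftFlow hb (‖z‖ + 1)
  rw [ContinuousWithinAt, tendsto_iff_norm_sub_tendsto_zero]
  have hlim : Tendsto (fun w : ℝ × ℝ × ℝ × ℝ => C * (|w.1 - z.1| + |w.2.1 - z.2.1| +
      |w.2.2.1 - z.2.2.1| + |w.2.2.2 - z.2.2.2|)) (𝓝[{z | z.1 ∈ Icc t₀ T}] z) (𝓝 0) := by
    have : Continuous (fun w : ℝ × ℝ × ℝ × ℝ => C * (|w.1 - z.1| + |w.2.1 - z.2.1| +
      |w.2.2.1 - z.2.2.1| + |w.2.2.2 - z.2.2.2|)) := by fun_prop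
    simpa using (this.tendsto z).mono_left nhdsWithin_le_nhds
  have hcomp : ∀ w : ℝ × ℝ × ℝ × ℝ, |w.2.1| ≤ ‖w‖ ∧ |w.2.2.1| ≤ ‖w‖ ∧ |w.2.2.2| ≤ ‖w‖ := by
    intro w
    simp [Prod.norm_def]
  refine squeeze_zero' (Eventually.of_forall fun _ => norm_nonneg _) ?_ hlim
  have hnear : ∀ᶠ w in 𝓝[{z | z.1 ∈ Icc t₀ T}] z, ‖w‖ ≤ ‖z‖ + 1 :=
    ((continuous_norm.tendsto z).eventually (Iic_mem_nhds (by linarith))).filter_mono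
      nhdsWithin_le_nhds
  filter_upwards [hnear, self_mem_nhdsWithin] with w hw hwt
  obtain ⟨w1, w2, w3⟩ := hcomp w
  obtain ⟨z1, z2, z3⟩ := hcomp z
  exact h _ hwt _ hz _ _ _ _ _ _ (w1.trans hw) (by linarith) (w2.trans hw) (by linarith)
    (w3.trans hw) (by linarith)

theorem continuous_driftFlow_fixed_time (hb : IsDrift H b t₀ T PL PR) {t : ℝ}
    (ht : t ∈ Icc t₀ T) :
    Continuous (fun z : ℝ × ℝ × ℝ => driftFlow b t z.1 z.2.1 z.2.2) :=
  (continuousOn_driftFlow hb).comp_continuous (f := fun z : ℝ × ℝ × ℝ => (t, z)) (by fun_prop)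
    fun _ => ht

end Drift

section Drift

variable {H b : ℝ → ℝ → ℝ → ℝ} {t₀ T PL PR : ℝ}

theorem continuousAt_driftFlow_curve (hb : IsDrift H b t₀ T PL PR) {ξ r : ℝ → ℝ} {t : ℝ}
    (ht : t ∈ Ioo t₀ T) (hξ : ContinuousAt ξ t) (hr : ContinuousAt r t) (x : ℝ) :
    ContinuousAt (fun z : ℝ × ℝ => driftFlow b z.2 (ξ z.2) (r z.2) z.1) (x, t) := by
  have h1 : ContinuousAt (fun z : ℝ × ℝ × ℝ × ℝ => driftFlow b z.1 z.2.1 z.2.2.1 z.2.2.2)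
      (t, ξ t, r t, x) := by
    refine (continuousOn_driftFlow hb).continuousAt ?_
    exact mem_of_superset ((isOpen_Ioo.preimage continuous_fst).mem_nhds ht)
      fun z hz => Ioo_subset_Icc_self hz
  have h2 : ContinuousAt (fun z : ℝ × ℝ => (z.2, ξ z.2, r z.2, z.1)) (x, t) :=
    continuousAt_snd.prodMk ((ContinuousAt.comp (f := Prod.snd) (x := (x, t)) hξ
      continuousAt_snd).prodMk ((ContinuousAt.comp (f := Prod.snd) (x := (x, t)) hr
        continuousAt_snd).prodMk continuousAt_fst))
  exact ContinuousAt.comp (f := fun z : ℝ × ℝ => (z.2, ξ z.2, r z.2, z.1)) (x := (x, t)) h1 h2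

/-- Uniformly for times near `t`, the profile issued from a moving point `(ξ, r)` has slope close
to `b` near the point `x`. -/
theorem exists_driftFlow_slope (hb : IsDrift H b t₀ T PL PR) {ξ r : ℝ → ℝ} {t : ℝ}
    (ht : t ∈ Ioo t₀ T) (hξ : ContinuousAt ξ t) (hr : ContinuousAt r t) (x : ℝ) {ε : ℝ}
    (hε : 0 < ε) :
    ∃ δ > 0, ∀ τ y y', |τ - t| < δ → |y - x| < δ → |y' - x| < δ → τ ∈ Ioo t₀ T ∧
      |driftFlow b τ (ξ τ) (r τ) y - driftFlow b τ (ξ τ) (r τ) y'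
        - b x t (driftFlow b t (ξ t) (r t) x) * (y - y')| ≤ ε * |y - y'| := by
  have hc : ContinuousAt (fun z : ℝ × ℝ => b z.1 z.2 (driftFlow b z.2 (ξ z.2) (r z.2) z.1))
      (x, t) := by
    have := hb.smooth.continuous.continuousAt (x := (x, t, driftFlow b t (ξ t) (r t) x))
    exact ContinuousAt.comp (f := fun z : ℝ × ℝ =>
      (z.1, z.2, driftFlow b z.2 (ξ z.2) (r z.2) z.1)) (x := (x, t)) this
      (continuousAt_fst.prodMk (continuousAt_snd.prodMk
        (continuousAt_driftFlow_curve hb ht hξ hr x)))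
  have h1 := (Metric.continuousAt_iff.1 hc ε hε)
  obtain ⟨δ₁, hδ₁, h1⟩ := h1
  obtain ⟨δ₂, hδ₂, h2⟩ := Metric.mem_nhds_iff.1 (Ioo_mem_nhds ht.1 ht.2)
  refine ⟨min δ₁ δ₂, lt_min hδ₁ hδ₂, fun τ y y' hτ hy hy' => ?_⟩
  have hτ' : τ ∈ Ioo t₀ T := h2 (by
    rw [Metric.mem_ball, Real.dist_eq]; exact hτ.trans_le (min_le_right _ _))
  refine ⟨hτ', ?_⟩
  have hder : ∀ z, HasDerivAt (fun z => driftFlow b τ (ξ τ) (r τ) z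
      - b x t (driftFlow b t (ξ t) (r t) x) * z) (b z τ (driftFlow b τ (ξ τ) (r τ) z)
      - b x t (driftFlow b t (ξ t) (r t) x)) z := fun z => by
    exact ((hasDerivAt_driftFlow hb (Ioo_subset_Icc_self hτ') (ξ τ) (r τ) z).sub
      ((hasDerivAt_id z).const_mul (b x t (driftFlow b t (ξ t) (r t) x)))).congr_deriv (by simp)
  have := (convex_ball x (min δ₁ δ₂)).norm_image_sub_le_of_norm_hasDerivWithin_le (C := ε)
    (fun z _ => (hder z).hasDerivWithinAt) (fun z hz => by
      rw [Metric.mem_ball] at hz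
      have := h1 (x := (z, τ)) (by
        rw [Prod.dist_eq]
        exact max_lt (hz.trans_le (min_le_left _ _))
          (by rw [Real.dist_eq]; exact hτ.trans_le (min_le_left _ _)))
      rw [Real.dist_eq] at this
      exact this.le)
    (by rw [Metric.mem_ball, Real.dist_eq]; exact hy') (by rw [Metric.mem_ball, Real.dist_eq]; exact hy)
  refine le_trans (le_of_eq ?_) this
  rw [Real.norm_eq_abs]
  congr 1
  ring

/-- The profile issued from a point `(ξ, r)` that moves with `r' = β + b ξ'` solves `ρ_t = β` as
long as its values stay in the slab. -/
theorem hasDerivAt_driftFlow_time (hH : IsHamiltonian H t₀ T PL PR)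
    (hb : IsDrift H b t₀ T PL PR) {ξ r : ℝ → ℝ} {ξ' t x : ℝ} (ht : t ∈ Ioo t₀ T)
    (hξ : HasDerivAt ξ ξ' t)
    (hr : HasDerivAt r (driftT H b (ξ t) t (r t) + b (ξ t) t (r t) * ξ') t) (hx : ξ t ≤ x)
    (hrange : ∀ y ∈ Icc (ξ t) x, driftFlow b t (ξ t) (r t) y ∈ Icc PL PR) :
    HasDerivAt (fun τ => driftFlow b τ (ξ τ) (r τ) x)
      (driftT H b x t (driftFlow b t (ξ t) (r t) x)) t := by
  have htc := Ioo_subset_Icc_self ht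
  set R : ℝ → ℝ → ℝ := fun τ y => driftFlow b τ (ξ τ) (r τ) y with hR
  have hR0 : R t (ξ t) = r t := driftFlow_self hb htc _ _
  have hder : ∀ τ ∈ Icc t₀ T, ∀ y, HasDerivAt (R τ) (b y τ (R τ y)) y := fun τ hτ y =>
    hasDerivAt_driftFlow hb hτ _ _ y
  have hnear : ∀ᶠ τ in 𝓝 t, τ ∈ Icc t₀ T := Icc_mem_nhds ht.1 ht.2
  -- a bound for all the points that occur
  set M : ℝ := max (max (|ξ t| + 1) (|r t| + 1)) (max |x| (max (|PL|) (|PR|) + |t|)) with hM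
  have hMx : |x| ≤ M := (le_max_left _ _).trans (le_max_right _ _)
  have hMξ : |ξ t| + 1 ≤ M := (le_max_left _ _).trans (le_max_left _ _)
  have hMr : |r t| + 1 ≤ M := (le_max_right _ _).trans (le_max_left _ _)
  have hMP : max (|PL|) (|PR|) + |t| ≤ M := (le_max_right _ _).trans (le_max_right _ _)
  have hMt : |t| ≤ M := by have := (abs_nonneg PL).trans (le_max_left _ |PR|); linarith
  have hy_abs : ∀ y ∈ Icc (ξ t) x, |y| ≤ M := fun y hy =>
    (abs_le_max_abs_abs hy.1 hy.2).trans (max_le (by linarith) hMx)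
  have hp : ∀ y ∈ Icc (ξ t) x, ‖((y, t, R t y) : ℝ × ℝ × ℝ)‖ ≤ M := fun y hy =>
    max_le (hy_abs y hy) (max_le hMt ((abs_le_max_abs_abs (hrange y hy).1 (hrange y hy).2).trans
      (by linarith [abs_nonneg t])))
  -- Lipschitz bound in time
  obtain ⟨C, hC, hlip⟩ := exists_lipschitz_driftFlow hb M
  obtain ⟨Cξ, hCξ⟩ := hξ.isBigO_sub.bound
  obtain ⟨Cr, hCr⟩ := hr.isBigO_sub.bound
  set C₁ := max 1 (C * (1 + |Cξ| + |Cr|)) with hC₁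
  have hC₁1 : 1 ≤ C₁ := le_max_left _ _
  have hlip' : ∀ᶠ τ in 𝓝 t, ∀ y ∈ Icc (ξ t) x, |R τ y - R t y| ≤ C₁ * |τ - t| := by
    have h1 : ∀ᶠ τ in 𝓝 t, |ξ τ| ≤ M :=
      (hξ.continuousAt.abs.tendsto.eventually (Iic_mem_nhds (by linarith)))
    have h2 : ∀ᶠ τ in 𝓝 t, |r τ| ≤ M :=
      (hr.continuousAt.abs.tendsto.eventually (Iic_mem_nhds (by linarith)))
    filter_upwards [h1, h2, hCξ, hCr, hnear] with τ h1 h2 h3 h4 h5 y hy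
    refine (hlip τ h5 t htc _ _ _ _ _ _ h1 (by linarith) h2 (by linarith) (hy_abs y hy)
      (hy_abs y hy)).trans ?_
    simp only [Real.norm_eq_abs] at h3 h4
    rw [sub_self, abs_zero, add_zero]
    calc C * (|τ - t| + |ξ τ - ξ t| + |r τ - r t|)
        ≤ C * (|τ - t| + |Cξ| * |τ - t| + |Cr| * |τ - t|) := by
          gcongr
          · exact h3.trans (mul_le_mul_of_nonneg_right (le_abs_self _) (abs_nonneg _))
          · exact h4.trans (mul_le_mul_of_nonneg_right (le_abs_self _) (abs_nonneg _))
      _ = C * (1 + |Cξ| + |Cr|) * |τ - t| := by ring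
      _ ≤ _ := mul_le_mul_of_nonneg_right (le_max_right _ _) (abs_nonneg _)
  obtain ⟨K, hK, hKb⟩ : ∃ K : ℝ, 0 ≤ K ∧ ∀ y ∈ Icc (ξ t) x, |dR b y t (R t y)| ≤ K := by
    obtain ⟨K, hK⟩ := (isCompact_closedBall (0 : ℝ × ℝ × ℝ) M).exists_bound_of_continuousOn
      (continuous_unc_dR hb.smooth).continuousOn
    exact ⟨max K 0, le_max_right _ _, fun y hy =>
      (hK (y, t, R t y) (by simpa using hp y hy)).trans (le_max_left _ _)⟩
  set β := driftT H b with hβ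
  have hβs : ContDiff ℝ 1 (unc β) := contDiff_unc_driftT hH hb
  -- the defect `R τ y - R t y - (τ - t) β` is small at the base point
  have hbase : ∀ ε > 0, ∀ᶠ τ in 𝓝 t,
      |R τ (ξ t) - R t (ξ t) - (τ - t) * β (ξ t) t (R t (ξ t))| ≤ ε * |τ - t| := by
    intro ε hε
    set b₀ := b (ξ t) t (r t) with hb₀
    set ε₁ := ε / (2 + |Cξ| + |b₀|) with hε₁
    have hε₁0 : 0 < ε₁ := by positivity
    obtain ⟨δ, hδ, hs⟩ := exists_driftFlow_slope hb ht hξ.continuousAt hr.continuousAt (ξ t) hε₁0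
    have e1 : ∀ᶠ τ in 𝓝 t, |ξ τ - ξ t| < δ := by
      have := Metric.tendsto_nhds.1 hξ.continuousAt δ hδ
      simpa [Real.dist_eq] using this
    have e2 : ∀ᶠ τ in 𝓝 t, |τ - t| < δ := by
      have := Metric.ball_mem_nhds t hδ
      filter_upwards [this] with τ hτ
      simpa [Real.dist_eq] using hτ
    have e3 := (hasDerivAt_iff_isLittleO.1 hξ).def hε₁0
    have e4 := (hasDerivAt_iff_isLittleO.1 hr).def hε₁0
    filter_upwards [e1, e2, e3, e4, hCξ] with τ e1 e2 e3 e4 e5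
    have e6 := (hs τ (ξ t) (ξ τ) e2 (by simpa using hδ) e1)
    have e7 : driftFlow b τ (ξ τ) (r τ) (ξ τ) = r τ :=
      driftFlow_self hb (Ioo_subset_Icc_self e6.1) _ _
    have e8 := e6.2
    rw [e7, driftFlow_self hb htc, ← hb₀] at e8
    simp only [smul_eq_mul, Real.norm_eq_abs] at e3 e4 e5
    rw [hR0]
    have : R τ (ξ t) - r t - (τ - t) * β (ξ t) t (r t)
        = (R τ (ξ t) - r τ - b₀ * (ξ t - ξ τ))
          + (r τ - r t - (τ - t) * (β (ξ t) t (r t) + b₀ * ξ'))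
          - b₀ * (ξ τ - ξ t - (τ - t) * ξ') := by ring
    rw [this]
    have e9 : |ξ t - ξ τ| ≤ |Cξ| * |τ - t| := by
      rw [abs_sub_comm]
      exact e5.trans (mul_le_mul_of_nonneg_right (le_abs_self _) (abs_nonneg _))
    calc _ ≤ |R τ (ξ t) - r τ - b₀ * (ξ t - ξ τ)|
          + |r τ - r t - (τ - t) * (β (ξ t) t (r t) + b₀ * ξ')|
          + |b₀ * (ξ τ - ξ t - (τ - t) * ξ')| :=
          (abs_sub _ _).trans (by gcongr; exact abs_add_le _ _)
      _ ≤ ε₁ * (|Cξ| * |τ - t|) + ε₁ * |τ - t| + |b₀| * (ε₁ * |τ - t|) := by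
          rw [abs_mul b₀]
          gcongr
          exact e8.trans (by gcongr)
      _ = ε₁ * (1 + |Cξ| + |b₀|) * |τ - t| := by ring
      _ ≤ ε * |τ - t| := by
          gcongr
          rw [hε₁, div_mul_eq_mul_div, div_le_iff₀ (by positivity)]
          gcongr
          norm_num
  rw [hasDerivAt_iff_isLittleO, Asymptotics.isLittleO_iff]
  intro ε hε
  set E := Real.exp (K * (x - ξ t)) with hE
  have hE0 : 0 < E := Real.exp_pos _
  set L := x - ξ t with hL
  have hL0 : 0 ≤ L := sub_nonneg.2 hx
  set ε₂ := ε / (2 * E * (1 + L)) with hε₂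
  have hε₂0 : 0 < ε₂ := by positivity
  obtain ⟨δ, hδ, hrem⟩ := exists_uniform_remainder (g := unc b) hb.smooth M (ε := ε₂ / C₁) (by positivity)
  have e1 : ∀ᶠ τ in 𝓝 t, C₁ * |τ - t| < δ := by
    have : Tendsto (fun τ => C₁ * |τ - t|) (𝓝 t) (𝓝 0) := by
      have : Continuous fun τ : ℝ => C₁ * |τ - t| := by fun_prop
      simpa using this.tendsto t
    exact this.eventually (Iio_mem_nhds hδ)
  filter_upwards [hlip', hnear, e1, hbase ε₂ hε₂0] with τ h1 h2 h3 h4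
  set d : ℝ → ℝ := fun y => R τ y - R t y - (τ - t) * β y t (R t y) with hd
  have hdd : ∀ y, HasDerivAt d (b y τ (R τ y) - b y t (R t y)
      - (τ - t) * (dX β y t (R t y) + dR β y t (R t y) * b y t (R t y))) y := by
    intro y
    have := hasDerivAt_unc_comp hβs (hasDerivAt_id y) (hasDerivAt_const y t) (hder t htc y)
    refine (((hder τ h2 y).sub (hder t htc y)).sub (this.const_mul (τ - t))).congr_deriv ?_
    simp
  have hfin := abs_right_le_of_abs_deriv_le (d := d) (ε := ε₂ * |τ - t|) hK (by positivity) hx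
    (fun y _ => (hdd y).continuousAt.continuousWithinAt) (fun y _ => hdd y) (fun y hy => by
      have hy' := Ioo_subset_Icc_self hy
      have k1 := h1 y hy'
      have hv : ‖((0, τ - t, R τ y - R t y) : ℝ × ℝ × ℝ)‖ ≤ C₁ * |τ - t| := by
        refine max_le (by simpa using by positivity) (max_le ?_ k1)
        exact le_mul_of_one_le_left (abs_nonneg _) hC₁1
      have k2 := hrem (y, t, R t y) (0, τ - t, R τ y - R t y) (hp y hy') (hv.trans h3.le)
      have k3 := fderiv_unc hb.smooth (y, t, R t y) (0, τ - t, R τ y - R t y)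
      rw [k3] at k2
      simp only [unc, Prod.mk_add_mk, add_zero, add_sub_cancel, mul_zero, zero_add] at k2
      have k4 := drift_compatible hH hb (x := y) htc (hrange y hy')
      have k5 : b y τ (R τ y) - b y t (R t y)
          - (τ - t) * (dX β y t (R t y) + dR β y t (R t y) * b y t (R t y))
          = (b y τ (R τ y) - b y t (R t y) - (dT b y t (R t y) * (τ - t)
            + dR b y t (R t y) * (R τ y - R t y))) + dR b y t (R t y) * d y := by
        rw [← hβ] at k4
        rw [← k4]
        simp only [hd]
        ring
      rw [k5]
      refine (abs_add_le _ _).trans ?_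
      rw [abs_mul, add_comm]
      refine add_le_add (mul_le_mul_of_nonneg_right (hKb y hy') (abs_nonneg _)) (k2.trans ?_)
      calc ε₂ / C₁ * ‖((0, τ - t, R τ y - R t y) : ℝ × ℝ × ℝ)‖ ≤ ε₂ / C₁ * (C₁ * |τ - t|) := by
            gcongr
        _ = ε₂ * |τ - t| := by field_simp)
  have k6 : R τ x - R t x - (τ - t) • β x t (R t x) = d x := by simp [hd]
  change ‖R τ x - R t x - (τ - t) • β x t (R t x)‖ ≤ _
  rw [k6, Real.norm_eq_abs, Real.norm_eq_abs]
  refine hfin.trans ?_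
  calc (|d (ξ t)| + ε₂ * |τ - t| * (x - ξ t)) * Real.exp (K * (x - ξ t))
      ≤ (ε₂ * |τ - t| + ε₂ * |τ - t| * L) * E := by gcongr
    _ = ε₂ * (E * (1 + L)) * |τ - t| := by ring
    _ = ε / 2 * |τ - t| := by rw [hε₂]; field_simp
    _ ≤ ε * |τ - t| := by gcongr; linarith

/-- The profile issued from a moving point `(ξ, r)` with `r' = β + b ξ'` is differentiable in
`(x, t)`, with `ρ_x = b` and `ρ_t = β`. -/
theorem hasFDerivAt_driftFlow_curve (hH : IsHamiltonian H t₀ T PL PR)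
    (hb : IsDrift H b t₀ T PL PR) {ξ r : ℝ → ℝ} {ξ' t x : ℝ} (ht : t ∈ Ioo t₀ T)
    (hξ : HasDerivAt ξ ξ' t)
    (hr : HasDerivAt r (driftT H b (ξ t) t (r t) + b (ξ t) t (r t) * ξ') t) (hx : ξ t ≤ x)
    (hrange : ∀ y ∈ Icc (ξ t) x, driftFlow b t (ξ t) (r t) y ∈ Icc PL PR) :
    HasFDerivAt (fun z : ℝ × ℝ => driftFlow b z.2 (ξ z.2) (r z.2) z.1)
      (b x t (driftFlow b t (ξ t) (r t) x) • ContinuousLinearMap.fst ℝ ℝ ℝ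
        + driftT H b x t (driftFlow b t (ξ t) (r t) x) • ContinuousLinearMap.snd ℝ ℝ ℝ)
      (x, t) := by
  have hT := hasDerivAt_driftFlow_time hH hb ht hξ hr hx hrange
  rw [hasFDerivAt_iff_isLittleO, Asymptotics.isLittleO_iff]
  intro ε hε
  obtain ⟨δ, hδ, hs⟩ := exists_driftFlow_slope hb ht hξ.continuousAt hr.continuousAt x
    (half_pos hε)
  have e1 := (hasDerivAt_iff_isLittleO.1 hT).def (half_pos hε)
  have e2 : ∀ᶠ z : ℝ × ℝ in 𝓝 (x, t), ‖z - (x, t)‖ < δ := by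
    filter_upwards [Metric.ball_mem_nhds (x, t) hδ] with z hz
    rwa [← dist_eq_norm]
  filter_upwards [e2, continuousAt_snd.eventually e1] with z hz e1
  have hz1 : |z.1 - x| ≤ ‖z - (x, t)‖ := norm_fst_le (z - (x, t))
  have hz2 : |z.2 - t| ≤ ‖z - (x, t)‖ := norm_snd_le (z - (x, t))
  have e3 := (hs z.2 z.1 x (hz2.trans_lt hz) (hz1.trans_lt hz) (by simpa using hδ)).2
  simp only [smul_eq_mul, Real.norm_eq_abs] at e1
  simp only [add_apply, smul_apply, ContinuousLinearMap.coe_fst',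
    ContinuousLinearMap.coe_snd', smul_eq_mul, Prod.fst_sub, Prod.snd_sub, Real.norm_eq_abs]
  rw [show driftFlow b z.2 (ξ z.2) (r z.2) z.1 - driftFlow b t (ξ t) (r t) x
      - (b x t (driftFlow b t (ξ t) (r t) x) * (z.1 - x)
        + driftT H b x t (driftFlow b t (ξ t) (r t) x) * (z.2 - t))
      = (driftFlow b z.2 (ξ z.2) (r z.2) z.1 - driftFlow b z.2 (ξ z.2) (r z.2) x
          - b x t (driftFlow b t (ξ t) (r t) x) * (z.1 - x))
        + (driftFlow b z.2 (ξ z.2) (r z.2) x - driftFlow b t (ξ t) (r t) x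
          - (z.2 - t) * driftT H b x t (driftFlow b t (ξ t) (r t) x)) by ring]
  refine (abs_add_le _ _).trans ?_
  calc _ ≤ ε / 2 * |z.1 - x| + ε / 2 * |z.2 - t| := add_le_add e3 e1
    _ ≤ ε / 2 * ‖z - (x, t)‖ + ε / 2 * ‖z - (x, t)‖ := by gcongr
    _ = ε * ‖z - (x, t)‖ := by ring

/-- The derivative of the profile along a curve. -/
theorem hasDerivAt_driftFlow_along (hH : IsHamiltonian H t₀ T PL PR)
    (hb : IsDrift H b t₀ T PL PR) {ξ r X : ℝ → ℝ} {ξ' X' t : ℝ} (ht : t ∈ Ioo t₀ T)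
    (hξ : HasDerivAt ξ ξ' t)
    (hr : HasDerivAt r (driftT H b (ξ t) t (r t) + b (ξ t) t (r t) * ξ') t) (hx : ξ t ≤ X t)
    (hrange : ∀ y ∈ Icc (ξ t) (X t), driftFlow b t (ξ t) (r t) y ∈ Icc PL PR)
    (hX : HasDerivAt X X' t) :
    HasDerivAt (fun τ => driftFlow b τ (ξ τ) (r τ) (X τ))
      (b (X t) t (driftFlow b t (ξ t) (r t) (X t)) * X'
        + driftT H b (X t) t (driftFlow b t (ξ t) (r t) (X t))) t := by
  have h := hasFDerivAt_driftFlow_curve hH hb ht hξ hr hx hrange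
  have := h.comp_hasDerivAt_of_eq t (hX.prodMk (hasDerivAt_id t)) rfl
  exact this.congr_deriv (by simp)

end Drift

/-! ### Shock speeds -/

section Speed

variable {H b : ℝ → ℝ → ℝ → ℝ} {t₀ T PL PR : ℝ}

theorem speed_mul_sub (H : ℝ → ℝ → ℝ → ℝ) (x t rm rp : ℝ) :
    speed H x t rm rp * (rp - rm) = H x t rp - H x t rm := by
  have := sub_smul_dslope (H x t) rm rp
  rw [smul_eq_mul] at this
  rw [speed, mul_comm]
  exact this

theorem speed_nonneg (hH : IsHamiltonian H t₀ T PL PR) {x t rm rp : ℝ} (ht : t ∈ Icc t₀ T)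
    (hm : rm ∈ Icc PL PR) (hp : rp ∈ Icc PL PR) (h : rm < rp) : 0 ≤ speed H x t rm rp := by
  have h1 := hH.mono x t ht hm hp h.le
  have h2 := speed_mul_sub H x t rm rp
  by_contra hneg
  have := mul_neg_of_neg_of_pos (not_le.1 hneg) (sub_pos.2 h)
  linarith

theorem exists_abs_speed_le (hH : IsHamiltonian H t₀ T PL PR) (aL aR : ℝ) :
    ∃ V : ℝ, 0 ≤ V ∧ ∀ x ∈ Icc aL aR, ∀ t ∈ Icc t₀ T, ∀ rm ∈ Icc PL PR, ∀ rp ∈ Icc PL PR,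
      rm ≠ rp → |speed H x t rm rp| ≤ V := by
  set M := max (max |aL| |aR|) (max (max |t₀| |T|) (max |PL| |PR|)) with hM
  obtain ⟨K, hK, h⟩ := exists_lipschitz_closedBall hH.contDiff_one M
  refine ⟨K, hK, fun x hx t ht rm hm rp hp hne => ?_⟩
  have hin : ∀ r ∈ Icc PL PR, ‖((x, t, r) : ℝ × ℝ × ℝ)‖ ≤ M := fun r hr =>
    max_le ((abs_le_max_abs_abs hx.1 hx.2).trans (le_max_left _ _))
      (max_le (((abs_le_max_abs_abs ht.1 ht.2).trans (le_max_left _ _)).trans (le_max_right _ _))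
        (((abs_le_max_abs_abs hr.1 hr.2).trans (le_max_right _ _)).trans (le_max_right _ _)))
  have h1 := h (x, t, rp) (x, t, rm) (hin rp hp) (hin rm hm)
  simp only [unc, Prod.mk_sub_mk, sub_self, ← speed_mul_sub H x t rm rp, abs_mul] at h1
  have h2 : ‖((0, 0, rp - rm) : ℝ × ℝ × ℝ)‖ = |rp - rm| := by
    simp [Prod.norm_def]
  rw [h2] at h1
  exact le_of_mul_le_mul_right h1 (abs_pos.2 (sub_ne_zero.2 hne.symm))

end Speed

/-! ### Configurations, collisions and profiles -/

section Config

variable {H b : ℝ → ℝ → ℝ → ℝ} {t₀ T PL PR aL aR : ℝ}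

/-- The smooth function that gives the profile of a configuration to the right of the particle
number `i`. -/
noncomputable def strip (b : ℝ → ℝ → ℝ → ℝ) {n : ℕ} (c : Fin (n + 1) → ℝ × ℝ) (t : ℝ) (i : Fin (n + 1))
    (x : ℝ) : ℝ :=
  driftFlow b t (c i).1 (c i).2 x

/-- The right end point of the interval where the profile is given by the particle number `i`. -/
def rightEnd (aR : ℝ) {n : ℕ} (c : Fin (n + 1) → ℝ × ℝ) (i : Fin (n + 1)) : ℝ :=
  Fin.snoc (α := fun _ => ℝ) (fun j : Fin n => (c j.succ).1) aR i

@[simp] theorem rightEnd_castSucc (aR : ℝ) {n : ℕ} (c : Fin (n + 1) → ℝ × ℝ) (i : Fin n) :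
    rightEnd aR c i.castSucc = (c i.succ).1 := by
  simp [rightEnd]

@[simp] theorem rightEnd_last (aR : ℝ) {n : ℕ} (c : Fin (n + 1) → ℝ × ℝ) :
    rightEnd aR c (Fin.last n) = aR := by
  simp [rightEnd]

theorem profile_eq_strip {n : ℕ} (c : Fin (n + 1) → ℝ × ℝ) (t : ℝ) {i : Fin (n + 1)} {x : ℝ}
    (h₁ : (c i).1 ≤ x) (h₂ : ∀ j, i < j → x < (c j).1) :
    profile b ⟨n, c⟩ t x = strip b c t i x := by
  classical
  rw [profile, Finset.sum_eq_single i]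
  · exact if_pos ⟨h₁, h₂⟩
  · intro j _ hj
    refine if_neg fun h => ?_
    rcases lt_or_gt_of_ne hj with h' | h'
    · exact absurd (h.2 i h') h₁.not_gt
    · exact absurd (h₂ j h') h.1.not_gt
  · simp

theorem profile_eq_strip_of_lt_rightEnd {n : ℕ} {c : Fin (n + 1) → ℝ × ℝ}
    (hc : Monotone fun i => (c i).1) (t : ℝ) {i : Fin (n + 1)} {x : ℝ}
    (h₁ : (c i).1 ≤ x) (h₂ : x < rightEnd aR c i) :
    profile b ⟨n, c⟩ t x = strip b c t i x := by
  refine profile_eq_strip c t h₁ fun j hj => ?_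
  induction i using Fin.lastCases with
  | last => exact absurd hj (Fin.le_last j).not_gt
  | cast i =>
    rw [rightEnd_castSucc] at h₂
    exact h₂.trans_le (hc (Fin.castSucc_lt_iff_succ_le.1 hj))

theorem profile_eq_strip_last {n : ℕ} {c : Fin (n + 1) → ℝ × ℝ} (t : ℝ) {x : ℝ}
    (h : (c (Fin.last n)).1 ≤ x) : profile b ⟨n, c⟩ t x = strip b c t (Fin.last n) x :=
  profile_eq_strip c t h fun j hj => absurd hj (Fin.le_last j).not_gt

/-- Weakly ordered configurations that start at `a₋`, with upward jumps at the particles. -/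
structure IsOrdered (b : ℝ → ℝ → ℝ → ℝ) (aL t : ℝ) (q : Config) : Prop where
  left : (q.2 0).1 = aL
  mono : Monotone fun i => (q.2 i).1
  jump : ∀ i : Fin q.1, leftValue b q.2 t i < (q.2 i.succ).2

/-- The last particle of a configuration. -/
def lastParticle (q : Config) : ℝ × ℝ := q.2 (Fin.last q.1)

theorem profile_merge {n : ℕ} (c : Fin (n + 2) → ℝ × ℝ) (i : Fin (n + 1))
    (h : (c i.castSucc).1 = (c i.succ).1) (t x : ℝ) :
    profile b ⟨n, fun j => c (i.castSucc.succAbove j)⟩ t x = profile b ⟨n + 1, c⟩ t x := by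
  classical
  simp only [profile]
  rw [Fin.sum_univ_succAbove _ i.castSucc, if_neg, zero_add]
  · refine Finset.sum_congr rfl fun j _ => ?_
    refine if_congr (and_congr_right fun _ => ⟨fun hj k hk => ?_, fun hj k hk => ?_⟩) rfl rfl
    · by_cases hki : k = i.castSucc
      · subst hki
        obtain ⟨k', hk'⟩ := Fin.exists_succAbove_eq (x := i.succ) (y := i.castSucc)
          Fin.castSucc_lt_succ.ne'
        rw [h, ← hk']
        refine hj k' ((Fin.strictMono_succAbove i.castSucc).lt_iff_lt.1 ?_)
        rw [hk']
        exact hk.trans Fin.castSucc_lt_succ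
      · obtain ⟨k', hk'⟩ := Fin.exists_succAbove_eq hki
        rw [← hk'] at hk ⊢
        exact hj k' ((Fin.strictMono_succAbove i.castSucc).lt_iff_lt.1 hk)
    · exact hj _ ((Fin.strictMono_succAbove i.castSucc).lt_iff_lt.2 hk)
  · rintro ⟨h1, h2⟩
    have := h2 i.succ Fin.castSucc_lt_succ
    rw [← h] at this
    exact absurd this h1.not_gt

theorem MergeStep.profile_eq {q q' : Config} (h : MergeStep q q') (t x : ℝ) :
    profile b q' t x = profile b q t x := by
  obtain ⟨n, c, i, hi, rfl, rfl⟩ := h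
  exact profile_merge c i hi t x

theorem MergeStep.lastParticle_eq {q q' : Config} (h : MergeStep q q') :
    lastParticle q' = lastParticle q := by
  obtain ⟨n, c, i, hi, rfl, rfl⟩ := h
  simp only [lastParticle]
  congr 1
  rw [Fin.succAbove_of_le_castSucc _ _ (Fin.castSucc_le_castSucc_iff.2 (Fin.le_last i)),
    Fin.succ_last]

theorem MergeStep.isOrdered (hb : IsDrift H b t₀ T PL PR) {t : ℝ} (ht : t ∈ Icc t₀ T)
    {q q' : Config} (h : MergeStep q q') (hq : IsOrdered b aL t q) : IsOrdered b aL t q' := by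
  obtain ⟨n, c, i, hi, rfl, rfl⟩ := h
  refine ⟨?_, hq.mono.comp (Fin.strictMono_succAbove _).monotone, fun j => ?_⟩
  · have h0 : (c 0).1 = aL := hq.left
    simp only
    rcases eq_or_ne i 0 with rfl | h
    · rw [← h0]
      simpa using hi.symm
    · rw [Fin.succAbove_ne_zero_zero]
      · exact h0
      · simpa using h
  · have hj1 : ∀ k : Fin (n + 1), driftFlow b t (c k.castSucc).1 (c k.castSucc).2 (c k.succ).1
        < (c k.succ).2 := hq.jump
    simp only [leftValue]
    change Fin n at j
    rcases lt_trichotomy (j.succ : Fin (n + 1)) i with hlt | heq | hgt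
    · have e1 : i.castSucc.succAbove j.castSucc = j.castSucc.castSucc :=
        Fin.succAbove_of_castSucc_lt _ _ (Fin.castSucc_lt_castSucc_iff.2
          (Fin.castSucc_lt_succ.trans hlt))
      have e2 : i.castSucc.succAbove j.succ = j.castSucc.succ := by
        rw [Fin.succAbove_of_castSucc_lt _ _ (Fin.castSucc_lt_castSucc_iff.2 hlt)]
        simp
      rw [e1, e2]
      exact hj1 _
    · have e1 : i.castSucc.succAbove j.castSucc = j.castSucc.castSucc :=
        Fin.succAbove_of_castSucc_lt _ _ (Fin.castSucc_lt_castSucc_iff.2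
          (Fin.castSucc_lt_succ.trans_eq heq))
      have e2 : i.castSucc.succAbove j.succ = j.succ.succ :=
        Fin.succAbove_of_le_castSucc _ _ (Fin.castSucc_le_castSucc_iff.2 heq.ge)
      rw [e1, e2]
      subst heq
      rw [← hi]
      -- the removed particle lies between its two neighbours
      have k1 := hj1 j.castSucc
      have k2 := hj1 j.succ
      rw [← hi, driftFlow_self hb ht] at k2
      rw [Fin.succ_castSucc] at k1
      exact k1.trans k2
    · have e1 : i.castSucc.succAbove j.castSucc = j.succ.castSucc := by
        rw [Fin.succAbove_of_le_castSucc _ _ (Fin.castSucc_le_castSucc_iff.2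
          (Fin.le_castSucc_iff.2 hgt))]
        simp
      have e2 : i.castSucc.succAbove j.succ = j.succ.succ :=
        Fin.succAbove_of_le_castSucc _ _ (Fin.castSucc_le_castSucc_iff.2 hgt.le)
      rw [e1, e2]
      exact hj1 _

theorem reflTransGen_merge (hb : IsDrift H b t₀ T PL PR) {t : ℝ} (ht : t ∈ Icc t₀ T)
    {q q' : Config} (h : Relation.ReflTransGen MergeStep q q') (hq : IsOrdered b aL t q) :
    IsOrdered b aL t q' ∧ (∀ x, profile b q' t x = profile b q t x) ∧
      lastParticle q' = lastParticle q := by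
  induction h with
  | refl => exact ⟨hq, fun _ => rfl, rfl⟩
  | tail _ h2 ih =>
    exact ⟨h2.isOrdered hb ht ih.1, fun x => (h2.profile_eq t x).trans (ih.2.1 x),
      h2.lastParticle_eq.trans ih.2.2⟩

theorem isOrdered_addLast {t m : ℝ} {q : Config} (hq : IsOrdered b aL t q)
    (hlast : (lastParticle q).1 ≤ aR) (hm : profile b q t aR < m) :
    IsOrdered b aL t (addLast q (aR, m)) := by
  obtain ⟨n, c⟩ := q
  simp only [lastParticle] at hlast
  rw [profile_eq_strip_last t hlast] at hm
  refine ⟨?_, ?_, ?_⟩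
  · have : (addLast ⟨n, c⟩ (aR, m)).2 0 = c 0 := by
      change Fin.snoc (α := fun _ => ℝ × ℝ) c (aR, m) (Fin.castSucc 0) = c 0
      rw [Fin.snoc_castSucc]
    rw [this]
    exact hq.left
  · refine Fin.monotone_iff_le_succ.2 fun i => ?_
    change Fin (n + 1) at i
    simp only [addLast]
    induction i using Fin.lastCases with
    | last => simpa using hlast
    | cast i =>
      rw [Fin.succ_castSucc, Fin.snoc_castSucc, Fin.snoc_castSucc]
      exact hq.mono Fin.castSucc_lt_succ.le
  · intro i
    change Fin (n + 1) at i
    simp only [addLast, leftValue]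
    induction i using Fin.lastCases with
    | last => simpa [strip] using hm
    | cast i =>
      rw [Fin.succ_castSucc, Fin.snoc_castSucc, Fin.snoc_castSucc]
      exact hq.jump i

end Config

/-! ### The flow between two events -/

section Piece

variable {H b : ℝ → ℝ → ℝ → ℝ} {t₀ T PL PR aL aR s s' : ℝ}

/-- The velocity of the particle number `i`. -/
noncomputable def velocity (H b : ℝ → ℝ → ℝ → ℝ) {n : ℕ} (c : Fin (n + 1) → ℝ × ℝ) (t : ℝ)
    (i : Fin (n + 1)) : ℝ :=
  Fin.cases 0 (fun j => -speed H (c j.succ).1 t (leftValue b c t j) (c j.succ).2) i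

@[simp] theorem velocity_zero {n : ℕ} (c : Fin (n + 1) → ℝ × ℝ) (t : ℝ) :
    velocity H b c t 0 = 0 := rfl

@[simp] theorem velocity_succ {n : ℕ} (c : Fin (n + 1) → ℝ × ℝ) (t : ℝ) (i : Fin n) :
    velocity H b c t i.succ = -speed H (c i.succ).1 t (leftValue b c t i) (c i.succ).2 := rfl

variable {n : ℕ} {c : ℝ → Fin (n + 1) → ℝ × ℝ}

theorem IsFlowPiece.continuousOn_apply (hc : IsFlowPiece H b aL aR s s' c) (i : Fin (n + 1)) :
    ContinuousOn (fun t => c t i) (Icc s s') :=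
  (continuous_apply i).comp_continuousOn hc.cont

theorem IsFlowPiece.hasDerivAt_position (hc : IsFlowPiece H b aL aR s s' c) {t : ℝ}
    (ht : t ∈ Ioo s s') (i : Fin (n + 1)) :
    HasDerivAt (fun τ => (c τ i).1) (velocity H b (c t) t i) t := by
  induction i using Fin.cases with
  | zero =>
    refine (hasDerivAt_const t aL).congr_of_eventuallyEq ?_
    filter_upwards [Ioo_mem_nhds ht.1 ht.2] with τ hτ
    exact hc.left τ hτ
  | succ i => exact hc.position t ht i

theorem IsFlowPiece.hasDerivAt_value (hc : IsFlowPiece H b aL aR s s' c) {t : ℝ}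
    (ht : t ∈ Ioo s s') (i : Fin (n + 1)) :
    HasDerivAt (fun τ => (c τ i).2) (driftT H b (c t i).1 t (c t i).2
      + b (c t i).1 t (c t i).2 * velocity H b (c t) t i) t := by
  induction i using Fin.cases with
  | zero => simpa using hc.first t ht
  | succ i =>
    refine (hc.value t ht i).congr_deriv ?_
    rw [velocity_succ, kay]
    ring

theorem IsFlowPiece.left_closed (hc : IsFlowPiece H b aL aR s s' c) (hs : s < s') :
    ∀ t ∈ Icc s s', (c t 0).1 = aL := by
  have h := hc.continuousOn_apply 0
  have : EqOn (fun t => (c t 0).1) (fun _ => aL) (Icc s s') := by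
    rw [← closure_Ioo hs.ne]
    refine EqOn.of_subset_closure (s := Ioo s s') (fun t ht => hc.left t ht) ?_
      continuousOn_const subset_closure subset_rfl
    rw [closure_Ioo hs.ne]
    exact continuous_fst.comp_continuousOn h
  exact this

/-- A weak inequality between continuous functions passes from an open interval to its closure. -/
theorem le_on_Icc_of_le_on_Ioo {f g : ℝ → ℝ} (hs : s < s') (hf : ContinuousOn f (Icc s s'))
    (hg : ContinuousOn g (Icc s s')) (h : ∀ t ∈ Ioo s s', f t ≤ g t) :
    ∀ t ∈ Icc s s', f t ≤ g t := by
  intro t ht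
  rw [← closure_Ioo hs.ne] at hf hg ht
  exact le_on_closure h hf hg ht

theorem IsFlowPiece.monotone_closed (hc : IsFlowPiece H b aL aR s s' c) (hs : s < s') :
    ∀ t ∈ Icc s s', Monotone fun i => (c t i).1 := by
  intro t ht i j hij
  exact le_on_Icc_of_le_on_Ioo hs (continuous_fst.comp_continuousOn (hc.continuousOn_apply i))
    (continuous_fst.comp_continuousOn (hc.continuousOn_apply j))
    (fun t ht => (hc.order t ht).monotone hij) t ht

theorem IsFlowPiece.right_closed (hc : IsFlowPiece H b aL aR s s' c) (hs : s < s') :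
    ∀ t ∈ Icc s s', ∀ i, (c t i).1 ≤ aR := by
  intro t ht i
  exact le_on_Icc_of_le_on_Ioo hs (continuous_fst.comp_continuousOn (hc.continuousOn_apply i))
    continuousOn_const
    (fun t ht => ((hc.order t ht).monotone (Fin.le_last i)).trans (hc.right t ht).le) t ht

theorem IsFlowPiece.left_le (hc : IsFlowPiece H b aL aR s s' c) (hs : s < s') :
    ∀ t ∈ Icc s s', ∀ i, aL ≤ (c t i).1 := by
  intro t ht i
  rw [← hc.left_closed hs t ht]
  exact hc.monotone_closed hs t ht (Fin.zero_le i)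

theorem IsFlowPiece.lt_rightEnd (hc : IsFlowPiece H b aL aR s s' c) {t : ℝ}
    (ht : t ∈ Ioo s s') (i : Fin (n + 1)) : (c t i).1 < rightEnd aR (c t) i := by
  induction i using Fin.lastCases with
  | last => simpa using hc.right t ht
  | cast i => simpa using hc.order t ht Fin.castSucc_lt_succ

theorem IsFlowPiece.rightEnd_le (hc : IsFlowPiece H b aL aR s s' c) (hs : s < s') {t : ℝ}
    (ht : t ∈ Icc s s') (i : Fin (n + 1)) : rightEnd aR (c t) i ≤ aR := by
  induction i using Fin.lastCases with
  | last => simp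
  | cast i => simpa using hc.right_closed hs t ht _

/-- A piece of a path between two events, with the a priori bounds that hold along the path. -/
structure IsGoodPiece (H b : ℝ → ℝ → ℝ → ℝ) (aL aR t₀ T PL PR s s' : ℝ) {n : ℕ}
    (c : ℝ → Fin (n + 1) → ℝ × ℝ) : Prop where
  flow : IsFlowPiece H b aL aR s s' c
  lt : s < s'
  le_left : t₀ ≤ s
  le_right : s' ≤ T
  range : ∀ t ∈ Ioo s s', ∀ x ∈ Icc aL aR, profile b ⟨n, c t⟩ t x ∈ Icc PL PR

theorem IsGoodPiece.mem_Ioo (hc : IsGoodPiece H b aL aR t₀ T PL PR s s' c) {t : ℝ}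
    (ht : t ∈ Ioo s s') : t ∈ Ioo t₀ T :=
  ⟨hc.le_left.trans_lt ht.1, ht.2.trans_le hc.le_right⟩

theorem IsGoodPiece.mem_Icc (hc : IsGoodPiece H b aL aR t₀ T PL PR s s' c) {t : ℝ}
    (ht : t ∈ Icc s s') : t ∈ Icc t₀ T :=
  ⟨hc.le_left.trans ht.1, ht.2.trans hc.le_right⟩

theorem IsGoodPiece.strip_mem (hb : IsDrift H b t₀ T PL PR)
    (hc : IsGoodPiece H b aL aR t₀ T PL PR s s' c) {t : ℝ} (ht : t ∈ Ioo s s')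
    (i : Fin (n + 1)) {x : ℝ} (hx : x ∈ Icc (c t i).1 (rightEnd aR (c t) i)) :
    strip b (c t) t i x ∈ Icc PL PR := by
  have hlt := hc.flow.lt_rightEnd ht i
  have htc := hc.mem_Icc (Ioo_subset_Icc_self ht)
  have hcont : Continuous (strip b (c t) t i) :=
    continuous_iff_continuousAt.2 fun x => (hasDerivAt_driftFlow hb htc _ _ x).continuousAt
  have hmaps : MapsTo (strip b (c t) t i) (Ico (c t i).1 (rightEnd aR (c t) i)) (Icc PL PR) := by
    intro y hy
    rw [← profile_eq_strip_of_lt_rightEnd (aR := aR) (hc.flow.order t ht).monotone t hy.1 hy.2]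
    exact hc.range t ht y ⟨(hc.flow.left_le hc.lt t (Ioo_subset_Icc_self ht) i).trans hy.1,
      hy.2.le.trans (hc.flow.rightEnd_le hc.lt (Ioo_subset_Icc_self ht) i)⟩
  have := hmaps.closure hcont
  rw [closure_Ico hlt.ne, isClosed_Icc.closure_eq] at this
  exact this hx

theorem IsGoodPiece.leftValue_mem (hb : IsDrift H b t₀ T PL PR)
    (hc : IsGoodPiece H b aL aR t₀ T PL PR s s' c) {t : ℝ} (ht : t ∈ Ioo s s')
    (i : Fin n) : leftValue b (c t) t i ∈ Icc PL PR := by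
  refine hc.strip_mem hb ht i.castSucc (x := (c t i.succ).1) ?_
  rw [rightEnd_castSucc]
  exact ⟨(hc.flow.order t ht Fin.castSucc_lt_succ).le, le_rfl⟩

theorem IsGoodPiece.value_mem (hb : IsDrift H b t₀ T PL PR)
    (hc : IsGoodPiece H b aL aR t₀ T PL PR s s' c) {t : ℝ} (ht : t ∈ Ioo s s')
    (i : Fin (n + 1)) : (c t i).2 ∈ Icc PL PR := by
  have := hc.strip_mem hb ht i (x := (c t i).1) ⟨le_rfl, (hc.flow.lt_rightEnd ht i).le⟩
  rwa [strip, driftFlow_self hb (hc.mem_Icc (Ioo_subset_Icc_self ht))] at this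

theorem IsGoodPiece.position_mem (hc : IsGoodPiece H b aL aR t₀ T PL PR s s' c) {t : ℝ}
    (ht : t ∈ Icc s s') (i : Fin (n + 1)) : (c t i).1 ∈ Icc aL aR :=
  ⟨hc.flow.left_le hc.lt t ht i, hc.flow.right_closed hc.lt t ht i⟩

theorem IsGoodPiece.hasFDerivAt_strip (hH : IsHamiltonian H t₀ T PL PR)
    (hb : IsDrift H b t₀ T PL PR) (hc : IsGoodPiece H b aL aR t₀ T PL PR s s' c) {t : ℝ}
    (ht : t ∈ Ioo s s') (i : Fin (n + 1)) {x : ℝ}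
    (hx : x ∈ Icc (c t i).1 (rightEnd aR (c t) i)) :
    HasFDerivAt (fun z : ℝ × ℝ => strip b (c z.2) z.2 i z.1)
      (b x t (strip b (c t) t i x) • ContinuousLinearMap.fst ℝ ℝ ℝ
        + driftT H b x t (strip b (c t) t i x) • ContinuousLinearMap.snd ℝ ℝ ℝ) (x, t) :=
  hasFDerivAt_driftFlow_curve hH hb (hc.mem_Ioo ht) (hc.flow.hasDerivAt_position ht i)
    (hc.flow.hasDerivAt_value ht i) hx.1
    fun _ hy => hc.strip_mem hb ht i ⟨hy.1, hy.2.trans hx.2⟩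

theorem IsGoodPiece.hasDerivAt_leftValue (hH : IsHamiltonian H t₀ T PL PR)
    (hb : IsDrift H b t₀ T PL PR) (hc : IsGoodPiece H b aL aR t₀ T PL PR s s' c) {t : ℝ}
    (ht : t ∈ Ioo s s') (i : Fin n) :
    HasDerivAt (fun τ => leftValue b (c τ) τ i)
      (b (c t i.succ).1 t (leftValue b (c t) t i) * velocity H b (c t) t i.succ
        + driftT H b (c t i.succ).1 t (leftValue b (c t) t i)) t := by
  refine hasDerivAt_driftFlow_along hH hb (hc.mem_Ioo ht)
    (hc.flow.hasDerivAt_position ht i.castSucc) (hc.flow.hasDerivAt_value ht i.castSucc)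
    (hc.flow.order t ht Fin.castSucc_lt_succ).le (fun y hy => ?_)
    (hc.flow.hasDerivAt_position ht i.succ)
  exact hc.strip_mem hb ht i.castSucc (by rwa [rightEnd_castSucc])

theorem IsGoodPiece.continuousOn_strip (hb : IsDrift H b t₀ T PL PR)
    (hc : IsGoodPiece H b aL aR t₀ T PL PR s s' c) (i : Fin (n + 1)) :
    ContinuousOn (fun z : ℝ × ℝ => strip b (c z.2) z.2 i z.1) (univ ×ˢ Icc s s') := by
  have h1 := hc.flow.continuousOn_apply i
  have h2 : ContinuousOn (fun z : ℝ × ℝ => c z.2 i) (univ ×ˢ Icc s s') :=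
    h1.comp continuousOn_snd fun z hz => hz.2
  exact (continuousOn_driftFlow hb).comp (f := fun z : ℝ × ℝ => (z.2, (c z.2 i).1, (c z.2 i).2, z.1))
    (continuousOn_snd.prodMk ((continuous_fst.comp_continuousOn h2).prodMk
      ((continuous_snd.comp_continuousOn h2).prodMk continuousOn_fst)))
    fun z hz => hc.mem_Icc hz.2

theorem IsGoodPiece.continuousOn_leftValue (hb : IsDrift H b t₀ T PL PR)
    (hc : IsGoodPiece H b aL aR t₀ T PL PR s s' c) (i : Fin n) :
    ContinuousOn (fun τ => leftValue b (c τ) τ i) (Icc s s') :=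
  (hc.continuousOn_strip hb i.castSucc).comp (f := fun τ => ((c τ i.succ).1, τ))
    ((continuous_fst.comp_continuousOn (hc.flow.continuousOn_apply i.succ)).prodMk continuousOn_id)
    fun _ hτ => ⟨mem_univ _, hτ⟩

/-- A continuous function that is positive initially stays positive if its derivative is bounded
below by a multiple of it as long as it is positive. -/
theorem pos_of_deriv_ge_neg_mul {D D' : ℝ → ℝ} {K : ℝ} (hD : ContinuousOn D (Icc s s'))
    (hD' : ∀ t ∈ Ioo s s', HasDerivAt D (D' t) t) (h0 : 0 < D s)
    (hK : ∀ t ∈ Ioo s s', 0 < D t → -(K * D t) ≤ D' t) : ∀ t ∈ Icc s s', 0 < D t := by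
  by_contra! hcon
  obtain ⟨t₁, ht₁, hle⟩ := hcon
  -- Grönwall up to the first zero of `D` gives a contradiction
  set Z := Icc s t₁ ∩ D ⁻¹' Iic 0 with hZ
  have hsub : Icc s t₁ ⊆ Icc s s' := Icc_subset_Icc_right ht₁.2
  have hZc : IsClosed Z := (hD.mono hsub).preimage_isClosed_of_isClosed isClosed_Icc isClosed_Iic
  have hZne : Z.Nonempty := ⟨t₁, ⟨ht₁.1, le_rfl⟩, hle⟩
  have hZb : BddBelow Z := ⟨s, fun z hz => hz.1.1⟩
  obtain ⟨hτ1, hτ2⟩ : sInf Z ∈ Z := hZc.csInf_mem hZne hZb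
  set τ := sInf Z with hτ
  have hsτ : s < τ := lt_of_le_of_ne hτ1.1 fun h => by
    have : D τ ≤ 0 := hτ2
    rw [← h] at this
    linarith
  have hpos : ∀ t ∈ Ico s τ, 0 < D t := fun t ht => by
    by_contra h
    exact absurd (csInf_le hZb ⟨⟨ht.1, ht.2.le.trans hτ1.2⟩, not_lt.1 h⟩) ht.2.not_ge
  have hmono : MonotoneOn (fun t => Real.exp (K * t) * D t) (Icc s τ) := by
    have hder : ∀ t ∈ Ioo s τ, HasDerivAt (fun t => Real.exp (K * t) * D t)
        (Real.exp (K * t) * (K * D t + D' t)) t := by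
      intro t ht
      have h1 : HasDerivAt (fun t => Real.exp (K * t)) (Real.exp (K * t) * K) t := by
        simpa using ((hasDerivAt_id t).const_mul K).exp
      exact (h1.mul (hD' t ⟨ht.1, ht.2.trans_le (hτ1.2.trans ht₁.2)⟩)).congr_deriv (by ring)
    refine monotoneOn_of_deriv_nonneg (convex_Icc s τ) ?_ ?_ ?_
    · exact (Continuous.continuousOn (by fun_prop)).mul
        (hD.mono (Icc_subset_Icc_right (hτ1.2.trans ht₁.2)))
    · rw [interior_Icc]
      exact fun t ht => (hder t ht).differentiableAt.differentiableWithinAt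
    · rw [interior_Icc]
      intro t ht
      rw [(hder t ht).deriv]
      have := hK t ⟨ht.1, ht.2.trans_le (hτ1.2.trans ht₁.2)⟩ (hpos t ⟨ht.1.le, ht.2⟩)
      exact mul_nonneg (Real.exp_pos _).le (by linarith)
  have h1 := hmono ⟨le_rfl, hsτ.le⟩ ⟨hsτ.le, le_rfl⟩ hsτ.le
  have h2 : 0 < Real.exp (K * s) * D s := mul_pos (Real.exp_pos _) h0
  have h3 : Real.exp (K * τ) * D τ ≤ 0 := mul_nonpos_of_nonneg_of_nonpos (Real.exp_pos _).le hτ2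
  simp only at h1
  linarith

theorem exists_slab_lipschitz {G : ℝ → ℝ → ℝ → ℝ} (hG : ContDiff ℝ 1 (unc G))
    (aL aR t₀ T PL PR : ℝ) : ∃ K : ℝ, 0 ≤ K ∧ ∀ x ∈ Icc aL aR, ∀ t ∈ Icc t₀ T,
      ∀ r ∈ Icc PL PR, ∀ r' ∈ Icc PL PR, |G x t r - G x t r'| ≤ K * |r - r'| := by
  set M := max (max |aL| |aR|) (max (max |t₀| |T|) (max |PL| |PR|)) with hM
  obtain ⟨K, hK, h⟩ := exists_lipschitz_closedBall hG M
  refine ⟨K, hK, fun x hx t ht r hr r' hr' => ?_⟩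
  have hin : ∀ r ∈ Icc PL PR, ‖((x, t, r) : ℝ × ℝ × ℝ)‖ ≤ M := fun r hr =>
    max_le ((abs_le_max_abs_abs hx.1 hx.2).trans (le_max_left _ _))
      (max_le (((abs_le_max_abs_abs ht.1 ht.2).trans (le_max_left _ _)).trans (le_max_right _ _))
        (((abs_le_max_abs_abs hr.1 hr.2).trans (le_max_right _ _)).trans (le_max_right _ _)))
  have h1 := h (x, t, r) (x, t, r') (hin r hr) (hin r' hr')
  have h2 : ‖((0, 0, r - r') : ℝ × ℝ × ℝ)‖ = |r - r'| := by
    simp [Prod.norm_def]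
  simpa only [unc, Prod.mk_sub_mk, sub_self, h2] using h1

/-- Upward jumps stay upward jumps. -/
theorem IsGoodPiece.jump (hH : IsHamiltonian H t₀ T PL PR)
    (hb : IsDrift H b t₀ T PL PR) (hc : IsGoodPiece H b aL aR t₀ T PL PR s s' c)
    (h0 : ∀ i : Fin n, leftValue b (c s) s i < (c s i.succ).2) :
    ∀ t ∈ Icc s s', ∀ i : Fin n, leftValue b (c t) t i < (c t i.succ).2 := by
  intro t ht i
  obtain ⟨K₁, hK₁, h₁⟩ := exists_slab_lipschitz (contDiff_unc_driftT hH hb) aL aR t₀ T PL PR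
  obtain ⟨K₂, hK₂, h₂⟩ := exists_slab_lipschitz hb.smooth aL aR t₀ T PL PR
  obtain ⟨V, hV, hsp⟩ := exists_abs_speed_le hH aL aR
  have := pos_of_deriv_ge_neg_mul (s := s) (s' := s')
    (D := fun t => (c t i.succ).2 - leftValue b (c t) t i) (K := K₁ + K₂ * V)
    ((continuous_snd.comp_continuousOn (hc.flow.continuousOn_apply i.succ)).sub
      (hc.continuousOn_leftValue hb i))
    (fun t ht => (hc.flow.hasDerivAt_value ht i.succ).sub (hc.hasDerivAt_leftValue hH hb ht i))
    (sub_pos.2 (h0 i)) (fun t ht hpos => ?_) t ht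
  · exact sub_pos.1 this
  · have hx := hc.position_mem (Ioo_subset_Icc_self ht) i.succ
    have htm := hc.mem_Icc (Ioo_subset_Icc_self ht)
    have hr := hc.value_mem hb ht i.succ
    have hl := hc.leftValue_mem hb ht i
    have e1 := h₁ _ hx t htm _ hr _ hl
    have e2 := h₂ _ hx t htm _ hr _ hl
    have e3 := hsp _ hx t htm _ hl _ hr (sub_pos.1 hpos).ne
    rw [abs_of_pos hpos] at e1 e2
    rw [velocity_succ]
    set v := speed H (c t i.succ).1 t (leftValue b (c t) t i) (c t i.succ).2
    set bp := b (c t i.succ).1 t (c t i.succ).2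
    set bm := b (c t i.succ).1 t (leftValue b (c t) t i)
    set βp := driftT H b (c t i.succ).1 t (c t i.succ).2
    set βm := driftT H b (c t i.succ).1 t (leftValue b (c t) t i)
    have e4 : |(bp - bm) * v| ≤ K₂ * ((c t i.succ).2 - leftValue b (c t) t i) * V := by
      rw [abs_mul]
      exact mul_le_mul e2 e3 (abs_nonneg _) (by positivity)
    have e5 := le_abs_self ((bp - bm) * v)
    have e6 := neg_abs_le (βp - βm)
    linarith

theorem IsGoodPiece.isOrdered (hH : IsHamiltonian H t₀ T PL PR)
    (hb : IsDrift H b t₀ T PL PR) (hc : IsGoodPiece H b aL aR t₀ T PL PR s s' c)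
    (h0 : IsOrdered b aL s ⟨n, c s⟩) : ∀ t ∈ Icc s s', IsOrdered b aL t ⟨n, c t⟩ := fun t ht =>
  ⟨hc.flow.left_closed hc.lt t ht, hc.flow.monotone_closed hc.lt t ht,
    hc.jump hH hb h0.jump t ht⟩

/-- The last particle has left `a₊` before the next event. -/
theorem IsGoodPiece.last_lt (hH : IsHamiltonian H t₀ T PL PR)
    (hb : IsDrift H b t₀ T PL PR) (hc : IsGoodPiece H b aL aR t₀ T PL PR s s' c)
    (h0 : IsOrdered b aL s ⟨n, c s⟩) : ∀ t ∈ Ioc s s', (c t (Fin.last n)).1 < aR := by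
  have hanti : AntitoneOn (fun t => (c t (Fin.last n)).1) (Icc s s') := by
    refine antitoneOn_of_deriv_nonpos (convex_Icc s s')
      (continuous_fst.comp_continuousOn (hc.flow.continuousOn_apply _)) ?_ ?_
    · rw [interior_Icc]
      exact fun t ht => (hc.flow.hasDerivAt_position ht _).differentiableAt.differentiableWithinAt
    · rw [interior_Icc]
      intro t ht
      rw [(hc.flow.hasDerivAt_position ht _).deriv]
      induction (Fin.last n) using Fin.cases with
      | zero => simp
      | succ i =>
        rw [velocity_succ, neg_nonpos]
        exact speed_nonneg hH (hc.mem_Icc (Ioo_subset_Icc_self ht)) (hc.leftValue_mem hb ht i)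
          (hc.value_mem hb ht i.succ) (hc.jump hH hb h0.jump t (Ioo_subset_Icc_self ht) i)
  intro t ht
  have hm : (s + t) / 2 ∈ Ioo s s' := ⟨by linarith [ht.1], by linarith [ht.1, ht.2]⟩
  exact (hanti (Ioo_subset_Icc_self hm) (Ioc_subset_Icc_self ht) (by linarith [ht.1])).trans_lt
    (hc.flow.right _ hm)

end Piece

/-! ### Whole paths -/

section Path

variable {H b : ℝ → ℝ → ℝ → ℝ} {t₀ T PL PR aL aR : ℝ}

/-- The structure of a particle path: its pieces are ordered with upward jumps, the profile off
`a₊` is continuous in time at the events, and at each event either nothing happens to the profile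
or a new last particle enters at `a₊`. -/
theorem IsParticlePath.structure (hH : IsHamiltonian H t₀ T PL PR)
    (hb : IsDrift H b t₀ T PL PR) {q : ℝ → Config}
    (hq : IsParticlePath H b aL aR t₀ T PL PR q) :
    ∃ (N : ℕ) (s : ℕ → ℝ) (n : ℕ → ℕ) (c : ∀ k, ℝ → Fin (n k + 1) → ℝ × ℝ),
      s 0 = t₀ ∧ s (N + 1) = T ∧
      (∀ k ≤ N, s k < s (k + 1) ∧ IsGoodPiece H b aL aR t₀ T PL PR (s k) (s (k + 1)) (c k) ∧
        (∀ t ∈ Ico (s k) (s (k + 1)), q t = ⟨n k, c k t⟩) ∧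
        (∀ t ∈ Icc (s k) (s (k + 1)), IsOrdered b aL t ⟨n k, c k t⟩)) ∧
      (lastParticle (q t₀)).1 < aR ∧
      ∀ k < N, ∃ r : Config, (∀ x, profile b r (s (k + 1)) x
          = profile b ⟨n k, c k (s (k + 1))⟩ (s (k + 1)) x) ∧ (lastParticle r).1 < aR ∧
        (q (s (k + 1)) = r ∨ ∃ m, profile b r (s (k + 1)) aR < m ∧
          q (s (k + 1)) = addLast r (aR, m)) := by
  obtain ⟨N, s, hs0, hsT, hev⟩ := hq.evolution
  choose! hlt n c hflow hqc hevent using hev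
  have hmono : ∀ k ≤ N + 1, t₀ ≤ s k := by
    intro k
    induction k with
    | zero => intro _; exact hs0.ge
    | succ k ih => intro hk; exact (ih (by omega)).trans (hlt k (by omega)).le
  have hmono' : ∀ j k, j + k = N + 1 → s k ≤ T := by
    intro j
    induction j with
    | zero => intro k hk; rw [zero_add] at hk; rw [hk, hsT]
    | succ j ih => intro k hk; exact (hlt k (by omega)).le.trans (ih (k + 1) (by omega))
  have hgood : ∀ k ≤ N, IsGoodPiece H b aL aR t₀ T PL PR (s k) (s (k + 1)) (c k) := by
    intro k hk
    have h1 := hmono k (by omega)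
    have h2 := hmono' (N - k) (k + 1) (by omega)
    refine ⟨hflow k hk, hlt k hk, h1, h2, fun t ht x hx => ?_⟩
    rw [← hqc k hk t (Ioo_subset_Ico_self ht)]
    exact hq.range t ⟨h1.trans ht.1.le, ht.2.trans_le h2⟩ x hx
  have hmerge : ∀ k, k < N → IsOrdered b aL (s k) ⟨n k, c k (s k)⟩ →
      ∃ r : Config, IsOrdered b aL (s (k + 1)) r ∧ (∀ x, profile b r (s (k + 1)) x
          = profile b ⟨n k, c k (s (k + 1))⟩ (s (k + 1)) x) ∧ (lastParticle r).1 < aR ∧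
        (q (s (k + 1)) = r ∨ ∃ m, profile b r (s (k + 1)) aR < m ∧
          q (s (k + 1)) = addLast r (aR, m)) := by
    intro k hk hord
    have hg := hgood k hk.le
    have ht : s (k + 1) ∈ Icc (s k) (s (k + 1)) := ⟨hg.lt.le, le_rfl⟩
    have hord' := hg.isOrdered hH hb hord _ ht
    have hlast := hg.last_lt hH hb hord _ ⟨hg.lt, le_rfl⟩
    rcases hevent k hk.le hk with hm | ⟨r, m, hm, hpm, hqr⟩
    · obtain ⟨h1, h2, h3⟩ := reflTransGen_merge hb (hg.mem_Icc ht) hm.1 hord'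
      exact ⟨_, h1, h2, by rw [h3]; exact hlast, Or.inl rfl⟩
    · obtain ⟨h1, h2, h3⟩ := reflTransGen_merge hb (hg.mem_Icc ht) hm.1 hord'
      exact ⟨r, h1, h2, by rw [h3]; exact hlast, Or.inr ⟨m, hpm, hqr⟩⟩
  have hord : ∀ k ≤ N, IsOrdered b aL (s k) ⟨n k, c k (s k)⟩ := by
    intro k
    induction k with
    | zero =>
      intro hk
      rw [← hqc 0 hk (s 0) ⟨le_rfl, hlt 0 hk⟩, hs0]
      exact ⟨hq.initial.1, hq.initial.2.1.monotone, hq.initial.2.2.2⟩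
    | succ k ih =>
      intro hk
      rw [← hqc (k + 1) hk (s (k + 1)) ⟨le_rfl, hlt (k + 1) hk⟩]
      obtain ⟨r, h1, h2, h3, h4⟩ := hmerge k (by omega) (ih (by omega))
      rcases h4 with h4 | ⟨m, hm, h4⟩
      · rw [h4]
        exact h1
      · rw [h4]
        exact isOrdered_addLast h1 h3.le hm
  refine ⟨N, s, n, c, hs0, hsT, fun k hk => ⟨hlt k hk, hgood k hk, hqc k hk,
    (hgood k hk).isOrdered hH hb (hord k hk)⟩, hq.initial.2.2.1, fun k hk => ?_⟩
  obtain ⟨r, _, h2, h3, h4⟩ := hmerge k hk (hord k hk.le)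
  exact ⟨r, h2, h3, h4⟩

end Path

/-! ### Integrals over intervals with moving end points -/

section Leibniz

variable {s s' : ℝ} {a e a' e' : ℝ → ℝ} {g gx gt : ℝ × ℝ → ℝ}

/-- Leibniz' rule for an integral between two moving end points. -/
theorem hasDerivAt_integral_moving {V G t : ℝ} (ht : t ∈ Ioo s s')
    (ha : ∀ τ ∈ Ioo s s', HasDerivAt a (a' τ) τ) (he : ∀ τ ∈ Ioo s s', HasDerivAt e (e' τ) τ)
    (hae : ∀ τ ∈ Ioo s s', a τ ≤ e τ)
    (hg : ∀ τ ∈ Ioo s s', ∀ x ∈ Icc (a τ) (e τ),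
      HasFDerivAt g (gx (x, τ) • ContinuousLinearMap.fst ℝ ℝ ℝ
        + gt (x, τ) • ContinuousLinearMap.snd ℝ ℝ ℝ) (x, τ))
    (hgx : ∀ τ ∈ Ioo s s', ContinuousOn (fun x => gx (x, τ)) (Icc (a τ) (e τ)))
    (hgt : ∀ τ ∈ Ioo s s', ContinuousOn (fun x => gt (x, τ)) (Icc (a τ) (e τ)))
    (hV : ∀ τ ∈ Ioo s s', |a' τ| ≤ V ∧ |e' τ| ≤ V ∧ e τ - a τ ≤ V)
    (hG : ∀ τ ∈ Ioo s s', ∀ x ∈ Icc (a τ) (e τ),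
      |g (x, τ)| ≤ G ∧ |gx (x, τ)| ≤ G ∧ |gt (x, τ)| ≤ G) :
    HasDerivAt (fun τ => ∫ x in a τ..e τ, g (x, τ))
      ((∫ x in a t..e t, gt (x, t)) + (g (e t, t) * e' t - g (a t, t) * a' t)) t := by
  -- substitute `x = a + y (e - a)`
  set X : ℝ → ℝ → ℝ := fun τ y => a τ + (e τ - a τ) * y with hX
  have hXmem : ∀ τ ∈ Ioo s s', ∀ y ∈ Icc (0 : ℝ) 1, X τ y ∈ Icc (a τ) (e τ) := by
    intro τ hτ y hy
    have h1 := hae τ hτ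
    constructor
    · have := mul_nonneg (sub_nonneg.2 h1) hy.1
      simp only [hX]; linarith
    · have := mul_le_of_le_one_right (sub_nonneg.2 h1) hy.2
      simp only [hX]; linarith
  have hXc : ∀ τ, Continuous (X τ) := fun τ => by fun_prop
  have hXmaps : ∀ τ ∈ Ioo s s', MapsTo (X τ) (Icc 0 1) (Icc (a τ) (e τ)) := fun τ hτ y hy =>
    hXmem τ hτ y hy
  have hgc : ∀ τ ∈ Ioo s s', ContinuousOn (fun x => g (x, τ)) (Icc (a τ) (e τ)) :=
    fun τ hτ x hx => ((hg τ hτ x hx).continuousAt.comp (f := fun x => (x, τ))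
      (by fun_prop : ContinuousAt (fun x : ℝ => (x, τ)) x)).continuousWithinAt
  set F : ℝ → ℝ → ℝ := fun τ y => (e τ - a τ) * g (X τ y, τ) with hF
  set F' : ℝ → ℝ → ℝ := fun τ y => (e' τ - a' τ) * g (X τ y, τ)
    + (e τ - a τ) * (gx (X τ y, τ) * (a' τ + (e' τ - a' τ) * y) + gt (X τ y, τ)) with hF'
  have hFint : ∀ τ, ∫ x in a τ..e τ, g (x, τ) = ∫ y in (0 : ℝ)..1, F τ y := by
    intro τ
    have := intervalIntegral.smul_integral_comp_add_mul (fun x => g (x, τ)) (e τ - a τ) (a τ)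
      (a := 0) (b := 1)
    simp only [mul_zero, add_zero, mul_one, smul_eq_mul, add_sub_cancel] at this
    rw [← this, ← intervalIntegral.integral_const_mul]
  have hFc : ∀ τ ∈ Ioo s s', ContinuousOn (F τ) (Icc 0 1) := fun τ hτ =>
    continuousOn_const.mul ((hgc τ hτ).comp (hXc τ).continuousOn (hXmaps τ hτ))
  have hF'c : ∀ τ ∈ Ioo s s', ContinuousOn (F' τ) (Icc 0 1) := fun τ hτ =>
    (continuousOn_const.mul ((hgc τ hτ).comp (hXc τ).continuousOn (hXmaps τ hτ))).add
      (continuousOn_const.mul ((((hgx τ hτ).comp (hXc τ).continuousOn (hXmaps τ hτ)).mul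
        (by fun_prop)).add ((hgt τ hτ).comp (hXc τ).continuousOn (hXmaps τ hτ))))
  have hder : ∀ τ ∈ Ioo s s', ∀ y ∈ Icc (0 : ℝ) 1,
      HasDerivAt (fun τ => F τ y) (F' τ y) τ := by
    intro τ hτ y hy
    have h1 : HasDerivAt (fun τ => X τ y) (a' τ + (e' τ - a' τ) * y) τ :=
      (ha τ hτ).add (((he τ hτ).sub (ha τ hτ)).mul_const y)
    have h2 := (hg τ hτ _ (hXmem τ hτ y hy)).comp_hasDerivAt_of_eq τ
      (h1.prodMk (hasDerivAt_id τ)) rfl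
    refine ((((he τ hτ).sub (ha τ hτ))).mul h2).congr_deriv ?_
    simp [hF']
  have hIoc : Ι (0 : ℝ) 1 ⊆ Icc 0 1 := by
    rw [uIoc_of_le zero_le_one]; exact Ioc_subset_Icc_self
  have hmeas : ∀ {f : ℝ → ℝ}, ContinuousOn f (Icc 0 1) →
      AEStronglyMeasurable f (volume.restrict (Ι (0 : ℝ) 1)) := fun hf =>
    (hf.mono hIoc).aestronglyMeasurable measurableSet_uIoc
  have hmain := (intervalIntegral.hasDerivAt_integral_of_dominated_loc_of_deriv_le
    (F := F) (F' := F') (x₀ := t) (a := 0) (b := 1) (μ := volume)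
    (bound := fun _ => 2 * V * G + V * (G * (3 * V) + G)) (s := Ioo s s')
    (Ioo_mem_nhds ht.1 ht.2)
    (by
      filter_upwards [Ioo_mem_nhds ht.1 ht.2] with τ hτ
      exact hmeas (hFc τ hτ))
    (by
      refine ContinuousOn.intervalIntegrable ?_
      rw [uIcc_of_le zero_le_one]
      exact hFc t ht)
    (hmeas (hF'c t ht))
    (Eventually.of_forall fun y hy τ hτ => by
      have hy' := hIoc hy
      obtain ⟨v1, v2, v3⟩ := hV τ hτ
      obtain ⟨g1, g2, g3⟩ := hG τ hτ _ (hXmem τ hτ y hy')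
      have hV0 : 0 ≤ V := (abs_nonneg _).trans v1
      have hG0 : 0 ≤ G := (abs_nonneg _).trans g1
      have v4 : |e' τ - a' τ| ≤ 2 * V := (abs_sub _ _).trans (by linarith)
      have v5 : |e τ - a τ| ≤ V := by rwa [abs_of_nonneg (sub_nonneg.2 (hae τ hτ))]
      have v6 : |a' τ + (e' τ - a' τ) * y| ≤ 3 * V := by
        refine (abs_add_le _ _).trans ?_
        rw [abs_mul, abs_of_nonneg hy'.1]
        have := mul_le_mul v4 hy'.2 hy'.1 (by positivity)
        linarith
      rw [Real.norm_eq_abs]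
      calc |F' τ y| ≤ |e' τ - a' τ| * |g (X τ y, τ)| + |e τ - a τ|
            * (|gx (X τ y, τ)| * |a' τ + (e' τ - a' τ) * y| + |gt (X τ y, τ)|) := by
            simp only [hF']
            refine (abs_add_le _ _).trans ?_
            rw [abs_mul, abs_mul]
            gcongr
            refine (abs_add_le _ _).trans ?_
            rw [abs_mul]
        _ ≤ _ := by gcongr)
    (by simp)
    (Eventually.of_forall fun y hy τ hτ => hder τ hτ y (hIoc hy))).2
  refine (hmain.congr_of_eventuallyEq (Eventually.of_forall hFint)).congr_deriv ?_
  -- the boundary terms are the integral of a derivative in `y`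
  set Y : ℝ → ℝ := fun y => a' t + (e' t - a' t) * y with hY
  have hsplit : ∀ y, F' t y = ((e' t - a' t) * g (X t y, t) + (e t - a t) * gx (X t y, t) * Y y)
      + (e t - a t) * gt (X t y, t) := fun y => by simp only [hF', hY]; ring
  have hc1 : ContinuousOn (fun y => (e' t - a' t) * g (X t y, t)
      + (e t - a t) * gx (X t y, t) * Y y) (Icc 0 1) :=
    (continuousOn_const.mul ((hgc t ht).comp (hXc t).continuousOn (hXmaps t ht))).add
      ((continuousOn_const.mul ((hgx t ht).comp (hXc t).continuousOn (hXmaps t ht))).mul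
        (by fun_prop))
  have hc2 : ContinuousOn (fun y => (e t - a t) * gt (X t y, t)) (Icc 0 1) :=
    continuousOn_const.mul ((hgt t ht).comp (hXc t).continuousOn (hXmaps t ht))
  rw [← uIcc_of_le zero_le_one] at hc1 hc2
  simp_rw [hsplit]
  rw [intervalIntegral.integral_add hc1.intervalIntegrable hc2.intervalIntegrable, add_comm]
  congr 1
  · have := intervalIntegral.smul_integral_comp_add_mul (fun x => gt (x, t)) (e t - a t) (a t)
      (a := 0) (b := 1)
    simp only [mul_zero, add_zero, mul_one, smul_eq_mul, add_sub_cancel] at this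
    rw [← this, ← intervalIntegral.integral_const_mul]
  · rw [intervalIntegral.integral_eq_sub_of_hasDerivAt (f := fun y => g (X t y, t) * Y y)]
    · simp [hX, hY]
    · intro y hy
      rw [uIcc_of_le zero_le_one] at hy
      have h1 : HasDerivAt (X t) (e t - a t) y := by
        refine (((hasDerivAt_id y).const_mul (e t - a t)).const_add (a t)).congr_deriv (by simp)
      have h2 := (hg t ht _ (hXmem t ht y hy)).comp_hasDerivAt_of_eq y
        (h1.prodMk (hasDerivAt_const y t)) rfl
      have h3 : HasDerivAt Y (e' t - a' t) y := by
        refine (((hasDerivAt_id y).const_mul (e' t - a' t)).const_add (a' t)).congr_deriv (by simp)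
      refine (h2.mul h3).congr_deriv ?_
      simp
      ring
    · exact hc1.intervalIntegrable

theorem continuous_clamp (s s' : ℝ) : Continuous fun t : ℝ => max s (min t s') := by fun_prop

theorem clamp_mem (h : s ≤ s') (t : ℝ) : max s (min t s') ∈ Icc s s' :=
  ⟨le_max_left _ _, max_le h (min_le_right _ _)⟩

theorem clamp_eq {t : ℝ} (ht : t ∈ Icc s s') : max s (min t s') = t := by
  rw [min_eq_left ht.2, max_eq_right ht.1]

theorem continuousOn_integral_moving (hs : s ≤ s') (ha : ContinuousOn a (Icc s s'))
    (he : ContinuousOn e (Icc s s')) (hg : ContinuousOn g (univ ×ˢ Icc s s')) :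
    ContinuousOn (fun τ => ∫ x in a τ..e τ, g (x, τ)) (Icc s s') := by
  have h1 : Continuous fun τ => ∫ x in (0 : ℝ)..(e (max s (min τ s'))),
      g (x, max s (min τ s')) := by
    refine intervalIntegral.continuous_parametric_intervalIntegral_of_continuous
      (f := fun τ x => g (x, max s (min τ s'))) ?_ ?_
    · exact hg.comp_continuous (f := fun z : ℝ × ℝ => (z.2, max s (min z.1 s'))) (by fun_prop)
        fun z => ⟨mem_univ _, clamp_mem hs _⟩
    · exact he.comp_continuous (continuous_clamp s s') (clamp_mem hs)
  have h2 : Continuous fun τ => ∫ x in (0 : ℝ)..(a (max s (min τ s'))),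
      g (x, max s (min τ s')) := by
    refine intervalIntegral.continuous_parametric_intervalIntegral_of_continuous
      (f := fun τ x => g (x, max s (min τ s'))) ?_ ?_
    · exact hg.comp_continuous (f := fun z : ℝ × ℝ => (z.2, max s (min z.1 s'))) (by fun_prop)
        fun z => ⟨mem_univ _, clamp_mem hs _⟩
    · exact ha.comp_continuous (continuous_clamp s s') (clamp_mem hs)
  refine (h1.sub h2).continuousOn.congr fun τ hτ => ?_
  have hc : Continuous fun x => g (x, τ) :=
    hg.comp_continuous (f := fun x : ℝ => (x, τ)) (by fun_prop) fun x => ⟨mem_univ _, hτ⟩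
  simp only [Pi.sub_apply, clamp_eq hτ]
  exact (intervalIntegral.integral_interval_sub_left (hc.intervalIntegrable _ _)
    (hc.intervalIntegrable _ _)).symm

end Leibniz

/-! ### The entropy balance between two events -/

section Balance

variable {H b : ℝ → ℝ → ℝ → ℝ} {t₀ T PL PR aL aR s s' : ℝ}

theorem exists_box_bound {Γ : ℝ × ℝ × ℝ → ℝ} (hΓ : Continuous Γ) (aL aR t₀ T PL PR : ℝ) :
    ∃ G : ℝ, 0 ≤ G ∧ ∀ x ∈ Icc aL aR, ∀ t ∈ Icc t₀ T, ∀ r ∈ Icc PL PR, |Γ (x, t, r)| ≤ G := by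
  obtain ⟨G, hG⟩ := ((isCompact_Icc (a := aL) (b := aR)).prod
    ((isCompact_Icc (a := t₀) (b := T)).prod
      (isCompact_Icc (a := PL) (b := PR)))).exists_bound_of_continuousOn hΓ.continuousOn
  exact ⟨max G 0, le_max_right _ _, fun x hx t ht r hr =>
    (hG (x, t, r) ⟨hx, ht, hr⟩).trans (le_max_left _ _)⟩

theorem sum_integral_strips {n : ℕ} (c : Fin (n + 1) → ℝ × ℝ) (aR : ℝ) {f : ℝ → ℝ}
    (hf : ∀ i, IntervalIntegrable f volume (c i).1 (rightEnd aR c i)) :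
    ∑ i, ∫ x in (c i).1..rightEnd aR c i, f x = ∫ x in (c 0).1..aR, f x := by
  set p : ℕ → ℝ := fun k => if h : k < n + 1 then (c ⟨k, h⟩).1 else aR with hp
  have h1 : ∀ i : Fin (n + 1), (c i).1 = p i := fun i => by simp only [hp, i.2, dite_true]
  have h2 : ∀ i : Fin (n + 1), rightEnd aR c i = p (i + 1) := by
    intro i
    induction i using Fin.lastCases with
    | last => simp [hp]
    | cast i => simp [hp, Fin.succ]
  have h3 : ∀ i : Fin (n + 1), ∫ x in (c i).1..rightEnd aR c i, f x
      = (fun k : ℕ => ∫ x in p k..p (k + 1), f x) i := fun i => by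
    rw [h1, h2]
  rw [Finset.sum_congr rfl fun i _ => h3 i,
    Fin.sum_univ_eq_sum_range (fun k => ∫ x in p k..p (k + 1), f x),
    intervalIntegral.sum_integral_adjacent_intervals]
  · simp [hp]
  · intro k hk
    have := hf ⟨k, hk⟩
    rwa [h1, h2] at this

/-- The integral of a function of the profile is the sum of the integrals over the strips. -/
theorem integral_profile_eq_sum {n : ℕ} {c : Fin (n + 1) → ℝ × ℝ} (t : ℝ)
    (hc : Monotone fun i => (c i).1) (hR : ∀ i, (c i).1 ≤ aR) {F : ℝ → ℝ → ℝ}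
    (hF : ∀ i, IntervalIntegrable (fun x => F x (strip b c t i x)) volume (c i).1
      (rightEnd aR c i)) :
    IntervalIntegrable (fun x => F x (profile b ⟨n, c⟩ t x)) volume (c 0).1 aR ∧
    ∫ x in (c 0).1..aR, F x (profile b ⟨n, c⟩ t x)
      = ∑ i, ∫ x in (c i).1..rightEnd aR c i, F x (strip b c t i x) := by
  have hle : ∀ i, (c i).1 ≤ rightEnd aR c i := by
    intro i
    induction i using Fin.lastCases with
    | last => simpa using hR _
    | cast i => simpa using hc Fin.castSucc_lt_succ.le
  have heq : ∀ i, ∀ x ∈ Ioo (c i).1 (rightEnd aR c i),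
      F x (strip b c t i x) = F x (profile b ⟨n, c⟩ t x) := fun i x hx => by
    rw [profile_eq_strip_of_lt_rightEnd hc t hx.1.le hx.2]
  have heq' : ∀ i, ∀ᵐ x, x ∈ Ι (c i).1 (rightEnd aR c i) →
      F x (strip b c t i x) = F x (profile b ⟨n, c⟩ t x) := by
    intro i
    filter_upwards [compl_mem_ae_iff.2 (measure_singleton (rightEnd aR c i))] with x hx hx'
    rw [uIoc_of_le (hle i)] at hx'
    exact heq i x ⟨hx'.1, lt_of_le_of_ne hx'.2 hx⟩
  have hint : ∀ i, IntervalIntegrable (fun x => F x (profile b ⟨n, c⟩ t x)) volume (c i).1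
      (rightEnd aR c i) := fun i =>
    (hF i).congr_ae ((ae_restrict_iff' measurableSet_uIoc).2 (heq' i))
  refine ⟨?_, ?_⟩
  · have key : ∀ i : Fin (n + 1), IntervalIntegrable (fun x => F x (profile b ⟨n, c⟩ t x)) volume
        (c 0).1 (c i).1 := by
      intro i
      induction i using Fin.induction with
      | zero => exact IntervalIntegrable.refl
      | succ i ih => exact ih.trans (by simpa using hint i.castSucc)
    exact (key (Fin.last n)).trans (by simpa using hint (Fin.last n))
  · rw [← sum_integral_strips c aR hint]
    exact Finset.sum_congr rfl fun i _ => (intervalIntegral.integral_congr_ae (heq' i)).symm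

/-- The density of the weak entropy balance for the entropy `η`, with the derivatives `η₁ = η'` and
`η₂ = η''`, the flux of which is normalized by subtracting `κ H (x, t, k)`. -/
noncomputable def entropyDensity (H b : ℝ → ℝ → ℝ → ℝ) (η η₁ η₂ : ℝ → ℝ) (κ k : ℝ)
    (φ : ℝ × ℝ → ℝ) (x t r : ℝ) : ℝ :=
  η r * fderiv ℝ φ (x, t) (0, 1) - η₁ r * (H x t r - κ * H x t k) * fderiv ℝ φ (x, t) (1, 0)
    + κ * (η₁ r * dX H x t k * φ (x, t)) - η₂ r * b x t r * (H x t r - κ * H x t k) * φ (x, t)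

/-- The contribution of a shock to the entropy balance. -/
noncomputable def entropyJump (H : ℝ → ℝ → ℝ → ℝ) (η η₁ : ℝ → ℝ) (κ k : ℝ)
    (φ : ℝ × ℝ → ℝ) (x t rm rp : ℝ) : ℝ :=
  φ (x, t) * (speed H x t rm rp * (η rp - η rm)
    - (η₁ rp * (H x t rp - κ * H x t k) - η₁ rm * (H x t rm - κ * H x t k)))

variable {n : ℕ} {c : ℝ → Fin (n + 1) → ℝ × ℝ} {η η₁ η₂ : ℝ → ℝ} {φ : ℝ × ℝ → ℝ}

theorem continuous_entropyDensity (hH : IsHamiltonian H t₀ T PL PR)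
    (hb : IsDrift H b t₀ T PL PR) (hφ : ContDiff ℝ ∞ φ) (hη : Continuous η) (hη₁ : Continuous η₁)
    (hη₂ : Continuous η₂) (κ k : ℝ) :
    Continuous fun z : ℝ × ℝ × ℝ => entropyDensity H b η η₁ η₂ κ k φ z.1 z.2.1 z.2.2 := by
  have hH' : Continuous fun z : ℝ × ℝ × ℝ => H z.1 z.2.1 z.2.2 := hH.smooth.continuous
  have hHk : Continuous fun z : ℝ × ℝ × ℝ => H z.1 z.2.1 k :=
    hH'.comp (by fun_prop : Continuous fun z : ℝ × ℝ × ℝ => (z.1, z.2.1, k))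
  have hXk : Continuous fun z : ℝ × ℝ × ℝ => dX H z.1 z.2.1 k :=
    (continuous_unc_dX hH.contDiff_one).comp
      (by fun_prop : Continuous fun z : ℝ × ℝ × ℝ => (z.1, z.2.1, k))
  have hb' : Continuous fun z : ℝ × ℝ × ℝ => b z.1 z.2.1 z.2.2 := hb.smooth.continuous
  have hφ0 : Continuous φ := hφ.continuous
  have hφ1 := hφ.continuous_fderiv (by simp)
  have h1 : Continuous fun z : ℝ × ℝ × ℝ => fderiv ℝ φ (z.1, z.2.1) (0, 1) :=
    (hφ1.comp (by fun_prop : Continuous fun z : ℝ × ℝ × ℝ => (z.1, z.2.1))).clm_apply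
      continuous_const
  have h2 : Continuous fun z : ℝ × ℝ × ℝ => fderiv ℝ φ (z.1, z.2.1) (1, 0) :=
    (hφ1.comp (by fun_prop : Continuous fun z : ℝ × ℝ × ℝ => (z.1, z.2.1))).clm_apply
      continuous_const
  unfold entropyDensity
  fun_prop

/-- Between two events the integral of an entropy against a test function changes by the entropy
density and by the contributions of the shocks. -/
theorem IsGoodPiece.hasDerivAt_entropy (hH : IsHamiltonian H t₀ T PL PR)
    (hb : IsDrift H b t₀ T PL PR) (hc : IsGoodPiece H b aL aR t₀ T PL PR s s' c)
    (hjump : ∀ t ∈ Ioo s s', ∀ i : Fin n, leftValue b (c t) t i < (c t i.succ).2)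
    (hφ : IsTest aL aR t₀ T φ) (hη : ∀ r, HasDerivAt η (η₁ r) r)
    (hη₁ : ∀ r, HasDerivAt η₁ (η₂ r) r) (hη₂ : Continuous η₂) (κ k : ℝ) {t : ℝ}
    (ht : t ∈ Ioo s s') :
    HasDerivAt (fun τ => ∫ x in aL..aR, η (profile b ⟨n, c τ⟩ τ x) * φ (x, τ))
      ((∫ x in aL..aR, entropyDensity H b η η₁ η₂ κ k φ x t (profile b ⟨n, c t⟩ t x))
        + ∑ i : Fin n, entropyJump H η η₁ κ k φ (c t i.succ).1 t (leftValue b (c t) t i)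
          (c t i.succ).2) t := by
  have hηc : Continuous η := continuous_iff_continuousAt.2 fun r => (hη r).continuousAt
  have hη₁c : Continuous η₁ := continuous_iff_continuousAt.2 fun r => (hη₁ r).continuousAt
  have hφd : Differentiable ℝ φ := hφ.1.differentiable (by simp)
  have hφc : Continuous φ := hφ.1.continuous
  have hφ1 := hφ.1.continuous_fderiv (by simp)
  have hφx : Continuous fun z => fderiv ℝ φ z (1, 0) := hφ1.clm_apply continuous_const
  have hφt : Continuous fun z => fderiv ℝ φ z (0, 1) := hφ1.clm_apply continuous_const
  have hβc : Continuous (unc (driftT H b)) := (contDiff_unc_driftT hH hb).continuous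
  have hbc : Continuous (unc b) := hb.smooth.continuous
  have hHc : Continuous (unc H) := hH.smooth.continuous
  have hzero : ∀ x τ, x ∉ Ioo aL aR → φ (x, τ) = 0 := fun x τ hx =>
    image_eq_zero_of_notMem_tsupport fun h => hx (hφ.2.2 h).1
  have hmono : ∀ τ ∈ Ioo s s', Monotone fun i => (c τ i).1 := fun τ hτ =>
    (hc.flow.order τ hτ).monotone
  have hR : ∀ τ ∈ Ioo s s', ∀ i, (c τ i).1 ≤ aR := fun τ hτ =>
    hc.flow.right_closed hc.lt τ (Ioo_subset_Icc_self hτ)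
  have hstripc : ∀ τ ∈ Icc s s', ∀ i, Continuous (strip b (c τ) τ i) := fun τ hτ i =>
    continuous_iff_continuousAt.2 fun x =>
      (hasDerivAt_driftFlow hb (hc.mem_Icc hτ) _ _ x).continuousAt
  -- the derivatives of `η (ρ) φ` on a strip
  set Γ : ℝ × ℝ × ℝ → ℝ := fun z => η z.2.2 * φ (z.1, z.2.1) with hΓ
  set Γx : ℝ × ℝ × ℝ → ℝ := fun z => η₁ z.2.2 * unc b z * φ (z.1, z.2.1)
    + η z.2.2 * fderiv ℝ φ (z.1, z.2.1) (1, 0) with hΓx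
  set Γt : ℝ × ℝ × ℝ → ℝ := fun z => η₁ z.2.2 * unc (driftT H b) z * φ (z.1, z.2.1)
    + η z.2.2 * fderiv ℝ φ (z.1, z.2.1) (0, 1) with hΓt
  have hΓc : Continuous Γ := by fun_prop
  have hΓxc : Continuous Γx := ((by fun_prop : Continuous fun z : ℝ × ℝ × ℝ =>
    η₁ z.2.2 * unc b z * φ (z.1, z.2.1))).add ((by fun_prop : Continuous fun z : ℝ × ℝ × ℝ =>
      η z.2.2).mul (hφx.comp (by fun_prop : Continuous fun z : ℝ × ℝ × ℝ => (z.1, z.2.1))))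
  have hΓtc : Continuous Γt := ((by fun_prop : Continuous fun z : ℝ × ℝ × ℝ =>
    η₁ z.2.2 * unc (driftT H b) z * φ (z.1, z.2.1))).add ((by fun_prop : Continuous
      fun z : ℝ × ℝ × ℝ => η z.2.2).mul (hφt.comp
        (by fun_prop : Continuous fun z : ℝ × ℝ × ℝ => (z.1, z.2.1))))
  obtain ⟨G₁, hG₁0, hG₁⟩ := exists_box_bound hΓc aL aR t₀ T PL PR
  obtain ⟨G₂, hG₂0, hG₂⟩ := exists_box_bound hΓxc aL aR t₀ T PL PR
  obtain ⟨G₃, hG₃0, hG₃⟩ := exists_box_bound hΓtc aL aR t₀ T PL PR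
  obtain ⟨V, hV0, hV⟩ := exists_abs_speed_le hH aL aR
  have hvel : ∀ τ ∈ Ioo s s', ∀ i, |velocity H b (c τ) τ i| ≤ V := by
    intro τ hτ i
    induction i using Fin.cases with
    | zero => simpa using hV0
    | succ i =>
      rw [velocity_succ, abs_neg]
      exact hV _ (hc.position_mem (Ioo_subset_Icc_self hτ) _) _
        (hc.mem_Icc (Ioo_subset_Icc_self hτ)) _ (hc.leftValue_mem hb hτ i) _
        (hc.value_mem hb hτ i.succ) (hjump τ hτ i).ne
  set eVel : ℝ → Fin (n + 1) → ℝ := fun τ i =>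
    Fin.snoc (α := fun _ => ℝ) (fun j : Fin n => velocity H b (c τ) τ j.succ) 0 i with heVel
  have hE : ∀ τ ∈ Ioo s s', ∀ i, HasDerivAt (fun τ => rightEnd aR (c τ) i) (eVel τ i) τ := by
    intro τ hτ i
    induction i using Fin.lastCases with
    | last => simpa [heVel] using hasDerivAt_const τ aR
    | cast i => simpa [heVel] using hc.flow.hasDerivAt_position hτ i.succ
  have hEb : ∀ τ ∈ Ioo s s', ∀ i, |eVel τ i| ≤ V := by
    intro τ hτ i
    induction i using Fin.lastCases with
    | last => simpa [heVel] using hV0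
    | cast i => simpa [heVel] using hvel τ hτ i.succ
  have hbox : ∀ τ ∈ Ioo s s', ∀ i, ∀ x ∈ Icc (c τ i).1 (rightEnd aR (c τ) i),
      x ∈ Icc aL aR ∧ τ ∈ Icc t₀ T ∧ strip b (c τ) τ i x ∈ Icc PL PR := fun τ hτ i x hx =>
    ⟨⟨(hc.position_mem (Ioo_subset_Icc_self hτ) i).1.trans hx.1,
      hx.2.trans (hc.flow.rightEnd_le hc.lt (Ioo_subset_Icc_self hτ) i)⟩,
      hc.mem_Icc (Ioo_subset_Icc_self hτ), hc.strip_mem hb hτ i hx⟩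
  have hpiece : ∀ i, HasDerivAt
      (fun τ => ∫ x in (c τ i).1..rightEnd aR (c τ) i, η (strip b (c τ) τ i x) * φ (x, τ))
      ((∫ x in (c t i).1..rightEnd aR (c t) i, Γt (x, t, strip b (c t) t i x))
        + (Γ (rightEnd aR (c t) i, t, strip b (c t) t i (rightEnd aR (c t) i)) * eVel t i
          - Γ ((c t i).1, t, strip b (c t) t i (c t i).1) * velocity H b (c t) t i)) t := by
    intro i
    refine hasDerivAt_integral_moving (g := fun z => η (strip b (c z.2) z.2 i z.1) * φ z)
      (gx := fun z => Γx (z.1, z.2, strip b (c z.2) z.2 i z.1))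
      (gt := fun z => Γt (z.1, z.2, strip b (c z.2) z.2 i z.1))
      (V := V + (aR - aL)) (G := G₁ + G₂ + G₃) ht
      (fun τ hτ => hc.flow.hasDerivAt_position hτ i) (fun τ hτ => hE τ hτ i)
      (fun τ hτ => (hc.flow.lt_rightEnd hτ i).le) ?_ ?_ ?_ ?_ ?_
    · intro τ hτ x hx
      have h1 := hc.hasFDerivAt_strip hH hb hτ i hx
      have h2 := ((hη (strip b (c τ) τ i x)).comp_hasFDerivAt (x, τ) h1).mul
        (hφd (x, τ)).hasFDerivAt
      refine h2.congr_fderiv ?_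
      ext <;> simp [hΓx, hΓt, unc] <;> ring
    · intro τ hτ
      exact (hΓxc.comp (Continuous.prodMk continuous_id (Continuous.prodMk continuous_const
        (hstripc τ (Ioo_subset_Icc_self hτ) i)))).continuousOn
    · intro τ hτ
      exact (hΓtc.comp (Continuous.prodMk continuous_id (Continuous.prodMk continuous_const
        (hstripc τ (Ioo_subset_Icc_self hτ) i)))).continuousOn
    · intro τ hτ
      have h1 := hc.position_mem (Ioo_subset_Icc_self hτ) i
      have h2 := hc.flow.rightEnd_le hc.lt (Ioo_subset_Icc_self hτ) i
      have h3 : aL ≤ aR := h1.1.trans h1.2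
      refine ⟨(hvel τ hτ i).trans (by linarith), (hEb τ hτ i).trans (by linarith), ?_⟩
      linarith [h1.1]
    · intro τ hτ x hx
      obtain ⟨k1, k2, k3⟩ := hbox τ hτ i x hx
      exact ⟨(hG₁ x k1 τ k2 _ k3).trans (by linarith), (hG₂ x k1 τ k2 _ k3).trans (by linarith),
        (hG₃ x k1 τ k2 _ k3).trans (by linarith)⟩
  -- integration by parts in `x`
  set Q : Fin (n + 1) → ℝ → ℝ := fun i x => η₁ (strip b (c t) t i x)
    * (H x t (strip b (c t) t i x) - κ * H x t k) * φ (x, t) with hQ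
  have htI := Ioo_subset_Icc_self ht
  have hdensc := continuous_entropyDensity hH hb hφ.1 hηc hη₁c hη₂ κ k
  have hparts : ∀ i, ∫ x in (c t i).1..rightEnd aR (c t) i, Γt (x, t, strip b (c t) t i x)
      = (∫ x in (c t i).1..rightEnd aR (c t) i,
          entropyDensity H b η η₁ η₂ κ k φ x t (strip b (c t) t i x))
        + (Q i (rightEnd aR (c t) i) - Q i (c t i).1) := by
    intro i
    have hd1 : Continuous fun x => Γt (x, t, strip b (c t) t i x) :=
      hΓtc.comp (Continuous.prodMk continuous_id (Continuous.prodMk continuous_const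
        (hstripc t htI i)))
    have hd2 : Continuous fun x => entropyDensity H b η η₁ η₂ κ k φ x t (strip b (c t) t i x) :=
      hdensc.comp (Continuous.prodMk continuous_id (Continuous.prodMk continuous_const
        (hstripc t htI i)))
    have hder : ∀ x, HasDerivAt (Q i) (Γt (x, t, strip b (c t) t i x)
        - entropyDensity H b η η₁ η₂ κ k φ x t (strip b (c t) t i x)) x := by
      intro x
      have h1 : HasDerivAt (strip b (c t) t i) (b x t (strip b (c t) t i x)) x :=
        hasDerivAt_driftFlow hb (hc.mem_Icc htI) _ _ x
      have h2 := (hη₁ (strip b (c t) t i x)).comp x h1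
      have h3 := hasDerivAt_unc_comp hH.contDiff_one (hasDerivAt_id x) (hasDerivAt_const x t) h1
      have h4 := hasDerivAt_unc_comp hH.contDiff_one (hasDerivAt_id x) (hasDerivAt_const x t)
        (hasDerivAt_const x k)
      have h5 := (hφd (x, t)).hasFDerivAt.comp_hasDerivAt_of_eq x
        ((hasDerivAt_id x).prodMk (hasDerivAt_const x t)) rfl
      refine ((h2.mul (h3.sub (h4.const_mul κ))).mul h5).congr_deriv ?_
      simp only [hΓt, entropyDensity, unc, driftT, id, Function.comp, Pi.mul_apply, Pi.sub_apply]
      ring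
    rw [← intervalIntegral.integral_eq_sub_of_hasDerivAt (fun x _ => hder x)
      ((hd1.sub hd2).intervalIntegrable _ _), intervalIntegral.integral_sub
      (hd1.intervalIntegrable _ _) (hd2.intervalIntegrable _ _)]
    ring
  have hsum := HasDerivAt.fun_sum (u := Finset.univ) fun i _ => hpiece i
  have hJ : (fun τ => ∫ x in aL..aR, η (profile b ⟨n, c τ⟩ τ x) * φ (x, τ)) =ᶠ[𝓝 t]
      fun τ => ∑ i, ∫ x in (c τ i).1..rightEnd aR (c τ) i, η (strip b (c τ) τ i x) * φ (x, τ) := by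
    filter_upwards [Ioo_mem_nhds ht.1 ht.2] with τ hτ
    rw [← hc.flow.left τ hτ]
    exact (integral_profile_eq_sum (b := b) τ (hmono τ hτ) (hR τ hτ)
      (F := fun x r => η r * φ (x, τ)) fun i =>
      ((hηc.comp (hstripc τ (Ioo_subset_Icc_self hτ) i)).mul (hφc.comp
        (by fun_prop : Continuous fun x : ℝ => (x, τ)))).intervalIntegrable _ _).2
  refine (hsum.congr_of_eventuallyEq hJ).congr_deriv ?_
  have hdens := (integral_profile_eq_sum (b := b) (aR := aR) t (hmono t ht) (hR t ht)
      (F := fun x r => entropyDensity H b η η₁ η₂ κ k φ x t r) fun i =>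
      (hdensc.comp (Continuous.prodMk continuous_id (Continuous.prodMk continuous_const
        (hstripc t htI i)))).intervalIntegrable _ _).2
  rw [hc.flow.left t ht] at hdens
  rw [hdens]
  simp_rw [hparts]
  have e1 : ∀ i, (∫ x in (c t i).1..rightEnd aR (c t) i,
        entropyDensity H b η η₁ η₂ κ k φ x t (strip b (c t) t i x))
      + (Q i (rightEnd aR (c t) i) - Q i (c t i).1)
      + (Γ (rightEnd aR (c t) i, t, strip b (c t) t i (rightEnd aR (c t) i)) * eVel t i
          - Γ ((c t i).1, t, strip b (c t) t i (c t i).1) * velocity H b (c t) t i)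
      = (∫ x in (c t i).1..rightEnd aR (c t) i,
        entropyDensity H b η η₁ η₂ κ k φ x t (strip b (c t) t i x))
        + (Q i (rightEnd aR (c t) i)
          + Γ (rightEnd aR (c t) i, t, strip b (c t) t i (rightEnd aR (c t) i)) * eVel t i)
        - (Q i (c t i).1 + Γ ((c t i).1, t, strip b (c t) t i (c t i).1)
          * velocity H b (c t) t i) := fun i => by ring
  simp_rw [e1]
  rw [Finset.sum_sub_distrib, Finset.sum_add_distrib, add_sub_assoc]
  congr 1
  rw [Fin.sum_univ_castSucc, Fin.sum_univ_succ]
  have z1 : φ (aR, t) = 0 := hzero _ _ (by simp)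
  have z2 : φ ((c t 0).1, t) = 0 := hzero _ _ (by simp [hc.flow.left t ht])
  have e2 : Q (Fin.last n) (rightEnd aR (c t) (Fin.last n)) = 0 := by
    simp [hQ, z1]
  have e3 : Q 0 (c t 0).1 = 0 := by simp [hQ, z2]
  rw [e2, e3]
  simp only [velocity_zero, mul_zero, add_zero, zero_add]
  have e4 : eVel t (Fin.last n) = 0 := by simp [heVel]
  rw [e4, mul_zero, add_zero, ← Finset.sum_sub_distrib]
  refine Finset.sum_congr rfl fun i _ => ?_
  have e5 : eVel t i.castSucc = velocity H b (c t) t i.succ := by simp [heVel]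
  have e6 : strip b (c t) t i.succ (c t i.succ).1 = (c t i.succ).2 :=
    driftFlow_self hb (hc.mem_Icc htI) _ _
  have e7 : strip b (c t) t i.castSucc (c t i.succ).1 = leftValue b (c t) t i := rfl
  simp only [rightEnd_castSucc, hQ, hΓ, e5, e6, e7, velocity_succ, entropyJump]
  ring

theorem IsGoodPiece.continuousOn_entropy (hb : IsDrift H b t₀ T PL PR)
    (hc : IsGoodPiece H b aL aR t₀ T PL PR s s' c) (hφ : Continuous φ) (hη : Continuous η) :
    ContinuousOn (fun τ => ∫ x in aL..aR, η (profile b ⟨n, c τ⟩ τ x) * φ (x, τ)) (Icc s s') := by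
  have hstripc : ∀ τ ∈ Icc s s', ∀ i, Continuous (strip b (c τ) τ i) := fun τ hτ i =>
    continuous_iff_continuousAt.2 fun x =>
      (hasDerivAt_driftFlow hb (hc.mem_Icc hτ) _ _ x).continuousAt
  have hJ : EqOn (fun τ => ∫ x in aL..aR, η (profile b ⟨n, c τ⟩ τ x) * φ (x, τ))
      (fun τ => ∑ i, ∫ x in (c τ i).1..rightEnd aR (c τ) i, η (strip b (c τ) τ i x) * φ (x, τ))
      (Icc s s') := by
    intro τ hτ
    simp only
    rw [← hc.flow.left_closed hc.lt τ hτ]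
    exact (integral_profile_eq_sum (b := b) τ (hc.flow.monotone_closed hc.lt τ hτ)
      (hc.flow.right_closed hc.lt τ hτ) (F := fun x r => η r * φ (x, τ)) fun i =>
      ((hη.comp (hstripc τ hτ i)).mul (hφ.comp
        (by fun_prop : Continuous fun x : ℝ => (x, τ)))).intervalIntegrable _ _).2
  refine ContinuousOn.congr (continuousOn_finsetSum _ fun i _ => ?_) hJ
  refine continuousOn_integral_moving (g := fun z => η (strip b (c z.2) z.2 i z.1) * φ z) hc.lt.le
    (continuous_fst.comp_continuousOn (hc.flow.continuousOn_apply i)) ?_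
    ((hη.comp_continuousOn (hc.continuousOn_strip hb i)).mul hφ.continuousOn)
  induction i using Fin.lastCases with
  | last => simpa using continuousOn_const
  | cast i =>
    simp only [rightEnd_castSucc]
    exact continuous_fst.comp_continuousOn (hc.flow.continuousOn_apply i.succ)

end Balance

/-! ### Smooth approximations of the Kruzhkov entropies -/

/-- The smooth convex entropy `√((r - k)² + ε²)`. -/
noncomputable def smoothAbs (k ε r : ℝ) : ℝ := Real.sqrt ((r - k) ^ 2 + ε ^ 2)

/-- The derivative of `smoothAbs`. -/
noncomputable def smoothSign (k ε r : ℝ) : ℝ := (r - k) / smoothAbs k ε r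

/-- The second derivative of `smoothAbs`. -/
noncomputable def smoothDelta (k ε r : ℝ) : ℝ := ε ^ 2 / smoothAbs k ε r ^ 3

theorem smoothAbs_pos {k ε r : ℝ} (hε : 0 < ε) : 0 < smoothAbs k ε r :=
  Real.sqrt_pos.2 (by positivity)

theorem abs_le_smoothAbs (k ε r : ℝ) : |r - k| ≤ smoothAbs k ε r := by
  rw [← Real.sqrt_sq_eq_abs]
  exact Real.sqrt_le_sqrt (by nlinarith [sq_nonneg ε])

theorem le_smoothAbs {k ε r : ℝ} : ε ≤ smoothAbs k ε r :=
  Real.le_sqrt_of_sq_le (by nlinarith [sq_nonneg (r - k)])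

theorem smoothAbs_le {k ε r : ℝ} (hε : 0 ≤ ε) : smoothAbs k ε r ≤ |r - k| + ε := by
  refine Real.sqrt_le_iff.2 ⟨by positivity, ?_⟩
  nlinarith [sq_abs (r - k), mul_nonneg (abs_nonneg (r - k)) hε]

theorem smoothAbs_sq {k ε r : ℝ} : smoothAbs k ε r ^ 2 = (r - k) ^ 2 + ε ^ 2 :=
  Real.sq_sqrt (by positivity)

theorem hasDerivAt_smoothAbs {k ε : ℝ} (hε : 0 < ε) (r : ℝ) :
    HasDerivAt (smoothAbs k ε) (smoothSign k ε r) r := by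
  have h1 : HasDerivAt (fun r => (r - k) ^ 2 + ε ^ 2) (2 * (r - k)) r := by
    refine ((((hasDerivAt_id r).sub_const k).pow 2).add_const (ε ^ 2)).congr_deriv ?_
    simp
  refine (h1.sqrt (by positivity)).congr_deriv ?_
  rw [smoothSign, smoothAbs, mul_div_mul_left _ _ two_ne_zero]

theorem hasDerivAt_smoothSign {k ε : ℝ} (hε : 0 < ε) (r : ℝ) :
    HasDerivAt (smoothSign k ε) (smoothDelta k ε r) r := by
  have h0 := (smoothAbs_pos (k := k) (r := r) hε).ne'
  refine (((hasDerivAt_id r).sub_const k).div (hasDerivAt_smoothAbs hε r) h0).congr_deriv ?_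
  rw [smoothDelta, smoothSign]
  have := smoothAbs_sq (k := k) (ε := ε) (r := r)
  simp only [id]
  field_simp
  linarith

theorem continuous_smoothAbs (k ε : ℝ) : Continuous (smoothAbs k ε) := by
  unfold smoothAbs
  fun_prop

theorem continuous_smoothDelta {k ε : ℝ} (hε : 0 < ε) : Continuous (smoothDelta k ε) :=
  continuous_const.div ((continuous_smoothAbs k ε).pow 3) fun _ =>
    pow_ne_zero _ (smoothAbs_pos hε).ne'

theorem abs_smoothSign_le {k ε r : ℝ} (hε : 0 < ε) : |smoothSign k ε r| ≤ 1 := by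
  rw [smoothSign, abs_div, abs_of_pos (smoothAbs_pos hε), div_le_one (smoothAbs_pos hε)]
  exact abs_le_smoothAbs k ε r

theorem smoothDelta_nonneg {k ε r : ℝ} (hε : 0 < ε) : 0 ≤ smoothDelta k ε r :=
  div_nonneg (sq_nonneg _) (pow_nonneg (smoothAbs_pos hε).le 3)

theorem smoothDelta_mul_le {k ε r : ℝ} (hε : 0 < ε) : smoothDelta k ε r * |r - k| ≤ 1 := by
  have h0 := smoothAbs_pos (k := k) (r := r) hε
  rw [smoothDelta, div_mul_eq_mul_div, div_le_one (by positivity)]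
  have h1 := abs_le_smoothAbs k ε r
  have h2 : ε ^ 2 ≤ smoothAbs k ε r ^ 2 := pow_le_pow_left₀ hε.le le_smoothAbs 2
  calc ε ^ 2 * |r - k| ≤ smoothAbs k ε r ^ 2 * smoothAbs k ε r := by gcongr
    _ = _ := by ring

theorem tendsto_smoothAbs (k r : ℝ) :
    Tendsto (fun ε => smoothAbs k ε r) (𝓝 0) (𝓝 |r - k|) := by
  have : Continuous fun ε => smoothAbs k ε r := by unfold smoothAbs; fun_prop
  simpa [smoothAbs, Real.sqrt_sq_eq_abs] using this.tendsto 0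

theorem tendsto_smoothSign (k r : ℝ) :
    Tendsto (fun ε => smoothSign k ε r) (𝓝 0) (𝓝 (Real.sign (r - k))) := by
  rcases eq_or_ne r k with rfl | h
  · simp [smoothSign]
  · have h1 := (tendsto_const_nhds (x := r - k)).div (tendsto_smoothAbs k r)
      (abs_ne_zero.2 (sub_ne_zero.2 h))
    have h2 : (r - k) / |r - k| = Real.sign (r - k) := by
      rcases lt_or_gt_of_ne (sub_ne_zero.2 h) with h3 | h3
      · rw [Real.sign_of_neg h3, abs_of_neg h3, div_neg, div_self h3.ne]
      · rw [Real.sign_of_pos h3, abs_of_pos h3, div_self h3.ne']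
    rw [← h2]
    exact h1

theorem tendsto_smoothDelta {k r : ℝ} (h : r ≠ k) :
    Tendsto (fun ε => smoothDelta k ε r) (𝓝 0) (𝓝 0) := by
  have h1 : Tendsto (fun ε : ℝ => ε ^ 2) (𝓝 0) (𝓝 0) := by
    have : Continuous fun ε : ℝ => ε ^ 2 := by fun_prop
    simpa using this.tendsto 0
  have := h1.div ((tendsto_smoothAbs k r).pow 3)
    (pow_ne_zero 3 (abs_ne_zero.2 (sub_ne_zero.2 h)))
  rw [zero_div] at this
  exact this

theorem measurable_sign : Measurable Real.sign := by
  unfold Real.sign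
  exact Measurable.ite measurableSet_Iio measurable_const
    (Measurable.ite measurableSet_Ioi measurable_const measurable_const)

theorem abs_sign_le (r : ℝ) : |Real.sign r| ≤ 1 := by
  rcases Real.sign_apply_eq r with h | h | h <;> simp [h]

section Kruzhkov

variable {H b : ℝ → ℝ → ℝ → ℝ} {t₀ T PL PR aL aR : ℝ}

/-- The density in the Kruzhkov inequality. -/
noncomputable def kruzhkovDensity (H : ℝ → ℝ → ℝ → ℝ) (k : ℝ) (φ : ℝ × ℝ → ℝ) (x t r : ℝ) : ℝ :=
  |r - k| * fderiv ℝ φ (x, t) (0, 1)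
    - Real.sign (r - k) * (H x t r - H x t k) * fderiv ℝ φ (x, t) (1, 0)
    + Real.sign (r - k) * dX H x t k * φ (x, t)

/-- Upward jumps satisfy the Kruzhkov inequality, because `H` is convex. -/
theorem kruzhkov_jump_nonpos (hH : IsHamiltonian H t₀ T PL PR) {x t rm rp k : ℝ}
    (ht : t ∈ Icc t₀ T) (hm : rm ∈ Icc PL PR) (hp : rp ∈ Icc PL PR)
    (h : rm < rp) :
    speed H x t rm rp * (|rp - k| - |rm - k|) - (Real.sign (rp - k) * (H x t rp - H x t k)
      - Real.sign (rm - k) * (H x t rm - H x t k)) ≤ 0 := by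
  have hv := speed_mul_sub H x t rm rp
  rcases lt_trichotomy k rm with h1 | h1 | h1
  · rw [abs_of_pos (by linarith), abs_of_pos (by linarith), Real.sign_of_pos (by linarith),
      Real.sign_of_pos (by linarith)]
    linarith
  · subst h1
    rw [abs_of_pos (by linarith), Real.sign_of_pos (by linarith)]
    simp only [sub_self, abs_zero, Real.sign_zero]
    linarith
  rcases lt_trichotomy k rp with h2 | h2 | h2
  · rw [abs_of_pos (by linarith : 0 < rp - k), abs_of_neg (by linarith : rm - k < 0),
      Real.sign_of_pos (by linarith), Real.sign_of_neg (by linarith)]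
    have hs := (hH.convex x t ht).secant_mono_aux1 hm hp h1 h2
    rw [← sub_pos] at h
    have h3 : (rp - rm) * H x t k ≤ (rp - k) * H x t rm + (k - rm) * H x t rp := hs
    refine nonpos_of_mul_nonpos_right (a := rp - rm) ?_ h
    have : (rp - rm) * (speed H x t rm rp * (rp - k - -(rm - k)) - (1 * (H x t rp - H x t k)
        - -1 * (H x t rm - H x t k)))
        = (speed H x t rm rp * (rp - rm)) * (rp + rm - 2 * k)
          - (rp - rm) * (H x t rp + H x t rm - 2 * H x t k) := by ring
    rw [this, hv]
    nlinarith
  · subst h2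
    rw [abs_of_neg (by linarith : rm - k < 0), Real.sign_of_neg (by linarith : rm - k < 0)]
    simp only [sub_self, abs_zero, Real.sign_zero]
    linarith
  · rw [abs_of_neg (by linarith), abs_of_neg (by linarith), Real.sign_of_neg (by linarith),
      Real.sign_of_neg (by linarith)]
    linarith

theorem exists_test_bound {φ : ℝ × ℝ → ℝ} (hφ : IsTest aL aR t₀ T φ) :
    ∃ C : ℝ, 0 ≤ C ∧ ∀ z, |φ z| ≤ C ∧ |fderiv ℝ φ z (1, 0)| ≤ C ∧ |fderiv ℝ φ z (0, 1)| ≤ C := by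
  have hφ1 := hφ.1.continuous_fderiv (by simp)
  obtain ⟨C₁, h₁⟩ := hφ.2.1.exists_bound_of_continuous hφ.1.continuous
  obtain ⟨C₂, h₂⟩ := (hφ.2.1.fderiv_apply ℝ (1, 0)).exists_bound_of_continuous
    (hφ1.clm_apply continuous_const)
  obtain ⟨C₃, h₃⟩ := (hφ.2.1.fderiv_apply ℝ (0, 1)).exists_bound_of_continuous
    (hφ1.clm_apply continuous_const)
  refine ⟨max C₁ (max C₂ C₃), (abs_nonneg _).trans ((h₁ 0).trans (le_max_left _ _)), fun z =>
    ⟨(h₁ z).trans (le_max_left _ _), (h₂ z).trans (by simp), (h₃ z).trans (by simp)⟩⟩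

theorem tendsto_entropyDensity (H b : ℝ → ℝ → ℝ → ℝ) (k : ℝ) (φ : ℝ × ℝ → ℝ) (x t r : ℝ) :
    Tendsto (fun ε => entropyDensity H b (smoothAbs k ε) (smoothSign k ε) (smoothDelta k ε) 1 k
      φ x t r) (𝓝 0) (𝓝 (kruzhkovDensity H k φ x t r)) := by
  have h1 := (tendsto_smoothAbs k r).mul_const (fderiv ℝ φ (x, t) (0, 1))
  have h2 := ((tendsto_smoothSign k r).mul_const (H x t r - 1 * H x t k)).mul_const
    (fderiv ℝ φ (x, t) (1, 0))
  have h3 := (((tendsto_smoothSign k r).mul_const (dX H x t k)).mul_const (φ (x, t))).const_mul 1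
  have h4 : Tendsto (fun ε => smoothDelta k ε r * b x t r * (H x t r - 1 * H x t k) * φ (x, t))
      (𝓝 0) (𝓝 0) := by
    rcases eq_or_ne r k with rfl | h
    · simp
    · simpa using (((tendsto_smoothDelta h).mul_const (b x t r)).mul_const
        (H x t r - 1 * H x t k)).mul_const (φ (x, t))
  have := ((h1.sub h2).add h3).sub h4
  simpa only [kruzhkovDensity, entropyDensity, one_mul, sub_zero] using this

theorem tendsto_entropyJump (H : ℝ → ℝ → ℝ → ℝ) (k : ℝ) (φ : ℝ × ℝ → ℝ) (x t rm rp : ℝ) :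
    Tendsto (fun ε => entropyJump H (smoothAbs k ε) (smoothSign k ε) 1 k φ x t rm rp) (𝓝 0)
      (𝓝 (φ (x, t) * (speed H x t rm rp * (|rp - k| - |rm - k|)
        - (Real.sign (rp - k) * (H x t rp - H x t k)
          - Real.sign (rm - k) * (H x t rm - H x t k))))) := by
  have h1 := ((tendsto_smoothAbs k rp).sub (tendsto_smoothAbs k rm)).const_mul
    (speed H x t rm rp)
  have h2 := ((tendsto_smoothSign k rp).mul_const (H x t rp - 1 * H x t k)).sub
    ((tendsto_smoothSign k rm).mul_const (H x t rm - 1 * H x t k))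
  simpa only [entropyJump, one_mul] using (h1.sub h2).const_mul (φ (x, t))

/-- The densities and shock terms of the smooth entropies are bounded uniformly in `ε`. -/
theorem exists_entropy_bound (hH : IsHamiltonian H t₀ T PL PR) (hb : IsDrift H b t₀ T PL PR)
    {φ : ℝ × ℝ → ℝ} (hφ : IsTest aL aR t₀ T φ) {k : ℝ} (hk : k ∈ Icc PL PR) :
    ∃ C : ℝ, 0 ≤ C ∧ ∀ x ∈ Icc aL aR, ∀ t ∈ Icc t₀ T, ∀ ε : ℝ, 0 < ε → ε ≤ 1 →
      (∀ r ∈ Icc PL PR, |entropyDensity H b (smoothAbs k ε) (smoothSign k ε) (smoothDelta k ε) 1 k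
        φ x t r| ≤ C) ∧
      (∀ rm ∈ Icc PL PR, ∀ rp ∈ Icc PL PR, rm ≠ rp →
        |entropyJump H (smoothAbs k ε) (smoothSign k ε) 1 k φ x t rm rp| ≤ C) := by
  obtain ⟨Φ, hΦ0, hΦ⟩ := exists_test_bound hφ
  obtain ⟨K, hK0, hK⟩ := exists_slab_lipschitz hH.contDiff_one aL aR t₀ T PL PR
  obtain ⟨h, hh0, hh⟩ := exists_box_bound (continuous_unc_dX hH.contDiff_one) aL aR t₀ T PL PR
  obtain ⟨B, hB0, hB⟩ := exists_box_bound hb.smooth.continuous aL aR t₀ T PL PR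
  obtain ⟨V, hV0, hV⟩ := exists_abs_speed_le hH aL aR
  set P := PR - PL with hP
  have hP0 : 0 ≤ P := sub_nonneg.2 (hk.1.trans hk.2)
  have hrk : ∀ r ∈ Icc PL PR, |r - k| ≤ P := fun r hr =>
    abs_sub_le_iff.2 ⟨by linarith [hr.2, hk.1], by linarith [hr.1, hk.2]⟩
  refine ⟨((P + 1) * Φ + K * P * Φ + h * Φ + B * K * Φ) + Φ * (V * (2 * (P + 1)) + 2 * (K * P)),
    by positivity, fun x hx t ht ε hε hε1 => ?_⟩
  have hE : ∀ r ∈ Icc PL PR, |H x t r - 1 * H x t k| ≤ K * |r - k| := fun r hr => by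
    rw [one_mul]; exact hK x hx t ht r hr k hk
  have hA : ∀ r ∈ Icc PL PR, |smoothAbs k ε r| ≤ P + 1 := fun r hr => by
    rw [abs_of_pos (smoothAbs_pos hε)]
    exact (smoothAbs_le hε.le).trans (add_le_add (hrk r hr) hε1)
  have hS : ∀ r ∈ Icc PL PR, |smoothSign k ε r * (H x t r - 1 * H x t k)| ≤ K * P :=
    fun r hr => by
      rw [abs_mul]
      calc _ ≤ 1 * (K * |r - k|) := mul_le_mul (abs_smoothSign_le hε) (hE r hr) (abs_nonneg _)
            zero_le_one
        _ ≤ K * P := by rw [one_mul]; gcongr; exact hrk r hr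
  obtain ⟨p1, p2, p3⟩ := hΦ (x, t)
  refine ⟨fun r hr => ?_, fun rm hm rp hp hne => ?_⟩
  · have d1 : |smoothAbs k ε r * fderiv ℝ φ (x, t) (0, 1)| ≤ (P + 1) * Φ := by
      rw [abs_mul]; exact mul_le_mul (hA r hr) p3 (abs_nonneg _) (by positivity)
    have d2 : |smoothSign k ε r * (H x t r - 1 * H x t k) * fderiv ℝ φ (x, t) (1, 0)|
        ≤ K * P * Φ := by
      rw [abs_mul]; exact mul_le_mul (hS r hr) p2 (abs_nonneg _) (by positivity)
    have d3 : |1 * (smoothSign k ε r * dX H x t k * φ (x, t))| ≤ h * Φ := by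
      rw [one_mul, abs_mul, abs_mul]
      refine mul_le_mul ?_ p1 (abs_nonneg _) hh0
      calc _ ≤ 1 * h := mul_le_mul (abs_smoothSign_le hε) (hh x hx t ht k hk) (abs_nonneg _)
            zero_le_one
        _ = h := one_mul h
    have d4 : |smoothDelta k ε r * b x t r * (H x t r - 1 * H x t k) * φ (x, t)|
        ≤ B * K * Φ := by
      rw [abs_mul, abs_mul, abs_mul, abs_of_nonneg (smoothDelta_nonneg hε)]
      refine mul_le_mul ?_ p1 (abs_nonneg _) (by positivity)
      calc smoothDelta k ε r * |b x t r| * |H x t r - 1 * H x t k|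
          ≤ smoothDelta k ε r * B * (K * |r - k|) := by
            have := smoothDelta_nonneg (k := k) (r := r) hε
            gcongr
            · exact hB x hx t ht r hr
            · exact hE r hr
        _ = B * K * (smoothDelta k ε r * |r - k|) := by ring
        _ ≤ B * K * 1 := by gcongr; exact smoothDelta_mul_le hε
        _ = B * K := mul_one _
    have hlast : 0 ≤ Φ * (V * (2 * (P + 1)) + 2 * (K * P)) := by positivity
    unfold entropyDensity
    refine (abs_sub _ _).trans ?_
    have e1 := abs_add_le (smoothAbs k ε r * fderiv ℝ φ (x, t) (0, 1)
      - smoothSign k ε r * (H x t r - 1 * H x t k) * fderiv ℝ φ (x, t) (1, 0))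
      (1 * (smoothSign k ε r * dX H x t k * φ (x, t)))
    have e2 := abs_sub (smoothAbs k ε r * fderiv ℝ φ (x, t) (0, 1))
      (smoothSign k ε r * (H x t r - 1 * H x t k) * fderiv ℝ φ (x, t) (1, 0))
    linarith
  · unfold entropyJump
    rw [abs_mul]
    have j1 : |speed H x t rm rp * (smoothAbs k ε rp - smoothAbs k ε rm)|
        ≤ V * (2 * (P + 1)) := by
      rw [abs_mul]
      refine mul_le_mul (hV x hx t ht rm hm rp hp hne) ?_ (abs_nonneg _) hV0
      have := abs_sub (smoothAbs k ε rp) (smoothAbs k ε rm)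
      linarith [hA rp hp, hA rm hm]
    have j2 := abs_sub (smoothSign k ε rp * (H x t rp - 1 * H x t k))
      (smoothSign k ε rm * (H x t rm - 1 * H x t k))
    have j3 := abs_sub (speed H x t rm rp * (smoothAbs k ε rp - smoothAbs k ε rm))
      (smoothSign k ε rp * (H x t rp - 1 * H x t k)
        - smoothSign k ε rm * (H x t rm - 1 * H x t k))
    have hS1 := hS rp hp
    have hS2 := hS rm hm
    have hfirst : 0 ≤ (P + 1) * Φ + K * P * Φ + h * Φ + B * K * Φ := by positivity
    have := mul_le_mul p1 (j3.trans (by linarith : _ ≤ V * (2 * (P + 1)) + 2 * (K * P)))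
      (abs_nonneg _) hΦ0
    linarith

end Kruzhkov

/-! ### Particle paths are entropy solutions -/

section PathEntropy

variable {H b : ℝ → ℝ → ℝ → ℝ} {t₀ T PL PR aL aR s s' : ℝ}

theorem integrableOn_of_abs_le {X : Type*} [MeasurableSpace X] {μ : Measure X} {S : Set X}
    {F : X → ℝ} {C : ℝ} (hS : μ S < ⊤) (hF : AEStronglyMeasurable F (μ.restrict S))
    (hC : ∀ᵐ x ∂μ.restrict S, |F x| ≤ C) : IntegrableOn F S μ := by
  have : IsFiniteMeasure (μ.restrict S) := ⟨by simpa using hS⟩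
  exact Integrable.of_bound hF C hC

theorem integral_of_bounded_hasDerivAt {J D : ℝ → ℝ} {C : ℝ} (hs : s ≤ s')
    (hJ : ContinuousOn J (Icc s s')) (hD : ∀ t ∈ Ioo s s', HasDerivAt J (D t) t)
    (hC : ∀ t ∈ Ioo s s', |D t| ≤ C) :
    IntervalIntegrable D volume s s' ∧ ∫ t in s..s', D t = J s' - J s := by
  have hint : IntegrableOn (deriv J) (Ioo s s') := by
    refine integrableOn_of_abs_le (C := C) (by simp)
      (measurable_deriv J).aestronglyMeasurable ?_
    refine (ae_restrict_iff' measurableSet_Ioo).2 (Eventually.of_forall fun t ht => ?_)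
    rw [(hD t ht).deriv]
    exact hC t ht
  have h1 : IntervalIntegrable D volume s s' := by
    rw [intervalIntegrable_iff_integrableOn_Ioo_of_le hs]
    exact hint.congr_fun (fun t ht => (hD t ht).deriv) measurableSet_Ioo
  exact ⟨h1, intervalIntegral.integral_eq_sub_of_hasDerivAt_of_le hs hJ hD h1⟩

theorem profile_addLast (q : Config) (t : ℝ) {m x : ℝ} (hx : x < aR) :
    profile b (addLast q (aR, m)) t x = profile b q t x := by
  classical
  obtain ⟨n, c⟩ := q
  set d : Fin (n + 1 + 1) → ℝ × ℝ := Fin.snoc (α := fun _ => ℝ × ℝ) c (aR, m) with hd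
  have hdl : d (Fin.last (n + 1)) = (aR, m) := Fin.snoc_last (α := fun _ => ℝ × ℝ) (aR, m) c
  have hdc : ∀ i : Fin (n + 1), d i.castSucc = c i := fun i =>
    Fin.snoc_castSucc (α := fun _ => ℝ × ℝ) (aR, m) c i
  change (∑ i : Fin (n + 1 + 1), if (d i).1 ≤ x ∧ ∀ j, i < j → x < (d j).1 then
    driftFlow b t (d i).1 (d i).2 x else 0) = ∑ i : Fin (n + 1), if (c i).1 ≤ x ∧
      ∀ j, i < j → x < (c j).1 then driftFlow b t (c i).1 (c i).2 x else 0
  rw [Fin.sum_univ_castSucc]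
  simp only [hdl, hdc]
  rw [if_neg (fun h => absurd h.1 hx.not_ge), add_zero]
  refine Finset.sum_congr rfl fun i _ => if_congr (and_congr_right fun _ =>
    ⟨fun h j hj => ?_, fun h j hj => ?_⟩) rfl rfl
  · simpa [hdc] using h j.castSucc (Fin.castSucc_lt_castSucc_iff.2 hj)
  · induction j using Fin.lastCases with
    | last => simpa [hdl] using hx
    | cast j => simpa [hdc] using h j (Fin.castSucc_lt_castSucc_iff.1 hj)

theorem volume_snd_preimage_singleton (a : ℝ) : volume {z : ℝ × ℝ | z.2 = a} = 0 := by
  have : {z : ℝ × ℝ | z.2 = a} = univ ×ˢ {a} := by ext; simp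
  rw [this, Measure.volume_eq_prod, Measure.prod_prod]
  simp

variable {N : ℕ} {σ : ℕ → ℝ} {n : ℕ → ℕ} {c : ∀ k, ℝ → Fin (n k + 1) → ℝ × ℝ} {q : ℝ → Config}

theorem exists_mem_Ico_of_partition (hσ : ∀ k ≤ N, σ k < σ (k + 1)) {t : ℝ}
    (ht : t ∈ Ico (σ 0) (σ (N + 1))) : ∃ k ≤ N, t ∈ Ico (σ k) (σ (k + 1)) := by
  induction N with
  | zero => exact ⟨0, le_rfl, ht⟩
  | succ N ih =>
    rcases lt_or_ge t (σ (N + 1)) with h | h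
    · obtain ⟨k, hk, hk'⟩ := ih (fun k hk => hσ k (by omega)) ⟨ht.1, h⟩
      exact ⟨k, by omega, hk'⟩
    · exact ⟨N + 1, le_rfl, h, ht.2⟩

theorem aestronglyMeasurable_profile (hb : IsDrift H b t₀ T PL PR) (hσ0 : σ 0 = t₀)
    (hσT : σ (N + 1) = T)
    (hg : ∀ k ≤ N, IsGoodPiece H b aL aR t₀ T PL PR (σ k) (σ (k + 1)) (c k))
    (hq : ∀ k ≤ N, ∀ t ∈ Ico (σ k) (σ (k + 1)), q t = ⟨n k, c k t⟩) :
    AEStronglyMeasurable (fun z : ℝ × ℝ => profile b (q z.2) z.2 z.1)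
      (volume.restrict (Ioo aL aR ×ˢ Ioo t₀ T)) := by
  set S : ∀ k, Fin (n k + 1) → Set (ℝ × ℝ) := fun k i =>
    {z | k ≤ N ∧ z.2 ∈ Ioo (σ k) (σ (k + 1)) ∧ (c k z.2 i).1 ≤ z.1 ∧
      z.1 < rightEnd aR (c k z.2) i} with hS
  have hmeas : ∀ k i, MeasurableSet (S k i) ∧
      AEStronglyMeasurable (fun z : ℝ × ℝ => profile b (q z.2) z.2 z.1)
        (volume.restrict (S k i)) := by
    intro k i
    by_cases hk : k ≤ N
    swap
    · have : S k i = ∅ := by ext z; simp [hS, hk]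
      simp [this]
    have hgk := hg k hk
    have hc1 := hgk.flow.continuousOn_apply i
    have hpos : Continuous fun z : ℝ × ℝ =>
        (c k (max (σ k) (min z.2 (σ (k + 1)))) i).1 :=
      (continuous_fst.comp_continuousOn hc1).comp_continuous (by fun_prop)
        fun z => clamp_mem hgk.lt.le _
    have hend : Continuous fun z : ℝ × ℝ =>
        rightEnd aR (c k (max (σ k) (min z.2 (σ (k + 1))))) i := by
      induction i using Fin.lastCases with
      | last => simpa using continuous_const
      | cast i =>
        simp only [rightEnd_castSucc]
        exact (continuous_fst.comp_continuousOn (hgk.flow.continuousOn_apply i.succ)).comp_continuous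
          (by fun_prop) fun z => clamp_mem hgk.lt.le _
    have hSeq : S k i = {z | z.2 ∈ Ioo (σ k) (σ (k + 1))} ∩
        ({z | (c k (max (σ k) (min z.2 (σ (k + 1)))) i).1 ≤ z.1} ∩
        {z | z.1 < rightEnd aR (c k (max (σ k) (min z.2 (σ (k + 1))))) i}) := by
      ext z
      simp only [hS, mem_ofPred_eq, mem_inter_iff, hk, true_and]
      refine and_congr_right fun h => ?_
      rw [clamp_eq (Ioo_subset_Icc_self h)]
    have hSm : MeasurableSet (S k i) := by
      rw [hSeq]
      exact (measurable_snd measurableSet_Ioo).inter ((measurableSet_le hpos.measurable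
        measurable_fst).inter (measurableSet_lt measurable_fst hend.measurable))
    refine ⟨hSm, ?_⟩
    have hcont : ContinuousOn (fun z : ℝ × ℝ => strip b (c k z.2) z.2 i z.1) (S k i) :=
      (hgk.continuousOn_strip hb i).mono fun z hz => ⟨mem_univ _, Ioo_subset_Icc_self hz.2.1⟩
    refine (hcont.aestronglyMeasurable hSm).congr
      ((ae_restrict_iff' hSm).2 (Eventually.of_forall fun z hz => ?_))
    change strip b (c k z.2) z.2 i z.1 = profile b (q z.2) z.2 z.1
    rw [hq k hk z.2 (Ioo_subset_Ico_self hz.2.1)]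
    exact (profile_eq_strip_of_lt_rightEnd (hgk.flow.order _ hz.2.1).monotone _ hz.2.2.1
      hz.2.2.2).symm
  have hun : AEStronglyMeasurable (fun z : ℝ × ℝ => profile b (q z.2) z.2 z.1)
      (volume.restrict (⋃ k, ⋃ i, S k i)) :=
    aestronglyMeasurable_iUnion_iff.2 fun k => aestronglyMeasurable_iUnion_iff.2 fun i =>
      (hmeas k i).2
  refine hun.mono_measure (Measure.restrict_mono_ae ?_)
  have hnull : ∀ᵐ z : ℝ × ℝ, ∀ k, z.2 ≠ σ k :=
    ae_all_iff.2 fun k => compl_mem_ae_iff.2 (volume_snd_preimage_singleton (σ k))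
  filter_upwards [hnull] with z hz hzR
  obtain ⟨k, hk, hkt⟩ := exists_mem_Ico_of_partition (fun k hk => (hg k hk).lt) (t := z.2)
    ⟨by rw [hσ0]; exact hzR.2.1.le, by rw [hσT]; exact hzR.2.2⟩
  have hkt' : z.2 ∈ Ioo (σ k) (σ (k + 1)) := ⟨lt_of_le_of_ne hkt.1 (hz k).symm, hkt.2⟩
  -- the strip containing `z`: the last particle to the left of it
  have hex : ∃ i : Fin (n k + 1), (c k z.2 i).1 ≤ z.1 ∧ z.1 < rightEnd aR (c k z.2) i := by
    by_contra! hcon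
    have : ∀ i : Fin (n k + 1), (c k z.2 i).1 ≤ z.1 := by
      intro i
      induction i using Fin.induction with
      | zero => rw [(hg k hk).flow.left _ hkt']; exact hzR.1.1.le
      | succ i ih => simpa using hcon i.castSucc ih
    have := hcon (Fin.last _) (this _)
    rw [rightEnd_last] at this
    exact absurd this hzR.1.2.not_ge
  obtain ⟨i, hi1, hi2⟩ := hex
  exact mem_iUnion.2 ⟨k, mem_iUnion.2 ⟨i, hk, hkt', hi1, hi2⟩⟩

/-- Integration over the rectangle, piece by piece in time. -/
theorem integral_rectangle_eq_sum (haR : aL ≤ aR) (hσ0 : σ 0 = t₀) (hσT : σ (N + 1) = T)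
    (hσ : ∀ k ≤ N, σ k < σ (k + 1)) {F : ℝ × ℝ → ℝ} {C : ℝ}
    (hF : AEStronglyMeasurable F (volume.restrict (Ioo aL aR ×ˢ Ioo t₀ T)))
    (hC : ∀ z ∈ Ioo aL aR ×ˢ Ioo t₀ T, |F z| ≤ C) :
    (∀ k ≤ N, IntervalIntegrable (fun t => ∫ x in aL..aR, F (x, t)) volume (σ k) (σ (k + 1))) ∧
    ∫ z in Ioo aL aR ×ˢ Ioo t₀ T, F z
      = ∑ k ∈ Finset.range (N + 1), ∫ t in σ k..σ (k + 1), ∫ x in aL..aR, F (x, t) := by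
  have hmono : ∀ j k, k + j ≤ N + 1 → σ k ≤ σ (k + j) := by
    intro j k
    induction j with
    | zero => intro _; exact le_rfl
    | succ j ih => intro h; exact (ih (by omega)).trans (hσ (k + j) (by omega)).le
  have ht0T : t₀ ≤ T := by
    rw [← hσ0, ← hσT]
    simpa using hmono (N + 1) 0 (by omega)
  have hfin : volume (Ioo aL aR ×ˢ Ioo t₀ T) < ⊤ := by
    rw [Measure.volume_eq_prod, Measure.prod_prod]
    exact ENNReal.mul_lt_top (by simp) (by simp)
  have hint : IntegrableOn F (Ioo aL aR ×ˢ Ioo t₀ T) :=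
    integrableOn_of_abs_le hfin hF
      ((ae_restrict_iff' (measurableSet_Ioo.prod measurableSet_Ioo)).2 (Eventually.of_forall hC))
  have hprod : Integrable F ((volume.restrict (Ioo aL aR)).prod (volume.restrict (Ioo t₀ T))) := by
    rw [Measure.prod_restrict, ← Measure.volume_eq_prod]
    exact hint
  have hI : ∀ t, ∫ x in aL..aR, F (x, t) = ∫ x in Ioo aL aR, F (x, t) := fun t => by
    rw [intervalIntegral.integral_of_le haR, integral_Ioc_eq_integral_Ioo]
  simp_rw [hI]
  have h1 : IntervalIntegrable (fun t => ∫ x in Ioo aL aR, F (x, t)) volume t₀ T := by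
    rw [intervalIntegrable_iff_integrableOn_Ioo_of_le ht0T]
    exact hprod.integral_prod_right
  have h2 : ∀ k ≤ N, IntervalIntegrable (fun t => ∫ x in Ioo aL aR, F (x, t)) volume
      (σ k) (σ (k + 1)) := by
    intro k hk
    refine h1.mono_set ?_
    rw [uIcc_of_le (hσ k hk).le, uIcc_of_le ht0T]
    refine Icc_subset_Icc ?_ ?_
    · rw [← hσ0]
      simpa using hmono k 0 (by omega)
    · rw [← hσT]
      have := hmono (N - k) (k + 1) (by omega)
      rwa [show k + 1 + (N - k) = N + 1 by omega] at this
  refine ⟨h2, ?_⟩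
  rw [intervalIntegral.sum_integral_adjacent_intervals (fun k hk => h2 k (by omega)), hσ0, hσT,
    intervalIntegral.integral_of_le ht0T, integral_Ioc_eq_integral_Ioo,
    Measure.volume_eq_prod, ← Measure.prod_restrict, integral_prod_symm F hprod]

/-- For a particle path, the entropy balances of the pieces add up to zero. -/
theorem sum_balance_eq_zero (hH : IsHamiltonian H t₀ T PL PR) (hb : IsDrift H b t₀ T PL PR)
    (haR : aL ≤ aR) (hσ0 : σ 0 = t₀) (hσT : σ (N + 1) = T)
    (hg : ∀ k ≤ N, IsGoodPiece H b aL aR t₀ T PL PR (σ k) (σ (k + 1)) (c k))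
    (hq : ∀ k ≤ N, ∀ t ∈ Ico (σ k) (σ (k + 1)), q t = ⟨n k, c k t⟩)
    (hord : ∀ k ≤ N, ∀ t ∈ Icc (σ k) (σ (k + 1)), IsOrdered b aL t ⟨n k, c k t⟩)
    (hev : ∀ k < N, ∀ x < aR, profile b (q (σ (k + 1))) (σ (k + 1)) x
      = profile b ⟨n k, c k (σ (k + 1))⟩ (σ (k + 1)) x)
    {φ : ℝ × ℝ → ℝ} (hφ : IsTest aL aR t₀ T φ) {η η₁ η₂ : ℝ → ℝ}
    (hη : ∀ r, HasDerivAt η (η₁ r) r) (hη₁ : ∀ r, HasDerivAt η₁ (η₂ r) r) (hη₂ : Continuous η₂)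
    (κ l : ℝ) {C : ℝ}
    (hC : ∀ k ≤ N, ∀ t ∈ Ioo (σ k) (σ (k + 1)),
      |(∫ x in aL..aR, entropyDensity H b η η₁ η₂ κ l φ x t (profile b ⟨n k, c k t⟩ t x))
        + ∑ i : Fin (n k), entropyJump H η η₁ κ l φ (c k t i.succ).1 t (leftValue b (c k t) t i)
          (c k t i.succ).2| ≤ C) :
    (∀ k ≤ N, IntervalIntegrable (fun t =>
      (∫ x in aL..aR, entropyDensity H b η η₁ η₂ κ l φ x t (profile b ⟨n k, c k t⟩ t x))
        + ∑ i : Fin (n k), entropyJump H η η₁ κ l φ (c k t i.succ).1 t (leftValue b (c k t) t i)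
          (c k t i.succ).2) volume (σ k) (σ (k + 1))) ∧
    ∑ k ∈ Finset.range (N + 1), ∫ t in σ k..σ (k + 1),
      ((∫ x in aL..aR, entropyDensity H b η η₁ η₂ κ l φ x t (profile b ⟨n k, c k t⟩ t x))
        + ∑ i : Fin (n k), entropyJump H η η₁ κ l φ (c k t i.succ).1 t (leftValue b (c k t) t i)
          (c k t i.succ).2) = 0 := by
  have hηc : Continuous η := continuous_iff_continuousAt.2 fun r => (hη r).continuousAt
  have hkey := fun k (hk : k ≤ N) => integral_of_bounded_hasDerivAt (C := C) (hg k hk).lt.le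
    ((hg k hk).continuousOn_entropy hb hφ.1.continuous hηc)
    (fun t ht => (hg k hk).hasDerivAt_entropy hH hb
      (fun t ht i => (hord k hk t (Ioo_subset_Icc_self ht)).jump i) hφ hη hη₁ hη₂ κ l ht)
    (hC k hk)
  refine ⟨fun k hk => (hkey k hk).1, ?_⟩
  set J : ℝ → ℝ := fun τ => ∫ x in aL..aR, η (profile b (q τ) τ x) * φ (x, τ) with hJ
  have hzero : ∀ x τ, τ ∉ Ioo t₀ T → φ (x, τ) = 0 := fun x τ hτ =>
    image_eq_zero_of_notMem_tsupport fun h => hτ (hφ.2.2 h).2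
  have h1 : ∀ k ∈ Finset.range (N + 1), ∫ t in σ k..σ (k + 1),
      ((∫ x in aL..aR, entropyDensity H b η η₁ η₂ κ l φ x t (profile b ⟨n k, c k t⟩ t x))
        + ∑ i : Fin (n k), entropyJump H η η₁ κ l φ (c k t i.succ).1 t (leftValue b (c k t) t i)
          (c k t i.succ).2) = J (σ (k + 1)) - J (σ k) := by
    intro k hk
    have hk' : k ≤ N := by simpa [Nat.lt_succ_iff] using hk
    rw [(hkey k hk').2]
    congr 1
    · rcases hk'.lt_or_eq with h | h
      · refine intervalIntegral.integral_congr_ae ?_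
        filter_upwards [compl_mem_ae_iff.2 (measure_singleton aR)] with x hx hx'
        rw [uIoc_of_le haR] at hx'
        rw [hev k h x (lt_of_le_of_ne hx'.2 hx)]
      · subst h
        have : σ (k + 1) ∉ Ioo t₀ T := by simp [hσT]
        simp [hJ, hzero _ _ this]
    · simp only [hJ, hq k hk' (σ k) ⟨le_rfl, (hg k hk').lt⟩]
  rw [Finset.sum_congr rfl h1, Finset.sum_range_sub (fun k => J (σ k))]
  have hT : σ (N + 1) ∉ Ioo t₀ T := by simp [hσT]
  have h0 : σ 0 ∉ Ioo t₀ T := by simp [hσ0]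
  simp [hJ, hzero _ _ hT, hzero _ _ h0]

end PathEntropy

section PathEntropy

variable {H b : ℝ → ℝ → ℝ → ℝ} {t₀ T PL PR aL aR s s' : ℝ}

variable {N : ℕ} {σ : ℕ → ℝ} {n : ℕ → ℕ} {c : ∀ k, ℝ → Fin (n k + 1) → ℝ × ℝ} {q : ℝ → Config}

/-- A particle path, cut at its event times `σ 1 < … < σ N`: between the times `σ k` and
`σ (k + 1)` the `n k + 1` particles are `c k`.  Only the profile is recorded at the events: it does
not change to the left of `a₊`. -/
structure IsPathPartition (H b : ℝ → ℝ → ℝ → ℝ) (aL aR t₀ T PL PR : ℝ) (N : ℕ) (σ : ℕ → ℝ)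
    (n : ℕ → ℕ) (c : ∀ k, ℝ → Fin (n k + 1) → ℝ × ℝ) (q : ℝ → Config) : Prop where
  zero : σ 0 = t₀
  last : σ (N + 1) = T
  good : ∀ k ≤ N, IsGoodPiece H b aL aR t₀ T PL PR (σ k) (σ (k + 1)) (c k)
  eq : ∀ k ≤ N, ∀ t ∈ Ico (σ k) (σ (k + 1)), q t = ⟨n k, c k t⟩
  ordered : ∀ k ≤ N, ∀ t ∈ Icc (σ k) (σ (k + 1)), IsOrdered b aL t ⟨n k, c k t⟩
  event : ∀ k < N, ∀ x < aR, profile b (q (σ (k + 1))) (σ (k + 1)) x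
    = profile b ⟨n k, c k (σ (k + 1))⟩ (σ (k + 1)) x
  range : ∀ x ∈ Icc aL aR, ∀ t ∈ Ioo t₀ T, profile b (q t) t x ∈ Icc PL PR

theorem IsParticlePath.exists_partition (hH : IsHamiltonian H t₀ T PL PR)
    (hb : IsDrift H b t₀ T PL PR) (hpath : IsParticlePath H b aL aR t₀ T PL PR q) :
    ∃ N σ n c, IsPathPartition H b aL aR t₀ T PL PR N σ n c q := by
  obtain ⟨N, σ, n, c, hσ0, hσT, hpiece, -, hevent⟩ := hpath.structure hH hb
  refine ⟨N, σ, n, c, hσ0, hσT, fun k hk => (hpiece k hk).2.1, fun k hk => (hpiece k hk).2.2.1,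
    fun k hk => (hpiece k hk).2.2.2, fun k hk x hx => ?_,
    fun x hx t ht => hpath.range t (Ioo_subset_Ico_self ht) x hx⟩
  obtain ⟨r, h1, -, h2 | ⟨m, -, h2⟩⟩ := hevent k hk
  · rw [h2, h1]
  · rw [h2, profile_addLast _ _ hx, h1]

theorem abs_intervalIntegral_le {F : ℝ → ℝ} {x y C : ℝ} (h : ∀ z ∈ Ι x y, |F z| ≤ C) :
    |∫ z in x..y, F z| ≤ C * |y - x| := by
  rw [← Real.norm_eq_abs]
  exact intervalIntegral.norm_integral_le_of_norm_le_const h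

theorem IsPathPartition.aestronglyMeasurable_profile_fixed_time (hb : IsDrift H b t₀ T PL PR)
    (hp : IsPathPartition H b aL aR t₀ T PL PR N σ n c q) {k : ℕ} (hk : k ≤ N) {t : ℝ}
    (ht : t ∈ Ioo (σ k) (σ (k + 1))) {F : ℝ → ℝ → ℝ} (hF : Measurable fun z : ℝ × ℝ => F z.1 z.2) :
    AEStronglyMeasurable (fun x => F x (profile b ⟨n k, c k t⟩ t x))
      (volume.restrict (Ι aL aR)) := by
  have hg := hp.good
  have hint := (integral_profile_eq_sum (b := b) (aR := aR) t
    ((hg k hk).flow.order t ht).monotone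
    ((hg k hk).flow.right_closed (hg k hk).lt t (Ioo_subset_Icc_self ht)) (F := fun _ r => r)
    fun i => (continuous_iff_continuousAt.2 fun x => (hasDerivAt_driftFlow hb
      ((hg k hk).mem_Icc (Ioo_subset_Icc_self ht)) _ _ x).continuousAt).intervalIntegrable _ _).1
  rw [(hg k hk).flow.left t ht] at hint
  have h1 := (intervalIntegrable_iff.1 hint).aestronglyMeasurable
  exact (hF.comp_aemeasurable (aemeasurable_id.prodMk h1.aemeasurable)).aestronglyMeasurable

theorem IsPathPartition.weak (ha : aL < aR) (hH : IsHamiltonian H t₀ T PL PR)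
    (hb : IsDrift H b t₀ T PL PR) (hp : IsPathPartition H b aL aR t₀ T PL PR N σ n c q)
    {φ : ℝ × ℝ → ℝ} (hφ : IsTest aL aR t₀ T φ) :
    ∫ z in Ioo aL aR ×ˢ Ioo t₀ T, (profile b (q z.2) z.2 z.1 * fderiv ℝ φ z (0, 1)
      - H z.1 z.2 (profile b (q z.2) z.2 z.1) * fderiv ℝ φ z (1, 0)) = 0 := by
  obtain ⟨hσ0, hσT, hg, hq, hord, hev, hrange⟩ := hp
  have hσ : ∀ k ≤ N, σ k < σ (k + 1) := fun k hk => (hg k hk).lt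
  have hmeas := aestronglyMeasurable_profile hb hσ0 hσT hg hq
  have htri : AEStronglyMeasurable (fun z : ℝ × ℝ => (z.1, z.2, profile b (q z.2) z.2 z.1))
      (volume.restrict (Ioo aL aR ×ˢ Ioo t₀ T)) :=
    (continuous_fst.aestronglyMeasurable).prodMk ((continuous_snd.aestronglyMeasurable).prodMk hmeas)
  have hIoo : ∀ k ≤ N, Ioo (σ k) (σ (k + 1)) ⊆ Ioo t₀ T := fun k hk t ht => (hg k hk).mem_Ioo ht
  have hη : ∀ r : ℝ, HasDerivAt (fun r : ℝ => r) 1 r := fun r => hasDerivAt_id r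
  have hη₁ : ∀ r : ℝ, HasDerivAt (fun _ : ℝ => (1 : ℝ)) 0 r := fun r => hasDerivAt_const r 1
  have hdens : ∀ x t r, entropyDensity H b (fun r => r) (fun _ => 1) (fun _ => 0) 0 0 φ x t r
      = r * fderiv ℝ φ (x, t) (0, 1) - H x t r * fderiv ℝ φ (x, t) (1, 0) := fun x t r => by
    simp [entropyDensity]
  have hjump : ∀ x t rm rp, entropyJump H (fun r => r) (fun _ => 1) 0 0 φ x t rm rp = 0 :=
    fun x t rm rp => by
      simp [entropyJump, speed_mul_sub]
  set G : ℝ × ℝ × ℝ → ℝ := fun z => z.2.2 * fderiv ℝ φ (z.1, z.2.1) (0, 1)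
    - H z.1 z.2.1 z.2.2 * fderiv ℝ φ (z.1, z.2.1) (1, 0) with hG
  have hGc : Continuous G := by
    have h1 := hφ.1.continuous_fderiv (by simp)
    have h2 := hH.smooth.continuous
    exact (by fun_prop : Continuous fun z : ℝ × ℝ × ℝ => z.2.2 * fderiv ℝ φ (z.1, z.2.1) (0, 1)).sub
      (h2.mul (by fun_prop))
  obtain ⟨C, hC0, hC⟩ := exists_box_bound hGc aL aR t₀ T PL PR
  have hbal := (sum_balance_eq_zero hH hb ha.le hσ0 hσT hg hq hord hev hφ hη hη₁
    continuous_const 0 0 (C := C * |aR - aL|) (fun k hk t ht => by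
      rw [Finset.sum_eq_zero fun i _ => hjump _ _ _ _, add_zero]
      refine abs_intervalIntegral_le fun x hx => ?_
      rw [uIoc_of_le ha.le] at hx
      have hx' := Ioc_subset_Icc_self hx
      rw [← hq k hk t (Ioo_subset_Ico_self ht), hdens]
      exact hC x hx' t (Ioo_subset_Icc_self (hIoo k hk ht)) _
        (hrange x hx' t (hIoo k hk ht)))).2
  have hF := (integral_rectangle_eq_sum (F := fun z => G (z.1, z.2, profile b (q z.2) z.2 z.1))
    ha.le hσ0 hσT hσ (hGc.comp_aestronglyMeasurable htri) (C := C) fun z hz =>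
      hC z.1 (Ioo_subset_Icc_self hz.1) z.2 (Ioo_subset_Icc_self hz.2) _
        (hrange _ (Ioo_subset_Icc_self hz.1) _ hz.2)).2
  refine hF.trans (Eq.trans (Finset.sum_congr rfl fun k hk => ?_) hbal)
  have hk' : k ≤ N := by simpa [Nat.lt_succ_iff] using hk
  refine intervalIntegral.integral_congr_ae ?_
  filter_upwards [compl_mem_ae_iff.2 (measure_singleton (σ (k + 1)))] with t ht ht'
  rw [uIoc_of_le (hσ k hk').le] at ht'
  have ht2 : t ∈ Ico (σ k) (σ (k + 1)) := ⟨ht'.1.le, lt_of_le_of_ne ht'.2 ht⟩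
  rw [Finset.sum_eq_zero fun i _ => hjump _ _ _ _, add_zero, hq k hk' t ht2]
  exact intervalIntegral.integral_congr fun x _ => (hdens _ _ _).symm

theorem tendsto_entropyDensity_seq (H b : ℝ → ℝ → ℝ → ℝ) (l : ℝ) (φ : ℝ × ℝ → ℝ) (x t r : ℝ) :
    Tendsto (fun j : ℕ => entropyDensity H b (smoothAbs l (1 / ((j : ℝ) + 1)))
      (smoothSign l (1 / ((j : ℝ) + 1))) (smoothDelta l (1 / ((j : ℝ) + 1))) 1 l φ x t r) atTop
      (𝓝 (kruzhkovDensity H l φ x t r)) :=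
  (tendsto_entropyDensity H b l φ x t r).comp tendsto_one_div_add_atTop_nhds_zero_nat

theorem continuous_entropyDensity_smooth (hH : IsHamiltonian H t₀ T PL PR)
    (hb : IsDrift H b t₀ T PL PR) {φ : ℝ × ℝ → ℝ} (hφ : IsTest aL aR t₀ T φ) (l : ℝ) {ε : ℝ}
    (hε : 0 < ε) : Continuous fun z : ℝ × ℝ × ℝ => entropyDensity H b (smoothAbs l ε)
      (smoothSign l ε) (smoothDelta l ε) 1 l φ z.1 z.2.1 z.2.2 :=
  continuous_entropyDensity hH hb hφ.1 (continuous_smoothAbs l ε)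
    (continuous_iff_continuousAt.2 fun r => (hasDerivAt_smoothSign hε r).continuousAt)
    (continuous_smoothDelta hε) 1 l

theorem measurable_kruzhkovDensity (hH : IsHamiltonian H t₀ T PL PR)
    (hb : IsDrift H b t₀ T PL PR) {φ : ℝ × ℝ → ℝ} (hφ : IsTest aL aR t₀ T φ) (l : ℝ) :
    Measurable fun z : ℝ × ℝ × ℝ => kruzhkovDensity H l φ z.1 z.2.1 z.2.2 :=
  measurable_of_tendsto_metrizable
    (fun j : ℕ => (continuous_entropyDensity_smooth hH hb hφ l
      (ε := 1 / ((j : ℝ) + 1)) (by positivity)).measurable)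
    (tendsto_pi_nhds.2 fun z => tendsto_entropyDensity_seq H b l φ z.1 z.2.1 z.2.2)

theorem exists_kruzhkovDensity_bound (hH : IsHamiltonian H t₀ T PL PR)
    (hb : IsDrift H b t₀ T PL PR) {φ : ℝ × ℝ → ℝ} (hφ : IsTest aL aR t₀ T φ) {l : ℝ}
    (hl : l ∈ Icc PL PR) : ∃ C : ℝ, ∀ x ∈ Icc aL aR, ∀ t ∈ Icc t₀ T, ∀ r ∈ Icc PL PR,
      |kruzhkovDensity H l φ x t r| ≤ C := by
  obtain ⟨C, hC0, hC⟩ := exists_entropy_bound hH hb hφ hl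
  refine ⟨C, fun x hx t ht r hr => le_of_tendsto (tendsto_entropyDensity_seq H b l φ x t r).norm
    (Eventually.of_forall fun j => (hC x hx t ht _ (by positivity) ?_).1 r hr)⟩
  rw [div_le_one (by positivity)]
  linarith [Nat.cast_nonneg (α := ℝ) j]

/-- The Kruzhkov balance of the configuration `c` at time `t`: the density of the entropy inequality
integrated over space, and the contribution of the jumps. -/
noncomputable def kruzhkovBalance (H b : ℝ → ℝ → ℝ → ℝ) (l aL aR : ℝ) (φ : ℝ × ℝ → ℝ) {n : ℕ}
    (c : Fin (n + 1) → ℝ × ℝ) (t : ℝ) : ℝ :=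
  (∫ x in aL..aR, kruzhkovDensity H l φ x t (profile b ⟨n, c⟩ t x))
    + ∑ i : Fin n, φ ((c i.succ).1, t) * (speed H (c i.succ).1 t
        (leftValue b c t i) (c i.succ).2 * (|(c i.succ).2 - l| - |leftValue b c t i - l|)
      - (Real.sign ((c i.succ).2 - l)
          * (H (c i.succ).1 t (c i.succ).2 - H (c i.succ).1 t l)
        - Real.sign (leftValue b c t i - l)
          * (H (c i.succ).1 t (leftValue b c t i) - H (c i.succ).1 t l)))

theorem IsPathPartition.sum_kruzhkovBalance (ha : aL < aR) (hH : IsHamiltonian H t₀ T PL PR)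
    (hb : IsDrift H b t₀ T PL PR) (hp : IsPathPartition H b aL aR t₀ T PL PR N σ n c q)
    {φ : ℝ × ℝ → ℝ} (hφ : IsTest aL aR t₀ T φ) {l : ℝ}
    (hl : l ∈ Icc PL PR) :
    (∀ k ≤ N, IntervalIntegrable (fun t => kruzhkovBalance H b l aL aR φ (c k t) t) volume
      (σ k) (σ (k + 1))) ∧
    ∑ k ∈ Finset.range (N + 1), ∫ t in σ k..σ (k + 1),
      kruzhkovBalance H b l aL aR φ (c k t) t = 0 := by
  have hprofc := fun k hk t ht F hF =>
    hp.aestronglyMeasurable_profile_fixed_time hb (k := k) hk (t := t) ht (F := F) hF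
  obtain ⟨hσ0, hσT, hg, hq, hord, hev, hrange⟩ := hp
  have hσ : ∀ k ≤ N, σ k < σ (k + 1) := fun k hk => (hg k hk).lt
  have hIoo : ∀ k ≤ N, Ioo (σ k) (σ (k + 1)) ⊆ Ioo t₀ T := fun k hk t ht => (hg k hk).mem_Ioo ht
  obtain ⟨C, hC0, hC⟩ := exists_entropy_bound hH hb hφ hl
  set ε : ℕ → ℝ := fun j => 1 / ((j : ℝ) + 1) with hε
  have hε0 : ∀ j, 0 < ε j := fun j => by positivity
  have hε1 : ∀ j, ε j ≤ 1 := fun j => by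
    simp only [hε]
    rw [div_le_one (by positivity)]
    linarith [Nat.cast_nonneg (α := ℝ) j]
  have hεlim : Tendsto ε atTop (𝓝 0) := tendsto_one_div_add_atTop_nhds_zero_nat
  set D : ℕ → ∀ k, ℝ → ℝ := fun j k t =>
    (∫ x in aL..aR, entropyDensity H b (smoothAbs l (ε j)) (smoothSign l (ε j))
      (smoothDelta l (ε j)) 1 l φ x t (profile b ⟨n k, c k t⟩ t x))
      + ∑ i : Fin (n k), entropyJump H (smoothAbs l (ε j)) (smoothSign l (ε j)) 1 l φ
        (c k t i.succ).1 t (leftValue b (c k t) t i) (c k t i.succ).2 with hD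
  have hprange : ∀ k ≤ N, ∀ t ∈ Ioo (σ k) (σ (k + 1)), ∀ x ∈ Icc aL aR,
      profile b ⟨n k, c k t⟩ t x ∈ Icc PL PR := fun k hk t ht x hx => (hg k hk).range t ht x hx
  have hDb : ∀ j, ∀ k ≤ N, ∀ t ∈ Ioo (σ k) (σ (k + 1)),
      |D j k t| ≤ C * |aR - aL| + n k * C := by
    intro j k hk t ht
    have htc := Ioo_subset_Icc_self (hIoo k hk ht)
    refine (abs_add_le _ _).trans (add_le_add ?_ ?_)
    · refine abs_intervalIntegral_le fun x hx => ?_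
      rw [uIoc_of_le ha.le] at hx
      have hx' := Ioc_subset_Icc_self hx
      exact (hC x hx' t htc _ (hε0 j) (hε1 j)).1 _ (hprange k hk t ht x hx')
    · refine (Finset.abs_sum_le_sum_abs _ _).trans ?_
      refine (Finset.sum_le_sum fun i _ => ?_).trans_eq
        (by rw [Finset.sum_const, Finset.card_univ, Fintype.card_fin, nsmul_eq_mul])
      exact (hC _ ((hg k hk).position_mem (Ioo_subset_Icc_self ht) _) t htc _ (hε0 j)
        (hε1 j)).2 _ ((hg k hk).leftValue_mem hb ht i) _ ((hg k hk).value_mem hb ht _)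
        ((hord k hk t (Ioo_subset_Icc_self ht)).jump i).ne
  have hDlim : ∀ k ≤ N, ∀ t ∈ Ioo (σ k) (σ (k + 1)),
      Tendsto (fun j => D j k t) atTop (𝓝 (kruzhkovBalance H b l aL aR φ (c k t) t)) := by
    intro k hk t ht
    have htc := Ioo_subset_Icc_self (hIoo k hk ht)
    refine Tendsto.add ?_ (tendsto_finsetSum _ fun i _ =>
      (tendsto_entropyJump H l φ _ t _ _).comp hεlim)
    refine intervalIntegral.tendsto_integral_filter_of_dominated_convergence (fun _ => C) ?_ ?_
      (by simp) (Eventually.of_forall fun x _ =>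
        (tendsto_entropyDensity H b l φ x t _).comp hεlim)
    · refine Eventually.of_forall fun j => hprofc k hk t ht _ ?_
      exact ((continuous_entropyDensity_smooth hH hb hφ l (hε0 j)).comp
        (by fun_prop : Continuous fun z : ℝ × ℝ => (z.1, t, z.2))).measurable
    · refine Eventually.of_forall fun j => Eventually.of_forall fun x hx => ?_
      rw [uIoc_of_le ha.le] at hx
      have hx' := Ioc_subset_Icc_self hx
      exact (hC x hx' t htc _ (hε0 j) (hε1 j)).1 _ (hprange k hk t ht x hx')
  have hDmeas : ∀ j, (∀ k ≤ N, IntervalIntegrable (D j k) volume (σ k) (σ (k + 1))) ∧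
      ∑ k ∈ Finset.range (N + 1), ∫ t in σ k..σ (k + 1), D j k t = 0 := fun j =>
    sum_balance_eq_zero hH hb ha.le hσ0 hσT hg hq hord hev hφ
      (hasDerivAt_smoothAbs (hε0 j)) (hasDerivAt_smoothSign (hε0 j))
      (continuous_smoothDelta (hε0 j)) 1 l
      (C := ∑ k ∈ Finset.range (N + 1), (C * |aR - aL| + n k * C)) fun k hk t ht =>
        (hDb j k hk t ht).trans (Finset.single_le_sum (f := fun k => C * |aR - aL| + n k * C)
          (fun k _ => by positivity) (by simpa [Nat.lt_succ_iff] using hk))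
  have hae : ∀ k ≤ N, ∀ᵐ t, t ∈ Ι (σ k) (σ (k + 1)) → t ∈ Ioo (σ k) (σ (k + 1)) := by
    intro k hk
    filter_upwards [compl_mem_ae_iff.2 (measure_singleton (σ (k + 1)))] with t ht ht'
    rw [uIoc_of_le (hσ k hk).le] at ht'
    exact ⟨ht'.1, lt_of_le_of_ne ht'.2 ht⟩
  have hlim : ∀ k ≤ N, Tendsto (fun j => ∫ t in σ k..σ (k + 1), D j k t) atTop
      (𝓝 (∫ t in σ k..σ (k + 1), kruzhkovBalance H b l aL aR φ (c k t) t)) := fun k hk =>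
    intervalIntegral.tendsto_integral_filter_of_dominated_convergence
      (fun _ => C * |aR - aL| + n k * C)
      (Eventually.of_forall fun j => ((hDmeas j).1 k hk).def'.aestronglyMeasurable)
      (Eventually.of_forall fun j => by
        filter_upwards [hae k hk] with t ht ht'
        exact hDb j k hk t (ht ht'))
      (by simp)
      (by
        filter_upwards [hae k hk] with t ht ht'
        exact hDlim k hk t (ht ht'))
  have hD₀int : ∀ k ≤ N, IntervalIntegrable (fun t => kruzhkovBalance H b l aL aR φ (c k t) t) volume (σ k) (σ (k + 1)) := by
    intro k hk
    rw [intervalIntegrable_iff]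
    refine integrableOn_of_abs_le (C := C * |aR - aL| + n k * C) (by simp [uIoc])
      (aestronglyMeasurable_of_tendsto_ae atTop
        (fun j => ((hDmeas j).1 k hk).def'.aestronglyMeasurable)
        ((ae_restrict_iff' measurableSet_uIoc).2 (by
          filter_upwards [hae k hk] with t ht ht'
          exact hDlim k hk t (ht ht')))) ?_
    refine (ae_restrict_iff' measurableSet_uIoc).2 ?_
    filter_upwards [hae k hk] with t ht ht'
    exact le_of_tendsto (hDlim k hk t (ht ht')).norm
      (Eventually.of_forall fun j => hDb j k hk t (ht ht'))
  refine ⟨hD₀int, ?_⟩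
  have h1 := tendsto_finsetSum (Finset.range (N + 1)) fun k hk =>
    hlim k (by simpa [Nat.lt_succ_iff] using hk)
  simp only [fun j => (hDmeas j).2] at h1
  exact (tendsto_nhds_unique h1 tendsto_const_nhds)

theorem IsPathPartition.kruzhkov (ha : aL < aR) (hH : IsHamiltonian H t₀ T PL PR)
    (hb : IsDrift H b t₀ T PL PR) (hp : IsPathPartition H b aL aR t₀ T PL PR N σ n c q)
    {φ : ℝ × ℝ → ℝ} (hφ : IsTest aL aR t₀ T φ) (hφ0 : ∀ z, 0 ≤ φ z) {l : ℝ}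
    (hl : l ∈ Icc PL PR) :
    0 ≤ ∫ z in Ioo aL aR ×ˢ Ioo t₀ T,
      kruzhkovDensity H l φ z.1 z.2 (profile b (q z.2) z.2 z.1) := by
  obtain ⟨hD₀int, hsum0⟩ := hp.sum_kruzhkovBalance ha hH hb hφ hl
  obtain ⟨hσ0, hσT, hg, hq, hord, hev, hrange⟩ := hp
  have hσ : ∀ k ≤ N, σ k < σ (k + 1) := fun k hk => (hg k hk).lt
  have hmeas := aestronglyMeasurable_profile hb hσ0 hσT hg hq
  have htri : AEStronglyMeasurable (fun z : ℝ × ℝ => (z.1, z.2, profile b (q z.2) z.2 z.1))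
      (volume.restrict (Ioo aL aR ×ˢ Ioo t₀ T)) :=
    (continuous_fst.aestronglyMeasurable).prodMk ((continuous_snd.aestronglyMeasurable).prodMk hmeas)
  have hIoo : ∀ k ≤ N, Ioo (σ k) (σ (k + 1)) ⊆ Ioo t₀ T := fun k hk t ht => (hg k hk).mem_Ioo ht
  obtain ⟨C, hKb⟩ := exists_kruzhkovDensity_bound hH hb hφ hl
  have hKm := ((measurable_kruzhkovDensity hH hb hφ l).comp_aemeasurable
    htri.aemeasurable).aestronglyMeasurable
  obtain ⟨hint, heq⟩ := integral_rectangle_eq_sum (F := fun z => kruzhkovDensity H l φ z.1 z.2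
    (profile b (q z.2) z.2 z.1)) ha.le hσ0 hσT hσ hKm (C := C) fun z hz =>
      hKb z.1 (Ioo_subset_Icc_self hz.1) z.2 (Ioo_subset_Icc_self hz.2) _
        (hrange _ (Ioo_subset_Icc_self hz.1) _ hz.2)
  rw [heq, ← hsum0]
  refine Finset.sum_le_sum fun k hk => ?_
  have hk' : k ≤ N := by simpa [Nat.lt_succ_iff] using hk
  refine intervalIntegral.integral_mono_on_of_le_Ioo (hσ k hk').le (hD₀int k hk') (hint k hk')
    fun t ht => ?_
  have htc := Ioo_subset_Icc_self (hIoo k hk' ht)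
  simp only [hq k hk' t (Ioo_subset_Ico_self ht)]
  exact (add_le_add le_rfl (Finset.sum_nonpos fun i _ => mul_nonpos_of_nonneg_of_nonpos (hφ0 _)
    (kruzhkov_jump_nonpos hH htc ((hg k hk').leftValue_mem hb ht i)
      ((hg k hk').value_mem hb ht i.succ)
      ((hord k hk' t (Ioo_subset_Icc_self ht)).jump i)))).trans_eq (add_zero _)

theorem isEntropySolution_of_isParticlePath (ha : aL < aR) (hH : IsHamiltonian H t₀ T PL PR)
    (hb : IsDrift H b t₀ T PL PR) (hpath : IsParticlePath H b aL aR t₀ T PL PR q) :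
    IsEntropySolution H aL aR t₀ T PL PR (fun x t => profile b (q t) t x) := by
  obtain ⟨N, σ, n, c, hp⟩ := hpath.exists_partition hH hb
  exact ⟨aestronglyMeasurable_profile hb hp.zero hp.last hp.good hp.eq,
    fun x hx t ht => hp.range x (Ioo_subset_Icc_self hx) t ht, fun φ hφ => hp.weak ha hH hb hφ,
    fun φ hφ hφ0 l hl => hp.kruzhkov ha hH hb hφ hφ0 hl⟩

end PathEntropy

/-! ### Doubling of variables -/

section Mollifier

/-- A smooth probability density on `[-1, 1]`, together with the moments of its derivative. -/
structure IsMollifier (η : ℝ → ℝ) : Prop where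
  smooth : ContDiff ℝ ∞ η
  nonneg : ∀ x, 0 ≤ η x
  zero : ∀ x, 1 < |x| → η x = 0
  deriv_zero : ∀ x, 1 < |x| → deriv η x = 0
  integral : ∫ x, η x = 1
  integral_deriv : ∫ x, deriv η x = 0
  integral_mul_deriv : ∫ x, x * deriv η x = -1

theorem exists_isMollifier : ∃ η : ℝ → ℝ, IsMollifier η := by
  let f : ContDiffBump (0 : ℝ) := ⟨1 / 2, 1, by norm_num, by norm_num⟩
  set η : ℝ → ℝ := f.normed volume with hη
  have hsm : ContDiff ℝ ∞ η := f.contDiff_normed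
  have hcs : HasCompactSupport η := f.hasCompactSupport_normed
  have hts : tsupport η = Metric.closedBall 0 1 := f.tsupport_normed_eq
  have hout : ∀ x : ℝ, 1 < |x| → x ∉ tsupport η := fun x hx h => by
    rw [hts, mem_closedBall_zero_iff, Real.norm_eq_abs] at h
    exact absurd h hx.not_ge
  have hder : ∀ x, HasDerivAt η (deriv η x) x := fun x =>
    ((hsm.differentiable (by simp)) x).hasDerivAt
  have hdc : Continuous (deriv η) := hsm.continuous_deriv (by simp)
  have hi : Integrable η := hsm.continuous.integrable_of_hasCompactSupport hcs
  have hdi : Integrable (deriv η) := hdc.integrable_of_hasCompactSupport hcs.deriv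
  refine ⟨η, hsm, f.nonneg_normed, fun x hx => image_eq_zero_of_notMem_tsupport (hout x hx),
    fun x hx => ?_, f.integral_normed, ?_, ?_⟩
  · exact image_eq_zero_of_notMem_tsupport fun h => hout x hx (tsupport_deriv_subset h)
  · exact integral_eq_zero_of_hasDerivAt_of_integrable hder hdi hi
  · have h := integral_mul_deriv_eq_deriv_mul_of_integrable (u := fun x : ℝ => x)
      (u' := fun _ => 1) (v := η) (v' := deriv η) (fun x _ => hasDerivAt_id x) (fun x _ => hder x)
      ((continuous_id.mul hdc).integrable_of_hasCompactSupport hcs.deriv.mul_left)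
      (by simpa [Pi.mul_def] using hi)
      ((continuous_id.mul hsm.continuous).integrable_of_hasCompactSupport hcs.mul_left)
    rw [h]
    simp only [one_mul]
    rw [show ∫ x, η x = 1 from f.integral_normed]

/-- The kernel `η ((p₁ - q₁) / h) η ((p₂ - q₂) / h)`, which concentrates on `p = q`. -/
noncomputable def mollKernel (η : ℝ → ℝ) (h : ℝ) (p q : ℝ × ℝ) : ℝ :=
  η ((p.1 - q.1) / h) * η ((p.2 - q.2) / h)

variable {η : ℝ → ℝ} {h : ℝ}

theorem IsMollifier.hasDerivAt (hη : IsMollifier η) (x : ℝ) : HasDerivAt η (deriv η x) x :=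
  ((hη.smooth.differentiable (by simp)) x).hasDerivAt

theorem IsMollifier.continuous_deriv (hη : IsMollifier η) : Continuous (deriv η) :=
  hη.smooth.continuous_deriv (by simp)

theorem fderiv_mul_mollKernel_left (hη : IsMollifier η) {ψ : ℝ × ℝ → ℝ} (hψ : ContDiff ℝ ∞ ψ)
    (p q w : ℝ × ℝ) :
    fderiv ℝ (fun p => ψ p * mollKernel η h p q) p w = fderiv ℝ ψ p w * mollKernel η h p q
      + ψ p * (deriv η ((p.1 - q.1) / h) * η ((p.2 - q.2) / h) * (w.1 / h)
        + η ((p.1 - q.1) / h) * deriv η ((p.2 - q.2) / h) * (w.2 / h)) := by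
  have h1 : HasFDerivAt (fun p : ℝ × ℝ => (p.1 - q.1) / h)
      (h⁻¹ • ContinuousLinearMap.fst ℝ ℝ ℝ) p := by
    simpa [div_eq_mul_inv] using (hasFDerivAt_fst.sub_const q.1).mul_const h⁻¹
  have h2 : HasFDerivAt (fun p : ℝ × ℝ => (p.2 - q.2) / h)
      (h⁻¹ • ContinuousLinearMap.snd ℝ ℝ ℝ) p := by
    simpa [div_eq_mul_inv] using (hasFDerivAt_snd.sub_const q.2).mul_const h⁻¹
  have h3 := (hη.hasDerivAt ((p.1 - q.1) / h)).comp_hasFDerivAt p h1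
  have h4 := (hη.hasDerivAt ((p.2 - q.2) / h)).comp_hasFDerivAt p h2
  have h5 := ((hψ.differentiable (by simp)) p).hasFDerivAt.mul (h3.mul h4)
  have h6 : fderiv ℝ (fun p => ψ p * mollKernel η h p q) p = _ := h5.fderiv
  rw [h6]
  simp [mollKernel, div_eq_mul_inv]
  ring

theorem fderiv_mul_mollKernel_right (hη : IsMollifier η) (c : ℝ) (p q w : ℝ × ℝ) :
    fderiv ℝ (fun q => c * mollKernel η h p q) q w =
      -(c * (deriv η ((p.1 - q.1) / h) * η ((p.2 - q.2) / h) * (w.1 / h)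
        + η ((p.1 - q.1) / h) * deriv η ((p.2 - q.2) / h) * (w.2 / h))) := by
  have h1 : HasFDerivAt (fun q : ℝ × ℝ => (p.1 - q.1) / h)
      (h⁻¹ • -ContinuousLinearMap.fst ℝ ℝ ℝ) q := by
    simpa [div_eq_mul_inv] using ((hasFDerivAt_fst (𝕜 := ℝ) (E := ℝ) (F := ℝ) (p := q)).const_sub p.1).mul_const h⁻¹
  have h2 : HasFDerivAt (fun q : ℝ × ℝ => (p.2 - q.2) / h)
      (h⁻¹ • -ContinuousLinearMap.snd ℝ ℝ ℝ) q := by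
    simpa [div_eq_mul_inv] using ((hasFDerivAt_snd (𝕜 := ℝ) (E := ℝ) (F := ℝ) (p := q)).const_sub p.2).mul_const h⁻¹
  have h3 := (hη.hasDerivAt ((p.1 - q.1) / h)).comp_hasFDerivAt q h1
  have h4 := (hη.hasDerivAt ((p.2 - q.2) / h)).comp_hasFDerivAt q h2
  have h5 := (h3.mul h4).const_mul c
  have h6 : fderiv ℝ (fun q => c * mollKernel η h p q) q = _ := h5.fderiv
  rw [h6]
  simp [div_eq_mul_inv]
  ring

theorem contDiff_mollKernel (hη : IsMollifier η) (h : ℝ) :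
    ContDiff ℝ ∞ fun w : (ℝ × ℝ) × (ℝ × ℝ) => mollKernel η h w.1 w.2 := by
  have := hη.smooth
  unfold mollKernel
  fun_prop

theorem dist_le_of_not_one_lt (hh : 0 < h) {p q : ℝ × ℝ}
    (hz : ¬ (1 < |(p.1 - q.1) / h| ∨ 1 < |(p.2 - q.2) / h|)) : dist q p ≤ h := by
  push Not at hz
  obtain ⟨h1, h2⟩ := hz
  rw [abs_div, abs_of_pos hh, div_le_one hh] at h1 h2
  rw [Prod.dist_eq, Real.dist_eq, Real.dist_eq, abs_sub_comm q.1, abs_sub_comm q.2]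
  exact max_le h1 h2

theorem isTest_mul_mollKernel (hη : IsMollifier η) (hh : 0 < h) {aL aR t₀ T : ℝ}
    {ψ : ℝ × ℝ → ℝ} (hψ : IsTest aL aR t₀ T ψ)
    (hsub : Metric.cthickening h (tsupport ψ) ⊆ Ioo aL aR ×ˢ Ioo t₀ T) (r : ℝ × ℝ) :
    IsTest aL aR t₀ T (fun p => ψ p * mollKernel η h p r) ∧
      IsTest aL aR t₀ T (fun q => ψ r * mollKernel η h r q) := by
  have hc := hψ.2.1.isCompact.cthickening (r := h)
  have hk := contDiff_mollKernel hη h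
  have hk1 : ContDiff ℝ ∞ fun p => mollKernel η h p r :=
    hk.comp (by fun_prop : ContDiff ℝ ∞ fun p : ℝ × ℝ => (p, r))
  have hk2 : ContDiff ℝ ∞ fun q => mollKernel η h r q :=
    hk.comp (by fun_prop : ContDiff ℝ ∞ fun q : ℝ × ℝ => (r, q))
  have hsupp : Function.support (fun q => ψ r * mollKernel η h r q)
      ⊆ Metric.cthickening h (tsupport ψ) := by
    intro q hq
    refine Metric.mem_cthickening_of_dist_le q r h _ (subset_tsupport ψ (left_ne_zero_of_mul hq))
      (dist_le_of_not_one_lt hh ?_)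
    rintro (h' | h')
    · exact hq (by simp [mollKernel, hη.zero _ h'])
    · exact hq (by simp [mollKernel, hη.zero _ h'])
  refine ⟨⟨hψ.1.mul hk1, hψ.2.1.mul_right, (tsupport_mul_subset_left).trans hψ.2.2⟩,
    ⟨contDiff_const.mul hk2, ?_, ?_⟩⟩
  · exact HasCompactSupport.intro' hc hc.isClosed fun q hq => by
      by_contra h'
      exact hq (hsupp h')
  · exact (closure_minimal hsupp hc.isClosed).trans hsub

end Mollifier

section SignForm

theorem tendsto_sign_mul {ι : Type*} {l : Filter ι} {a g : ι → ℝ} {a₀ g₀ : ℝ}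
    (ha : Tendsto a l (𝓝 a₀)) (hg : Tendsto g l (𝓝 g₀)) (h0 : a₀ = 0 → g₀ = 0) :
    Tendsto (fun i => Real.sign (a i) * g i) l (𝓝 (Real.sign a₀ * g₀)) := by
  rcases lt_trichotomy a₀ 0 with h | h | h
  · refine Tendsto.mul ?_ hg
    rw [Real.sign_of_neg h]
    refine tendsto_const_nhds.congr' ?_
    filter_upwards [ha.eventually (gt_mem_nhds h)] with i hi
    rw [Real.sign_of_neg hi]
  · rw [h0 h, mul_zero]
    rw [h0 h] at hg
    refine squeeze_zero_norm (a := fun i => |g i|) (fun i => ?_) (by simpa using hg.abs)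
    rw [Real.norm_eq_abs, abs_mul]
    exact mul_le_of_le_one_left (abs_nonneg _) (abs_sign_le _)
  · refine Tendsto.mul ?_ hg
    rw [Real.sign_of_pos h]
    refine tendsto_const_nhds.congr' ?_
    filter_upwards [ha.eventually (lt_mem_nhds h)] with i hi
    rw [Real.sign_of_pos hi]

/-- The functions which appear in the doubling of variables are integrable: they are bounded with
compact support. -/
theorem integrable_sign_form {PL PR : ℝ} {c₀ : (ℝ × ℝ) × (ℝ × ℝ) → ℝ}
    {c₁ : ((ℝ × ℝ) × (ℝ × ℝ)) × ℝ × ℝ → ℝ} (h₀ : Continuous c₀) (h₁ : Continuous c₁)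
    {K : Set ((ℝ × ℝ) × (ℝ × ℝ))} (hK : IsCompact K)
    (hK₀ : ∀ w ∉ K, c₀ w = 0) (hK₁ : ∀ w ∉ K, ∀ z, c₁ (w, z) = 0)
    {U V : (ℝ × ℝ) × (ℝ × ℝ) → ℝ} (hU : Measurable U) (hV : Measurable V)
    (hUr : ∀ w, U w ∈ Icc PL PR) (hVr : ∀ w, V w ∈ Icc PL PR) :
    Integrable fun w => |U w - V w| * c₀ w + Real.sign (U w - V w) * c₁ (w, U w, V w) := by
  obtain ⟨C₀, hC₀⟩ := hK.exists_bound_of_continuousOn h₀.continuousOn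
  obtain ⟨C₁, hC₁⟩ := (hK.prod ((isCompact_Icc (a := PL) (b := PR)).prod
    (isCompact_Icc (a := PL) (b := PR)))).exists_bound_of_continuousOn h₁.continuousOn
  have hm : Measurable fun w => |U w - V w| * c₀ w
      + Real.sign (U w - V w) * c₁ (w, U w, V w) :=
    ((hU.sub hV).abs.mul h₀.measurable).add ((measurable_sign.comp (hU.sub hV)).mul
      (h₁.measurable.comp (measurable_id.prodMk (hU.prodMk hV))))
  have hsupp : Function.support (fun w => |U w - V w| * c₀ w
      + Real.sign (U w - V w) * c₁ (w, U w, V w)) ⊆ K := fun w hw => by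
    by_contra h
    exact hw (by simp [hK₀ w h, hK₁ w h])
  rw [← integrableOn_iff_integrable_of_support_subset hsupp]
  refine integrableOn_of_abs_le (C := (PR - PL) * C₀ + C₁) hK.measure_lt_top
    hm.aestronglyMeasurable ((ae_restrict_iff' hK.measurableSet).2
      (Eventually.of_forall fun w hw => ?_))
  have e1 : |U w - V w| ≤ PR - PL := by
    rw [abs_le]
    constructor <;> linarith [(hUr w).1, (hUr w).2, (hVr w).1, (hVr w).2]
  have e2 := hC₀ w hw
  have e3 := hC₁ (w, U w, V w) ⟨hw, hUr w, hVr w⟩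
  rw [Real.norm_eq_abs] at e2 e3
  calc _ ≤ |U w - V w| * |c₀ w| + |Real.sign (U w - V w)| * |c₁ (w, U w, V w)| := by
        refine (abs_add_le _ _).trans (add_le_add ?_ ?_) <;> simp [abs_mul]
    _ ≤ (PR - PL) * C₀ + 1 * C₁ := by
        gcongr
        · linarith [abs_nonneg (U w - V w)]
        · exact abs_sign_le _
    _ = _ := by ring

end SignForm

section Doubling

variable {H : ℝ → ℝ → ℝ → ℝ} {aL aR t₀ T PL PR h : ℝ} {η : ℝ → ℝ} {ψ : ℝ × ℝ → ℝ}

/-- The Kruzhkov inequalities of an entropy solution, integrated over the whole plane (the test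
functions are supported in the rectangle). -/
def SatisfiesKruzhkov (H : ℝ → ℝ → ℝ → ℝ) (aL aR t₀ T PL PR : ℝ) (u : ℝ × ℝ → ℝ) : Prop :=
  ∀ φ, IsTest aL aR t₀ T φ → (∀ z, 0 ≤ φ z) → ∀ c ∈ Icc PL PR,
    0 ≤ ∫ z, kruzhkovDensity H c φ z.1 z.2 (u z)

/-- The factor of the sign in the doubled Kruzhkov inequality, at the points `p` and
`q = p - h z`. -/
noncomputable def doubledFlux (H : ℝ → ℝ → ℝ → ℝ) (ψ : ℝ × ℝ → ℝ) (η : ℝ → ℝ) (h : ℝ)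
    (p z : ℝ × ℝ) (r r' : ℝ) : ℝ :=
  -((H p.1 p.2 r - H p.1 p.2 r') * fderiv ℝ ψ p (1, 0) * (η z.1 * η z.2))
    - ψ p * (deriv η z.1 * η z.2) *
      (h⁻¹ * ((H p.1 p.2 r - H (p - h • z).1 (p - h • z).2 r)
        - (H p.1 p.2 r' - H (p - h • z).1 (p - h • z).2 r')))
    + ψ p * (η z.1 * η z.2) * (dX H p.1 p.2 r' - dX H (p - h • z).1 (p - h • z).2 r)

/-- The derivatives of the kernel in the time variables of `p` and `q` cancel. -/
theorem kruzhkovDensity_add (hη : IsMollifier η) (hh : 0 < h) (hψ : IsTest aL aR t₀ T ψ)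
    (p z : ℝ × ℝ) (r r' : ℝ) :
    kruzhkovDensity H r' (fun p' => ψ p' * mollKernel η h p' (p - h • z)) p.1 p.2 r
      + kruzhkovDensity H r (fun q => ψ p * mollKernel η h p q) (p - h • z).1 (p - h • z).2 r'
    = |r - r'| * (fderiv ℝ ψ p (0, 1) * (η z.1 * η z.2))
      + Real.sign (r - r') * doubledFlux H ψ η h p z r r' := by
  have e1 : (p.1 - (p - h • z).1) / h = z.1 := by simp [hh.ne']
  have e2 : (p.2 - (p - h • z).2) / h = z.2 := by simp [hh.ne']
  have e3 : Real.sign (r' - r) = -Real.sign (r - r') := by rw [← Real.sign_neg, neg_sub]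
  have e4 : |r' - r| = |r - r'| := abs_sub_comm _ _
  simp only [kruzhkovDensity, Prod.mk.eta, fderiv_mul_mollKernel_left hη hψ.1,
    fderiv_mul_mollKernel_right hη]
  simp only [e1, e2, e3, e4, doubledFlux, mollKernel]
  field_simp
  ring

theorem integrable_doubled (hH : IsHamiltonian H t₀ T PL PR) (hη : IsMollifier η) (hh : 0 < h)
    (hψ : IsTest aL aR t₀ T ψ) {u v : ℝ × ℝ → ℝ} (hu : Measurable u) (hv : Measurable v)
    (hur : ∀ z, u z ∈ Icc PL PR) (hvr : ∀ z, v z ∈ Icc PL PR) :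
    Integrable (fun w : (ℝ × ℝ) × (ℝ × ℝ) =>
        kruzhkovDensity H (v w.2) (fun p => ψ p * mollKernel η h p w.2) w.1.1 w.1.2 (u w.1)) ∧
      Integrable (fun w : (ℝ × ℝ) × (ℝ × ℝ) =>
        kruzhkovDensity H (u w.1) (fun q => ψ w.1 * mollKernel η h w.1 q) w.2.1 w.2.2
          (v w.2)) := by
  have hK := hψ.2.1.isCompact.prod (hψ.2.1.isCompact.cthickening (r := h))
  have hHc : Continuous fun z : ℝ × ℝ × ℝ => H z.1 z.2.1 z.2.2 := hH.smooth.continuous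
  have hXc : Continuous fun z : ℝ × ℝ × ℝ => dX H z.1 z.2.1 z.2.2 :=
    continuous_unc_dX hH.contDiff_one
  have hηc := hη.smooth.continuous
  have hη'c := hη.continuous_deriv
  have hψc := hψ.1.continuous
  have hψ'c := hψ.1.continuous_fderiv (by simp)
  have hout : ∀ w ∉ tsupport ψ ×ˢ Metric.cthickening h (tsupport ψ), (ψ w.1 = 0 ∧
      ∀ d, fderiv ℝ ψ w.1 d = 0) ∨ (η ((w.1.1 - w.2.1) / h) = 0 ∧
        deriv η ((w.1.1 - w.2.1) / h) = 0) ∨ (η ((w.1.2 - w.2.2) / h) = 0 ∧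
        deriv η ((w.1.2 - w.2.2) / h) = 0) := by
    intro w hw
    by_cases h1 : w.1 ∈ tsupport ψ
    · right
      have h2 : w.2 ∉ Metric.cthickening h (tsupport ψ) := fun h2 => hw ⟨h1, h2⟩
      by_cases h3 : 1 < |(w.1.1 - w.2.1) / h|
      · exact Or.inl ⟨hη.zero _ h3, hη.deriv_zero _ h3⟩
      by_cases h4 : 1 < |(w.1.2 - w.2.2) / h|
      · exact Or.inr ⟨hη.zero _ h4, hη.deriv_zero _ h4⟩
      exact absurd (Metric.mem_cthickening_of_dist_le _ _ _ _ h1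
        (dist_le_of_not_one_lt hh (not_or.2 ⟨h3, h4⟩))) h2
    · exact Or.inl ⟨image_eq_zero_of_notMem_tsupport h1, fun d => by
        rw [image_eq_zero_of_notMem_tsupport (f := fderiv ℝ ψ)
          fun h' => h1 (tsupport_fderiv_subset ℝ h')]
        rfl⟩
  constructor
  · have := integrable_sign_form (PL := PL) (PR := PR)
      (c₀ := fun w => fderiv ℝ ψ w.1 (0, 1) * mollKernel η h w.1 w.2
        + ψ w.1 * (η ((w.1.1 - w.2.1) / h) * deriv η ((w.1.2 - w.2.2) / h) * (1 / h)))
      (c₁ := fun y => -((H y.1.1.1 y.1.1.2 y.2.1 - H y.1.1.1 y.1.1.2 y.2.2)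
          * (fderiv ℝ ψ y.1.1 (1, 0) * mollKernel η h y.1.1 y.1.2
        + ψ y.1.1 * (deriv η ((y.1.1.1 - y.1.2.1) / h) * η ((y.1.1.2 - y.1.2.2) / h) * (1 / h))))
        + dX H y.1.1.1 y.1.1.2 y.2.2 * (ψ y.1.1 * mollKernel η h y.1.1 y.1.2))
      (by unfold mollKernel; fun_prop) (by
        have i1 : Continuous fun y : ((ℝ × ℝ) × (ℝ × ℝ)) × ℝ × ℝ => H y.1.1.1 y.1.1.2 y.2.1 :=
          hHc.comp (by fun_prop : Continuous fun y : ((ℝ × ℝ) × (ℝ × ℝ)) × ℝ × ℝ =>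
            (y.1.1.1, y.1.1.2, y.2.1))
        have i2 : Continuous fun y : ((ℝ × ℝ) × (ℝ × ℝ)) × ℝ × ℝ => H y.1.1.1 y.1.1.2 y.2.2 :=
          hHc.comp (by fun_prop : Continuous fun y : ((ℝ × ℝ) × (ℝ × ℝ)) × ℝ × ℝ =>
            (y.1.1.1, y.1.1.2, y.2.2))
        have i3 : Continuous fun y : ((ℝ × ℝ) × (ℝ × ℝ)) × ℝ × ℝ => dX H y.1.1.1 y.1.1.2 y.2.2 :=
          hXc.comp (by fun_prop : Continuous fun y : ((ℝ × ℝ) × (ℝ × ℝ)) × ℝ × ℝ =>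
            (y.1.1.1, y.1.1.2, y.2.2))
        unfold mollKernel
        fun_prop) hK
      (fun w hw => by
        rcases hout w hw with h | h | h <;> simp [h.1, h.2, mollKernel])
      (fun w hw z => by
        rcases hout w hw with h | h | h <;> simp [h.1, h.2, mollKernel])
      (hu.comp measurable_fst) (hv.comp measurable_snd) (fun w => hur _) (fun w => hvr _)
    refine this.congr (Eventually.of_forall fun w => ?_)
    simp only [kruzhkovDensity, Prod.mk.eta, fderiv_mul_mollKernel_left hη hψ.1, Function.comp]
    ring
  · have := integrable_sign_form (PL := PL) (PR := PR)
      (c₀ := fun w => -(ψ w.1 * (η ((w.1.1 - w.2.1) / h) * deriv η ((w.1.2 - w.2.2) / h)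
        * (1 / h))))
      (c₁ := fun y => -((H y.1.2.1 y.1.2.2 y.2.2 - H y.1.2.1 y.1.2.2 y.2.1)
        * (ψ y.1.1 * (deriv η ((y.1.1.1 - y.1.2.1) / h) * η ((y.1.1.2 - y.1.2.2) / h) * (1 / h))))
        - dX H y.1.2.1 y.1.2.2 y.2.1 * (ψ y.1.1 * mollKernel η h y.1.1 y.1.2))
      (by fun_prop) (by
        have i1 : Continuous fun y : ((ℝ × ℝ) × (ℝ × ℝ)) × ℝ × ℝ => H y.1.2.1 y.1.2.2 y.2.1 :=
          hHc.comp (by fun_prop : Continuous fun y : ((ℝ × ℝ) × (ℝ × ℝ)) × ℝ × ℝ =>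
            (y.1.2.1, y.1.2.2, y.2.1))
        have i2 : Continuous fun y : ((ℝ × ℝ) × (ℝ × ℝ)) × ℝ × ℝ => H y.1.2.1 y.1.2.2 y.2.2 :=
          hHc.comp (by fun_prop : Continuous fun y : ((ℝ × ℝ) × (ℝ × ℝ)) × ℝ × ℝ =>
            (y.1.2.1, y.1.2.2, y.2.2))
        have i3 : Continuous fun y : ((ℝ × ℝ) × (ℝ × ℝ)) × ℝ × ℝ => dX H y.1.2.1 y.1.2.2 y.2.1 :=
          hXc.comp (by fun_prop : Continuous fun y : ((ℝ × ℝ) × (ℝ × ℝ)) × ℝ × ℝ =>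
            (y.1.2.1, y.1.2.2, y.2.1))
        unfold mollKernel
        fun_prop) hK
      (fun w hw => by
        rcases hout w hw with h | h | h <;> simp [h.1, h.2])
      (fun w hw z => by
        rcases hout w hw with h | h | h <;> simp [h.1, h.2, mollKernel])
      (hu.comp measurable_fst) (hv.comp measurable_snd) (fun w => hur _) (fun w => hvr _)
    refine this.congr (Eventually.of_forall fun w => ?_)
    have e3 : Real.sign (v w.2 - u w.1) = -Real.sign (u w.1 - v w.2) := by
      rw [← Real.sign_neg, neg_sub]
    simp only [kruzhkovDensity, Prod.mk.eta, fderiv_mul_mollKernel_right hη, Function.comp, e3,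
      abs_sub_comm (v w.2)]
    ring

/-- The doubled Kruzhkov inequality, with the second point written as `p - h z`. -/
theorem doubled_nonneg (hH : IsHamiltonian H t₀ T PL PR) (hη : IsMollifier η) (hh : 0 < h)
    (hψ : IsTest aL aR t₀ T ψ) (hψ0 : ∀ z, 0 ≤ ψ z)
    (hsub : Metric.cthickening h (tsupport ψ) ⊆ Ioo aL aR ×ˢ Ioo t₀ T)
    {u v : ℝ × ℝ → ℝ} (hu : Measurable u) (hv : Measurable v)
    (hur : ∀ z, u z ∈ Icc PL PR) (hvr : ∀ z, v z ∈ Icc PL PR)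
    (huK : SatisfiesKruzhkov H aL aR t₀ T PL PR u)
    (hvK : SatisfiesKruzhkov H aL aR t₀ T PL PR v) :
    0 ≤ ∫ p, ∫ z, (|u p - v (p - h • z)| * (fderiv ℝ ψ p (0, 1) * (η z.1 * η z.2))
      + Real.sign (u p - v (p - h • z)) * doubledFlux H ψ η h p z (u p) (v (p - h • z))) := by
  obtain ⟨hA, hB⟩ := integrable_doubled hH hη hh hψ hu hv hur hvr
  have hk0 : ∀ p q, 0 ≤ ψ p * mollKernel η h p q := fun p q =>
    mul_nonneg (hψ0 p) (mul_nonneg (hη.nonneg _) (hη.nonneg _))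
  have htest := isTest_mul_mollKernel hη hh hψ hsub
  set A : (ℝ × ℝ) → (ℝ × ℝ) → ℝ := fun p q =>
    kruzhkovDensity H (v q) (fun p => ψ p * mollKernel η h p q) p.1 p.2 (u p) with hAdef
  set B : (ℝ × ℝ) → (ℝ × ℝ) → ℝ := fun p q =>
    kruzhkovDensity H (u p) (fun q => ψ p * mollKernel η h p q) q.1 q.2 (v q) with hBdef
  rw [Measure.volume_eq_prod] at hA hB
  have nA : 0 ≤ ∫ w : (ℝ × ℝ) × (ℝ × ℝ), A w.1 w.2 ∂volume.prod volume := by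
    rw [integral_prod_symm _ hA]
    exact integral_nonneg fun q => huK _ (htest q).1 (fun p => hk0 p q) _ (hvr q)
  have nB : 0 ≤ ∫ w : (ℝ × ℝ) × (ℝ × ℝ), B w.1 w.2 ∂volume.prod volume := by
    rw [integral_prod _ hB]
    exact integral_nonneg fun p => hvK _ (htest p).2 (fun q => hk0 p q) _ (hur p)
  have nAB : 0 ≤ ∫ p, ∫ q, (A p q + B p q) := by
    rw [← integral_prod (fun w : (ℝ × ℝ) × (ℝ × ℝ) => A w.1 w.2 + B w.1 w.2) (hA.add hB),
      integral_add hA hB]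
    exact add_nonneg nA nB
  have hsubst : ∀ p : ℝ × ℝ, (∫ z : ℝ × ℝ, (A p (p - h • z) + B p (p - h • z)))
      = |(h ^ Module.finrank ℝ (ℝ × ℝ))⁻¹| * ∫ q, (A p q + B p q) := by
    intro p
    have h1 := Measure.integral_comp_smul (volume : Measure (ℝ × ℝ))
      (fun q => A p (p - q) + B p (p - q)) h
    rw [h1, integral_sub_left_eq_self (fun q => A p q + B p q) volume p, smul_eq_mul]
  have hpt : ∀ p z : ℝ × ℝ, |u p - v (p - h • z)| * (fderiv ℝ ψ p (0, 1) * (η z.1 * η z.2))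
      + Real.sign (u p - v (p - h • z)) * doubledFlux H ψ η h p z (u p) (v (p - h • z))
      = A p (p - h • z) + B p (p - h • z) := fun p z =>
    (kruzhkovDensity_add hη hh hψ p z _ _).symm
  simp_rw [hpt, hsubst]
  rw [integral_const_mul]
  exact mul_nonneg (abs_nonneg _) nAB

end Doubling

section DoublingLimit

variable {H : ℝ → ℝ → ℝ → ℝ} {aL aR t₀ T PL PR h : ℝ} {η : ℝ → ℝ} {ψ : ℝ × ℝ → ℝ}

/-- The integrand of the doubled inequality is bounded, uniformly in the scale `h`: this uses the
Lipschitz continuity of `H` for the term with the factor `1 / h`. -/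
theorem exists_doubled_bound (hH : IsHamiltonian H t₀ T PL PR) (hη : IsMollifier η)
    (hψ : IsTest aL aR t₀ T ψ) :
    ∃ C : ℝ, 0 ≤ C ∧ ∀ h ∈ Ioc (0 : ℝ) 1, ∀ p : ℝ × ℝ, ∀ z ∈ Icc (-1 : ℝ) 1 ×ˢ Icc (-1 : ℝ) 1,
      ∀ r ∈ Icc PL PR, ∀ r' ∈ Icc PL PR,
        |(|r - r'| * (fderiv ℝ ψ p (0, 1) * (η z.1 * η z.2))
          + Real.sign (r - r') * doubledFlux H ψ η h p z r r')| ≤ C := by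
  obtain ⟨M, hM⟩ := hψ.2.1.isCompact.exists_bound_of_continuousOn (f := fun p : ℝ × ℝ => p)
    continuous_id.continuousOn
  have hψ'c := hψ.1.continuous_fderiv (by simp)
  set M' := max M 0 + 1 + |PL| + |PR| with hM'
  obtain ⟨L, hL0, hL⟩ := exists_lipschitz_closedBall hH.contDiff_one M'
  obtain ⟨D, hD⟩ := (isCompact_closedBall (0 : ℝ × ℝ × ℝ) M').exists_bound_of_continuousOn
    (continuous_unc_dX hH.contDiff_one).continuousOn
  obtain ⟨G, hG⟩ := (isCompact_closedBall (0 : ℝ × ℝ × ℝ) M').exists_bound_of_continuousOn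
    hH.contDiff_one.continuous.continuousOn
  obtain ⟨P, hP⟩ := hψ.2.1.isCompact.exists_bound_of_continuousOn hψ.1.continuous.continuousOn
  obtain ⟨P', hP'⟩ := hψ.2.1.isCompact.exists_bound_of_continuousOn hψ'c.continuousOn
  obtain ⟨E, hE⟩ := (isCompact_Icc (a := (-1 : ℝ)) (b := 1)).exists_bound_of_continuousOn
    hη.smooth.continuous.continuousOn
  obtain ⟨E', hE'⟩ := (isCompact_Icc (a := (-1 : ℝ)) (b := 1)).exists_bound_of_continuousOn
    hη.continuous_deriv.continuousOn
  have hE0 : 0 ≤ E := (norm_nonneg _).trans (hE 0 (by simp))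
  have hE'0 : 0 ≤ E' := (norm_nonneg _).trans (hE' 0 (by simp))
  set Q := max P 0
  set Q' := max P' 0
  refine ⟨|PR - PL| * (Q' * (E * E)) + (2 * |G| * Q' * (E * E) + Q * (E' * E) * (2 * L)
    + Q * (E * E) * (2 * |D|)), by positivity, ?_⟩
  rintro h ⟨hh0, hh1⟩ p z hz r hr r' hr'
  by_cases hp : p ∈ tsupport ψ
  swap
  · have e1 : ψ p = 0 := image_eq_zero_of_notMem_tsupport hp
    have e2 : fderiv ℝ ψ p = 0 := image_eq_zero_of_notMem_tsupport (f := fderiv ℝ ψ)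
      fun h' => hp (tsupport_fderiv_subset ℝ h')
    simp only [doubledFlux, e1, e2]
    simp
    positivity
  have hz1 : ‖z‖ ≤ 1 := by
    rw [Prod.norm_def]
    exact max_le (abs_le.2 hz.1) (abs_le.2 hz.2)
  have hhz : ‖h • z‖ ≤ h := by
    rw [norm_smul, Real.norm_eq_abs, abs_of_pos hh0]
    exact mul_le_of_le_one_right hh0.le hz1
  have hpM : ‖p‖ ≤ max M 0 := (hM p hp).trans (le_max_left _ _)
  have hqM : ‖p - h • z‖ ≤ max M 0 + 1 := (norm_sub_le _ _).trans (by linarith)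
  have hball : ∀ y : ℝ × ℝ, ‖y‖ ≤ max M 0 + 1 → ∀ s ∈ Icc PL PR,
      ‖((y.1, y.2, s) : ℝ × ℝ × ℝ)‖ ≤ M' := by
    intro y hy s hs
    have hs' : |s| ≤ |PL| + |PR| := by
      rw [abs_le]
      constructor
      · linarith [hs.1, neg_abs_le PL, abs_nonneg PR]
      · linarith [hs.2, le_abs_self PR, abs_nonneg PL]
    rw [Prod.norm_def, Prod.norm_def] at *
    have i1 := le_max_left ‖y.1‖ ‖y.2‖
    have i2 := le_max_right ‖y.1‖ ‖y.2‖
    have i3 := le_max_right M 0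
    refine max_le ?_ (max_le ?_ ?_)
    · linarith [abs_nonneg PL, abs_nonneg PR]
    · linarith [abs_nonneg PL, abs_nonneg PR]
    · rw [Real.norm_eq_abs]; linarith
  have bG : ∀ s ∈ Icc PL PR, |H p.1 p.2 s| ≤ |G| := fun s hs =>
    (hG (p.1, p.2, s) (mem_closedBall_zero_iff.2 (hball p (by linarith) s hs))).trans (le_abs_self G)
  have bD : ∀ y : ℝ × ℝ, ‖y‖ ≤ max M 0 + 1 → ∀ s ∈ Icc PL PR, |dX H y.1 y.2 s| ≤ |D| :=
    fun y hy s hs => (hD (y.1, y.2, s) (mem_closedBall_zero_iff.2 (hball y hy s hs))).trans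
      (le_abs_self D)
  have bL : ∀ s ∈ Icc PL PR,
      |H p.1 p.2 s - H (p - h • z).1 (p - h • z).2 s| ≤ L * h := by
    intro s hs
    have := hL (p.1, p.2, s) ((p - h • z).1, (p - h • z).2, s) (hball p (by linarith) s hs)
      (hball _ hqM s hs)
    refine this.trans (mul_le_mul_of_nonneg_left ?_ hL0)
    have e : ((p.1, p.2, s) : ℝ × ℝ × ℝ) - ((p - h • z).1, (p - h • z).2, s)
        = ((h • z).1, (h • z).2, 0) := by ext <;> simp
    rw [e, Prod.norm_def, Prod.norm_def]
    rw [Prod.norm_def] at hhz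
    simpa [hh0.le] using hhz
  have bQ : |ψ p| ≤ Q := (hP p hp).trans (le_max_left _ _)
  have bQ' : ∀ d : ℝ × ℝ, ‖d‖ ≤ 1 → |fderiv ℝ ψ p d| ≤ Q' := fun d hd =>
    ((fderiv ℝ ψ p).le_opNorm d).trans ((mul_le_of_le_one_right (norm_nonneg _) hd).trans
      ((hP' p hp).trans (le_max_left _ _)))
  have b1 : |η z.1| ≤ E := hE _ hz.1
  have b2 : |η z.2| ≤ E := hE _ hz.2
  have b3 : |deriv η z.1| ≤ E' := hE' _ hz.1
  have c1 : |r - r'| ≤ |PR - PL| := by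
    rw [abs_le]
    have := le_abs_self (PR - PL)
    constructor <;> linarith [hr.1, hr.2, hr'.1, hr'.2]
  have c2 : |H p.1 p.2 r - H p.1 p.2 r'| ≤ 2 * |G| :=
    (abs_sub _ _).trans (by linarith [bG r hr, bG r' hr'])
  have c3 : |dX H p.1 p.2 r' - dX H (p - h • z).1 (p - h • z).2 r| ≤ 2 * |D| :=
    (abs_sub _ _).trans (by linarith [bD p (by linarith) r' hr', bD _ hqM r hr])
  have c4 : |h⁻¹ * ((H p.1 p.2 r - H (p - h • z).1 (p - h • z).2 r)
      - (H p.1 p.2 r' - H (p - h • z).1 (p - h • z).2 r'))| ≤ 2 * L := by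
    rw [abs_mul, abs_of_pos (inv_pos.2 hh0), inv_mul_le_iff₀ hh0]
    exact (abs_sub _ _).trans (by linarith [bL r hr, bL r' hr'])
  have c5 : |fderiv ℝ ψ p (0, 1)| ≤ Q' := bQ' _ (by simp [Prod.norm_def])
  have c6 : |fderiv ℝ ψ p (1, 0)| ≤ Q' := bQ' _ (by simp [Prod.norm_def])
  have d1 : |η z.1 * η z.2| ≤ E * E := by rw [abs_mul]; gcongr
  have d2 : |deriv η z.1 * η z.2| ≤ E' * E := by rw [abs_mul]; gcongr
  refine (abs_add_le _ _).trans (add_le_add ?_ ?_)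
  · rw [abs_mul, abs_mul, abs_abs]
    gcongr
  · rw [abs_mul]
    refine (mul_le_of_le_one_left (abs_nonneg _) (abs_sign_le _)).trans ?_
    rw [doubledFlux]
    refine (abs_add_le _ _).trans (add_le_add ((abs_sub _ _).trans (add_le_add ?_ ?_)) ?_)
    · rw [abs_neg, abs_mul, abs_mul]
      gcongr
    · rw [abs_mul, abs_mul]
      gcongr
    · rw [abs_mul, abs_mul]
      gcongr

theorem doubled_eq_zero (hη : IsMollifier η) {p z : ℝ × ℝ}
    (hz : (p, z) ∉ tsupport ψ ×ˢ (Icc (-1 : ℝ) 1 ×ˢ Icc (-1 : ℝ) 1)) (r r' : ℝ) :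
    |r - r'| * (fderiv ℝ ψ p (0, 1) * (η z.1 * η z.2))
      + Real.sign (r - r') * doubledFlux H ψ η h p z r r' = 0 := by
  by_cases hp : p ∈ tsupport ψ
  · have hz' : ¬ (z.1 ∈ Icc (-1 : ℝ) 1 ∧ z.2 ∈ Icc (-1 : ℝ) 1) := fun h' => hz ⟨hp, h'⟩
    by_cases h1 : 1 < |z.1|
    · simp [doubledFlux, hη.zero _ h1, hη.deriv_zero _ h1]
    by_cases h2 : 1 < |z.2|
    · simp [doubledFlux, hη.zero _ h2]
    exact absurd ⟨abs_le.1 (not_lt.1 h1), abs_le.1 (not_lt.1 h2)⟩ hz'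
  · have e1 : ψ p = 0 := image_eq_zero_of_notMem_tsupport hp
    have e2 : fderiv ℝ ψ p = 0 := image_eq_zero_of_notMem_tsupport (f := fderiv ℝ ψ)
      fun h' => hp (tsupport_fderiv_subset ℝ h')
    simp [doubledFlux, e1, e2]

/-- Difference quotients of `H` in `(x, t)`, when also `ρ` converges. -/
theorem tendsto_diff_quotient (hH : IsHamiltonian H t₀ T PL PR) (p z : ℝ × ℝ) {ρ : ℝ → ℝ} {r : ℝ}
    (hρ : Tendsto ρ (𝓝[>] 0) (𝓝 r)) :
    Tendsto (fun h => h⁻¹ * (H p.1 p.2 (ρ h) - H (p - h • z).1 (p - h • z).2 (ρ h))) (𝓝[>] 0)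
      (𝓝 (dX H p.1 p.2 r * z.1 + dT H p.1 p.2 r * z.2)) := by
  have hs : HasStrictFDerivAt (unc H) (fderiv ℝ (unc H) (p.1, p.2, r)) (p.1, p.2, r) :=
    hH.contDiff_one.contDiffAt.hasStrictFDerivAt one_ne_zero
  have hid : Tendsto (fun h : ℝ => h) (𝓝[>] 0) (𝓝 0) := tendsto_id.mono_left nhdsWithin_le_nhds
  have hq : Tendsto (fun h : ℝ => p - h • z) (𝓝[>] 0) (𝓝 p) := by
    have : Tendsto (fun h : ℝ => p - h • z) (𝓝[>] 0) (𝓝 (p - (0 : ℝ) • z)) :=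
      tendsto_const_nhds.sub (hid.smul_const z)
    simpa using this
  have h1 : Tendsto (fun h => (((p.1, p.2, ρ h) : ℝ × ℝ × ℝ),
      (((p - h • z).1, (p - h • z).2, ρ h) : ℝ × ℝ × ℝ))) (𝓝[>] 0)
      (𝓝 ((p.1, p.2, r), (p.1, p.2, r))) :=
    (tendsto_const_nhds.prodMk_nhds (tendsto_const_nhds.prodMk_nhds hρ)).prodMk_nhds
      (((continuous_fst.tendsto _).comp hq).prodMk_nhds
        (((continuous_snd.tendsto _).comp hq).prodMk_nhds hρ))
  have h2 := hs.isLittleO.comp_tendsto h1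
  have h3 : ((fun h => unc H (p.1, p.2, ρ h) - unc H ((p - h • z).1, (p - h • z).2, ρ h)
      - h * (dX H p.1 p.2 r * z.1 + dT H p.1 p.2 r * z.2)) : ℝ → ℝ) =o[𝓝[>] 0] fun h : ℝ => h := by
    have e : ∀ h : ℝ, ((p.1, p.2, ρ h) : ℝ × ℝ × ℝ) - ((p - h • z).1, (p - h • z).2, ρ h)
        = h • ((z.1, z.2, 0) : ℝ × ℝ × ℝ) := fun h => by ext <;> simp
    refine (h2.congr_left fun h => ?_).trans_isBigO ?_
    · simp only [Function.comp, e, fderiv_unc hH.contDiff_one, Prod.smul_mk, smul_eq_mul]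
      ring
    · refine Asymptotics.IsBigO.of_bound ‖((z.1, z.2, 0) : ℝ × ℝ × ℝ)‖
        (Eventually.of_forall fun h => ?_)
      simp only [Function.comp, e, norm_smul]
      rw [mul_comm]
  have h4 := h3.tendsto_div_nhds_zero
  have h5 := h4.add_const (dX H p.1 p.2 r * z.1 + dT H p.1 p.2 r * z.2)
  rw [zero_add] at h5
  refine h5.congr' ?_
  filter_upwards [self_mem_nhdsWithin] with h hh
  have : h ≠ 0 := ne_of_gt hh
  simp only [unc]
  field_simp
  ring

/-- The pointwise limit of the doubled integrand, at a point of continuity of `v`. -/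
theorem tendsto_doubled (hH : IsHamiltonian H t₀ T PL PR) {v : ℝ × ℝ → ℝ} {p : ℝ × ℝ}
    (hv : ContinuousAt v p) (z : ℝ × ℝ) (r : ℝ) :
    Tendsto (fun h => |r - v (p - h • z)| * (fderiv ℝ ψ p (0, 1) * (η z.1 * η z.2))
      + Real.sign (r - v (p - h • z)) * doubledFlux H ψ η h p z r (v (p - h • z))) (𝓝[>] 0)
      (𝓝 (|r - v p| * (fderiv ℝ ψ p (0, 1) * (η z.1 * η z.2)) + Real.sign (r - v p) *
        (-((H p.1 p.2 r - H p.1 p.2 (v p)) * fderiv ℝ ψ p (1, 0) * (η z.1 * η z.2))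
          - ψ p * (deriv η z.1 * η z.2) *
            ((dX H p.1 p.2 r * z.1 + dT H p.1 p.2 r * z.2)
              - (dX H p.1 p.2 (v p) * z.1 + dT H p.1 p.2 (v p) * z.2))
          + ψ p * (η z.1 * η z.2) * (dX H p.1 p.2 (v p) - dX H p.1 p.2 r)))) := by
  have hid : Tendsto (fun h : ℝ => h) (𝓝[>] 0) (𝓝 0) := tendsto_id.mono_left nhdsWithin_le_nhds
  have hq : Tendsto (fun h : ℝ => p - h • z) (𝓝[>] 0) (𝓝 p) := by
    have : Tendsto (fun h : ℝ => p - h • z) (𝓝[>] 0) (𝓝 (p - (0 : ℝ) • z)) :=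
      tendsto_const_nhds.sub (hid.smul_const z)
    simpa using this
  have hvq : Tendsto (fun h : ℝ => v (p - h • z)) (𝓝[>] 0) (𝓝 (v p)) := hv.tendsto.comp hq
  have hr : Tendsto (fun h : ℝ => r - v (p - h • z)) (𝓝[>] 0) (𝓝 (r - v p)) :=
    tendsto_const_nhds.sub hvq
  refine (hr.abs.mul_const _).add (tendsto_sign_mul hr ?_ fun h0 => ?_)
  · have hHc : Continuous fun z : ℝ × ℝ × ℝ => H z.1 z.2.1 z.2.2 := hH.smooth.continuous
    have hXc : Continuous fun z : ℝ × ℝ × ℝ => dX H z.1 z.2.1 z.2.2 :=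
      continuous_unc_dX hH.contDiff_one
    have t1 : Tendsto (fun h : ℝ => H p.1 p.2 (v (p - h • z))) (𝓝[>] 0) (𝓝 (H p.1 p.2 (v p))) :=
      (hHc.tendsto (p.1, p.2, v p)).comp
        (tendsto_const_nhds.prodMk_nhds (tendsto_const_nhds.prodMk_nhds hvq))
    have t2 : Tendsto (fun h : ℝ => dX H p.1 p.2 (v (p - h • z))) (𝓝[>] 0)
        (𝓝 (dX H p.1 p.2 (v p))) :=
      (hXc.tendsto (p.1, p.2, v p)).comp
        (tendsto_const_nhds.prodMk_nhds (tendsto_const_nhds.prodMk_nhds hvq))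
    have t3 : Tendsto (fun h : ℝ => dX H (p - h • z).1 (p - h • z).2 r) (𝓝[>] 0)
        (𝓝 (dX H p.1 p.2 r)) :=
      (hXc.tendsto (p.1, p.2, r)).comp (((continuous_fst.tendsto _).comp hq).prodMk_nhds
        (((continuous_snd.tendsto _).comp hq).prodMk_nhds tendsto_const_nhds))
    have t4 := (tendsto_diff_quotient hH p z (tendsto_const_nhds (x := r))).sub
      (tendsto_diff_quotient hH p z hvq)
    simp only [← mul_sub] at t4
    unfold doubledFlux
    exact ((((tendsto_const_nhds.sub t1).mul_const _).mul_const _).neg.sub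
      (t4.const_mul _)).add ((t2.sub t3).const_mul _)
  · rw [← sub_eq_zero.1 h0]
    ring

/-- **Kruzhkov's inequality** for two entropy solutions, one of which is continuous almost
everywhere. -/
theorem kruzhkov_contraction (hH : IsHamiltonian H t₀ T PL PR)
    (hψ : IsTest aL aR t₀ T ψ) (hψ0 : ∀ z, 0 ≤ ψ z)
    {u v : ℝ × ℝ → ℝ} (hu : Measurable u) (hv : Measurable v)
    (hur : ∀ z, u z ∈ Icc PL PR) (hvr : ∀ z, v z ∈ Icc PL PR)
    (huK : SatisfiesKruzhkov H aL aR t₀ T PL PR u)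
    (hvK : SatisfiesKruzhkov H aL aR t₀ T PL PR v)
    (hvc : ∀ᵐ z ∂volume.restrict (Ioo aL aR ×ˢ Ioo t₀ T), ContinuousAt v z) :
    0 ≤ ∫ p, (|u p - v p| * fderiv ℝ ψ p (0, 1) - Real.sign (u p - v p)
      * (H p.1 p.2 (u p) - H p.1 p.2 (v p)) * fderiv ℝ ψ p (1, 0)) := by
  obtain ⟨η, hη⟩ := exists_isMollifier
  have hηc := hη.smooth.continuous
  have hη'c := hη.continuous_deriv
  obtain ⟨C, hC0, hC⟩ := exists_doubled_bound hH hη hψ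
  set K := tsupport ψ ×ˢ (Icc (-1 : ℝ) 1 ×ˢ Icc (-1 : ℝ) 1) with hK
  have hKc : IsCompact K := hψ.2.1.isCompact.prod (isCompact_Icc.prod isCompact_Icc)
  set Φ : ℝ → (ℝ × ℝ) × (ℝ × ℝ) → ℝ := fun h w =>
    |u w.1 - v (w.1 - h • w.2)| * (fderiv ℝ ψ w.1 (0, 1) * (η w.2.1 * η w.2.2))
      + Real.sign (u w.1 - v (w.1 - h • w.2))
        * doubledFlux H ψ η h w.1 w.2 (u w.1) (v (w.1 - h • w.2)) with hΦ
  have hHc : Measurable fun z : ℝ × ℝ × ℝ => H z.1 z.2.1 z.2.2 := hH.smooth.continuous.measurable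
  have hXc : Measurable fun z : ℝ × ℝ × ℝ => dX H z.1 z.2.1 z.2.2 :=
    (continuous_unc_dX hH.contDiff_one).measurable
  have hΦm : ∀ h, Measurable (Φ h) := by
    intro h
    have m1 : Measurable fun w : (ℝ × ℝ) × (ℝ × ℝ) => w.1 - h • w.2 := by fun_prop
    have m2 : Measurable fun w : (ℝ × ℝ) × (ℝ × ℝ) => v (w.1 - h • w.2) := hv.comp m1
    have m3 : Measurable fun w : (ℝ × ℝ) × (ℝ × ℝ) => u w.1 := hu.comp measurable_fst
    have m4 := hψ.1.continuous.measurable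
    have m5 : ∀ d, Measurable fun p => fderiv ℝ ψ p d := fun d =>
      ((hψ.1.continuous_fderiv (by simp)).clm_apply continuous_const).measurable
    have n : ∀ (G : ℝ → ℝ → ℝ → ℝ), (Measurable fun z : ℝ × ℝ × ℝ => G z.1 z.2.1 z.2.2) →
        ∀ (y : (ℝ × ℝ) × (ℝ × ℝ) → ℝ × ℝ) (s : (ℝ × ℝ) × (ℝ × ℝ) → ℝ), Measurable y →
          Measurable s → Measurable fun w => G (y w).1 (y w).2 (s w) := fun G hG y s hy hs =>
      hG.comp ((measurable_fst.comp hy).prodMk ((measurable_snd.comp hy).prodMk hs))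
    have g1 : Measurable fun w : (ℝ × ℝ) × (ℝ × ℝ) => η w.2.1 * η w.2.2 := by fun_prop
    have g2 : Measurable fun w : (ℝ × ℝ) × (ℝ × ℝ) => deriv η w.2.1 * η w.2.2 := by fun_prop
    have g3 : ∀ d, Measurable fun w : (ℝ × ℝ) × (ℝ × ℝ) => fderiv ℝ ψ w.1 d := fun d =>
      (m5 d).comp measurable_fst
    have g4 : Measurable fun w : (ℝ × ℝ) × (ℝ × ℝ) => ψ w.1 := m4.comp measurable_fst
    refine ((m3.sub m2).abs.mul ((g3 _).mul g1)).add
      ((measurable_sign.comp (m3.sub m2)).mul ?_)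
    exact (((((n _ hHc _ _ measurable_fst m3).sub (n _ hHc _ _ measurable_fst m2)).mul
      (g3 _)).mul g1).neg.sub ((g4.mul g2).mul ((((n _ hHc _ _ measurable_fst m3).sub
        (n _ hHc _ _ m1 m3)).sub ((n _ hHc _ _ measurable_fst m2).sub
          (n _ hHc _ _ m1 m2))).const_mul _))).add ((g4.mul g1).mul
            ((n _ hXc _ _ measurable_fst m2).sub (n _ hXc _ _ m1 m3)))
  have hdom : ∀ h ∈ Ioc (0 : ℝ) 1, ∀ w, ‖Φ h w‖ ≤ K.indicator (fun _ => C) w := by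
    intro h hh w
    by_cases hw : w ∈ K
    · rw [indicator_of_mem hw]
      exact hC h hh w.1 w.2 hw.2 _ (hur _) _ (hvr _)
    · rw [indicator_of_notMem hw]
      exact (congrArg norm (doubled_eq_zero hη hw _ _)).trans_le (by simp)
  have hdomi : Integrable (K.indicator fun _ => C) (volume : Measure ((ℝ × ℝ) × (ℝ × ℝ))) :=
    (integrable_indicator_iff hKc.measurableSet).2
      (integrableOn_const hKc.measure_lt_top.ne)
  have hev : ∀ᶠ h : ℝ in 𝓝[>] 0, h ∈ Ioc (0 : ℝ) 1 := Ioc_mem_nhdsGT one_pos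
  obtain ⟨δ, hδ0, hδ⟩ := hψ.2.1.isCompact.exists_cthickening_subset_open
    (isOpen_Ioo.prod isOpen_Ioo) hψ.2.2
  have hpos : ∀ᶠ h : ℝ in 𝓝[>] 0, 0 ≤ ∫ w, Φ h w := by
    filter_upwards [hev, Ioc_mem_nhdsGT hδ0] with h hh hh'
    have hi : Integrable (Φ h) := hdomi.mono' (hΦm h).aestronglyMeasurable
      (Eventually.of_forall (hdom h hh))
    rw [Measure.volume_eq_prod] at hi ⊢
    rw [integral_prod _ hi]
    exact doubled_nonneg hH hη hh.1 hψ hψ0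
      ((Metric.cthickening_mono hh'.2 _).trans hδ) hu hv hur hvr huK hvK
  set s : ℝ × ℝ → ℝ := fun p => Real.sign (u p - v p) with hs
  -- the coefficients of the three kinds of terms in the limit
  set a : ℝ × ℝ → ℝ := fun p => dX H p.1 p.2 (u p) - dX H p.1 p.2 (v p) with ha
  set b : ℝ × ℝ → ℝ := fun p => dT H p.1 p.2 (u p) - dT H p.1 p.2 (v p) with hb
  set g : ℝ × ℝ → ℝ := fun p => |u p - v p| * fderiv ℝ ψ p (0, 1) - Real.sign (u p - v p)
      * (H p.1 p.2 (u p) - H p.1 p.2 (v p)) * fderiv ℝ ψ p (1, 0) with hg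
  set Φ₀ : (ℝ × ℝ) × (ℝ × ℝ) → ℝ := fun w =>
    (g w.1 - ψ w.1 * s w.1 * a w.1) * (η w.2.1 * η w.2.2)
      - ψ w.1 * s w.1 * a w.1 * (w.2.1 * deriv η w.2.1 * η w.2.2)
      - ψ w.1 * s w.1 * b w.1 * (deriv η w.2.1 * (w.2.2 * η w.2.2)) with hΦ₀
  have hae : ∀ᵐ w : (ℝ × ℝ) × (ℝ × ℝ), w.1 ∈ tsupport ψ → ContinuousAt v w.1 := by
    have h1 : ∀ᵐ z : ℝ × ℝ, z ∈ tsupport ψ → ContinuousAt v z := by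
      filter_upwards [(ae_restrict_iff' (measurableSet_Ioo.prod measurableSet_Ioo)).1 hvc]
        with z hz hz'
      exact hz (hψ.2.2 hz')
    rw [Measure.volume_eq_prod]
    exact Measure.quasiMeasurePreserving_fst.ae h1
  have hlim : ∀ᵐ w : (ℝ × ℝ) × (ℝ × ℝ), Tendsto (fun h => Φ h w) (𝓝[>] 0) (𝓝 (Φ₀ w)) := by
    filter_upwards [hae] with w hw
    by_cases hw1 : w.1 ∈ tsupport ψ
    · have := tendsto_doubled (ψ := ψ) (η := η) hH (hw hw1) w.2 (u w.1)
      convert this using 2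
      simp only [hΦ₀, hg, hs, ha, hb]
      ring
    · have e1 : ψ w.1 = 0 := image_eq_zero_of_notMem_tsupport hw1
      have e2 : fderiv ℝ ψ w.1 = 0 := image_eq_zero_of_notMem_tsupport (f := fderiv ℝ ψ)
        fun h' => hw1 (tsupport_fderiv_subset ℝ h')
      have : Φ₀ w = 0 := by simp [hΦ₀, hg, e1, e2]
      rw [this]
      refine tendsto_const_nhds.congr fun h => ?_
      simp [hΦ, doubledFlux, e1, e2]
  have hT : Tendsto (fun h => ∫ w, Φ h w) (𝓝[>] 0) (𝓝 (∫ w, Φ₀ w)) :=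
    tendsto_integral_filter_of_dominated_convergence (K.indicator fun _ => C)
      (Eventually.of_forall fun h => (hΦm h).aestronglyMeasurable)
      (hev.mono fun h hh => Eventually.of_forall (hdom h hh)) hdomi hlim
  have h0 : 0 ≤ ∫ w, Φ₀ w := ge_of_tendsto hT hpos
  have hΦ₀i : Integrable Φ₀ := by
    refine hdomi.mono' (aestronglyMeasurable_of_tendsto_ae (𝓝[>] (0 : ℝ))
      (fun h => (hΦm h).aestronglyMeasurable) hlim) ?_
    filter_upwards [hlim] with w hw
    exact le_of_tendsto hw.norm (hev.mono fun h hh => hdom h hh w)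
  rw [Measure.volume_eq_prod] at h0 hΦ₀i
  rw [integral_prod _ hΦ₀i] at h0
  have hcs : HasCompactSupport η := HasCompactSupport.intro (isCompact_Icc (a := (-1 : ℝ)) (b := 1))
    fun x hx => hη.zero x (by
      by_contra h'
      exact hx (abs_le.1 (not_lt.1 h')))
  have i1 : Integrable η := hηc.integrable_of_hasCompactSupport hcs
  have i2 : Integrable (deriv η) := hη'c.integrable_of_hasCompactSupport hcs.deriv
  have i3 : Integrable fun x => x * η x :=
    (continuous_id.mul hηc).integrable_of_hasCompactSupport hcs.mul_left
  have i4 : Integrable fun x => x * deriv η x :=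
    (continuous_id.mul hη'c).integrable_of_hasCompactSupport hcs.deriv.mul_left
  have hinner : ∀ p, ∫ z, Φ₀ (p, z) = g p := by
    intro p
    have j1 : Integrable fun z : ℝ × ℝ => η z.1 * η z.2 := i1.mul_prod i1
    have j2 : Integrable fun z : ℝ × ℝ => z.1 * deriv η z.1 * η z.2 := i4.mul_prod i1
    have j3 : Integrable fun z : ℝ × ℝ => deriv η z.1 * (z.2 * η z.2) := i2.mul_prod i3
    have k1 : ∫ z : ℝ × ℝ, η z.1 * η z.2 = 1 := by
      rw [Measure.volume_eq_prod, integral_prod_mul, hη.integral, one_mul]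
    have k2 : ∫ z : ℝ × ℝ, z.1 * deriv η z.1 * η z.2 = -1 := by
      rw [Measure.volume_eq_prod, integral_prod_mul (fun x => x * deriv η x), hη.integral,
        hη.integral_mul_deriv, mul_one]
    have k3 : ∫ z : ℝ × ℝ, deriv η z.1 * (z.2 * η z.2) = 0 := by
      rw [Measure.volume_eq_prod, integral_prod_mul (deriv η) (fun x => x * η x),
        hη.integral_deriv, zero_mul]
    simp only [hΦ₀]
    have l1 := j1.const_mul (g p - ψ p * s p * a p)
    have l2 := j2.const_mul (ψ p * s p * a p)
    have l3 := j3.const_mul (ψ p * s p * b p)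
    have l12 : Integrable (fun z : ℝ × ℝ => (g p - ψ p * s p * a p) * (η z.1 * η z.2)
      - ψ p * s p * a p * (z.1 * deriv η z.1 * η z.2)) volume := l1.sub l2
    rw [integral_sub l12 l3, integral_sub l1 l2, integral_const_mul, integral_const_mul,
      integral_const_mul, k1, k2, k3]
    ring
  simp_rw [hinner] at h0
  exact h0

end DoublingLimit

/-! ### Cutoff functions and the `L¹` estimate -/

section Cutoff

theorem hasDerivAt_smoothTransition (x : ℝ) :
    HasDerivAt Real.smoothTransition (deriv Real.smoothTransition x) x :=
  ((Real.smoothTransition.contDiff (n := 1)).differentiable one_ne_zero x).hasDerivAt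

theorem continuous_deriv_smoothTransition : Continuous (deriv Real.smoothTransition) :=
  (Real.smoothTransition.contDiff (n := 1)).continuous_deriv le_rfl

theorem deriv_smoothTransition_nonneg (x : ℝ) : 0 ≤ deriv Real.smoothTransition x :=
  Real.smoothTransition.monotone.deriv_nonneg

theorem deriv_smoothTransition_eq_zero {x : ℝ} (hx : x ∉ Icc (0 : ℝ) 1) :
    deriv Real.smoothTransition x = 0 := by
  rcases lt_or_ge x 0 with h | h
  · have : Real.smoothTransition =ᶠ[𝓝 x] fun _ => 0 := by
      filter_upwards [gt_mem_nhds h] with y hy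
      exact Real.smoothTransition.zero_of_nonpos hy.le
    rw [this.deriv_eq, deriv_const]
  · have h1 : 1 < x := by
      by_contra h'
      exact hx ⟨h, not_lt.1 h'⟩
    have : Real.smoothTransition =ᶠ[𝓝 x] fun _ => 1 := by
      filter_upwards [lt_mem_nhds h1] with y hy
      exact Real.smoothTransition.one_of_one_le hy.le
    rw [this.deriv_eq, deriv_const]

theorem integrable_deriv_smoothTransition : Integrable (deriv Real.smoothTransition) :=
  continuous_deriv_smoothTransition.integrable_of_hasCompactSupport
    (HasCompactSupport.intro isCompact_Icc fun _ hx => deriv_smoothTransition_eq_zero hx)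

theorem integral_deriv_smoothTransition : ∫ x, deriv Real.smoothTransition x = 1 := by
  have h0 : Tendsto Real.smoothTransition atBot (𝓝 0) :=
    tendsto_const_nhds.congr' (by
      filter_upwards [eventually_le_atBot 0] with x hx
      exact (Real.smoothTransition.zero_of_nonpos hx).symm)
  have h1 : Tendsto Real.smoothTransition atTop (𝓝 1) :=
    tendsto_const_nhds.congr' (by
      filter_upwards [eventually_ge_atTop 1] with x hx
      exact (Real.smoothTransition.one_of_one_le hx).symm)
  rw [integral_of_hasDerivAt_of_tendsto hasDerivAt_smoothTransition
    integrable_deriv_smoothTransition h0 h1, sub_zero]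

/-- The derivatives of `τ ↦ S (k (τ - c) - 1)`, where `S` is the smooth transition, form an
approximation of the Dirac measure at `c`, from the right. -/
theorem tendsto_integral_mul_deriv_transition {F : ℕ → ℝ → ℝ} {c L C : ℝ}
    (hF : ∀ n, Measurable (F n)) (hC : ∀ n τ, |F n τ| ≤ C)
    (hlim : ∀ y ∈ Icc (0 : ℝ) 1,
      Tendsto (fun n : ℕ => F n (c + (y + 1) / (n + 1))) atTop (𝓝 L)) :
    Tendsto (fun n : ℕ => ∫ τ, F n τ *
      ((n + 1) * deriv Real.smoothTransition ((n + 1) * (τ - c) - 1))) atTop (𝓝 L) := by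
  have hsub : ∀ n : ℕ, ∫ τ, F n τ *
      ((n + 1) * deriv Real.smoothTransition ((n + 1) * (τ - c) - 1))
      = ∫ y, F n (c + (y + 1) / (n + 1)) * deriv Real.smoothTransition y := by
    intro n
    have hk : (0 : ℝ) < n + 1 := by positivity
    set g : ℝ → ℝ := fun τ => F n τ *
      ((n + 1) * deriv Real.smoothTransition ((n + 1) * (τ - c) - 1)) with hg
    have h1 : ∫ y, g ((y + (1 + c * (n + 1))) / (n + 1)) = (n + 1) * ∫ τ, g τ := by
      rw [integral_add_right_eq_self (fun y => g (y / ((n : ℝ) + 1))) (1 + c * (n + 1)),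
        Measure.integral_comp_div, abs_of_pos hk, smul_eq_mul]
    have h2 : ∀ y, g ((y + (1 + c * (n + 1))) / (n + 1))
        = (n + 1) * (F n (c + (y + 1) / (n + 1)) * deriv Real.smoothTransition y) := by
      intro y
      have e1 : (y + (1 + c * (n + 1))) / ((n : ℝ) + 1) = c + (y + 1) / (n + 1) := by
        field_simp
        ring
      have e2 : ((n : ℝ) + 1) * (c + (y + 1) / (n + 1) - c) - 1 = y := by
        field_simp
        ring
      simp only [hg, e1, e2]
      ring
    simp_rw [h2] at h1
    rw [integral_const_mul] at h1
    exact (mul_left_cancel₀ hk.ne' h1).symm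
  simp_rw [hsub]
  have hL : ∫ y, L * deriv Real.smoothTransition y = L := by
    rw [integral_const_mul, integral_deriv_smoothTransition, mul_one]
  have hC0 : 0 ≤ C := (abs_nonneg _).trans (hC 0 0)
  have key : Tendsto (fun n : ℕ => ∫ y, F n (c + (y + 1) / (n + 1))
      * deriv Real.smoothTransition y) atTop (𝓝 (∫ y, L * deriv Real.smoothTransition y)) := by
    refine tendsto_integral_of_dominated_convergence
      (fun y => C * deriv Real.smoothTransition y) (fun n => ?_)
      (integrable_deriv_smoothTransition.const_mul C) (fun n => Eventually.of_forall fun y => ?_)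
      (Eventually.of_forall fun y => ?_)
    · exact (((hF n).comp (by fun_prop)).mul
        continuous_deriv_smoothTransition.measurable).aestronglyMeasurable
    · rw [norm_mul, Real.norm_eq_abs, Real.norm_eq_abs,
        abs_of_nonneg (deriv_smoothTransition_nonneg y)]
      exact mul_le_mul_of_nonneg_right (hC n _) (deriv_smoothTransition_nonneg y)
    · by_cases hy : y ∈ Icc (0 : ℝ) 1
      · exact (hlim y hy).mul_const _
      · simp [deriv_smoothTransition_eq_zero hy]
  rwa [hL] at key

/-- The same, from the left. -/
theorem tendsto_integral_mul_deriv_transition_left {F : ℕ → ℝ → ℝ} {c L C : ℝ}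
    (hF : ∀ n, Measurable (F n)) (hC : ∀ n τ, |F n τ| ≤ C)
    (hlim : ∀ y ∈ Icc (0 : ℝ) 1,
      Tendsto (fun n : ℕ => F n (c - (y + 1) / (n + 1))) atTop (𝓝 L)) :
    Tendsto (fun n : ℕ => ∫ τ, F n τ *
      ((n + 1) * deriv Real.smoothTransition ((n + 1) * (c - τ) - 1))) atTop (𝓝 L) := by
  have h := tendsto_integral_mul_deriv_transition (F := fun n τ => F n (-τ)) (c := -c) (L := L)
    (fun n => (hF n).comp measurable_neg) (fun n τ => hC n _) (fun y hy => by
      refine (hlim y hy).congr fun n => ?_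
      congr 1
      ring)
  refine h.congr fun n => ?_
  rw [← integral_neg_eq_self (fun τ => F n τ *
    ((n + 1) * deriv Real.smoothTransition ((n + 1) * (c - τ) - 1)))]
  refine integral_congr_ae (Eventually.of_forall fun τ => ?_)
  simp only
  rw [show (c - -τ) = (τ - -c) by ring]

/-- A smooth cutoff of the interval `(a, c)`: it is `0` at distance `≤ 1 / k` from the complement
and `1` at distance `≥ 2 / k`. -/
noncomputable def cutoff (a c k x : ℝ) : ℝ :=
  Real.smoothTransition (k * (x - a) - 1) * Real.smoothTransition (k * (c - x) - 1)

variable {a c k x : ℝ}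

theorem contDiff_cutoff (a c k : ℝ) : ContDiff ℝ ∞ (cutoff a c k) :=
  ((Real.smoothTransition.contDiff (n := ⊤)).comp (by fun_prop)).mul
    ((Real.smoothTransition.contDiff (n := ⊤)).comp (by fun_prop))

theorem cutoff_nonneg (a c k x : ℝ) : 0 ≤ cutoff a c k x :=
  mul_nonneg (Real.smoothTransition.nonneg _) (Real.smoothTransition.nonneg _)

theorem cutoff_le_one (a c k x : ℝ) : cutoff a c k x ≤ 1 :=
  mul_le_one₀ (Real.smoothTransition.le_one _) (Real.smoothTransition.nonneg _)
    (Real.smoothTransition.le_one _)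

theorem cutoff_eq_zero (hk : 0 < k) (hx : x ∉ Icc (a + 1 / k) (c - 1 / k)) :
    cutoff a c k x = 0 := by
  rw [mem_Icc, not_and_or, not_le, not_le] at hx
  unfold cutoff
  rcases hx with h | h
  · rw [Real.smoothTransition.zero_of_nonpos, zero_mul]
    have : k * (x - a) < k * (1 / k) := mul_lt_mul_of_pos_left (by linarith) hk
    rw [mul_one_div_cancel hk.ne'] at this
    linarith
  · rw [Real.smoothTransition.zero_of_nonpos (x := k * (c - x) - 1), mul_zero]
    have : k * (c - x) < k * (1 / k) := mul_lt_mul_of_pos_left (by linarith) hk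
    rw [mul_one_div_cancel hk.ne'] at this
    linarith

theorem tsupport_cutoff_subset (hk : 0 < k) :
    tsupport (cutoff a c k) ⊆ Icc (a + 1 / k) (c - 1 / k) :=
  closure_minimal (fun x hx => by
    by_contra h
    exact hx (cutoff_eq_zero hk h)) isClosed_Icc

theorem Icc_subset_Ioo_cutoff (hk : 0 < k) : Icc (a + 1 / k) (c - 1 / k) ⊆ Ioo a c := by
  have : 0 < 1 / k := by positivity
  exact fun x hx => ⟨by linarith [hx.1], by linarith [hx.2]⟩

theorem hasDerivAt_cutoff (a c k x : ℝ) : HasDerivAt (cutoff a c k)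
    (Real.smoothTransition (k * (c - x) - 1) *
        (k * deriv Real.smoothTransition (k * (x - a) - 1))
      - Real.smoothTransition (k * (x - a) - 1) *
        (k * deriv Real.smoothTransition (k * (c - x) - 1))) x := by
  have h1 : HasDerivAt (fun x => k * (x - a) - 1) k x := by
    simpa using (((hasDerivAt_id x).sub_const a).const_mul k).sub_const 1
  have h2 : HasDerivAt (fun x => k * (c - x) - 1) (-k) x := by
    simpa using (((hasDerivAt_id x).const_sub c).const_mul k).sub_const 1
  have h3 := (hasDerivAt_smoothTransition (k * (x - a) - 1)).comp x h1
  have h4 := (hasDerivAt_smoothTransition (k * (c - x) - 1)).comp x h2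
  exact (h3.mul h4).congr_deriv (by simp only [Function.comp]; ring)

theorem tendsto_mul_natCast_atTop {y : ℝ} (hy : 0 < y) (C : ℝ) :
    ∀ᶠ n : ℕ in atTop, C ≤ ((n : ℝ) + 1) * y := by
  have h : Tendsto (fun n : ℕ => ((n : ℝ) + 1) * y) atTop atTop :=
    (tendsto_atTop_add_const_right _ 1 tendsto_natCast_atTop_atTop).atTop_mul_const hy
  exact h.eventually_ge_atTop C

theorem tendsto_cutoff (a c x : ℝ) : Tendsto (fun n : ℕ => cutoff a c (n + 1) x) atTop
    (𝓝 ((Ioo a c).indicator (fun _ => 1) x)) := by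
  by_cases hx : x ∈ Ioo a c
  · rw [indicator_of_mem hx]
    refine tendsto_const_nhds.congr' ?_
    filter_upwards [tendsto_mul_natCast_atTop (sub_pos.2 hx.1) 2,
      tendsto_mul_natCast_atTop (sub_pos.2 hx.2) 2] with n h1 h2
    rw [cutoff, Real.smoothTransition.one_of_one_le (by linarith),
      Real.smoothTransition.one_of_one_le (by linarith), mul_one]
  · rw [indicator_of_notMem hx]
    refine tendsto_const_nhds.congr fun n => ?_
    have hk : (0 : ℝ) < n + 1 := by positivity
    rw [cutoff_eq_zero hk fun h => hx (Icc_subset_Ioo_cutoff hk h)]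

end Cutoff

section Contraction

variable {H : ℝ → ℝ → ℝ → ℝ} {aL aR t₀ T PL PR : ℝ} {u v : ℝ × ℝ → ℝ}

/-- The conclusion of the doubling of variables. -/
def SatisfiesContraction (H : ℝ → ℝ → ℝ → ℝ) (aL aR t₀ T : ℝ) (u v : ℝ × ℝ → ℝ) : Prop :=
  ∀ ψ : ℝ × ℝ → ℝ, IsTest aL aR t₀ T ψ → (∀ z, 0 ≤ ψ z) →
    0 ≤ ∫ p : ℝ × ℝ, (|u p - v p| * fderiv ℝ ψ p (0, 1) - Real.sign (u p - v p)
      * (H p.1 p.2 (u p) - H p.1 p.2 (v p)) * fderiv ℝ ψ p (1, 0))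

theorem fderiv_prod_mul {χ θ : ℝ → ℝ} {p : ℝ × ℝ} {χ' θ' : ℝ} (hχ : HasDerivAt χ χ' p.1)
    (hθ : HasDerivAt θ θ' p.2) (d : ℝ × ℝ) :
    fderiv ℝ (fun p : ℝ × ℝ => χ p.1 * θ p.2) p d = χ' * d.1 * θ p.2 + χ p.1 * (θ' * d.2) := by
  have h1 := hχ.comp_hasFDerivAt p (hasFDerivAt_fst (𝕜 := ℝ) (E := ℝ) (F := ℝ) (p := p))
  have h2 := hθ.comp_hasFDerivAt p (hasFDerivAt_snd (𝕜 := ℝ) (E := ℝ) (F := ℝ) (p := p))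
  have h3 : fderiv ℝ (fun p : ℝ × ℝ => χ p.1 * θ p.2) p = _ := (h1.mul h2).fderiv
  rw [h3]
  simp
  ring

theorem sign_mul_flux_eq_abs (hH : IsHamiltonian H t₀ T PL PR) {x t r r' : ℝ}
    (ht : t ∈ Icc t₀ T) (hr : r ∈ Icc PL PR) (hr' : r' ∈ Icc PL PR) :
    Real.sign (r - r') * (H x t r - H x t r') = |H x t r - H x t r'| := by
  rcases lt_trichotomy r r' with h | h | h
  · rw [Real.sign_of_neg (by linarith), abs_of_nonpos (by linarith [hH.mono x t ht hr hr' h.le])]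
    ring
  · simp [h]
  · rw [Real.sign_of_pos (by linarith), abs_of_nonneg (by linarith [hH.mono x t ht hr' hr h.le])]
    ring

/-- Space cutoffs in the contraction inequality: the flux at `a₋` has a good sign, because `H` is
increasing, so that only the flux at `a₊` remains. -/
theorem contraction_time (hH : IsHamiltonian H t₀ T PL PR) (ha : aL < aR)
    (hu : Measurable u) (hv : Measurable v)
    (hur : ∀ z, u z ∈ Icc PL PR) (hvr : ∀ z, v z ∈ Icc PL PR)
    (hout : ∀ z ∉ Ioo aL aR ×ˢ Ioo t₀ T, u z = v z)
    (hc : SatisfiesContraction H aL aR t₀ T u v) {G : ℝ → ℝ}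
    (hG : ∀ᵐ τ, τ ∈ Ioo t₀ T → Tendsto (fun x => |H x τ (u (x, τ)) - H x τ (v (x, τ))|)
      (𝓝[<] aR) (𝓝 (G τ))) :
    IntegrableOn G (Ioo t₀ T) ∧ ∀ θ : ℝ → ℝ, ContDiff ℝ ∞ θ → HasCompactSupport θ →
      tsupport θ ⊆ Ioo t₀ T → (∀ τ, 0 ≤ θ τ) →
      0 ≤ (∫ τ, deriv θ τ * ∫ x, |u (x, τ) - v (x, τ)|) + ∫ τ, θ τ * G τ := by
  have hHc : Continuous fun z : ℝ × ℝ × ℝ => H z.1 z.2.1 z.2.2 := hH.smooth.continuous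
  obtain ⟨D, hD0, hD⟩ := exists_box_bound hHc aL aR t₀ T PL PR
  set g : ℝ × ℝ → ℝ := fun p => |H p.1 p.2 (u p) - H p.1 p.2 (v p)| with hg
  have hgm : Measurable g := by
    have h1 : Measurable fun p : ℝ × ℝ => H p.1 p.2 (u p) :=
      hHc.measurable.comp (measurable_fst.prodMk (measurable_snd.prodMk hu))
    have h2 : Measurable fun p : ℝ × ℝ => H p.1 p.2 (v p) :=
      hHc.measurable.comp (measurable_fst.prodMk (measurable_snd.prodMk hv))
    exact (h1.sub h2).abs
  have hgb : ∀ p, |g p| ≤ 2 * D := by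
    intro p
    simp only [hg, abs_abs]
    by_cases hp : p ∈ Ioo aL aR ×ˢ Ioo t₀ T
    · have hx := Ioo_subset_Icc_self hp.1
      have ht := Ioo_subset_Icc_self hp.2
      exact (abs_sub _ _).trans (by
        linarith [hD p.1 hx p.2 ht (u p) (hur p), hD p.1 hx p.2 ht (v p) (hvr p)])
    · rw [hout p hp, sub_self, abs_zero]
      linarith
  have hgs : ∀ τ, Measurable fun x => g (x, τ) := fun τ => hgm.comp (by fun_prop)
  -- the inner integral of the flux term
  set I : ℕ → ℝ → ℝ := fun n τ => ∫ x, g (x, τ) *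
    Real.smoothTransition ((n + 1) * (x - aL) - 1) *
      ((n + 1) * deriv Real.smoothTransition ((n + 1) * (aR - x) - 1)) with hI
  have hSm : Measurable Real.smoothTransition := Real.smoothTransition.continuous.measurable
  have hSm' := continuous_deriv_smoothTransition.measurable
  have hIlim : ∀ᵐ τ, τ ∈ Ioo t₀ T → Tendsto (fun n => I n τ) atTop (𝓝 (G τ)) := by
    filter_upwards [hG] with τ hτ hτ'
    refine tendsto_integral_mul_deriv_transition_left (F := fun n x => g (x, τ) *
      Real.smoothTransition ((n + 1) * (x - aL) - 1)) (C := 2 * D)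
      (fun n => (hgs τ).mul (hSm.comp (by fun_prop))) (fun n x => ?_) (fun y hy => ?_)
    · rw [abs_mul, abs_of_nonneg (Real.smoothTransition.nonneg _)]
      exact (mul_le_of_le_one_right (abs_nonneg _) (Real.smoothTransition.le_one _)).trans (hgb _)
    · have hy1 : 0 < y + 1 := by linarith [hy.1]
      have hx0 : Tendsto (fun n : ℕ => aR - (y + 1) / ((n : ℝ) + 1)) atTop (𝓝 aR) := by
        have := (tendsto_one_div_add_atTop_nhds_zero_nat (𝕜 := ℝ)).const_mul (y + 1)
        have := this.const_sub aR
        simpa [div_eq_mul_inv] using this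
      have hx1 : Tendsto (fun n : ℕ => aR - (y + 1) / ((n : ℝ) + 1)) atTop (𝓝[<] aR) :=
        tendsto_nhdsWithin_iff.2 ⟨hx0, Eventually.of_forall fun n => by
          have : 0 < (y + 1) / ((n : ℝ) + 1) := by positivity
          simp only [mem_Iio]
          linarith⟩
      have h1 := (hτ hτ').comp hx1
      have h2 : Tendsto (fun n : ℕ => Real.smoothTransition
          ((n + 1) * (aR - (y + 1) / ((n : ℝ) + 1) - aL) - 1)) atTop (𝓝 1) := by
        refine tendsto_const_nhds.congr' ?_
        filter_upwards [tendsto_mul_natCast_atTop (sub_pos.2 ha) 4] with n hn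
        rw [Real.smoothTransition.one_of_one_le]
        have hk : (0 : ℝ) < n + 1 := by positivity
        have e : ((n : ℝ) + 1) * (aR - (y + 1) / ((n : ℝ) + 1) - aL)
            = (n + 1) * (aR - aL) - (y + 1) := by
          field_simp
          ring
        rw [e]
        linarith [hy.2]
      simpa using h1.mul h2
  have hprodm : ∀ n : ℕ, Measurable fun p : ℝ × ℝ => g p *
      Real.smoothTransition ((n + 1) * (p.1 - aL) - 1) *
      ((n + 1) * deriv Real.smoothTransition ((n + 1) * (aR - p.1) - 1)) := fun n =>
    (hgm.mul (hSm.comp (by fun_prop))).mul ((hSm'.comp (by fun_prop)).const_mul _)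
  have hIm : ∀ n, Measurable (I n) := by
    intro n
    have : StronglyMeasurable fun τ => ∫ x, (fun p : ℝ × ℝ => g p *
      Real.smoothTransition ((n + 1) * (p.1 - aL) - 1) *
      ((n + 1) * deriv Real.smoothTransition ((n + 1) * (aR - p.1) - 1))) (x, τ) :=
      (hprodm n).stronglyMeasurable.integral_prod_left'
    exact this.measurable
  have hSint : ∀ n : ℕ, Integrable (fun x : ℝ => ((n : ℝ) + 1) *
      deriv Real.smoothTransition ((n + 1) * (aR - x) - 1)) ∧
      ∫ x : ℝ, ((n : ℝ) + 1) * deriv Real.smoothTransition ((n + 1) * (aR - x) - 1) = 1 := by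
    intro n
    have hk : (0 : ℝ) < n + 1 := by positivity
    have hder : ∀ x : ℝ, HasDerivAt (fun x : ℝ => -Real.smoothTransition ((n + 1) * (aR - x) - 1))
        (((n : ℝ) + 1) * deriv Real.smoothTransition ((n + 1) * (aR - x) - 1)) x := by
      intro x
      have h2 : HasDerivAt (fun x => ((n : ℝ) + 1) * (aR - x) - 1) (-((n : ℝ) + 1)) x := by
        simpa using (((hasDerivAt_id x).const_sub aR).const_mul ((n : ℝ) + 1)).sub_const 1
      exact ((hasDerivAt_smoothTransition _).comp x h2).neg.congr_deriv (by ring)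
    have hint : Integrable (fun x : ℝ => ((n : ℝ) + 1) *
        deriv Real.smoothTransition ((n + 1) * (aR - x) - 1)) := by
      refine Continuous.integrable_of_hasCompactSupport ?_ ?_
      · have := continuous_deriv_smoothTransition
        fun_prop
      · refine HasCompactSupport.intro (isCompact_Icc (a := aR - 2 / (n + 1))
          (b := aR - 1 / (n + 1))) fun x hx => ?_
        rw [deriv_smoothTransition_eq_zero, mul_zero]
        rintro ⟨h1, h2⟩
        refine hx ⟨?_, ?_⟩
        · rw [sub_le_comm, le_div_iff₀ hk]; linarith
        · rw [le_sub_comm, div_le_iff₀ hk]; linarith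
    refine ⟨hint, ?_⟩
    have h0 : Tendsto (fun x : ℝ => -Real.smoothTransition (((n : ℝ) + 1) * (aR - x) - 1)) atBot
        (𝓝 (-1)) := by
      refine tendsto_const_nhds.congr' ?_
      filter_upwards [eventually_le_atBot (aR - 2 / (n + 1))] with x hx
      rw [Real.smoothTransition.one_of_one_le]
      rw [le_sub_comm, div_le_iff₀ hk] at hx
      linarith
    have h1 : Tendsto (fun x : ℝ => -Real.smoothTransition (((n : ℝ) + 1) * (aR - x) - 1)) atTop
        (𝓝 0) := by
      refine tendsto_const_nhds.congr' ?_
      filter_upwards [eventually_ge_atTop aR] with x hx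
      rw [Real.smoothTransition.zero_of_nonpos, neg_zero]
      nlinarith
    rw [integral_of_hasDerivAt_of_tendsto hder hint h0 h1]
    ring
  have hdomx : ∀ (n : ℕ) (p : ℝ × ℝ), ‖g p * Real.smoothTransition ((n + 1) * (p.1 - aL) - 1) *
      ((n + 1) * deriv Real.smoothTransition ((n + 1) * (aR - p.1) - 1))‖
      ≤ 2 * D * ((n + 1) * deriv Real.smoothTransition ((n + 1) * (aR - p.1) - 1)) := by
    intro n p
    have h0 : 0 ≤ ((n : ℝ) + 1) * deriv Real.smoothTransition ((n + 1) * (aR - p.1) - 1) :=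
      mul_nonneg (by positivity) (deriv_smoothTransition_nonneg _)
    rw [norm_mul, Real.norm_eq_abs, Real.norm_eq_abs, abs_of_nonneg h0, abs_mul,
      abs_of_nonneg (Real.smoothTransition.nonneg _)]
    exact mul_le_mul_of_nonneg_right ((mul_le_of_le_one_right (abs_nonneg _)
      (Real.smoothTransition.le_one _)).trans (hgb _)) h0
  have hIb : ∀ n τ, |I n τ| ≤ 2 * D := by
    intro n τ
    refine (norm_integral_le_of_norm_le ((hSint n).1.const_mul (2 * D))
      (Eventually.of_forall fun x => hdomx n (x, τ))).trans_eq ?_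
    rw [integral_const_mul, (hSint n).2, mul_one]
  have hGi : IntegrableOn G (Ioo t₀ T) := by
    refine integrableOn_of_abs_le (C := 2 * D) (by simp) (aestronglyMeasurable_of_tendsto_ae atTop
      (fun n => (hIm n).aestronglyMeasurable) ((ae_restrict_iff' measurableSet_Ioo).2 hIlim)) ?_
    rw [ae_restrict_iff' measurableSet_Ioo]
    filter_upwards [hIlim] with τ hτ hτ'
    exact le_of_tendsto (hτ hτ').norm (Eventually.of_forall fun n => hIb n τ)
  refine ⟨hGi, fun θ hθ hθc hθs hθ0 => ?_⟩
  have hθd : ∀ τ, HasDerivAt θ (deriv θ τ) τ := fun τ =>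
    (hθ.differentiable (by simp) τ).hasDerivAt
  have hθ'c : Continuous (deriv θ) := hθ.continuous_deriv (by simp)
  have hθz : ∀ τ ∉ Ioo t₀ T, θ τ = 0 := fun τ hτ =>
    image_eq_zero_of_notMem_tsupport fun h => hτ (hθs h)
  have hθi : Integrable θ := hθ.continuous.integrable_of_hasCompactSupport hθc
  have hθ'i : Integrable (deriv θ) := hθ'c.integrable_of_hasCompactSupport hθc.deriv
  have huv : ∀ p, |u p - v p| ≤ |PR - PL| := fun p => by
    rw [abs_le]
    have := le_abs_self (PR - PL)
    constructor <;> linarith [(hur p).1, (hur p).2, (hvr p).1, (hvr p).2]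
  -- the term with the time derivative: the space cutoffs increase to the indicator of `(a₋, a₊)`
  set A : ℕ → ℝ × ℝ → ℝ := fun n p => |u p - v p| * (cutoff aL aR (n + 1) p.1 * deriv θ p.2)
    with hA
  set bd : ℝ × ℝ → ℝ := fun p => |PR - PL| * ((Icc aL aR).indicator (fun _ => (1 : ℝ)) p.1
    * |deriv θ p.2|) with hbd
  have hind : Integrable ((Icc aL aR).indicator (fun _ => (1 : ℝ))) :=
    (integrable_indicator_iff measurableSet_Icc).2 (integrableOn_const (by simp))
  have hbdi : Integrable bd := (hind.mul_prod hθ'i.abs).const_mul _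
  have hAm : ∀ n, Measurable (A n) := fun n => (hu.sub hv).abs.mul
    (((contDiff_cutoff aL aR (n + 1)).continuous.measurable.comp measurable_fst).mul
      (hθ'c.measurable.comp measurable_snd))
  have hAb : ∀ n p, ‖A n p‖ ≤ bd p := by
    intro n p
    rw [Real.norm_eq_abs, hA, hbd]
    simp only [abs_mul, abs_abs]
    have h1 : |cutoff aL aR (n + 1) p.1| ≤ (Icc aL aR).indicator (fun _ => (1 : ℝ)) p.1 := by
      by_cases hp : p.1 ∈ Icc aL aR
      · rw [indicator_of_mem hp, abs_of_nonneg (cutoff_nonneg _ _ _ _)]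
        exact cutoff_le_one _ _ _ _
      · have hk : (0 : ℝ) < n + 1 := by positivity
        rw [indicator_of_notMem hp, cutoff_eq_zero hk fun h =>
          hp (Ioo_subset_Icc_self (Icc_subset_Ioo_cutoff hk h)), abs_zero]
    exact mul_le_mul (huv p) (mul_le_mul_of_nonneg_right h1 (abs_nonneg _)) (by positivity)
      (abs_nonneg _)
  have hAi : ∀ n, Integrable (A n) := fun n => hbdi.mono' (hAm n).aestronglyMeasurable
    (Eventually.of_forall (hAb n))
  have hAlim : Tendsto (fun n => ∫ p, A n p) atTop
      (𝓝 (∫ τ, deriv θ τ * ∫ x, |u (x, τ) - v (x, τ)|)) := by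
    have hlim0 : ∀ p, Tendsto (fun n => A n p) atTop (𝓝 (|u p - v p| * deriv θ p.2)) := by
      intro p
      have h := ((tendsto_cutoff aL aR p.1).mul_const (deriv θ p.2)).const_mul |u p - v p|
      convert h using 2
      by_cases hp : p.1 ∈ Ioo aL aR
      · rw [indicator_of_mem hp, one_mul]
      · rw [hout p fun h => hp h.1]
        simp
    have h1 := tendsto_integral_of_dominated_convergence bd
      (fun n => (hAm n).aestronglyMeasurable) hbdi (fun n => Eventually.of_forall (hAb n))
      (Eventually.of_forall hlim0)
    have hi0 : Integrable (fun p : ℝ × ℝ => |u p - v p| * deriv θ p.2)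
        (volume.prod volume) := by
      rw [← Measure.volume_eq_prod]
      refine hbdi.mono' ((hu.sub hv).abs.mul
        (hθ'c.measurable.comp measurable_snd)).aestronglyMeasurable (Eventually.of_forall fun p =>
          le_of_tendsto (hlim0 p).norm (Eventually.of_forall fun n => hAb n p))
    have h2 : ∫ p : ℝ × ℝ, |u p - v p| * deriv θ p.2
        = ∫ τ, deriv θ τ * ∫ x, |u (x, τ) - v (x, τ)| := by
      rw [Measure.volume_eq_prod, integral_prod_symm _ hi0]
      refine integral_congr_ae (Eventually.of_forall fun τ => ?_)
      change ∫ x, |u (x, τ) - v (x, τ)| * deriv θ τ = deriv θ τ * ∫ x, |u (x, τ) - v (x, τ)|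
      rw [integral_mul_const, mul_comm]
    rwa [h2] at h1
  -- the flux through the right end, where the derivative of the cutoff concentrates
  set B : ℕ → ℝ × ℝ → ℝ := fun n p => θ p.2 * (g p *
    Real.smoothTransition ((n + 1) * (p.1 - aL) - 1) *
      ((n + 1) * deriv Real.smoothTransition ((n + 1) * (aR - p.1) - 1))) with hB
  have hBi : ∀ n, Integrable (B n) := by
    intro n
    refine ((((hSint n).1.const_mul (2 * D)).mul_prod hθi.abs)).mono'
      ((hθ.continuous.measurable.comp measurable_snd).mul (hprodm n)).aestronglyMeasurable
      (Eventually.of_forall fun p => ?_)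
    rw [norm_mul, Real.norm_eq_abs (θ p.2), mul_comm]
    exact mul_le_mul_of_nonneg_right (hdomx n p) (abs_nonneg _)
  have hBlim : Tendsto (fun n => ∫ p, B n p) atTop (𝓝 (∫ τ, θ τ * G τ)) := by
    have e : ∀ n, ∫ p, B n p = ∫ τ, θ τ * I n τ := by
      intro n
      have := hBi n
      rw [Measure.volume_eq_prod] at this ⊢
      rw [integral_prod_symm _ this]
      refine integral_congr_ae (Eventually.of_forall fun τ => ?_)
      simp only [hB, hI]
      rw [integral_const_mul]
    simp_rw [e]
    refine tendsto_integral_of_dominated_convergence (fun τ => |θ τ| * (2 * D))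
      (fun n => (hθ.continuous.measurable.mul (hIm n)).aestronglyMeasurable)
      (hθi.abs.mul_const _) (fun n => Eventually.of_forall fun τ => ?_) ?_
    · rw [norm_mul]
      exact mul_le_mul_of_nonneg_left (hIb n τ) (abs_nonneg _)
    · filter_upwards [hIlim] with τ hτ
      by_cases h : τ ∈ Ioo t₀ T
      · exact (hτ h).const_mul _
      · simp [hθz τ h]
  refine ge_of_tendsto' (hAlim.add hBlim) fun n => ?_
  have hk : (0 : ℝ) < n + 1 := by positivity
  have hχ := contDiff_cutoff aL aR (n + 1)
  have hsupp : Function.support (fun p : ℝ × ℝ => cutoff aL aR (n + 1) p.1 * θ p.2)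
      ⊆ Icc (aL + 1 / (n + 1)) (aR - 1 / (n + 1)) ×ˢ tsupport θ := by
    intro p hp
    constructor
    · by_contra h
      exact hp (by simp only [cutoff_eq_zero hk h, zero_mul])
    · exact subset_tsupport _ (right_ne_zero_of_mul hp)
  have hcomp := (isCompact_Icc (a := aL + 1 / ((n : ℝ) + 1)) (b := aR - 1 / (n + 1))).prod
    hθc.isCompact
  have htest : IsTest aL aR t₀ T (fun p : ℝ × ℝ => cutoff aL aR (n + 1) p.1 * θ p.2) := by
    refine ⟨(hχ.comp contDiff_fst).mul (hθ.comp contDiff_snd), ?_, ?_⟩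
    · exact HasCompactSupport.intro' hcomp hcomp.isClosed fun p hp => by
        by_contra h
        exact hp (hsupp h)
    · exact (closure_minimal hsupp hcomp.isClosed).trans
        (prod_mono (Icc_subset_Ioo_cutoff hk) hθs)
  have hpos := hc _ htest fun p => mul_nonneg (cutoff_nonneg _ _ _ _) (hθ0 _)
  rw [← integral_add (hAi n) (hBi n)]
  -- the flux through the left end, which has a sign
  set E : ℝ × ℝ → ℝ := fun p => θ p.2 * (g p *
    Real.smoothTransition ((n + 1) * (aR - p.1) - 1) *
      ((n + 1) * deriv Real.smoothTransition ((n + 1) * (p.1 - aL) - 1))) with hE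
  have hE0 : ∀ p, 0 ≤ E p := fun p => mul_nonneg (hθ0 _) (mul_nonneg (mul_nonneg (abs_nonneg _)
    (Real.smoothTransition.nonneg _)) (mul_nonneg hk.le (deriv_smoothTransition_nonneg _)))
  have hEi : Integrable E := by
    have h1 : Integrable fun x : ℝ =>
        deriv Real.smoothTransition (((n : ℝ) + 1) * x - ((n + 1) * aL + 1)) :=
      (integrable_deriv_smoothTransition.comp_sub_right (((n : ℝ) + 1) * aL + 1)).comp_mul_left'
        hk.ne'
    refine (((h1.const_mul (2 * D * (n + 1))).mul_prod hθi)).mono' ?_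
      (Eventually.of_forall fun p => ?_)
    · exact ((hθ.continuous.measurable.comp measurable_snd).mul
        ((hgm.mul (hSm.comp (by fun_prop))).mul
          ((hSm'.comp (by fun_prop)).const_mul _))).aestronglyMeasurable
    · rw [Real.norm_eq_abs, abs_of_nonneg (hE0 p), hE]
      simp only
      rw [show ((n : ℝ) + 1) * (p.1 - aL) - 1 = (n + 1) * p.1 - ((n + 1) * aL + 1) by ring,
        mul_comm (θ p.2)]
      refine mul_le_mul_of_nonneg_right ?_ (hθ0 _)
      rw [mul_assoc (2 * D)]
      refine mul_le_mul_of_nonneg_right ?_ (mul_nonneg hk.le (deriv_smoothTransition_nonneg _))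
      exact (mul_le_of_le_one_right (abs_nonneg _) (Real.smoothTransition.le_one _)).trans
        ((le_abs_self _).trans (hgb p))
  have hpt : ∀ p : ℝ × ℝ, |u p - v p| * fderiv ℝ (fun p : ℝ × ℝ =>
        cutoff aL aR (n + 1) p.1 * θ p.2) p (0, 1) - Real.sign (u p - v p)
      * (H p.1 p.2 (u p) - H p.1 p.2 (v p)) * fderiv ℝ (fun p : ℝ × ℝ =>
        cutoff aL aR (n + 1) p.1 * θ p.2) p (1, 0) = A n p + B n p - E p := by
    intro p
    rw [fderiv_prod_mul (hasDerivAt_cutoff _ _ _ _) (hθd _),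
      fderiv_prod_mul (hasDerivAt_cutoff _ _ _ _) (hθd _)]
    simp only [hA, hB, hE, hg]
    by_cases hp : p.2 ∈ Ioo t₀ T
    · rw [sign_mul_flux_eq_abs hH (Ioo_subset_Icc_self hp) (hur p) (hvr p)]
      ring
    · rw [hθz _ hp]
      ring
  refine hpos.trans ((integral_congr_ae (Eventually.of_forall hpt)).le.trans ?_)
  refine integral_mono (((hAi n).add (hBi n)).sub hEi) ((hAi n).add (hBi n)) fun p => ?_
  exact sub_le_self _ (hE0 p)

/-- Time cutoffs: the `L¹` distance at time `t` is at most that at time `s` plus the flux through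
`a₊`. -/
theorem contraction_of_limits (hH : IsHamiltonian H t₀ T PL PR) (ha : aL < aR)
    (hu : Measurable u) (hv : Measurable v)
    (hur : ∀ z, u z ∈ Icc PL PR) (hvr : ∀ z, v z ∈ Icc PL PR)
    (hout : ∀ z ∉ Ioo aL aR ×ˢ Ioo t₀ T, u z = v z)
    (hc : SatisfiesContraction H aL aR t₀ T u v) {G : ℝ → ℝ} (hG0 : ∀ τ, 0 ≤ G τ)
    (hG : ∀ᵐ τ, τ ∈ Ioo t₀ T → Tendsto (fun x => |H x τ (u (x, τ)) - H x τ (v (x, τ))|)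
      (𝓝[<] aR) (𝓝 (G τ))) {s t es et : ℝ} (hs : t₀ ≤ s) (hst : s < t) (ht : t < T)
    (hes : Tendsto (fun τ => ∫ x, |u (x, τ) - v (x, τ)|) (𝓝[>] s) (𝓝 es))
    (het : Tendsto (fun τ => ∫ x, |u (x, τ) - v (x, τ)|) (𝓝[<] t) (𝓝 et)) :
    et ≤ es + ∫ τ in s..t, G τ := by
  obtain ⟨hGi, hmain⟩ := contraction_time hH ha hu hv hur hvr hout hc hG
  set E : ℝ → ℝ := fun τ => ∫ x, |u (x, τ) - v (x, τ)| with hE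
  have hEm : Measurable E := by
    have : StronglyMeasurable fun τ => ∫ x, (fun p : ℝ × ℝ => |u p - v p|) (x, τ) :=
      (hu.sub hv).abs.stronglyMeasurable.integral_prod_left'
    exact this.measurable
  have hEb : ∀ τ, |E τ| ≤ |PR - PL| * (aR - aL) := by
    intro τ
    have h1 : ∀ x, |u (x, τ) - v (x, τ)| ≤ (Icc aL aR).indicator (fun _ => |PR - PL|) x := by
      intro x
      by_cases hx : x ∈ Icc aL aR
      · rw [indicator_of_mem hx, abs_le]
        have := le_abs_self (PR - PL)
        constructor <;> linarith [(hur (x, τ)).1, (hur (x, τ)).2, (hvr (x, τ)).1, (hvr (x, τ)).2]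
      · rw [indicator_of_notMem hx, hout (x, τ) fun h => hx (Ioo_subset_Icc_self h.1)]
        simp
    have h2 : Integrable ((Icc aL aR).indicator fun _ => |PR - PL|) :=
      (integrable_indicator_iff measurableSet_Icc).2 (integrableOn_const (by simp))
    change ‖∫ x, |u (x, τ) - v (x, τ)|‖ ≤ _
    refine (norm_integral_le_of_norm_le h2 (Eventually.of_forall fun x => ?_)).trans_eq ?_
    · rw [Real.norm_eq_abs, abs_abs]
      exact h1 x
    · rw [integral_indicator measurableSet_Icc]
      simp [ha.le, mul_comm]
  have hsub : Ioo s t ⊆ Ioo t₀ T := Ioo_subset_Ioo hs ht.le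
  have hGst : IntegrableOn G (Ioo s t) := hGi.mono_set hsub
  have hSm : Measurable Real.smoothTransition := Real.smoothTransition.continuous.measurable
  have hFb : ∀ (n : ℕ) (a : ℝ) (τ : ℝ),
      |E τ * Real.smoothTransition a| ≤ |PR - PL| * (aR - aL) := fun n a τ => by
    rw [abs_mul, abs_of_nonneg (Real.smoothTransition.nonneg _)]
    exact (mul_le_of_le_one_right (abs_nonneg _) (Real.smoothTransition.le_one _)).trans (hEb _)
  have hseq : ∀ y ∈ Icc (0 : ℝ) 1,
      Tendsto (fun n : ℕ => (y + 1) / ((n : ℝ) + 1)) atTop (𝓝[>] 0) := by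
    intro y hy
    have hy1 : 0 < y + 1 := by linarith [hy.1]
    refine tendsto_nhdsWithin_iff.2 ⟨?_, Eventually.of_forall fun n => ?_⟩
    · have := (tendsto_one_div_add_atTop_nhds_zero_nat (𝕜 := ℝ)).const_mul (y + 1)
      simpa [div_eq_mul_inv] using this
    · exact div_pos hy1 (by positivity)
  have hone : ∀ y ∈ Icc (0 : ℝ) 1, ∀ᶠ n : ℕ in atTop,
      Real.smoothTransition (((n : ℝ) + 1) * (t - s - (y + 1) / ((n : ℝ) + 1)) - 1) = 1 := by
    intro y hy
    filter_upwards [tendsto_mul_natCast_atTop (sub_pos.2 hst) 4] with n hn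
    refine Real.smoothTransition.one_of_one_le ?_
    have hk : (0 : ℝ) < n + 1 := by positivity
    have e : ((n : ℝ) + 1) * (t - s - (y + 1) / ((n : ℝ) + 1))
        = (n + 1) * (t - s) - (y + 1) := by
      field_simp
    rw [e]
    linarith [hy.2]
  -- the derivatives of the time cutoff concentrate at `s` and at `t`
  have hT1 : Tendsto (fun n : ℕ => ∫ τ, E τ * Real.smoothTransition ((n + 1) * (t - τ) - 1) *
      ((n + 1) * deriv Real.smoothTransition ((n + 1) * (τ - s) - 1))) atTop (𝓝 es) := by
    refine tendsto_integral_mul_deriv_transition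
      (F := fun n τ => E τ * Real.smoothTransition ((n + 1) * (t - τ) - 1))
      (fun n => hEm.mul (hSm.comp (by fun_prop))) (fun n τ => hFb n _ τ) fun y hy => ?_
    have h1 : Tendsto (fun n : ℕ => s + (y + 1) / ((n : ℝ) + 1)) atTop (𝓝[>] s) := by
      have h := tendsto_nhdsWithin_iff.1 (hseq y hy)
      refine tendsto_nhdsWithin_iff.2 ⟨by simpa using h.1.const_add s, ?_⟩
      filter_upwards [h.2] with n hn
      simpa using hn
    refine (hes.comp h1).congr' ?_
    filter_upwards [hone y hy] with n hn
    rw [show t - (s + (y + 1) / ((n : ℝ) + 1)) = t - s - (y + 1) / ((n : ℝ) + 1) by ring, hn,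
      mul_one]
    rfl
  have hT2 : Tendsto (fun n : ℕ => ∫ τ, E τ * Real.smoothTransition ((n + 1) * (τ - s) - 1) *
      ((n + 1) * deriv Real.smoothTransition ((n + 1) * (t - τ) - 1))) atTop (𝓝 et) := by
    refine tendsto_integral_mul_deriv_transition_left
      (F := fun n τ => E τ * Real.smoothTransition ((n + 1) * (τ - s) - 1))
      (fun n => hEm.mul (hSm.comp (by fun_prop))) (fun n τ => hFb n _ τ) fun y hy => ?_
    have h1 : Tendsto (fun n : ℕ => t - (y + 1) / ((n : ℝ) + 1)) atTop (𝓝[<] t) := by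
      have h := tendsto_nhdsWithin_iff.1 (hseq y hy)
      refine tendsto_nhdsWithin_iff.2 ⟨by simpa using h.1.const_sub t, ?_⟩
      filter_upwards [h.2] with n hn
      simpa using hn
    refine (het.comp h1).congr' ?_
    filter_upwards [hone y hy] with n hn
    rw [show t - (y + 1) / ((n : ℝ) + 1) - s = t - s - (y + 1) / ((n : ℝ) + 1) by ring, hn,
      mul_one]
    rfl
  have hlim := (hT1.sub hT2).add_const (∫ τ in s..t, G τ)
  suffices h : 0 ≤ es - et + ∫ τ in s..t, G τ by linarith
  refine ge_of_tendsto' hlim fun n => ?_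
  have hk : (0 : ℝ) < n + 1 := by positivity
  have hθ := contDiff_cutoff s t ((n : ℝ) + 1)
  have hθs := tsupport_cutoff_subset (a := s) (c := t) hk
  have h0 := hmain (cutoff s t (n + 1)) hθ
    (HasCompactSupport.of_support_subset_isCompact isCompact_Icc ((subset_tsupport _).trans hθs))
    (hθs.trans ((Icc_subset_Ioo_cutoff hk).trans hsub)) (cutoff_nonneg _ _ _)
  have hI : ∀ (a c : ℝ → ℝ) (x y : ℝ), Continuous a → Continuous c →
      (∀ τ ∉ Icc x y, c τ ∉ Icc (0 : ℝ) 1) →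
      Integrable fun τ => E τ * Real.smoothTransition (a τ) *
        (((n : ℝ) + 1) * deriv Real.smoothTransition (c τ)) := by
    intro a c x y ha hc hz
    have hSc := continuous_deriv_smoothTransition
    have h2 : Integrable fun τ => ((n : ℝ) + 1) * deriv Real.smoothTransition (c τ) :=
      Continuous.integrable_of_hasCompactSupport (by fun_prop)
        (HasCompactSupport.intro (isCompact_Icc (a := x) (b := y)) fun τ hτ => by
          rw [deriv_smoothTransition_eq_zero (hz τ hτ), mul_zero])
    refine h2.bdd_mul (c := |PR - PL| * (aR - aL)) ?_ (Eventually.of_forall fun τ => hFb n _ τ)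
    exact (hEm.mul (hSm.comp ha.measurable)).aestronglyMeasurable
  have i1 := hI (fun τ => (n + 1) * (t - τ) - 1) (fun τ => (n + 1) * (τ - s) - 1) s
    (s + 2 / (n + 1)) (by fun_prop) (by fun_prop) fun τ hτ h => hτ ⟨by nlinarith [h.1], by
      rw [← sub_le_iff_le_add', le_div_iff₀ hk]
      linarith [h.2]⟩
  have i2 := hI (fun τ => (n + 1) * (τ - s) - 1) (fun τ => (n + 1) * (t - τ) - 1)
    (t - 2 / (n + 1)) t (by fun_prop) (by fun_prop) fun τ hτ h => hτ ⟨by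
      rw [sub_le_comm, le_div_iff₀ hk]
      linarith [h.2], by nlinarith [h.1]⟩
  rw [← integral_sub i1 i2]
  refine h0.trans (add_le_add (le_of_eq ?_) ?_)
  · refine integral_congr_ae (Eventually.of_forall fun τ => ?_)
    simp only [(hasDerivAt_cutoff s t (n + 1) τ).deriv]
    ring
  · have hz : ∀ τ ∉ Ioo s t, cutoff s t (n + 1) τ * G τ = 0 := fun τ hτ => by
      rw [cutoff_eq_zero hk fun h => hτ (Icc_subset_Ioo_cutoff hk h), zero_mul]
    rw [← setIntegral_eq_integral_of_forall_compl_eq_zero hz,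
      intervalIntegral.integral_of_le hst.le, integral_Ioc_eq_integral_Ioo]
    exact integral_mono_of_nonneg
      (Eventually.of_forall fun τ => mul_nonneg (cutoff_nonneg _ _ _ _) (hG0 τ)) hGst
      (Eventually.of_forall fun τ => mul_le_of_le_one_left (hG0 τ) (cutoff_le_one _ _ _ _))

end Contraction

/-! ### Stability of piecewise `C¹` entropy solutions -/

section Stability

variable {H : ℝ → ℝ → ℝ → ℝ} {aL aR t₀ T PL PR : ℝ} {ρ ρ' : ℝ → ℝ → ℝ}

/-- The singular set of a piecewise `C¹` function: it is closed, each time slice of it is finite,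
and it meets the line `x = a₊` at finitely many times only. -/
theorem IsPiecewiseC1.exists_singular_set (h : IsPiecewiseC1 aL aR t₀ T ρ) :
    ∃ Γ : Set (ℝ × ℝ), IsClosed Γ ∧ (∀ τ, {x | (x, τ) ∈ Γ}.Finite) ∧
      {τ | (aR, τ) ∈ Γ}.Finite ∧
      ContinuousOn (fun z : ℝ × ℝ => ρ z.1 z.2) ((Icc aL aR ×ˢ Ico t₀ T) \ Γ) := by
  obtain ⟨J, α, δ, γ, hγ, hρ⟩ := h
  refine ⟨⋃ j, {z | z.2 ∈ Icc (α j) (δ j) ∧ z.1 = γ j z.2}, ?_, fun τ => ?_, ?_, hρ.continuousOn⟩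
  · refine isClosed_iUnion_of_finite fun j => ?_
    have : {z : ℝ × ℝ | z.2 ∈ Icc (α j) (δ j) ∧ z.1 = γ j z.2}
        = (fun t => (γ j t, t)) '' Icc (α j) (δ j) := by
      ext ⟨x, t⟩
      constructor
      · rintro ⟨h1, h2⟩
        exact ⟨t, h1, Prod.ext h2.symm rfl⟩
      · rintro ⟨t', h1, h2⟩
        obtain ⟨h3, h4⟩ := Prod.mk.inj h2
        subst h4
        exact ⟨h1, h3.symm⟩
    rw [this]
    exact (isCompact_Icc.image_of_continuousOn ((hγ j).2.1.prodMk continuousOn_id)).isClosed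
  · refine (finite_range fun j => γ j τ).subset ?_
    rintro x hx
    obtain ⟨j, -, hj⟩ := mem_iUnion.1 hx
    exact ⟨j, hj.symm⟩
  · refine ((finite_range α).union (finite_range δ)).subset ?_
    rintro τ hτ
    obtain ⟨j, hj1, hj2⟩ := mem_iUnion.1 hτ
    by_contra hcon
    have h1 : τ ≠ α j := fun h => hcon (Or.inl ⟨j, h.symm⟩)
    have h2 : τ ≠ δ j := fun h => hcon (Or.inr ⟨j, h.symm⟩)
    have := (hγ j).2.2.2 τ ⟨lt_of_le_of_ne hj1.1 h1.symm, lt_of_le_of_ne hj1.2 h2⟩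
    exact absurd hj2 this.2.ne'

theorem volume_eq_zero_of_slices {Γ : Set (ℝ × ℝ)} (hΓ : IsClosed Γ)
    (hs : ∀ τ, {x | (x, τ) ∈ Γ}.Finite) : volume Γ = 0 := by
  rw [Measure.volume_eq_prod, Measure.prod_apply_symm hΓ.measurableSet]
  have : ∀ y, volume ((fun x : ℝ => (x, y)) ⁻¹' Γ) = 0 := fun y => (hs y).measure_zero _
  simp [this]

open Classical in
/-- A function on the rectangle, made measurable: it is replaced by a constant off the open set
`O` on which it is continuous. -/
noncomputable def regularize (O : Set (ℝ × ℝ)) (PL : ℝ) (ρ : ℝ → ℝ → ℝ) : ℝ × ℝ → ℝ :=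
  O.piecewise (fun z => ρ z.1 z.2) fun _ => PL

variable {O : Set (ℝ × ℝ)}

theorem regularize_of_mem {z : ℝ × ℝ} (hz : z ∈ O) : regularize O PL ρ z = ρ z.1 z.2 := by
  classical exact piecewise_eq_of_mem _ _ _ hz

theorem regularize_of_notMem {z : ℝ × ℝ} (hz : z ∉ O) : regularize O PL ρ z = PL := by
  classical exact piecewise_eq_of_notMem _ _ _ hz

theorem measurable_regularize (hO : IsOpen O)
    (hc : ContinuousOn (fun z : ℝ × ℝ => ρ z.1 z.2) O) : Measurable (regularize O PL ρ) := by
  classical exact hc.measurable_piecewise continuousOn_const hO.measurableSet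

theorem regularize_mem (hP : PL ≤ PR) (hr : ∀ z ∈ O, ρ z.1 z.2 ∈ Icc PL PR) (z : ℝ × ℝ) :
    regularize O PL ρ z ∈ Icc PL PR := by
  by_cases hz : z ∈ O
  · rw [regularize_of_mem hz]
    exact hr z hz
  · rw [regularize_of_notMem hz]
    exact ⟨le_rfl, hP⟩

theorem continuousAt_regularize (hO : IsOpen O)
    (hc : ContinuousOn (fun z : ℝ × ℝ => ρ z.1 z.2) O) {z : ℝ × ℝ} (hz : z ∈ O) :
    ContinuousAt (regularize O PL ρ) z := by
  refine (hc.continuousAt (hO.mem_nhds hz)).congr ?_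
  filter_upwards [hO.mem_nhds hz] with w hw
  exact (regularize_of_mem hw).symm

theorem satisfiesKruzhkov_regularize (hρ : IsEntropySolution H aL aR t₀ T PL PR ρ)
    (hae : ∀ᵐ z ∂volume.restrict (Ioo aL aR ×ˢ Ioo t₀ T), z ∈ O) :
    SatisfiesKruzhkov H aL aR t₀ T PL PR (regularize O PL ρ) := by
  intro φ hφ hφ0 c hc
  have h1 := hρ.entropy φ hφ hφ0 c hc
  have h2 : ∫ z in Ioo aL aR ×ˢ Ioo t₀ T, kruzhkovDensity H c φ z.1 z.2 (regularize O PL ρ z)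
      = ∫ z, kruzhkovDensity H c φ z.1 z.2 (regularize O PL ρ z) := by
    refine setIntegral_eq_integral_of_forall_compl_eq_zero fun z hz => ?_
    have hz' : z ∉ tsupport φ := fun h => hz (hφ.2.2 h)
    have e1 : φ z = 0 := image_eq_zero_of_notMem_tsupport hz'
    have e2 : fderiv ℝ φ z = 0 := image_eq_zero_of_notMem_tsupport (f := fderiv ℝ φ)
      fun h => hz' (tsupport_fderiv_subset ℝ h)
    simp [kruzhkovDensity, e1, e2]
  rw [← h2]
  refine h1.trans (le_of_eq (integral_congr_ae ?_))
  filter_upwards [hae] with z hz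
  simp only [kruzhkovDensity, regularize_of_mem hz]

theorem stabConst_nonneg : 0 ≤ stabConst H aL aR t₀ T PL PR :=
  Real.sSup_nonneg (by
    rintro _ ⟨z, -, rfl⟩
    exact abs_nonneg _)

/-- The `L¹` distance of two piecewise continuous functions is continuous in time. -/
theorem continuousOn_integral_abs_sub (ha : aL < aR) {Γ : Set (ℝ × ℝ)} (hΓ : IsClosed Γ)
    (hs : ∀ τ, {x | (x, τ) ∈ Γ}.Finite)
    (hc : ContinuousOn (fun z : ℝ × ℝ => ρ z.1 z.2) ((Icc aL aR ×ˢ Ico t₀ T) \ Γ))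
    (hc' : ContinuousOn (fun z : ℝ × ℝ => ρ' z.1 z.2) ((Icc aL aR ×ˢ Ico t₀ T) \ Γ))
    (hr : ∀ x ∈ Icc aL aR, ∀ t ∈ Ico t₀ T, ρ x t ∈ Icc PL PR)
    (hr' : ∀ x ∈ Icc aL aR, ∀ t ∈ Ico t₀ T, ρ' x t ∈ Icc PL PR) :
    ContinuousOn (fun τ => ∫ x in aL..aR, |ρ' x τ - ρ x τ|) (Ico t₀ T) := by
  intro τ₀ hτ₀
  have hdiff : ContinuousOn (fun z : ℝ × ℝ => |ρ' z.1 z.2 - ρ z.1 z.2|)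
      ((Icc aL aR ×ˢ Ico t₀ T) \ Γ) := (hc'.sub hc).abs
  refine intervalIntegral.tendsto_integral_filter_of_dominated_convergence
    (fun _ => |PR - PL|) ?_ ?_ (by simp) ?_
  · filter_upwards [self_mem_nhdsWithin] with τ hτ
    rw [uIoc_of_le ha.le]
    have hfin := hs τ
    have h1 : ContinuousOn (fun x => |ρ' x τ - ρ x τ|) (Ioc aL aR \ {x | (x, τ) ∈ Γ}) :=
      hdiff.comp (by fun_prop : ContinuousOn (fun x : ℝ => (x, τ)) _)
        fun x hx => ⟨⟨Ioc_subset_Icc_self hx.1, hτ⟩, hx.2⟩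
    have h2 := h1.aestronglyMeasurable (μ := volume)
      (measurableSet_Ioc.diff hfin.measurableSet)
    refine h2.mono_measure (Measure.restrict_mono_ae ?_)
    filter_upwards [compl_mem_ae_iff.2 (hfin.measure_zero volume)] with x hx hx'
    exact ⟨hx', hx⟩
  · filter_upwards [self_mem_nhdsWithin] with τ hτ
    refine Eventually.of_forall fun x hx => ?_
    rw [uIoc_of_le ha.le] at hx
    have h1 := hr x (Ioc_subset_Icc_self hx) τ hτ
    have h2 := hr' x (Ioc_subset_Icc_self hx) τ hτ
    rw [Real.norm_eq_abs, abs_abs, abs_le]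
    have := le_abs_self (PR - PL)
    constructor <;> linarith [h1.1, h1.2, h2.1, h2.2]
  · filter_upwards [compl_mem_ae_iff.2 ((hs τ₀).measure_zero volume)] with x hx hx'
    rw [uIoc_of_le ha.le] at hx'
    have hz : (x, τ₀) ∈ (Icc aL aR ×ˢ Ico t₀ T) \ Γ := ⟨⟨Ioc_subset_Icc_self hx', hτ₀⟩, hx⟩
    refine Tendsto.comp (f := fun τ => (x, τ)) (hdiff _ hz).tendsto
      (tendsto_nhdsWithin_iff.2 ⟨?_, ?_⟩)
    · exact tendsto_const_nhds.prodMk_nhds (tendsto_id.mono_left nhdsWithin_le_nhds)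
    · have hlim : Tendsto (fun τ : ℝ => (x, τ)) (𝓝[Ico t₀ T] τ₀) (𝓝 (x, τ₀)) :=
        tendsto_const_nhds.prodMk_nhds (tendsto_id.mono_left nhdsWithin_le_nhds)
      filter_upwards [self_mem_nhdsWithin, hlim.eventually (hΓ.isOpen_compl.mem_nhds hz.2)]
        with τ h1 h2
      exact ⟨⟨Ioc_subset_Icc_self hx', h1⟩, h2⟩

theorem stability (ha : aL < aR) (hP : PL ≤ PR) (hH : IsHamiltonian H t₀ T PL PR)
    (hr : ∀ x ∈ Icc aL aR, ∀ t ∈ Ico t₀ T, ρ x t ∈ Icc PL PR)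
    (hr' : ∀ x ∈ Icc aL aR, ∀ t ∈ Ico t₀ T, ρ' x t ∈ Icc PL PR)
    (hp : IsPiecewiseC1 aL aR t₀ T ρ) (hp' : IsPiecewiseC1 aL aR t₀ T ρ')
    (he : IsEntropySolution H aL aR t₀ T PL PR ρ)
    (he' : IsEntropySolution H aL aR t₀ T PL PR ρ') {s t : ℝ} (hs : t₀ ≤ s) (hst : s < t)
    (ht : t < T) :
    ∫ x in aL..aR, |ρ' x t - ρ x t| ≤ (∫ x in aL..aR, |ρ' x s - ρ x s|)
      + ∫ θ in s..t, |H aR θ (ρ' aR θ) - H aR θ (ρ aR θ)| := by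
  obtain ⟨Γ₁, hΓ₁, hs₁, hR₁, hc₁⟩ := hp.exists_singular_set
  obtain ⟨Γ₂, hΓ₂, hs₂, hR₂, hc₂⟩ := hp'.exists_singular_set
  set Γ := Γ₁ ∪ Γ₂ with hΓdef
  have hΓ : IsClosed Γ := hΓ₁.union hΓ₂
  have hsl : ∀ τ, {x | (x, τ) ∈ Γ}.Finite := fun τ => (hs₁ τ).union (hs₂ τ)
  have hRΓ : {τ | (aR, τ) ∈ Γ}.Finite := hR₁.union hR₂
  have hc : ContinuousOn (fun z : ℝ × ℝ => ρ z.1 z.2) ((Icc aL aR ×ˢ Ico t₀ T) \ Γ) :=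
    hc₁.mono (sdiff_subset_sdiff_right subset_union_left)
  have hc' : ContinuousOn (fun z : ℝ × ℝ => ρ' z.1 z.2) ((Icc aL aR ×ˢ Ico t₀ T) \ Γ) :=
    hc₂.mono (sdiff_subset_sdiff_right subset_union_right)
  set O := (Ioo aL aR ×ˢ Ioo t₀ T) \ Γ with hOdef
  have hO : IsOpen O := (isOpen_Ioo.prod isOpen_Ioo).sdiff hΓ
  have hOsub : O ⊆ (Icc aL aR ×ˢ Ico t₀ T) \ Γ :=
    sdiff_subset_sdiff_left (prod_mono Ioo_subset_Icc_self Ioo_subset_Ico_self)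
  have hae : ∀ᵐ z ∂volume.restrict (Ioo aL aR ×ˢ Ioo t₀ T), z ∈ O := by
    rw [ae_restrict_iff' (measurableSet_Ioo.prod measurableSet_Ioo)]
    filter_upwards [compl_mem_ae_iff.2 (volume_eq_zero_of_slices hΓ hsl)] with z hz hz'
    exact ⟨hz', hz⟩
  set u := regularize O PL ρ' with hu
  set v := regularize O PL ρ with hv
  have hur : ∀ z, u z ∈ Icc PL PR := regularize_mem hP fun z hz =>
    hr' _ (hOsub hz).1.1 _ (hOsub hz).1.2
  have hvr : ∀ z, v z ∈ Icc PL PR := regularize_mem hP fun z hz =>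
    hr _ (hOsub hz).1.1 _ (hOsub hz).1.2
  have hum : Measurable u := measurable_regularize hO (hc'.mono hOsub)
  have hvm : Measurable v := measurable_regularize hO (hc.mono hOsub)
  have hcon : SatisfiesContraction H aL aR t₀ T u v := fun ψ hψ hψ0 =>
    kruzhkov_contraction hH hψ hψ0 hum hvm hur hvr (satisfiesKruzhkov_regularize he' hae)
      (satisfiesKruzhkov_regularize he hae) (by
        filter_upwards [hae] with z hz
        exact continuousAt_regularize hO (hc.mono hOsub) hz)
  have hout : ∀ z ∉ Ioo aL aR ×ˢ Ioo t₀ T, u z = v z := fun z hz => by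
    rw [hu, hv, regularize_of_notMem fun h => hz h.1, regularize_of_notMem fun h => hz h.1]
  have hE : ∀ τ ∈ Ioo t₀ T, ∫ x, |u (x, τ) - v (x, τ)| = ∫ x in aL..aR, |ρ' x τ - ρ x τ| := by
    intro τ hτ
    have h1 : ∀ x ∉ Ioo aL aR, |u (x, τ) - v (x, τ)| = 0 := fun x hx => by
      rw [hout _ fun h => hx h.1, sub_self, abs_zero]
    rw [← setIntegral_eq_integral_of_forall_compl_eq_zero h1,
      intervalIntegral.integral_of_le ha.le, integral_Ioc_eq_integral_Ioo]
    refine setIntegral_congr_ae measurableSet_Ioo ?_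
    filter_upwards [compl_mem_ae_iff.2 ((hsl τ).measure_zero volume)] with x hx hx'
    have hz : (x, τ) ∈ O := ⟨⟨hx', hτ⟩, hx⟩
    rw [hu, hv, regularize_of_mem hz, regularize_of_mem hz]
  have hecont := continuousOn_integral_abs_sub ha hΓ hsl hc hc' hr hr'
  have hHc : Continuous fun z : ℝ × ℝ × ℝ => H z.1 z.2.1 z.2.2 := hH.smooth.continuous
  refine contraction_of_limits hH ha hum hvm hur hvr hout hcon (fun τ => abs_nonneg _) ?_ hs hst ht
    ?_ ?_
  · filter_upwards [compl_mem_ae_iff.2 (hRΓ.measure_zero volume)] with τ hτ hτ'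
    have hz : (aR, τ) ∈ (Icc aL aR ×ˢ Ico t₀ T) \ Γ :=
      ⟨⟨right_mem_Icc.2 ha.le, Ioo_subset_Ico_self hτ'⟩, hτ⟩
    have hx0 : Tendsto (fun x : ℝ => x) (𝓝[<] aR) (𝓝 aR) := tendsto_id.mono_left nhdsWithin_le_nhds
    have hlim : Tendsto (fun x : ℝ => (x, τ)) (𝓝[<] aR) (𝓝 (aR, τ)) :=
      hx0.prodMk_nhds tendsto_const_nhds
    have hmem : ∀ᶠ x in 𝓝[<] aR, (x, τ) ∈ O := by
      filter_upwards [Ioo_mem_nhdsLT ha, hlim.eventually (hΓ.isOpen_compl.mem_nhds hz.2)]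
        with x h1 h2
      exact ⟨⟨h1, hτ'⟩, h2⟩
    have hlim' : Tendsto (fun x : ℝ => (x, τ)) (𝓝[<] aR)
        (𝓝[(Icc aL aR ×ˢ Ico t₀ T) \ Γ] (aR, τ)) :=
      tendsto_nhdsWithin_iff.2 ⟨hlim, hmem.mono fun x hx => hOsub hx⟩
    have l1 : Tendsto (fun x => ρ x τ) (𝓝[<] aR) (𝓝 (ρ aR τ)) := (hc _ hz).tendsto.comp hlim'
    have l2 : Tendsto (fun x => ρ' x τ) (𝓝[<] aR) (𝓝 (ρ' aR τ)) := (hc' _ hz).tendsto.comp hlim'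
    have l3 : Tendsto (fun x => H x τ (ρ x τ)) (𝓝[<] aR) (𝓝 (H aR τ (ρ aR τ))) :=
      (hHc.tendsto (aR, τ, ρ aR τ)).comp (hx0.prodMk_nhds (tendsto_const_nhds.prodMk_nhds l1))
    have l4 : Tendsto (fun x => H x τ (ρ' x τ)) (𝓝[<] aR) (𝓝 (H aR τ (ρ' aR τ))) :=
      (hHc.tendsto (aR, τ, ρ' aR τ)).comp (hx0.prodMk_nhds (tendsto_const_nhds.prodMk_nhds l2))
    refine (l4.sub l3).abs.congr' ?_
    filter_upwards [hmem] with x hx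
    rw [hu, hv, regularize_of_mem hx, regularize_of_mem hx]
  · have h1 := (hecont s ⟨hs, hst.trans ht⟩).mono_left
      (nhdsWithin_mono s (fun τ hτ => ⟨hs.trans hτ.1.le, hτ.2⟩ : Ioo s T ⊆ Ico t₀ T))
    rw [nhdsWithin_Ioo_eq_nhdsGT (hst.trans ht)] at h1
    refine h1.congr' ?_
    filter_upwards [Ioo_mem_nhdsGT (hst.trans ht)] with τ hτ
    exact (hE τ ⟨hs.trans_lt hτ.1, hτ.2⟩).symm
  · have h1 := (hecont t ⟨hs.trans hst.le, ht⟩).mono_left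
      (nhdsWithin_mono t (fun τ hτ => ⟨hs.trans hτ.1.le, hτ.2.trans ht⟩ : Ioo s t ⊆ Ico t₀ T))
    rw [nhdsWithin_Ioo_eq_nhdsLT hst] at h1
    refine h1.congr' ?_
    filter_upwards [Ioo_mem_nhdsLT hst] with τ hτ
    exact (hE τ ⟨hs.trans_lt hτ.1, hτ.2.trans ht⟩).symm

end Stability

/-! ### The value at the right end point along a particle path -/

section JumpPaths

variable {H b : ℝ → ℝ → ℝ → ℝ} {t₀ T PL PR aL aR : ℝ} {q : ℝ → Config}

/-- A `[PL, PR]`-valued path `m` on `[t₀, T)` which is right continuous with left limits `mL`, is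
continuous off the finite set `J` of jump times, and solves `m' = β (t, m)` off a finite set. -/
structure IsJumpPath (β : ℝ → ℝ → ℝ) (t₀ T PL PR : ℝ) (J : Finset ℝ) (m mL : ℝ → ℝ) : Prop where
  range : ∀ t ∈ Ico t₀ T, m t ∈ Icc PL PR
  jump_mem : ∀ s ∈ J, s ∈ Ioo t₀ T
  right : ∀ t ∈ Ico t₀ T, ContinuousWithinAt m (Ici t) t
  left : ∀ t ∈ Ioo t₀ T, Tendsto m (𝓝[<] t) (𝓝 (mL t))
  left_eq : ∀ t ∈ Ioo t₀ T, t ∉ J → mL t = m t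
  deriv : ∃ E : Set ℝ, E.Finite ∧ ∀ t ∈ Ioo t₀ T \ E, HasDerivAt m (β t (m t)) t

theorem exists_mem_Ioc_of_partition {N : ℕ} {σ : ℕ → ℝ} (hσ : ∀ k ≤ N, σ k < σ (k + 1)) {t : ℝ}
    (ht : t ∈ Ioc (σ 0) (σ (N + 1))) : ∃ k ≤ N, t ∈ Ioc (σ k) (σ (k + 1)) := by
  induction N with
  | zero => exact ⟨0, le_rfl, ht⟩
  | succ N ih =>
    rcases le_or_gt t (σ (N + 1)) with h | h
    · obtain ⟨k, hk, hk'⟩ := ih (fun k hk => hσ k (by omega)) ⟨ht.1, h⟩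
      exact ⟨k, by omega, hk'⟩
    · exact ⟨N + 1, le_rfl, h, ht.2⟩

theorem partition_bounds {N : ℕ} {σ : ℕ → ℝ} (hσ : ∀ k ≤ N, σ k < σ (k + 1)) {k : ℕ}
    (hk : k ≤ N) : σ 0 ≤ σ k ∧ σ (k + 1) ≤ σ (N + 1) := by
  have hm : ∀ j l : ℕ, j ≤ l → l ≤ N + 1 → σ j ≤ σ l := by
    intro j l hjl
    induction l, hjl using Nat.le_induction with
    | base => exact fun _ => le_rfl
    | succ l _ ih => exact fun hl => (ih (by omega)).trans (hσ l (by omega)).le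
  exact ⟨hm _ _ (Nat.zero_le _) (by omega), hm _ _ (by omega) le_rfl⟩

theorem lastParticle_addLast (q : Config) (p : ℝ × ℝ) : lastParticle (addLast q p) = p :=
  Fin.snoc_last (α := fun _ => ℝ × ℝ) p q.2

open Classical in
/-- The value of the profile at `a₊` jumps exactly when a particle enters, and it jumps to the value
of that particle; in between it solves `m' = β (a₊, t, m)`. -/
theorem IsParticlePath.exists_isJumpPath (hH : IsHamiltonian H t₀ T PL PR)
    (hb : IsDrift H b t₀ T PL PR) (ha : aL < aR) (hq : IsParticlePath H b aL aR t₀ T PL PR q) :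
    ∃ (J : Finset ℝ) (mL : ℝ → ℝ),
      IsJumpPath (driftT H b aR) t₀ T PL PR J (fun t => profile b (q t) t aR) mL ∧
      ∀ B, ∀ t < T, entries aR t₀ q B t
        = (J.filter fun s => s ≤ t ∧ profile b (q s) s aR ∈ B).card := by
  obtain ⟨N, σ, n, c, hσ0, hσT, hpiece, -, hevent⟩ := hq.structure hH hb
  have hlt : ∀ k ≤ N, σ k < σ (k + 1) := fun k hk => (hpiece k hk).1
  have hgood := fun k (hk : k ≤ N) => (hpiece k hk).2.1
  have hqc := fun k (hk : k ≤ N) => (hpiece k hk).2.2.1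
  have hord := fun k (hk : k ≤ N) => (hpiece k hk).2.2.2
  have hsub : ∀ k ≤ N, ∀ t ∈ Icc (σ k) (σ (k + 1)), t ∈ Icc t₀ T := fun k hk t ht =>
    ⟨(hσ0 ▸ (partition_bounds hlt hk).1).trans ht.1,
      ht.2.trans (hσT ▸ (partition_bounds hlt hk).2)⟩
  set m : ℝ → ℝ := fun t => profile b (q t) t aR with hm
  set mk : ℕ → ℝ → ℝ := fun k t => strip b (c k t) t (Fin.last (n k)) aR with hmk
  have hlast : ∀ k ≤ N, ∀ t ∈ Icc (σ k) (σ (k + 1)), (c k t (Fin.last (n k))).1 ≤ aR :=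
    fun k hk t ht => (hgood k hk).flow.right_closed (hlt k hk) t ht _
  have hmeq : ∀ k ≤ N, ∀ t ∈ Ico (σ k) (σ (k + 1)), m t = mk k t := fun k hk t ht => by
    simp only [hm, hqc k hk t ht]
    exact profile_eq_strip_last t (hlast k hk t (Ico_subset_Icc_self ht))
  have hmkc : ∀ k ≤ N, ContinuousOn (mk k) (Icc (σ k) (σ (k + 1))) := fun k hk =>
    ((hgood k hk).continuousOn_strip hb (Fin.last (n k))).comp (f := fun t => (aR, t))
      (by fun_prop) fun t ht => ⟨mem_univ _, ht⟩
  -- no particle sits at `a₊` strictly between two events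
  have hpos : ∀ k ≤ N, ∀ t ∈ Ioo (σ k) (σ (k + 1)), (lastParticle (q t)).1 < aR := by
    intro k hk t ht
    rw [hqc k hk t (Ioo_subset_Ico_self ht)]
    exact (hgood k hk).flow.right t ht
  set S : Set ℝ := {s | s ∈ Ioo t₀ T ∧ (lastParticle (q s)).1 = aR} with hS
  have hSsub : S ⊆ σ '' Iic (N + 1) := by
    rintro s ⟨hs, hsa⟩
    obtain ⟨k, hk, h1, h2⟩ := exists_mem_Ico_of_partition hlt (t := s)
      ⟨hσ0.le.trans hs.1.le, hs.2.trans_le hσT.ge⟩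
    rcases h1.eq_or_lt with h | h
    · exact ⟨k, hk.trans (Nat.le_succ _), h⟩
    · exact absurd hsa (hpos k hk s ⟨h, h2⟩).ne
  have hSfin : S.Finite := ((Set.finite_Iic (N + 1)).image σ).subset hSsub
  have hright : ∀ t ∈ Ico t₀ T, ContinuousWithinAt m (Ici t) t := by
    intro t ht
    obtain ⟨k, hk, hk'⟩ := exists_mem_Ico_of_partition hlt (t := t)
      ⟨hσ0.le.trans ht.1, ht.2.trans_le hσT.ge⟩
    have h1 : ContinuousWithinAt (mk k) (Ici t) t :=
      (hmkc k hk t (Ico_subset_Icc_self hk')).mono_of_mem_nhdsWithin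
        (mem_of_superset (Ico_mem_nhdsGE hk'.2) fun y hy => ⟨hk'.1.trans hy.1, hy.2.le⟩)
    exact h1.congr_of_eventuallyEq (mem_of_superset (Ico_mem_nhdsGE hk'.2) fun y hy =>
      hmeq k hk y ⟨hk'.1.trans hy.1, hy.2⟩) (hmeq k hk t hk')
  have hleft : ∀ t ∈ Ioo t₀ T, ∃ l, Tendsto m (𝓝[<] t) (𝓝 l) ∧ (t ∉ S → l = m t) := by
    intro t ht
    obtain ⟨k, hk, hk'⟩ := exists_mem_Ioc_of_partition hlt (t := t)
      ⟨hσ0.trans_lt ht.1, ht.2.le.trans hσT.ge⟩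
    refine ⟨mk k t, ?_, fun htS => ?_⟩
    · have h1 : Tendsto (mk k) (𝓝[<] t) (𝓝 (mk k t)) :=
        (hmkc k hk t (Ioc_subset_Icc_self hk')).mono_of_mem_nhdsWithin
          (mem_of_superset (Ioo_mem_nhdsLT hk'.1) fun y hy => ⟨hy.1.le, hy.2.le.trans hk'.2⟩)
      refine h1.congr' (mem_of_superset (Ioo_mem_nhdsLT hk'.1) fun y hy => ?_)
      exact (hmeq k hk y ⟨hy.1.le, hy.2.trans_le hk'.2⟩).symm
    · rcases hk'.2.eq_or_lt with h | h
      · have hkN : k < N := by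
          refine lt_of_le_of_ne hk fun hkN => ?_
          rw [h, hkN, hσT] at ht
          exact lt_irrefl _ ht.2
        obtain ⟨r, h1, h2, h3 | ⟨m', -, h3⟩⟩ := hevent k hkN
        · simp only [hm]
          rw [h, h3, h1]
          exact (profile_eq_strip_last _ (hlast k hk _ ⟨(hlt k hk).le, le_rfl⟩)).symm
        · refine absurd ⟨ht, ?_⟩ htS
          rw [h, h3, lastParticle_addLast]
      · exact (hmeq k hk t ⟨hk'.1.le, h⟩).symm
  have hval : ∀ s ∈ S, (lastParticle (q s)).2 = m s := by
    rintro s ⟨hs, hsa⟩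
    have h1 : (q s).2 (Fin.last (q s).1) = lastParticle (q s) := rfl
    have h2 := profile_eq_strip_last (b := b) (n := (q s).1) (c := (q s).2) s (x := aR) hsa.le
    change m s = _ at h2
    rw [h2, strip, h1, hsa]
    exact (driftFlow_self hb (Ioo_subset_Icc_self hs) aR _).symm
  choose! mL hmL hmL' using hleft
  refine ⟨hSfin.toFinset, mL, ⟨fun t ht => hq.range t ht aR ⟨ha.le, le_rfl⟩,
    fun s hs => ((hSfin.mem_toFinset).1 hs).1, hright, hmL,
    fun t ht htJ => hmL' t ht fun h => htJ (hSfin.mem_toFinset.2 h), ?_⟩, fun B t htT => ?_⟩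
  · refine ⟨σ '' Iic (N + 1), (Set.finite_Iic _).image σ, fun t ht => ?_⟩
    obtain ⟨k, hk, h1, h2⟩ := exists_mem_Ico_of_partition hlt (t := t)
      ⟨hσ0.le.trans ht.1.1.le, ht.1.2.trans_le hσT.ge⟩
    have h1' : σ k < t := lt_of_le_of_ne h1 fun h => ht.2 ⟨k, hk.trans (Nat.le_succ _), h⟩
    have h3 := (hgood k hk).hasFDerivAt_strip hH hb ⟨h1', h2⟩ (Fin.last (n k)) (x := aR)
      ⟨hlast k hk t ⟨h1, h2.le⟩, by simp [rightEnd]⟩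
    have h4 : HasDerivAt (fun τ : ℝ => (aR, τ)) ((0 : ℝ), (1 : ℝ)) t :=
      (hasDerivAt_const t aR).prodMk (hasDerivAt_id t)
    have h5 : HasDerivAt (mk k) _ t := h3.comp_hasDerivAt t h4
    have h6 : mk k t = m t := (hmeq k hk t ⟨h1, h2⟩).symm
    refine (h5.congr_deriv ?_).congr_of_eventuallyEq ?_
    · rw [← h6]
      simp [hmk]
    · filter_upwards [Ioo_mem_nhds h1' h2] with y hy
      exact hmeq k hk y (Ioo_subset_Ico_self hy)
  · rw [entries, ← Set.ncard_coe_finset]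
    congr 1
    ext s
    simp only [Finset.coe_filter, Set.Finite.mem_toFinset]
    constructor
    · rintro ⟨h1, h2, h3⟩
      have hs : s ∈ S := ⟨⟨h1.1, h1.2.trans_lt htT⟩, h2⟩
      refine ⟨hs, h1.2, ?_⟩
      change m s ∈ B
      rw [← hval s hs]
      exact h3
    · rintro ⟨hs, h1, h2⟩
      refine ⟨⟨hs.1.1, h1⟩, hs.2, ?_⟩
      have h3 := hval s hs
      change m s ∈ B at h2
      rw [← h3] at h2
      exact h2

end JumpPaths

section PathFormula

variable {β : ℝ → ℝ → ℝ} {t₀ T PL PR : ℝ} {J : Finset ℝ} {m mL : ℝ → ℝ}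

/-- The part up to time `τ` of a finite sum of jumps `c u`, `u ∈ J`. -/
noncomputable def jumpSum (J : Finset ℝ) (c : ℝ → ℝ) (τ : ℝ) : ℝ :=
  ∑ u ∈ J, if u ≤ τ then c u else 0

theorem jumpSum_sub (J : Finset ℝ) (c : ℝ → ℝ) {s t : ℝ} (hst : s ≤ t) :
    jumpSum J c t - jumpSum J c s = ∑ u ∈ J with s < u ∧ u ≤ t, c u := by
  rw [jumpSum, jumpSum, ← Finset.sum_sub_distrib, Finset.sum_filter]
  refine Finset.sum_congr rfl fun u _ => ?_
  by_cases h1 : u ≤ s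
  · simp [h1, h1.trans hst, h1.not_gt]
  · simp [h1, not_le.1 h1]

theorem eventually_jumpSum_right (J : Finset ℝ) (c : ℝ → ℝ) (τ : ℝ) :
    ∀ᶠ y in 𝓝[≥] τ, jumpSum J c y = jumpSum J c τ := by
  have h : ∀ u ∈ J, ∀ᶠ y in 𝓝[≥] τ, (u ≤ y ↔ u ≤ τ) := by
    intro u _
    rcases le_or_gt u τ with h | h
    · filter_upwards [self_mem_nhdsWithin] with y hy
      exact ⟨fun _ => h, fun _ => h.trans hy⟩
    · filter_upwards [Ico_mem_nhdsGE h] with y hy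
      exact ⟨fun h' => absurd hy.2 h'.not_gt, fun h' => absurd h h'.not_gt⟩
  filter_upwards [(Filter.eventually_all_finset J).2 h] with y hy
  exact Finset.sum_congr rfl fun u hu => by simp only [hy u hu]

theorem eventually_jumpSum_left (J : Finset ℝ) (c : ℝ → ℝ) (τ : ℝ) :
    ∀ᶠ y in 𝓝[<] τ, jumpSum J c y = jumpSum J c τ - if τ ∈ J then c τ else 0 := by
  have h : ∀ u ∈ J, ∀ᶠ y in 𝓝[<] τ, (u ≤ y ↔ u < τ) := by
    intro u _
    rcases lt_or_ge u τ with h | h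
    · filter_upwards [Ioo_mem_nhdsLT h] with y hy
      exact ⟨fun _ => h, fun _ => hy.1.le⟩
    · filter_upwards [self_mem_nhdsWithin] with y hy
      exact ⟨fun h' => absurd (h.trans h') (not_le.2 hy), fun h' => absurd h' h.not_gt⟩
  filter_upwards [(Filter.eventually_all_finset J).2 h] with y hy
  rw [jumpSum, jumpSum, ← Finset.sum_ite_eq' J τ c, ← Finset.sum_sub_distrib]
  refine Finset.sum_congr rfl fun u hu => ?_
  simp only [hy u hu]
  rcases lt_trichotomy u τ with h | h | h
  · simp [h, h.le, h.ne]
  · simp [h]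
  · simp [h.not_gt, h.not_ge, h.ne']

/-- The fundamental theorem of calculus along a path with jumps. -/
theorem IsJumpPath.sub_eq_integral_add_sum (hm : IsJumpPath β t₀ T PL PR J m mL) {g : ℝ → ℝ → ℝ}
    (hg : Continuous fun z : ℝ × ℝ => g z.1 z.2) {D : ℝ → ℝ} {E : Set ℝ} (hE : E.Finite)
    (hD : ∀ τ ∈ Ioo t₀ T \ E, HasDerivAt (fun τ => g τ (m τ)) (D τ) τ) {s t : ℝ}
    (hs : t₀ ≤ s) (hst : s ≤ t) (htT : t < T) (hint : IntervalIntegrable D volume s t) :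
    g t (m t) - g s (m s)
      = (∫ τ in s..t, D τ) + ∑ u ∈ J with s < u ∧ u ≤ t, (g u (m u) - g u (mL u)) := by
  set c : ℝ → ℝ := fun u => g u (m u) - g u (mL u) with hc
  set G : ℝ → ℝ := fun τ => g τ (m τ) - jumpSum J c τ with hG
  have hright : ∀ τ ∈ Ico t₀ T, ContinuousWithinAt G (Ici τ) τ := by
    intro τ hτ
    have h1 : Tendsto (fun y => (y, m y)) (𝓝[≥] τ) (𝓝 (τ, m τ)) :=
      (tendsto_id.mono_left nhdsWithin_le_nhds).prodMk_nhds (hm.right τ hτ)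
    have h2 : Tendsto (fun y => g y (m y)) (𝓝[≥] τ) (𝓝 (g τ (m τ))) :=
      (hg.tendsto (τ, m τ)).comp h1
    exact h2.sub ((tendsto_congr' (eventually_jumpSum_right J c τ)).2 tendsto_const_nhds)
  have hleft : ∀ τ ∈ Ioo t₀ T, ContinuousWithinAt G (Iio τ) τ := by
    intro τ hτ
    have h1 : Tendsto (fun y => (y, m y)) (𝓝[<] τ) (𝓝 (τ, mL τ)) :=
      (tendsto_id.mono_left nhdsWithin_le_nhds).prodMk_nhds (hm.left τ hτ)
    have h2 : Tendsto (fun y => g y (m y)) (𝓝[<] τ) (𝓝 (g τ (mL τ))) :=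
      (hg.tendsto (τ, mL τ)).comp h1
    have h3 := h2.sub ((tendsto_congr' (eventually_jumpSum_left J c τ)).2 tendsto_const_nhds)
    have h4 : g τ (mL τ) - (jumpSum J c τ - if τ ∈ J then c τ else 0) = G τ := by
      simp only [hG]
      split_ifs with h
      · simp only [hc]; ring
      · rw [hm.left_eq τ hτ h, sub_zero]
    rw [h4] at h3
    exact h3
  have hcont : ContinuousOn G (Icc s t) := by
    intro τ hτ
    have h1 := hright τ ⟨hs.trans hτ.1, hτ.2.trans_lt htT⟩
    rcases hτ.1.eq_or_lt with h | h
    · exact h1.mono fun y hy => (h ▸ hy.1 : τ ≤ y)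
    · have h2 : Tendsto G (𝓝[<] τ ⊔ 𝓝[≥] τ) (𝓝 (G τ)) :=
        Tendsto.sup (hleft τ ⟨hs.trans_lt h, hτ.2.trans_lt htT⟩) h1
      rw [nhdsLT_sup_nhdsGE] at h2
      exact h2.mono_left nhdsWithin_le_nhds
  have hder : ∀ τ ∈ Ioo s t \ (E ∪ J), HasDerivAt G (D τ) τ := by
    intro τ hτ
    have h1 := hD τ ⟨⟨hs.trans_lt hτ.1.1, hτ.1.2.trans htT⟩, fun h => hτ.2 (Or.inl h)⟩
    have hJ : τ ∉ J := fun h => hτ.2 (Or.inr h)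
    have h2 := eventually_jumpSum_left J c τ
    rw [if_neg hJ, sub_zero] at h2
    have h3 : ∀ᶠ y in 𝓝 τ, jumpSum J c y = jumpSum J c τ := by
      rw [← nhdsLT_sup_nhdsGE τ, Filter.eventually_sup]
      exact ⟨h2, eventually_jumpSum_right J c τ⟩
    exact ((h1.sub ((hasDerivAt_const τ (jumpSum J c τ)).congr_of_eventuallyEq h3))).congr_deriv
      (sub_zero _)
  have hFTC := MeasureTheory.integral_eq_of_hasDerivAt_off_countable_of_le G D hst
    (hE.union J.finite_toSet).countable hcont hder hint
  rw [hFTC, ← jumpSum_sub J c hst]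
  simp only [hG]
  ring

end PathFormula

/-! ### Measurability in time, and jump intensities -/

section Measurability

/-- Right-continuous processes are jointly measurable: they are limits of their values on grids
`ℤ / (n + 1)`, read at the grid point to the right. -/
theorem measurable_uncurry_of_right_continuous {Ω : Type*} [MeasurableSpace Ω] {X : ℝ → Ω → ℝ}
    {s t : ℝ} (hst : s ≤ t) (hX : ∀ τ ∈ Icc s t, Measurable (X τ))
    (hr : ∀ τ ∈ Ico s t, ∀ w, ContinuousWithinAt (fun y => X y w) (Ici τ) τ) :
    Measurable fun z : ℝ × Ω => X (max s (min z.1 t)) z.2 := by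
  set G : ℕ → ℝ → ℝ := fun n τ => ((⌊((n : ℝ) + 1) * τ⌋ : ℝ) + 1) / (n + 1) with hG
  have hGlt : ∀ n τ, τ < G n τ := fun n τ => by
    rw [hG, lt_div_iff₀ (by positivity), mul_comm]
    exact Int.lt_floor_add_one _
  have hGle : ∀ n τ, G n τ ≤ τ + 1 / ((n : ℝ) + 1) := fun n τ => by
    have h1 : (τ + 1 / ((n : ℝ) + 1)) * (n + 1) = (n + 1) * τ + 1 := by field_simp
    rw [hG, div_le_iff₀ (by positivity), h1]
    linarith [Int.floor_le (((n : ℝ) + 1) * τ)]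
  have hGt : ∀ τ, Tendsto (fun n => G n τ) atTop (𝓝 τ) := fun τ =>
    tendsto_of_tendsto_of_tendsto_of_le_of_le tendsto_const_nhds
      (by simpa using (tendsto_const_nhds (x := τ)).add (tendsto_one_div_add_atTop_nhds_zero_nat (𝕜 := ℝ)))
      (fun n => (hGlt n τ).le) (fun n => hGle n τ)
  refine measurable_of_tendsto_metrizable (f := fun n (z : ℝ × Ω) => X (max s (min (G n z.1) t)) z.2)
    (fun n => ?_) (tendsto_pi_nhds.2 fun z => ?_)
  · have h1 : Measurable fun z : ℤ × Ω =>
        X (max s (min (((z.1 : ℝ) + 1) / ((n : ℝ) + 1)) t)) z.2 :=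
      measurable_from_prod_countable_right fun j =>
        hX (max s (min (((j : ℝ) + 1) / ((n : ℝ) + 1)) t)) (clamp_mem hst _)
    exact h1.comp ((Int.measurable_floor.comp (measurable_fst.const_mul _)).prodMk measurable_snd)
  · obtain ⟨τ, w⟩ := z
    simp only
    rcases lt_or_ge τ s with h | h
    · refine tendsto_const_nhds.congr' ?_
      filter_upwards [(hGt τ).eventually (gt_mem_nhds h)] with n hn
      rw [max_eq_left ((min_le_left _ _).trans h.le), max_eq_left ((min_le_left _ _).trans hn.le)]
    · rcases lt_or_ge τ t with h' | h'
      · rw [clamp_eq ⟨h, h'.le⟩]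
        refine (hr τ ⟨h, h'⟩ w).tendsto.comp (tendsto_nhdsWithin_iff.2 ⟨?_, ?_⟩)
        · have h2 := ((continuous_clamp s t).tendsto τ).comp (hGt τ)
          rwa [clamp_eq ⟨h, h'.le⟩] at h2
        · exact Eventually.of_forall fun n =>
            (le_min (hGlt n τ).le h'.le).trans (le_max_right _ _)
      · refine tendsto_const_nhds.congr fun n => ?_
        rw [min_eq_right h', min_eq_right (h'.trans (hGlt n τ).le)]

theorem measurable_integral_comp {Ω : Type*} [MeasurableSpace Ω] {X : ℝ → Ω → ℝ}
    {s t : ℝ} (hst : s ≤ t) (hX : ∀ τ ∈ Icc s t, Measurable (X τ))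
    (hr : ∀ τ ∈ Ico s t, ∀ w, ContinuousWithinAt (fun y => X y w) (Ici τ) τ) {G : ℝ → ℝ → ℝ}
    (hG : Measurable fun z : ℝ × ℝ => G z.1 z.2) :
    Measurable fun w => ∫ τ in s..t, G τ (X τ w) := by
  have h1 := measurable_uncurry_of_right_continuous hst hX hr
  have h2 : Measurable fun z : ℝ × Ω => G z.1 (X (max s (min z.1 t)) z.2) :=
    hG.comp (measurable_fst.prodMk h1)
  have h3 := (h2.stronglyMeasurable.integral_prod_left' (μ := volume.restrict (Ioc s t))).measurable
  convert h3 using 2 with w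
  rw [intervalIntegral.integral_of_le hst]
  refine setIntegral_congr_fun measurableSet_Ioc fun τ hτ => ?_
  simp only [clamp_eq (Ioc_subset_Icc_self hτ)]

theorem measurable_of_right_continuous {X : ℝ → ℝ} {s t : ℝ} (hst : s ≤ t)
    (hr : ∀ τ ∈ Ico s t, ContinuousWithinAt X (Ici τ) τ) :
    Measurable fun τ => X (max s (min τ t)) :=
  (measurable_uncurry_of_right_continuous (Ω := Unit) (X := fun τ _ => X τ) hst
    (fun _ _ => measurable_const) fun τ hτ _ => hr τ hτ).comp
    (measurable_id.prodMk (measurable_const (a := ())))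

theorem intervalIntegrable_comp {X : ℝ → ℝ} {s t : ℝ} (hst : s ≤ t)
    (hr : ∀ τ ∈ Ico s t, ContinuousWithinAt X (Ici τ) τ) {G : ℝ → ℝ → ℝ}
    (hG : Measurable fun z : ℝ × ℝ => G z.1 z.2) {c : ℝ} (hc : ∀ τ ∈ Ioc s t, |G τ (X τ)| ≤ c) :
    IntervalIntegrable (fun τ => G τ (X τ)) volume s t := by
  rw [intervalIntegrable_iff_integrableOn_Ioc_of_le hst]
  have h1 : Measurable fun τ => G τ (X (max s (min τ t))) :=
    hG.comp (measurable_id.prodMk (measurable_of_right_continuous hst hr))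
  refine integrableOn_of_abs_le (C := c) (by simp) (h1.aestronglyMeasurable.congr ?_) ?_
  · filter_upwards [ae_restrict_mem measurableSet_Ioc] with τ hτ
    rw [clamp_eq (Ioc_subset_Icc_self hτ)]
  · filter_upwards [ae_restrict_mem measurableSet_Ioc] with τ hτ using hc τ hτ

end Measurability

section Intensity

variable {γ : ℝ → ℝ → ℝ → ℝ} {PL PR C : ℝ}

/-- A bounded jump intensity `γ (τ, ρ, r) dr` for jumps at time `τ` from `ρ` to `r ∈ [PL, PR]`,
continuous in `ρ` for almost all `r`. -/
structure IsIntensity (γ : ℝ → ℝ → ℝ → ℝ) (PL PR C : ℝ) : Prop where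
  meas : Measurable fun z : (ℝ × ℝ) × ℝ => γ z.1.1 z.1.2 z.2
  bound : ∀ τ ρ r, |γ τ ρ r| ≤ C
  support : ∀ τ ρ, ∀ r ∉ Icc PL PR, γ τ ρ r = 0
  cont : ∀ τ ρ, ∀ᵐ r, ContinuousAt (fun ρ' => γ τ ρ' r) ρ

theorem IsIntensity.abs_mul_le (hγ : IsIntensity γ PL PR C) {c x : ℝ} (hx : |x| ≤ c) (τ ρ r : ℝ) :
    |x * γ τ ρ r| ≤ (Icc PL PR).indicator (fun _ => c * C) r := by
  by_cases hr : r ∈ Icc PL PR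
  · rw [indicator_of_mem hr, abs_mul]
    exact mul_le_mul hx (hγ.bound τ ρ r) (abs_nonneg _) ((abs_nonneg _).trans hx)
  · rw [indicator_of_notMem hr, hγ.support τ ρ r hr]
    simp

theorem integrable_indicator_const (PL PR c : ℝ) :
    Integrable ((Icc PL PR).indicator fun _ => c) :=
  (integrable_indicator_iff measurableSet_Icc).2 (integrableOn_const (by simp))

theorem IsIntensity.integrable_mul (hγ : IsIntensity γ PL PR C) {φ : ℝ → ℝ} (hφ : Measurable φ)
    {c : ℝ} (hc : ∀ r, |φ r| ≤ c) (τ ρ : ℝ) : Integrable fun r => φ r * γ τ ρ r :=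
  (integrable_indicator_const PL PR (c * C)).mono'
    (hφ.mul (hγ.meas.comp (f := fun r : ℝ => ((τ, ρ), r)) (by fun_prop))).aestronglyMeasurable
    (Eventually.of_forall fun r => hγ.abs_mul_le (hc r) τ ρ r)

theorem IsIntensity.abs_integral_le (hγ : IsIntensity γ PL PR C) (hP : PL ≤ PR) {φ : ℝ → ℝ} {c : ℝ}
    (hc : ∀ r, |φ r| ≤ c) (τ ρ : ℝ) : |∫ r, φ r * γ τ ρ r| ≤ c * C * (PR - PL) := by
  have := norm_integral_le_of_norm_le (f := fun r => φ r * γ τ ρ r)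
    (integrable_indicator_const PL PR (c * C))
    (Eventually.of_forall fun r => hγ.abs_mul_le (hc r) τ ρ r)
  rw [integral_indicator measurableSet_Icc, setIntegral_const, smul_eq_mul,
    Real.volume_real_Icc_of_le hP, mul_comm] at this
  exact this

theorem IsIntensity.tendsto_integral (hγ : IsIntensity γ PL PR C) {ι : Type*} {l : Filter ι}
    [l.IsCountablyGenerated] {φ : ι → ℝ → ℝ} {φ' : ℝ → ℝ} {c : ℝ}
    {τ : ι → ℝ} {ρ : ι → ℝ} {τ' ρ' : ℝ}
    (hφ : ∀ n, Measurable (φ n)) (hc : ∀ n r, |φ n r| ≤ c)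
    (hlim : ∀ᵐ r, Tendsto (fun n => φ n r * γ (τ n) (ρ n) r) l (𝓝 (φ' r * γ τ' ρ' r))) :
    Tendsto (fun n => ∫ r, φ n r * γ (τ n) (ρ n) r) l (𝓝 (∫ r, φ' r * γ τ' ρ' r)) :=
  tendsto_integral_filter_of_dominated_convergence _
    (Eventually.of_forall fun n =>
      ((hφ n).mul (hγ.meas.comp (f := fun r : ℝ => ((τ n, ρ n), r))
        (by fun_prop))).aestronglyMeasurable)
    (Eventually.of_forall fun n => Eventually.of_forall fun r => hγ.abs_mul_le (hc n r) _ _ r)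
    (integrable_indicator_const PL PR (c * C)) hlim

/-- The rate `∫ φ (τ, ρ, r) γ (τ, ρ, r) dr` depends measurably on `(τ, ρ)`. -/
theorem IsIntensity.measurable_integral (hγ : IsIntensity γ PL PR C) {φ : ℝ → ℝ → ℝ → ℝ}
    (hφ : Measurable fun z : (ℝ × ℝ) × ℝ => φ z.1.1 z.1.2 z.2) :
    Measurable fun z : ℝ × ℝ => ∫ r, φ z.1 z.2 r * γ z.1 z.2 r :=
  ((hφ.mul hγ.meas).stronglyMeasurable.integral_prod_right' (ν := volume)).measurable

end Intensity

/-! ### Compensation of the jumps -/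

section JumpProcess

theorem integrable_of_abs_le {Ω : Type*} [MeasurableSpace Ω] {μ : Measure Ω} [IsFiniteMeasure μ]
    {X : Ω → ℝ} (hX : AEStronglyMeasurable X μ) {c : ℝ} (hc : ∀ w, |X w| ≤ c) : Integrable X μ :=
  Integrable.of_bound hX c (Eventually.of_forall hc)

theorem integral_mul_martingale_sub {Ω ι : Type*} [Preorder ι] [mΩ : MeasurableSpace Ω]
    {μ : Measure Ω} [IsProbabilityMeasure μ] {F : Filtration ι mΩ} {M : ι → Ω → ℝ}
    (hM : Martingale M F μ) {i j : ι} (hij : i ≤ j) {Y : Ω → ℝ} (hY : StronglyMeasurable[F i] Y)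
    {c : ℝ} (hc : ∀ w, |Y w| ≤ c) : ∫ w, Y w * (M j w - M i w) ∂μ = 0 := by
  have hY' := hY.mono (F.le i)
  have hint : ∀ k, Integrable (fun w => Y w * M k w) μ := fun k =>
    (hM.integrable k).bdd_mul (c := c) hY'.aestronglyMeasurable (Eventually.of_forall hc)
  have h1 : μ[Y * M j | F i] =ᵐ[μ] Y * μ[M j | F i] :=
    condExp_mul_of_stronglyMeasurable_left hY (hint j) (hM.integrable j)
  have h2 : ∫ w, Y w * M j w ∂μ = ∫ w, Y w * M i w ∂μ := by
    rw [← integral_condExp (F.le i)]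
    refine integral_congr_ae ((h1.trans ?_))
    filter_upwards [hM.2 i j hij] with w hw
    simp only [Pi.mul_apply, hw]
  simp only [mul_sub]
  rw [integral_sub (hint j) (hint i), h2, sub_self]

variable {β : ℝ → ℝ → ℝ} {γ : ℝ → ℝ → ℝ → ℝ} {t₀ T PL PR C : ℝ} {Ω : Type*}
  [mΩ : MeasurableSpace Ω] {μ : Measure Ω} {F : Filtration (Ico t₀ T) mΩ}
  {J : Ω → Finset ℝ} {m : ℝ → Ω → ℝ} {mL : Ω → ℝ → ℝ}

open Classical in
/-- An adapted process whose paths jump at finitely many times and solve `m' = β (t, m)` in between,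
and whose jumps to `dr` have the stochastic intensity `γ (t, m, r) dr`. -/
structure IsJumpProcess (β : ℝ → ℝ → ℝ) (γ : ℝ → ℝ → ℝ → ℝ) (t₀ T PL PR : ℝ) {Ω : Type*}
    [mΩ : MeasurableSpace Ω] (μ : Measure Ω) (F : Filtration (Ico t₀ T) mΩ) (J : Ω → Finset ℝ)
    (m : ℝ → Ω → ℝ) (mL : Ω → ℝ → ℝ) : Prop where
  adapted : ∀ t : Ico t₀ T, Measurable[F t] (m t)
  path : ∀ w, IsJumpPath β t₀ T PL PR (J w) (fun t => m t w) (mL w)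
  rate : ∀ B : Set ℝ, MeasurableSet B → Martingale (fun (t : Ico t₀ T) w =>
    (((J w).filter fun s => s ≤ t.1 ∧ m s w ∈ B).card : ℝ)
      - ∫ s in t₀..t, ∫ r in B, γ s (m s w) r) F μ

theorem IsJumpProcess.measurable_le (hm : IsJumpProcess β γ t₀ T PL PR μ F J m mL)
    {τ : ℝ} {t : Ico t₀ T} (hτ : τ ∈ Icc t₀ t) : Measurable[F t] (m τ) :=
  (hm.adapted ⟨τ, hτ.1, hτ.2.trans_lt t.2.2⟩).mono (F.mono hτ.2) le_rfl

theorem IsJumpProcess.measurable (hm : IsJumpProcess β γ t₀ T PL PR μ F J m mL)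
    {τ : ℝ} (hτ : τ ∈ Ico t₀ T) : Measurable (m τ) :=
  (hm.adapted ⟨τ, hτ⟩).mono (F.le _) le_rfl

theorem IsJumpProcess.measurable_integral_le (hm : IsJumpProcess β γ t₀ T PL PR μ F J m mL)
    {s : ℝ} (hs : t₀ ≤ s) {t : Ico t₀ T} (hst : s ≤ t) {G : ℝ → ℝ → ℝ}
    (hG : Measurable fun z : ℝ × ℝ => G z.1 z.2) :
    Measurable[F t] fun w => ∫ τ in s..t, G τ (m τ w) :=
  @measurable_integral_comp Ω (F t) m s t hst
    (fun _ hτ => hm.measurable_le ⟨hs.trans hτ.1, hτ.2⟩)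
    (fun _ hτ w => (hm.path w).right _ ⟨hs.trans hτ.1, hτ.2.trans t.2.2⟩) G hG

theorem IsJumpProcess.measurable_integral (hm : IsJumpProcess β γ t₀ T PL PR μ F J m mL)
    {s t : ℝ} (hs : t₀ ≤ s) (hst : s ≤ t) (htT : t < T) {G : ℝ → ℝ → ℝ}
    (hG : Measurable fun z : ℝ × ℝ => G z.1 z.2) :
    Measurable fun w => ∫ τ in s..t, G τ (m τ w) :=
  (hm.measurable_integral_le hs (t := ⟨t, hs.trans hst, htT⟩) hst hG).mono (F.le _) le_rfl

theorem IsJumpProcess.intervalIntegrable (hm : IsJumpProcess β γ t₀ T PL PR μ F J m mL)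
    {s t : ℝ} (hs : t₀ ≤ s) (hst : s ≤ t) (htT : t < T) {G : ℝ → ℝ → ℝ}
    (hG : Measurable fun z : ℝ × ℝ => G z.1 z.2) (w : Ω) {c : ℝ}
    (hc : ∀ τ ∈ Ioc s t, |G τ (m τ w)| ≤ c) :
    IntervalIntegrable (fun τ => G τ (m τ w)) volume s t :=
  intervalIntegrable_comp hst
    (fun _ hτ => (hm.path w).right _ ⟨hs.trans hτ.1, hτ.2.trans htT⟩) hG hc

theorem abs_integral_le_mul_sub {D : ℝ → ℝ} {s t c : ℝ} (hst : s ≤ t)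
    (hc : ∀ τ ∈ Ioc s t, |D τ| ≤ c) : |∫ τ in s..t, D τ| ≤ c * (t - s) := by
  have := intervalIntegral.norm_integral_le_of_norm_le_const (f := D) (a := s) (b := t) (C := c)
    fun τ hτ => hc τ (by rwa [uIoc_of_le hst] at hτ)
  rwa [abs_of_nonneg (sub_nonneg.2 hst)] at this

variable [IsProbabilityMeasure μ]

theorem IsJumpProcess.integral_mul_sum_indicator (hm : IsJumpProcess β γ t₀ T PL PR μ F J m mL)
    (hγ : IsIntensity γ PL PR C) (hP : PL ≤ PR) {s t : Ico t₀ T} (hst : s ≤ t) {Y : Ω → ℝ}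
    (hY : StronglyMeasurable[F s] Y) {c : ℝ} (hc : ∀ w, |Y w| ≤ c) {B : Set ℝ}
    (hB : MeasurableSet B) :
    Integrable (fun w => ∑ u ∈ J w with s.1 < u ∧ u ≤ t.1, B.indicator (1 : ℝ → ℝ) (m u w)) μ ∧
    ∫ w, Y w * ∑ u ∈ J w with s.1 < u ∧ u ≤ t.1, B.indicator (1 : ℝ → ℝ) (m u w) ∂μ
      = ∫ w, Y w * (∫ τ in s.1..t.1, ∫ r, B.indicator (1 : ℝ → ℝ) r * γ τ (m τ w) r) ∂μ := by
  classical
  set φ : ℝ → ℝ := B.indicator 1 with hφ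
  have hφm : Measurable φ := measurable_one.indicator hB
  have hφ1 : ∀ r, |φ r| ≤ 1 := fun r => by
    rw [hφ]
    by_cases h : r ∈ B <;> simp [h]
  set G : ℝ → ℝ → ℝ := fun τ ρ => ∫ r, φ r * γ τ ρ r with hG
  have hGm : Measurable fun z : ℝ × ℝ => G z.1 z.2 :=
    hγ.measurable_integral (φ := fun _ _ r => φ r) (hφm.comp measurable_snd)
  have hGc : ∀ τ ρ, |G τ ρ| ≤ 1 * C * (PR - PL) := fun τ ρ => hγ.abs_integral_le hP hφ1 τ ρ
  have hGint : ∀ (a b : ℝ) (w : Ω), t₀ ≤ a → a ≤ b → b < T →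
      IntervalIntegrable (fun τ => G τ (m τ w)) volume a b := fun a b w ha hab hb =>
    hm.intervalIntegrable ha hab hb hGm w fun τ _ => hGc τ _
  set M : Ico t₀ T → Ω → ℝ := fun t w => (((J w).filter fun s => s ≤ t.1 ∧ m s w ∈ B).card : ℝ)
      - ∫ s in t₀..t.1, ∫ r in B, γ s (m s w) r with hMdef
  have hM : Martingale M F μ := hm.rate B hB
  have hcomp : ∀ (t : Ico t₀ T) (w : Ω), ∫ s in t₀..t.1, ∫ r in B, γ s (m s w) r
      = ∫ τ in t₀..t.1, G τ (m τ w) := by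
    intro t w
    refine intervalIntegral.integral_congr fun τ _ => ?_
    simp only [hG]
    rw [← integral_indicator hB]
    refine integral_congr_ae (Eventually.of_forall fun r => ?_)
    by_cases h : r ∈ B <;> simp [hφ, h]
  have hsum : ∀ w, ∑ u ∈ J w with s.1 < u ∧ u ≤ t.1, φ (m u w)
      = (M t w - M s w) + ∫ τ in s.1..t.1, G τ (m τ w) := by
    intro w
    have hcard : ∀ t : Ico t₀ T, (((J w).filter fun s => s ≤ t.1 ∧ m s w ∈ B).card : ℝ)
        = jumpSum (J w) (fun u => φ (m u w)) t.1 := by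
      intro t
      rw [Finset.card_filter, jumpSum]
      push_cast
      refine Finset.sum_congr rfl fun u _ => ?_
      by_cases h1 : u ≤ t.1 <;> by_cases h2 : m u w ∈ B <;> simp [hφ, h1, h2]
    have h3 : (∫ τ in t₀..t.1, G τ (m τ w)) - ∫ τ in t₀..s.1, G τ (m τ w)
        = ∫ τ in s.1..t.1, G τ (m τ w) :=
      intervalIntegral.integral_interval_sub_left (hGint _ _ w le_rfl t.2.1 t.2.2)
        (hGint _ _ w le_rfl s.2.1 s.2.2)
    rw [← jumpSum_sub (J w) (fun u => φ (m u w)) hst, ← h3]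
    simp only [hMdef, hcard, hcomp]
    ring
  have hRm : Measurable fun w => ∫ τ in s.1..t.1, G τ (m τ w) :=
    hm.measurable_integral s.2.1 hst t.2.2 hGm
  have hRi : Integrable (fun w => ∫ τ in s.1..t.1, G τ (m τ w)) μ :=
    integrable_of_abs_le hRm.aestronglyMeasurable fun w =>
      abs_integral_le_mul_sub hst fun τ _ => hGc τ _
  have hMi : Integrable (fun w => M t w - M s w) μ := (hM.integrable t).sub (hM.integrable s)
  have hYm := (hY.mono (F.le s)).aestronglyMeasurable (μ := μ)
  simp only [hsum]
  refine ⟨hMi.add hRi, ?_⟩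
  simp only [mul_add]
  rw [integral_add (hMi.bdd_mul (c := c) hYm (Eventually.of_forall hc))
    (hRi.bdd_mul (c := c) hYm (Eventually.of_forall hc)),
    integral_mul_martingale_sub hM hst hY hc, zero_add]

end JumpProcess

section SumOfJumps

variable {β : ℝ → ℝ → ℝ} {γ : ℝ → ℝ → ℝ → ℝ} {t₀ T PL PR C : ℝ} {Ω : Type*}
  [mΩ : MeasurableSpace Ω] {μ : Measure Ω} {F : Filtration (Ico t₀ T) mΩ}
  {J : Ω → Finset ℝ} {m : ℝ → Ω → ℝ} {mL : Ω → ℝ → ℝ}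

theorem IsJumpProcess.intervalIntegrable_rate (hm : IsJumpProcess β γ t₀ T PL PR μ F J m mL)
    (hγ : IsIntensity γ PL PR C) (hP : PL ≤ PR) {s t : Ico t₀ T} (hst : s ≤ t) {φ : ℝ → ℝ}
    (hφ : Measurable φ) {d : ℝ} (hd : ∀ r, |φ r| ≤ d) (w : Ω) :
    IntervalIntegrable (fun τ => ∫ r, φ r * γ τ (m τ w) r) volume s t :=
  hm.intervalIntegrable (G := fun τ ρ => ∫ r, φ r * γ τ ρ r) s.2.1 hst t.2.2
    (hγ.measurable_integral (φ := fun _ _ r => φ r) (hφ.comp measurable_snd)) w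
    fun τ _ => hγ.abs_integral_le hP hd τ _

theorem IsJumpProcess.measurable_rate (hm : IsJumpProcess β γ t₀ T PL PR μ F J m mL)
    (hγ : IsIntensity γ PL PR C) {s t : Ico t₀ T} (hst : s ≤ t) {φ : ℝ → ℝ} (hφ : Measurable φ) :
    Measurable fun w => ∫ τ in s.1..t.1, ∫ r, φ r * γ τ (m τ w) r :=
  hm.measurable_integral (G := fun τ ρ => ∫ r, φ r * γ τ ρ r) s.2.1 hst t.2.2
    (hγ.measurable_integral (φ := fun _ _ r => φ r) (hφ.comp measurable_snd))

variable [IsProbabilityMeasure μ]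

theorem IsJumpProcess.integrable_card (hm : IsJumpProcess β γ t₀ T PL PR μ F J m mL)
    (hγ : IsIntensity γ PL PR C) (hP : PL ≤ PR) {s t : Ico t₀ T} (hst : s ≤ t) :
    Integrable (fun w => ∑ u ∈ J w with s.1 < u ∧ u ≤ t.1, (1 : ℝ)) μ := by
  simpa using (hm.integral_mul_sum_indicator hγ hP hst (Y := fun _ => 0)
    stronglyMeasurable_const (c := 0) (by simp) MeasurableSet.univ).1

/-- The compensation formula for a function of the value after the jump.  By linearity and dominated
convergence it follows from the case of an indicator function. -/
theorem IsJumpProcess.integral_mul_sum (hm : IsJumpProcess β γ t₀ T PL PR μ F J m mL)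
    (hγ : IsIntensity γ PL PR C) (hP : PL ≤ PR) {s t : Ico t₀ T} (hst : s ≤ t) {Y : Ω → ℝ}
    (hY : StronglyMeasurable[F s] Y) {c : ℝ} (hc : ∀ w, |Y w| ≤ c) {φ : ℝ → ℝ}
    (hφ : Measurable φ) {d : ℝ} (hd : ∀ r, |φ r| ≤ d) :
    Integrable (fun w => ∑ u ∈ J w with s.1 < u ∧ u ≤ t.1, φ (m u w)) μ ∧
    ∫ w, Y w * ∑ u ∈ J w with s.1 < u ∧ u ≤ t.1, φ (m u w) ∂μ
      = ∫ w, Y w * (∫ τ in s.1..t.1, ∫ r, φ r * γ τ (m τ w) r) ∂μ := by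
  have hYm := (hY.mono (F.le s)).aestronglyMeasurable (μ := μ)
  have hR : ∀ {φ : ℝ → ℝ}, Measurable φ → ∀ {d : ℝ}, (∀ r, |φ r| ≤ d) → ∀ w,
      |∫ τ in s.1..t.1, ∫ r, φ r * γ τ (m τ w) r| ≤ d * C * (PR - PL) * (t - s) :=
    fun _ _ hd w => abs_integral_le_mul_sub hst fun τ _ => hγ.abs_integral_le hP hd τ _
  have hRi : ∀ {φ : ℝ → ℝ}, Measurable φ → ∀ {d : ℝ}, (∀ r, |φ r| ≤ d) →
      Integrable (fun w => ∫ τ in s.1..t.1, ∫ r, φ r * γ τ (m τ w) r) μ :=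
    fun hφ _ hd => integrable_of_abs_le (hm.measurable_rate hγ hst hφ).aestronglyMeasurable
      (hR hφ hd)
  have hmul : ∀ {X : Ω → ℝ}, Integrable X μ → Integrable (fun w => Y w * X w) μ :=
    fun hX => hX.bdd_mul (c := c) hYm (Eventually.of_forall hc)
  -- simple functions are sums of multiples of indicators
  have hsimple : ∀ ψ : SimpleFunc ℝ ℝ,
      Integrable (fun w => ∑ u ∈ J w with s.1 < u ∧ u ≤ t.1, ψ (m u w)) μ ∧
      ∫ w, Y w * ∑ u ∈ J w with s.1 < u ∧ u ≤ t.1, ψ (m u w) ∂μ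
        = ∫ w, Y w * (∫ τ in s.1..t.1, ∫ r, ψ r * γ τ (m τ w) r) ∂μ := by
    intro ψ
    induction ψ using SimpleFunc.induction with
    | const a hB =>
      rename_i B
      obtain ⟨h1, h2⟩ := hm.integral_mul_sum_indicator hγ hP hst hY hc hB
      have h3 : ∀ r, (SimpleFunc.piecewise B hB (SimpleFunc.const ℝ a) (SimpleFunc.const ℝ 0)) r
          = a * B.indicator (1 : ℝ → ℝ) r := by
        intro r
        by_cases h : r ∈ B <;> simp [h]
      simp only [h3, ← Finset.mul_sum, mul_assoc, integral_const_mul,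
        intervalIntegral.integral_const_mul, mul_left_comm (Y _) a]
      exact ⟨h1.const_mul a, by rw [h2]⟩
    | add _ hf hg =>
      rename_i f g _
      obtain ⟨df, hdf⟩ := f.exists_forall_norm_le
      obtain ⟨dg, hdg⟩ := g.exists_forall_norm_le
      have h3 : ∀ w, ∫ τ in s.1..t.1, ∫ r, (f + g) r * γ τ (m τ w) r
          = (∫ τ in s.1..t.1, ∫ r, f r * γ τ (m τ w) r)
            + ∫ τ in s.1..t.1, ∫ r, g r * γ τ (m τ w) r := by
        intro w
        rw [← intervalIntegral.integral_add
          (hm.intervalIntegrable_rate hγ hP hst f.measurable hdf w)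
          (hm.intervalIntegrable_rate hγ hP hst g.measurable hdg w)]
        refine intervalIntegral.integral_congr fun τ _ => ?_
        rw [← integral_add (hγ.integrable_mul f.measurable hdf _ _)
          (hγ.integrable_mul g.measurable hdg _ _)]
        simp only [SimpleFunc.coe_add, Pi.add_apply, add_mul]
      simp only [h3]
      simp only [SimpleFunc.coe_add, Pi.add_apply, Finset.sum_add_distrib, mul_add]
      refine ⟨hf.1.add hg.1, ?_⟩
      rw [integral_add (hmul hf.1) (hmul hg.1), hf.2, hg.2,
        integral_add (hmul (hRi f.measurable hdf)) (hmul (hRi g.measurable hdg))]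
  -- a bounded measurable function is a limit of simple functions with the same bound
  have hd0 : 0 ≤ d := (abs_nonneg _).trans (hd 0)
  have hc0 : ∀ w, 0 ≤ c := fun w => (abs_nonneg _).trans (hc w)
  set ψ : ℕ → SimpleFunc ℝ ℝ := hφ.stronglyMeasurable.approxBounded d with hψ
  have hψd : ∀ n r, |ψ n r| ≤ d := fun n r => hφ.stronglyMeasurable.norm_approxBounded_le hd0 n r
  have hψl : ∀ r, Tendsto (fun n => ψ n r) atTop (𝓝 (φ r)) := fun r =>
    hφ.stronglyMeasurable.tendsto_approxBounded_of_norm_le (hd r)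
  have hS : ∀ w, Tendsto (fun n => ∑ u ∈ J w with s.1 < u ∧ u ≤ t.1, ψ n (m u w)) atTop
      (𝓝 (∑ u ∈ J w with s.1 < u ∧ u ≤ t.1, φ (m u w))) :=
    fun w => tendsto_finsetSum _ fun u _ => hψl _
  have hbound : ∀ {φ : ℝ → ℝ}, (∀ r, |φ r| ≤ d) → ∀ w,
      |∑ u ∈ J w with s.1 < u ∧ u ≤ t.1, φ (m u w)|
        ≤ d * ∑ u ∈ J w with s.1 < u ∧ u ≤ t.1, (1 : ℝ) := by
    intro φ hd w
    refine (Finset.abs_sum_le_sum_abs _ _).trans ?_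
    rw [Finset.mul_sum]
    exact Finset.sum_le_sum fun u _ => by rw [mul_one]; exact hd _
  have hcard := (hm.integrable_card hγ hP hst).const_mul d
  have hSi : Integrable (fun w => ∑ u ∈ J w with s.1 < u ∧ u ≤ t.1, φ (m u w)) μ :=
    hcard.mono' (aestronglyMeasurable_of_tendsto_ae atTop
      (fun n => (hsimple (ψ n)).1.aestronglyMeasurable) (Eventually.of_forall hS))
      (Eventually.of_forall (hbound hd))
  refine ⟨hSi, ?_⟩
  have hL : Tendsto (fun n => ∫ w, Y w * ∑ u ∈ J w with s.1 < u ∧ u ≤ t.1, ψ n (m u w) ∂μ) atTop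
      (𝓝 (∫ w, Y w * ∑ u ∈ J w with s.1 < u ∧ u ≤ t.1, φ (m u w) ∂μ)) := by
    refine tendsto_integral_of_dominated_convergence _
      (fun n => (hmul (hsimple (ψ n)).1).aestronglyMeasurable) (hcard.const_mul c) (fun n => ?_)
      (Eventually.of_forall fun w => (hS w).const_mul _)
    refine Eventually.of_forall fun w => ?_
    rw [norm_mul]
    exact mul_le_mul (hc w) (hbound (hψd n) w) (norm_nonneg _) (hc0 w)
  have hRl : Tendsto (fun n => ∫ w, Y w * (∫ τ in s.1..t.1, ∫ r, ψ n r * γ τ (m τ w) r) ∂μ) atTop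
      (𝓝 (∫ w, Y w * (∫ τ in s.1..t.1, ∫ r, φ r * γ τ (m τ w) r) ∂μ)) := by
    refine tendsto_integral_of_dominated_convergence (fun _ => c * (d * C * (PR - PL) * (t - s)))
      (fun n => (hmul (hRi (ψ n).measurable (hψd n))).aestronglyMeasurable)
      (integrable_const _) (fun n => ?_) (Eventually.of_forall fun w => Tendsto.const_mul _ ?_)
    · refine Eventually.of_forall fun w => ?_
      rw [norm_mul]
      exact mul_le_mul (hc w) (hR (ψ n).measurable (hψd n) w) (norm_nonneg _) (hc0 w)
    · refine intervalIntegral.tendsto_integral_filter_of_dominated_convergence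
        (fun _ => d * C * (PR - PL)) (Eventually.of_forall fun n =>
          (intervalIntegrable_iff.1 (hm.intervalIntegrable_rate hγ hP hst (ψ n).measurable
            (hψd n) w)).aestronglyMeasurable)
        (Eventually.of_forall fun n => Eventually.of_forall fun τ _ =>
          hγ.abs_integral_le hP (hψd n) τ _) intervalIntegrable_const
        (Eventually.of_forall fun τ _ => ?_)
      exact hγ.tendsto_integral (fun n => (ψ n).measurable) hψd
        (Eventually.of_forall fun r => (hψl r).mul_const _)
  refine tendsto_nhds_unique hL (hRl.congr fun n => ((hsimple (ψ n)).2).symm)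

end SumOfJumps

section Grid

/-- The points `s + i (t - s) / (n + 1)` of a regular grid on `[s, t]`. -/
noncomputable def gridPoint (s t : ℝ) (n i : ℕ) : ℝ := s + i * ((t - s) / ((n : ℝ) + 1))

/-- The last point of the regular grid on `[s, t]` which is strictly smaller than `x`. -/
noncomputable def leftGrid (s t : ℝ) (n : ℕ) (x : ℝ) : ℝ :=
  s + (⌈(x - s) / ((t - s) / ((n : ℝ) + 1))⌉ - 1) * ((t - s) / ((n : ℝ) + 1))

variable {s t : ℝ}

theorem gridPoint_zero (s t : ℝ) (n : ℕ) : gridPoint s t n 0 = s := by simp [gridPoint]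

theorem gridPoint_last (s t : ℝ) (n : ℕ) : gridPoint s t n (n + 1) = t := by
  rw [gridPoint]
  push_cast
  field_simp
  ring

theorem grid_step_pos (hst : s < t) (n : ℕ) : 0 < (t - s) / ((n : ℝ) + 1) :=
  div_pos (sub_pos.2 hst) (by positivity)

theorem gridPoint_mono (hst : s < t) (n : ℕ) : Monotone (gridPoint s t n) := by
  intro i j hij
  have h1 : (i : ℝ) ≤ j := by exact_mod_cast hij
  have := mul_le_mul_of_nonneg_right h1 (grid_step_pos hst n).le
  simp only [gridPoint]
  linarith

theorem gridPoint_mem (hst : s < t) {n i : ℕ} (hi : i ≤ n + 1) :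
    gridPoint s t n i ∈ Icc s t := by
  have h1 := gridPoint_mono hst n (Nat.zero_le i)
  have h2 := gridPoint_mono hst n hi
  rw [gridPoint_zero] at h1
  rw [gridPoint_last] at h2
  exact ⟨h1, h2⟩

theorem leftGrid_eq (hst : s < t) {n i : ℕ} {x : ℝ}
    (hx : x ∈ Ioc (gridPoint s t n i) (gridPoint s t n (i + 1))) :
    leftGrid s t n x = gridPoint s t n i := by
  have hp := grid_step_pos hst n
  have h1 : ⌈(x - s) / ((t - s) / ((n : ℝ) + 1))⌉ = (i : ℤ) + 1 := by
    rw [Int.ceil_eq_iff, lt_div_iff₀ hp, div_le_iff₀ hp]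
    have h2 := hx.1
    have h3 := hx.2
    simp only [gridPoint] at h2 h3
    push_cast at h3 ⊢
    constructor <;> linarith
  rw [leftGrid, h1, gridPoint]
  push_cast
  ring

theorem leftGrid_lt (hst : s < t) (n : ℕ) (x : ℝ) : leftGrid s t n x < x := by
  have hp := grid_step_pos hst n
  have h1 := Int.ceil_lt_add_one ((x - s) / ((t - s) / ((n : ℝ) + 1)))
  have h2 := mul_lt_mul_of_pos_right (sub_lt_iff_lt_add.2 h1) hp
  rw [div_mul_cancel₀ _ hp.ne'] at h2
  rw [leftGrid]
  linarith

theorem le_leftGrid (hst : s < t) (n : ℕ) (x : ℝ) :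
    x - (t - s) / ((n : ℝ) + 1) ≤ leftGrid s t n x := by
  have hp := grid_step_pos hst n
  have h1 := Int.le_ceil ((x - s) / ((t - s) / ((n : ℝ) + 1)))
  have h2 := mul_le_mul_of_nonneg_right h1 hp.le
  rw [div_mul_cancel₀ _ hp.ne'] at h2
  rw [leftGrid, sub_mul]
  linarith

theorem tendsto_leftGrid (hst : s < t) (x : ℝ) :
    Tendsto (fun n => leftGrid s t n x) atTop (𝓝[<] x) := by
  refine tendsto_nhdsWithin_iff.2 ⟨?_, Eventually.of_forall fun n => leftGrid_lt hst n x⟩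
  refine tendsto_of_tendsto_of_tendsto_of_le_of_le (g := fun n : ℕ => x - (t - s) / ((n : ℝ) + 1))
    ?_ tendsto_const_nhds (fun n => le_leftGrid hst n x) (fun n => (leftGrid_lt hst n x).le)
  have := (tendsto_one_div_add_atTop_nhds_zero_nat (𝕜 := ℝ)).const_mul (t - s)
  have h2 := (tendsto_const_nhds (x := x)).sub this
  simpa [div_eq_mul_inv] using h2

theorem sum_grid (hst : s < t) (n : ℕ) (J : Finset ℝ) (f : ℝ → ℝ → ℝ) :
    ∑ i ∈ Finset.range (n + 1), ∑ u ∈ J with gridPoint s t n i < u ∧ u ≤ gridPoint s t n (i + 1),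
      f (gridPoint s t n i) u
    = ∑ u ∈ J with s < u ∧ u ≤ t, f (leftGrid s t n u) u := by
  have h1 : ∀ i, ∑ u ∈ J with gridPoint s t n i < u ∧ u ≤ gridPoint s t n (i + 1),
      f (gridPoint s t n i) u = jumpSum J (fun u => f (leftGrid s t n u) u) (gridPoint s t n (i + 1))
        - jumpSum J (fun u => f (leftGrid s t n u) u) (gridPoint s t n i) := by
    intro i
    rw [jumpSum_sub J _ (gridPoint_mono hst n (Nat.le_succ i))]
    refine Finset.sum_congr rfl fun u hu => ?_
    rw [leftGrid_eq hst (Finset.mem_filter.1 hu).2]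
  simp only [h1]
  rw [Finset.sum_range_sub (fun i => jumpSum J (fun u => f (leftGrid s t n u) u)
    (gridPoint s t n i)), gridPoint_last, gridPoint_zero, jumpSum_sub J _ hst.le]

theorem integral_grid (hst : s < t) (n : ℕ) {f : ℝ → ℝ → ℝ}
    (hf : ∀ i ≤ n, IntervalIntegrable (f (gridPoint s t n i)) volume (gridPoint s t n i)
      (gridPoint s t n (i + 1))) :
    IntervalIntegrable (fun τ => f (leftGrid s t n τ) τ) volume s t ∧
    ∑ i ∈ Finset.range (n + 1), ∫ τ in gridPoint s t n i..gridPoint s t n (i + 1),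
      f (gridPoint s t n i) τ = ∫ τ in s..t, f (leftGrid s t n τ) τ := by
  have hle : ∀ i, gridPoint s t n i ≤ gridPoint s t n (i + 1) := fun i =>
    gridPoint_mono hst n (Nat.le_succ i)
  have h1 : ∀ i, ∀ τ ∈ Ι (gridPoint s t n i) (gridPoint s t n (i + 1)),
      f (gridPoint s t n i) τ = f (leftGrid s t n τ) τ := by
    intro i τ hτ
    rw [uIoc_of_le (hle i)] at hτ
    rw [leftGrid_eq hst hτ]
  have h2 : ∀ i < n + 1, IntervalIntegrable (fun τ => f (leftGrid s t n τ) τ) volume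
      (gridPoint s t n i) (gridPoint s t n (i + 1)) := fun i hi =>
    (hf i (Nat.lt_succ_iff.1 hi)).congr fun τ hτ => h1 i τ hτ
  have h3 := intervalIntegral.sum_integral_adjacent_intervals h2
  have h4 := IntervalIntegrable.trans_iterate h2
  rw [gridPoint_zero, gridPoint_last] at h3 h4
  refine ⟨h4, ?_⟩
  rw [← h3]
  refine Finset.sum_congr rfl fun i _ => ?_
  rw [intervalIntegral.integral_of_le (hle i), intervalIntegral.integral_of_le (hle i)]
  refine setIntegral_congr_fun measurableSet_Ioc fun τ hτ => h1 i τ ?_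
  rwa [uIoc_of_le (hle i)]

end Grid

section Compensation

variable {β : ℝ → ℝ → ℝ} {γ : ℝ → ℝ → ℝ → ℝ} {t₀ T PL PR C : ℝ} {Ω : Type*}
  [mΩ : MeasurableSpace Ω] {μ : Measure Ω} {F : Filtration (Ico t₀ T) mΩ}
  {J : Ω → Finset ℝ} {m : ℝ → Ω → ℝ} {mL : Ω → ℝ → ℝ} [IsProbabilityMeasure μ]

/-- The compensation formula on one interval of a time grid: the value before the jump is frozen
at the left end point. -/
theorem IsJumpProcess.integral_mul_sum_frozen (hm : IsJumpProcess β γ t₀ T PL PR μ F J m mL)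
    (hγ : IsIntensity γ PL PR C) (hP : PL ≤ PR) {s a e : Ico t₀ T} (hsa : s ≤ a) (hae : a ≤ e)
    {Y : Ω → ℝ} (hY : StronglyMeasurable[F s] Y) {c : ℝ} (hc : ∀ w, |Y w| ≤ c) {φ : ℝ → ℝ}
    (hφ : Measurable φ) {d : ℝ} (hd : ∀ r, |φ r| ≤ d) :
    Integrable (fun w => ∑ u ∈ J w with a.1 < u ∧ u ≤ e.1, (φ (m u w) - φ (m a w))) μ ∧
    Integrable (fun w => ∫ τ in a.1..e.1, ∫ r, (φ r - φ (m a w)) * γ τ (m τ w) r) μ ∧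
    ∫ w, Y w * ∑ u ∈ J w with a.1 < u ∧ u ≤ e.1, (φ (m u w) - φ (m a w)) ∂μ
      = ∫ w, Y w * (∫ τ in a.1..e.1, ∫ r, (φ r - φ (m a w)) * γ τ (m τ w) r) ∂μ := by
  have hYa : StronglyMeasurable[F a] Y := hY.mono (F.mono hsa)
  have hYm := (hY.mono (F.le s)).aestronglyMeasurable (μ := μ)
  have hφa : StronglyMeasurable[F a] fun w => φ (m a w) :=
    (hφ.comp (hm.adapted a)).stronglyMeasurable
  have hφam := (hφa.mono (F.le a)).aestronglyMeasurable (μ := μ)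
  have hZ : StronglyMeasurable[F a] fun w => Y w * φ (m a w) := hYa.mul hφa
  have hZc : ∀ w, |Y w * φ (m a w)| ≤ c * d := fun w => by
    rw [abs_mul]
    exact mul_le_mul (hc w) (hd _) (abs_nonneg _) ((abs_nonneg _).trans (hc w))
  obtain ⟨h1, h2⟩ := hm.integral_mul_sum hγ hP hae hYa hc hφ hd
  obtain ⟨h3, h4⟩ := hm.integral_mul_sum hγ hP hae hZ hZc (φ := fun _ => (1 : ℝ)) measurable_const
    (d := 1) (by simp)
  have hRi : ∀ {φ : ℝ → ℝ}, Measurable φ → ∀ {d : ℝ}, (∀ r, |φ r| ≤ d) →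
      Integrable (fun w => ∫ τ in a.1..e.1, ∫ r, φ r * γ τ (m τ w) r) μ :=
    fun hφ _ hd => integrable_of_abs_le (hm.measurable_rate hγ hae hφ).aestronglyMeasurable
      fun w => abs_integral_le_mul_sub hae fun τ _ => hγ.abs_integral_le hP hd τ _
  have hone : ∀ _ : ℝ, |(1 : ℝ)| ≤ 1 := by simp
  have hR1 := hRi hφ hd
  have hR2 := hRi (φ := fun _ => (1 : ℝ)) measurable_const hone
  have hmul : ∀ {X : Ω → ℝ}, Integrable X μ → Integrable (fun w => Y w * X w) μ :=
    fun hX => hX.bdd_mul (c := c) hYm (Eventually.of_forall hc)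
  have hmul' : ∀ {X : Ω → ℝ}, Integrable X μ → Integrable (fun w => φ (m a w) * X w) μ :=
    fun hX => hX.bdd_mul (c := d) hφam (Eventually.of_forall fun w => hd _)
  have hsum : ∀ w, ∑ u ∈ J w with a.1 < u ∧ u ≤ e.1, (φ (m u w) - φ (m a w))
      = ∑ u ∈ J w with a.1 < u ∧ u ≤ e.1, φ (m u w)
        - φ (m a w) * ∑ u ∈ J w with a.1 < u ∧ u ≤ e.1, (1 : ℝ) := by
    intro w
    rw [Finset.sum_sub_distrib, Finset.mul_sum, mul_one]
  have hint : ∀ w, ∫ τ in a.1..e.1, ∫ r, (φ r - φ (m a w)) * γ τ (m τ w) r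
      = (∫ τ in a.1..e.1, ∫ r, φ r * γ τ (m τ w) r)
        - φ (m a w) * ∫ τ in a.1..e.1, ∫ r, 1 * γ τ (m τ w) r := by
    intro w
    rw [← intervalIntegral.integral_const_mul, ← intervalIntegral.integral_sub
      (hm.intervalIntegrable_rate hγ hP hae hφ hd w)
      ((hm.intervalIntegrable_rate hγ hP hae (φ := fun _ => 1) measurable_const hone w).const_mul _)]
    refine intervalIntegral.integral_congr fun τ _ => ?_
    rw [← integral_const_mul, ← integral_sub (hγ.integrable_mul hφ hd _ _)
      ((hγ.integrable_mul (φ := fun _ => 1) measurable_const hone _ _).const_mul _)]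
    refine integral_congr_ae (Eventually.of_forall fun r => ?_)
    simp only
    ring
  simp only [hsum, hint]
  refine ⟨h1.sub (hmul' h3), hR1.sub (hmul' hR2), ?_⟩
  simp only [mul_sub]
  rw [integral_sub (hmul h1) (hmul (hmul' h3)), integral_sub (hmul hR1) (hmul (hmul' hR2)), h2]
  simp only [← mul_assoc] at h4 ⊢
  rw [h4]

/-- **Compensation formula.**  For bounded continuous `W`, the jumps of `W (τ, m τ)` are compensated
by the integral of their rate.  The sum over the jumps is the limit of the sums where the values
before the jump are read at the last preceding point of a time grid. -/
theorem IsJumpProcess.compensation (hm : IsJumpProcess β γ t₀ T PL PR μ F J m mL)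
    (hγ : IsIntensity γ PL PR C) (hP : PL ≤ PR) {s t : Ico t₀ T} (hst : s ≤ t)
    {Y : Ω → ℝ} (hY : StronglyMeasurable[F s] Y) {c : ℝ} (hc : ∀ w, |Y w| ≤ c) {W : ℝ → ℝ → ℝ}
    (hW : Continuous fun z : ℝ × ℝ => W z.1 z.2) {d : ℝ} (hd : ∀ τ ρ, |W τ ρ| ≤ d) :
    Integrable (fun w => ∑ u ∈ J w with s.1 < u ∧ u ≤ t.1, (W u (m u w) - W u (mL w u))) μ ∧
    ∫ w, Y w * ∑ u ∈ J w with s.1 < u ∧ u ≤ t.1, (W u (m u w) - W u (mL w u)) ∂μ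
      = ∫ w, Y w * (∫ τ in s.1..t.1, ∫ r, (W τ r - W τ (m τ w)) * γ τ (m τ w) r) ∂μ := by
  rcases hst.eq_or_lt with h | hlt
  · subst h
    have h1 : ∀ (w : Ω), ∑ u ∈ J w with s.1 < u ∧ u ≤ s.1, (W u (m u w) - W u (mL w u)) = 0 := by
      intro w
      rw [Finset.filter_false_of_mem fun u _ h => h.1.not_ge h.2, Finset.sum_empty]
    simp only [h1, intervalIntegral.integral_same]
    exact ⟨integrable_zero _ _ _, trivial⟩
  have hst' : s.1 < t.1 := hlt
  have hYm := (hY.mono (F.le s)).aestronglyMeasurable (μ := μ)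
  have hWτ : ∀ τ, Continuous (W τ) := fun τ => hW.comp (by fun_prop : Continuous fun ρ => (τ, ρ))
  have hd2 : ∀ τ ρ τ' ρ', |W τ ρ - W τ' ρ'| ≤ 2 * d := fun τ ρ τ' ρ' =>
    (abs_sub _ _).trans (by linarith [hd τ ρ, hd τ' ρ'])
  have hc0 : ∀ w, 0 ≤ c := fun w => (abs_nonneg _).trans (hc w)
  have hmul : ∀ {X : Ω → ℝ}, Integrable X μ → Integrable (fun w => Y w * X w) μ :=
    fun hX => hX.bdd_mul (c := c) hYm (Eventually.of_forall hc)
  set g : ℕ → ℕ → ℝ := fun n i => gridPoint s t n i with hg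
  have hgm : ∀ n i, i ≤ n + 1 → g n i ∈ Ico t₀ T := fun n i hi =>
    ⟨s.2.1.trans (gridPoint_mem hst' hi).1, (gridPoint_mem hst' hi).2.trans_lt t.2.2⟩
  set f : Ω → ℝ → ℝ → ℝ := fun w a u => W a (m u w) - W a (m a w) with hf
  set k : Ω → ℝ → ℝ → ℝ := fun w a τ => ∫ r, (W a r - W a (m a w)) * γ τ (m τ w) r with hk
  have hkb : ∀ w a τ, |k w a τ| ≤ 2 * d * C * (PR - PL) := fun w a τ =>
    hγ.abs_integral_le hP (fun r => hd2 _ _ _ _) τ _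
  have hfro := fun n i (hi : i ≤ n) => hm.integral_mul_sum_frozen hγ hP
    (s := s) (a := ⟨g n i, hgm n i (hi.trans (Nat.le_succ n))⟩)
    (e := ⟨g n (i + 1), hgm n (i + 1) (Nat.succ_le_succ hi)⟩)
    (gridPoint_mem hst' (hi.trans (Nat.le_succ n))).1 (gridPoint_mono hst' n (Nat.le_succ i)) hY hc
    (hWτ (g n i)).measurable (hd (g n i))
  have hkint : ∀ n w, IntervalIntegrable (fun τ => k w (leftGrid s t n τ) τ) volume s t ∧
      ∑ i ∈ Finset.range (n + 1), ∫ τ in g n i..g n (i + 1), k w (g n i) τ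
        = ∫ τ in s.1..t.1, k w (leftGrid s t n τ) τ := fun n w =>
    integral_grid hst' n fun i hi => hm.intervalIntegrable_rate hγ hP
      (s := ⟨g n i, hgm n i (hi.trans (Nat.le_succ n))⟩)
      (t := ⟨g n (i + 1), hgm n (i + 1) (Nat.succ_le_succ hi)⟩)
      (gridPoint_mono hst' n (Nat.le_succ i))
      ((hWτ (g n i)).measurable.sub measurable_const) (fun r => hd2 _ _ _ _) w
  have hfsum : ∀ n w, ∑ i ∈ Finset.range (n + 1), ∑ u ∈ J w with g n i < u ∧ u ≤ g n (i + 1),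
      f w (g n i) u = ∑ u ∈ J w with s.1 < u ∧ u ≤ t.1, f w (leftGrid s t n u) u :=
    fun n w => sum_grid hst' n (J w) (f w)
  have hLi : ∀ n, Integrable (fun w => ∑ u ∈ J w with s.1 < u ∧ u ≤ t.1,
      f w (leftGrid s t n u) u) μ := by
    intro n
    simp only [← hfsum]
    exact integrable_finsetSum _ fun i hi => (hfro n i (Nat.lt_succ_iff.1 (Finset.mem_range.1 hi))).1
  have hKi : ∀ n, Integrable (fun w => ∫ τ in s.1..t.1, k w (leftGrid s t n τ) τ) μ := by
    intro n
    simp only [← (hkint n _).2]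
    exact integrable_finsetSum _ fun i hi =>
      (hfro n i (Nat.lt_succ_iff.1 (Finset.mem_range.1 hi))).2.1
  have heq : ∀ n, ∫ w, Y w * ∑ u ∈ J w with s.1 < u ∧ u ≤ t.1, f w (leftGrid s t n u) u ∂μ
      = ∫ w, Y w * (∫ τ in s.1..t.1, k w (leftGrid s t n τ) τ) ∂μ := by
    intro n
    have hms : ∀ (w : Ω) (h : ℕ → ℝ), Y w * ∑ i ∈ Finset.range (n + 1), h i
        = ∑ i ∈ Finset.range (n + 1), Y w * h i := fun w h => Finset.mul_sum _ _ _
    simp only [← hfsum, ← (hkint n _).2, hms]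
    rw [integral_finsetSum, integral_finsetSum]
    · exact Finset.sum_congr rfl fun i hi =>
        (hfro n i (Nat.lt_succ_iff.1 (Finset.mem_range.1 hi))).2.2
    · exact fun i hi => hmul (hfro n i (Nat.lt_succ_iff.1 (Finset.mem_range.1 hi))).2.1
    · exact fun i hi => hmul (hfro n i (Nat.lt_succ_iff.1 (Finset.mem_range.1 hi))).1
  -- the preceding grid points tend to `τ` strictly from the left, hence the left limits `mL`
  have hlimL : ∀ w, ∀ τ ∈ Ioc s.1 t.1,
      Tendsto (fun n => (leftGrid s t n τ, m (leftGrid s t n τ) w)) atTop (𝓝 (τ, mL w τ)) :=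
    fun w τ hτ => ((tendsto_leftGrid hst' τ).mono_right nhdsWithin_le_nhds).prodMk_nhds
      (((hm.path w).left τ ⟨s.2.1.trans_lt hτ.1, hτ.2.trans_lt t.2.2⟩).comp
        (tendsto_leftGrid hst' τ))
  have hlimW : ∀ τ r, Tendsto (fun n => W (leftGrid s t n τ) r) atTop (𝓝 (W τ r)) := fun τ r =>
    (hW.tendsto (τ, r)).comp
      (((tendsto_leftGrid hst' τ).mono_right nhdsWithin_le_nhds).prodMk_nhds tendsto_const_nhds)
  have hlimS : ∀ w, Tendsto (fun n => ∑ u ∈ J w with s.1 < u ∧ u ≤ t.1, f w (leftGrid s t n u) u)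
      atTop (𝓝 (∑ u ∈ J w with s.1 < u ∧ u ≤ t.1, (W u (m u w) - W u (mL w u)))) :=
    fun w => tendsto_finsetSum _ fun u hu => (hlimW u _).sub
      ((hW.tendsto _).comp (hlimL w u (Finset.mem_filter.1 hu).2))
  have hlimK : ∀ w, Tendsto (fun n => ∫ τ in s.1..t.1, k w (leftGrid s t n τ) τ) atTop
      (𝓝 (∫ τ in s.1..t.1, ∫ r, (W τ r - W τ (m τ w)) * γ τ (m τ w) r)) := by
    intro w
    refine intervalIntegral.tendsto_integral_filter_of_dominated_convergence
      (fun _ => 2 * d * C * (PR - PL)) (Eventually.of_forall fun n =>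
        (intervalIntegrable_iff.1 (hkint n w).1).aestronglyMeasurable)
      (Eventually.of_forall fun n => Eventually.of_forall fun τ _ => hkb w _ τ)
      intervalIntegrable_const ?_
    filter_upwards [(J w).countable_toSet.ae_notMem volume] with τ hτJ hτ
    rw [uIoc_of_le hst'.le] at hτ
    have h1 := (hm.path w).left_eq τ ⟨s.2.1.trans_lt hτ.1, hτ.2.trans_lt t.2.2⟩ hτJ
    refine hγ.tendsto_integral (φ := fun n r => W (leftGrid s t n τ) r
        - W (leftGrid s t n τ) (m (leftGrid s t n τ) w)) (τ := fun _ => τ) (ρ := fun _ => m τ w)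
      (φ' := fun r => W τ r - W τ (m τ w)) (c := 2 * d)
      (fun n => (hWτ _).measurable.sub measurable_const) (fun n r => hd2 _ _ _ _)
      (Eventually.of_forall fun r => Tendsto.mul_const _ ((hlimW τ r).sub ?_))
    rw [← h1]
    exact (hW.tendsto _).comp (hlimL w τ hτ)
  have hcard := (hm.integrable_card hγ hP hst).const_mul (2 * d)
  have hbound : ∀ w (h : ℝ → ℝ), (∀ u, |h u| ≤ 2 * d) →
      |∑ u ∈ J w with s.1 < u ∧ u ≤ t.1, h u|
        ≤ 2 * d * ∑ u ∈ J w with s.1 < u ∧ u ≤ t.1, (1 : ℝ) := by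
    intro w h hh
    refine (Finset.abs_sum_le_sum_abs _ _).trans ?_
    rw [Finset.mul_sum]
    exact Finset.sum_le_sum fun u _ => by rw [mul_one]; exact hh _
  refine ⟨hcard.mono' (aestronglyMeasurable_of_tendsto_ae atTop
    (fun n => (hLi n).aestronglyMeasurable) (Eventually.of_forall hlimS))
    (Eventually.of_forall fun w => hbound w _ fun u => hd2 _ _ _ _), ?_⟩
  refine tendsto_nhds_unique (f := fun n => ∫ w, Y w *
    ∑ u ∈ J w with s.1 < u ∧ u ≤ t.1, f w (leftGrid s t n u) u ∂μ) (l := atTop) ?_ ?_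
  · refine tendsto_integral_of_dominated_convergence _
      (fun n => (hmul (hLi n)).aestronglyMeasurable) (hcard.const_mul c) (fun n => ?_)
      (Eventually.of_forall fun w => (hlimS w).const_mul _)
    refine Eventually.of_forall fun w => ?_
    rw [norm_mul]
    exact mul_le_mul (hc w) (hbound w _ fun u => hd2 _ _ _ _) (norm_nonneg _) (hc0 w)
  · simp only [heq]
    refine tendsto_integral_of_dominated_convergence
      (fun _ => c * (2 * d * C * (PR - PL) * (t - s)))
      (fun n => (hmul (hKi n)).aestronglyMeasurable) (integrable_const _) (fun n => ?_)
      (Eventually.of_forall fun w => (hlimK w).const_mul _)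
    refine Eventually.of_forall fun w => ?_
    rw [norm_mul]
    exact mul_le_mul (hc w) (abs_integral_le_mul_sub hst fun τ _ => hkb w _ τ) (norm_nonneg _)
      (hc0 w)

end Compensation

/-! ### Dynkin's formula and the martingale problem -/

section Dynkin

variable {β : ℝ → ℝ → ℝ} {γ : ℝ → ℝ → ℝ → ℝ} {t₀ T PL PR C : ℝ} {Ω : Type*}
  [mΩ : MeasurableSpace Ω] {μ : Measure Ω} {F : Filtration (Ico t₀ T) mΩ}
  {J : Ω → Finset ℝ} {m : ℝ → Ω → ℝ} {mL : Ω → ℝ → ℝ} [IsProbabilityMeasure μ]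

/-- The rate `∫ (φ (r) - φ (ρ)) γ (τ, ρ, r) dr` at which the jumps change `φ`. -/
noncomputable def jumpRate (γ : ℝ → ℝ → ℝ → ℝ) (τ : ℝ) (φ : ℝ → ℝ) (ρ : ℝ) : ℝ :=
  ∫ r, (φ r - φ ρ) * γ τ ρ r

theorem IsIntensity.measurable_jumpRate (hγ : IsIntensity γ PL PR C) {W : ℝ → ℝ → ℝ}
    (hW : Measurable fun z : ℝ × ℝ => W z.1 z.2) :
    Measurable fun z : ℝ × ℝ => jumpRate γ z.1 (W z.1) z.2 :=
  hγ.measurable_integral (φ := fun τ ρ r => W τ r - W τ ρ)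
    ((hW.comp (f := fun z : (ℝ × ℝ) × ℝ => (z.1.1, z.2)) (by fun_prop)).sub
      (hW.comp (f := fun z : (ℝ × ℝ) × ℝ => (z.1.1, z.1.2)) (by fun_prop)))

theorem IsIntensity.abs_jumpRate_le (hγ : IsIntensity γ PL PR C) (hP : PL ≤ PR) {φ : ℝ → ℝ} {d : ℝ}
    (hd : ∀ r, |φ r| ≤ d) (τ ρ : ℝ) : |jumpRate γ τ φ ρ| ≤ 2 * d * C * (PR - PL) :=
  hγ.abs_integral_le hP (fun r => (abs_sub _ _).trans (by linarith [hd r, hd ρ])) τ ρ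

theorem IsIntensity.continuous_jumpRate (hγ : IsIntensity γ PL PR C) {φ : ℝ → ℝ}
    (hφ : Continuous φ) {d : ℝ} (hd : ∀ r, |φ r| ≤ d) (τ : ℝ) : Continuous (jumpRate γ τ φ) := by
  refine continuous_iff_continuousAt.2 fun ρ => ?_
  refine hγ.tendsto_integral (l := 𝓝 ρ) (φ := fun ρ r => φ r - φ ρ) (τ := fun _ => τ)
    (ρ := fun ρ => ρ) (c := 2 * d) (fun _ => hφ.measurable.sub measurable_const)
    (fun ρ r => (abs_sub _ _).trans (by linarith [hd r, hd ρ])) ?_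
  filter_upwards [hγ.cont τ ρ] with r hr
  exact (tendsto_const_nhds.sub (hφ.tendsto ρ)).mul hr

/-- **Dynkin's formula**, tested against a bounded variable `Y` known at the initial time. -/
theorem IsJumpProcess.dynkin (hm : IsJumpProcess β γ t₀ T PL PR μ F J m mL)
    (hγ : IsIntensity γ PL PR C) (hP : PL ≤ PR) {s t : Ico t₀ T} (hst : s ≤ t)
    {Y : Ω → ℝ} (hY : StronglyMeasurable[F s] Y) {c : ℝ} (hc : ∀ w, |Y w| ≤ c) {W : ℝ → ℝ → ℝ}
    (hW : Continuous fun z : ℝ × ℝ => W z.1 z.2) {d : ℝ} (hd : ∀ τ ρ, |W τ ρ| ≤ d) {D : ℝ → ℝ → ℝ}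
    (hDm : Measurable fun z : ℝ × ℝ => D z.1 z.2) {e : ℝ}
    (hDe : ∀ τ ∈ Ico t₀ T, ∀ w, |D τ (m τ w)| ≤ e)
    (hD : ∀ w, ∃ E : Set ℝ, E.Finite ∧ ∀ τ ∈ Ioo t₀ T \ E,
      HasDerivAt (fun τ => W τ (m τ w)) (D τ (m τ w)) τ) :
    ∫ w, Y w * (W t (m t w) - W s (m s w)) ∂μ
      = ∫ w, Y w * (∫ τ in s.1..t.1, (D τ (m τ w) + jumpRate γ τ (W τ) (m τ w))) ∂μ := by
  have hYm := (hY.mono (F.le s)).aestronglyMeasurable (μ := μ)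
  have hmul : ∀ {X : Ω → ℝ}, Integrable X μ → Integrable (fun w => Y w * X w) μ :=
    fun hX => hX.bdd_mul (c := c) hYm (Eventually.of_forall hc)
  obtain ⟨h1, h2⟩ := hm.compensation hγ hP hst hY hc hW hd
  have hDe' : ∀ w, ∀ τ ∈ Ioc s.1 t.1, |D τ (m τ w)| ≤ e := fun w τ hτ =>
    hDe τ ⟨s.2.1.trans hτ.1.le, hτ.2.trans_lt t.2.2⟩ w
  have hDi : ∀ w, IntervalIntegrable (fun τ => D τ (m τ w)) volume s t := fun w =>
    hm.intervalIntegrable s.2.1 hst t.2.2 hDm w (hDe' w)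
  have hkm := hγ.measurable_jumpRate hW.measurable
  have hki : ∀ w, IntervalIntegrable (fun τ => jumpRate γ τ (W τ) (m τ w)) volume s t := fun w =>
    hm.intervalIntegrable (G := fun τ ρ => jumpRate γ τ (W τ) ρ) s.2.1 hst t.2.2 hkm w
      fun τ _ => hγ.abs_jumpRate_le hP (hd τ) τ _
  have hpath : ∀ w, W t (m t w) - W s (m s w) = (∫ τ in s.1..t.1, D τ (m τ w))
      + ∑ u ∈ J w with s.1 < u ∧ u ≤ t.1, (W u (m u w) - W u (mL w u)) := by
    intro w
    obtain ⟨E, hE, hEd⟩ := hD w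
    exact (hm.path w).sub_eq_integral_add_sum hW hE hEd s.2.1 hst t.2.2 (hDi w)
  have hI1 : Integrable (fun w => ∫ τ in s.1..t.1, D τ (m τ w)) μ :=
    integrable_of_abs_le (hm.measurable_integral s.2.1 hst t.2.2 hDm).aestronglyMeasurable
      fun w => abs_integral_le_mul_sub hst (hDe' w)
  have hI2 : Integrable (fun w => ∫ τ in s.1..t.1, jumpRate γ τ (W τ) (m τ w)) μ :=
    integrable_of_abs_le (hm.measurable_integral (G := fun τ ρ => jumpRate γ τ (W τ) ρ)
      s.2.1 hst t.2.2 hkm).aestronglyMeasurable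
      fun w => abs_integral_le_mul_sub hst fun τ _ => hγ.abs_jumpRate_le hP (hd τ) τ _
  have hadd : ∀ w, ∫ τ in s.1..t.1, (D τ (m τ w) + jumpRate γ τ (W τ) (m τ w))
      = (∫ τ in s.1..t.1, D τ (m τ w)) + ∫ τ in s.1..t.1, jumpRate γ τ (W τ) (m τ w) :=
    fun w => intervalIntegral.integral_add (hDi w) (hki w)
  simp only [hpath, hadd, mul_add]
  rw [integral_add (hmul hI1) (hmul h1), integral_add (hmul hI1) (hmul hI2), h2]
  rfl

/-- A jump process solves the martingale problem for its generator. -/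
theorem IsJumpProcess.martingale (hm : IsJumpProcess β γ t₀ T PL PR μ F J m mL)
    (hγ : IsIntensity γ PL PR C) (hP : PL ≤ PR) (hβ : Continuous fun z : ℝ × ℝ => β z.1 z.2)
    {B : ℝ} (hB : ∀ τ ρ, |β τ ρ| ≤ B) {ψ : ℝ → ℝ} (hψ : ContDiff ℝ 1 ψ) (hψc : HasCompactSupport ψ) :
    Martingale (fun (t : Ico t₀ T) w => ψ (m t w)
      - ∫ τ in t₀..t, (β τ (m τ w) * deriv ψ (m τ w) + jumpRate γ τ ψ (m τ w))) F μ := by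
  obtain ⟨d, hd⟩ := hψc.exists_bound_of_continuous hψ.continuous
  have hψ' : Continuous (deriv ψ) := hψ.continuous_deriv le_rfl
  obtain ⟨d', hd'⟩ := hψc.deriv.exists_bound_of_continuous hψ'
  set G : ℝ → ℝ → ℝ := fun τ ρ => β τ ρ * deriv ψ ρ + jumpRate γ τ ψ ρ with hG
  have hDm : Measurable fun z : ℝ × ℝ => β z.1 z.2 * deriv ψ z.2 :=
    (hβ.mul (hψ'.comp continuous_snd)).measurable
  have hGm : Measurable fun z : ℝ × ℝ => G z.1 z.2 :=
    hDm.add (hγ.measurable_jumpRate (W := fun _ => ψ) (hψ.continuous.measurable.comp measurable_snd))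
  have hDb : ∀ τ ρ, |β τ ρ * deriv ψ ρ| ≤ B * d' := fun τ ρ => by
    rw [abs_mul]
    exact mul_le_mul (hB τ ρ) (hd' ρ) (abs_nonneg _) ((abs_nonneg _).trans (hB τ ρ))
  have hGb : ∀ τ ρ, |G τ ρ| ≤ B * d' + 2 * d * C * (PR - PL) := fun τ ρ =>
    (abs_add_le _ _).trans (add_le_add (hDb τ ρ) (hγ.abs_jumpRate_le hP hd τ ρ))
  set X : Ico t₀ T → Ω → ℝ := fun t w => ψ (m t w) - ∫ τ in t₀..t.1, G τ (m τ w) with hX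
  have hXm : ∀ t, Measurable[F t] (X t) := fun t =>
    (hψ.continuous.measurable.comp (hm.adapted t)).sub
      (hm.measurable_integral_le le_rfl (t := t) t.2.1 hGm)
  have hXi : ∀ t, Integrable (X t) μ := fun t =>
    integrable_of_abs_le ((hXm t).mono (F.le t) le_rfl).aestronglyMeasurable
      (c := d + (B * d' + 2 * d * C * (PR - PL)) * (t.1 - t₀)) fun w => (abs_sub _ _).trans
        (add_le_add (hd _) (abs_integral_le_mul_sub t.2.1 fun τ _ => hGb τ _))
  refine ⟨fun t => (hXm t).stronglyMeasurable, fun s t hst => ?_⟩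
  refine (ae_eq_condExp_of_forall_setIntegral_eq (F.le s) (hXi t)
    (fun _ _ _ => (hXi s).integrableOn) (fun A hA _ => ?_)
    (hXm s).stronglyMeasurable.aestronglyMeasurable).symm
  have hA' : MeasurableSet A := F.le s A hA
  have h1 := hm.dynkin hγ hP hst (Y := A.indicator fun _ => 1)
    (stronglyMeasurable_const.indicator hA) (c := 1)
    (fun w => by by_cases h : w ∈ A <;> simp [h]) (W := fun _ => ψ)
    (hψ.continuous.comp continuous_snd) (fun _ => hd) (D := fun τ ρ => β τ ρ * deriv ψ ρ) hDm
    (fun τ _ w => hDb τ _) fun w => by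
      obtain ⟨E, hE, h⟩ := (hm.path w).deriv
      refine ⟨E, hE, fun τ hτ => ?_⟩
      have h2 : HasDerivAt ψ (deriv ψ (m τ w)) (m τ w) :=
        ((hψ.differentiable one_ne_zero) _).hasDerivAt
      exact (h2.comp τ (h τ hτ)).congr_deriv (mul_comm _ _)
  have hint : ∀ (t : Ico t₀ T) w, IntervalIntegrable (fun τ => G τ (m τ w)) volume t₀ t :=
    fun t w => hm.intervalIntegrable le_rfl t.2.1 t.2.2 hGm w fun τ _ => hGb τ _
  have h2 : ∀ w, X t w - X s w = (ψ (m t w) - ψ (m s w)) - ∫ τ in s.1..t.1, G τ (m τ w) := by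
    intro w
    rw [← intervalIntegral.integral_interval_sub_left (hint t w) (hint s w)]
    simp only [hX]
    ring
  have hYi : ∀ {Z : Ω → ℝ}, Integrable Z μ →
      Integrable (fun w => A.indicator (fun _ => (1 : ℝ)) w * Z w) μ := fun hZ =>
    hZ.bdd_mul (c := 1) (stronglyMeasurable_const.indicator hA').aestronglyMeasurable
      (Eventually.of_forall fun w => by by_cases h : w ∈ A <;> simp [h])
  have hset : ∀ Z : Ω → ℝ, ∫ w in A, Z w ∂μ = ∫ w, A.indicator (fun _ => (1 : ℝ)) w * Z w ∂μ := by
    intro Z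
    rw [← integral_indicator hA']
    refine integral_congr_ae (Eventually.of_forall fun w => ?_)
    by_cases h : w ∈ A <;> simp [h]
  have hI : Integrable (fun w => ∫ τ in s.1..t.1, G τ (m τ w)) μ :=
    integrable_of_abs_le (hm.measurable_integral s.2.1 hst t.2.2 hGm).aestronglyMeasurable
      fun w => abs_integral_le_mul_sub hst fun τ _ => hGb τ _
  have hψi : Integrable (fun w => ψ (m t w) - ψ (m s w)) μ :=
    integrable_of_abs_le ((hψ.continuous.measurable.comp (hm.measurable t.2)).sub
      (hψ.continuous.measurable.comp (hm.measurable s.2))).aestronglyMeasurable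
      (c := d + d) fun w => (abs_sub _ _).trans (add_le_add (hd _) (hd _))
  have h3 : ∫ w, A.indicator (fun _ => (1 : ℝ)) w * (X t w - X s w) ∂μ = 0 := by
    simp only [h2, mul_sub (A.indicator (fun _ => (1 : ℝ)) _) (_ - _)]
    rw [integral_sub (hYi hψi) (hYi hI), h1, sub_self]
  simp only [mul_sub] at h3
  rw [integral_sub (hYi (hXi t)) (hYi (hXi s))] at h3
  rw [hset, hset]
  linarith

end Dynkin

/-! ### The Markov property -/

section Flow

variable {β : ℝ → ℝ → ℝ} {B K : ℝ}

/-- The value at time `t` of the solution of `r' = g (τ, r)` with `r (τ) = ρ`. -/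
noncomputable def IsField.flow (hβ : IsField β B) (t τ ρ : ℝ) : ℝ :=
  (hβ.exists_solution τ ρ).choose t

theorem IsField.flow_eq (hβ : IsField β B) {r : ℝ → ℝ} (hr : ∀ x, HasDerivAt r (β x (r x)) x)
    (t τ : ℝ) : hβ.flow t τ (r τ) = r t := by
  obtain ⟨h1, h2⟩ := (hβ.exists_solution τ (r τ)).choose_spec
  exact congr_fun (hβ.eq_of_hasDerivAt h2 hr h1) t

theorem IsField.flow_self (hβ : IsField β B) (t ρ : ℝ) : hβ.flow t t ρ = ρ :=
  (hβ.exists_solution t ρ).choose_spec.1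

theorem IsField.continuous_flow (hβ : IsField β B) (hK : 0 ≤ K)
    (hL : ∀ τ ρ ρ', |β τ ρ - β τ ρ'| ≤ K * |ρ - ρ'|) (t : ℝ) :
    Continuous fun z : ℝ × ℝ => hβ.flow t z.1 z.2 := by
  refine continuous_iff_continuousAt.2 fun z => ?_
  obtain ⟨h1, h2⟩ := (hβ.exists_solution z.1 z.2).choose_spec
  set r := (hβ.exists_solution z.1 z.2).choose with hr
  have hbound : ∀ y : ℝ × ℝ, |hβ.flow t y.1 y.2 - hβ.flow t z.1 z.2|
      ≤ |y.2 - r y.1| * Real.exp (K * |t - y.1|) := by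
    intro y
    obtain ⟨h3, h4⟩ := (hβ.exists_solution y.1 y.2).choose_spec
    set r' := (hβ.exists_solution y.1 y.2).choose with hr'
    have := abs_le_of_abs_deriv_le (d := fun x => r' x - r x) (d' := fun x => β x (r' x) - β x (r x))
      (a := min y.1 t) (b := max y.1 t) (x := y.1) (y := t) (ε := 0) hK le_rfl
      (fun x _ => ((h4 x).continuousAt.sub (h2 x).continuousAt).continuousWithinAt)
      (fun x _ => (h4 x).sub (h2 x)) (fun x _ => by rw [add_zero]; exact hL _ _ _)
      ⟨min_le_left _ _, le_max_left _ _⟩ ⟨min_le_right _ _, le_max_right _ _⟩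
    rw [zero_mul, add_zero, h3] at this
    exact this
  have hcr : Continuous r := continuous_iff_continuousAt.2 fun x => (h2 x).continuousAt
  have hlim : Tendsto (fun y : ℝ × ℝ => |y.2 - r y.1| * Real.exp (K * |t - y.1|)) (𝓝 z) (𝓝 0) := by
    have hc : Continuous fun y : ℝ × ℝ => |y.2 - r y.1| * Real.exp (K * |t - y.1|) := by fun_prop
    have := hc.tendsto z
    rwa [h1, sub_self, abs_zero, zero_mul] at this
  rw [ContinuousAt, tendsto_iff_dist_tendsto_zero]
  exact squeeze_zero (fun _ => dist_nonneg) hbound hlim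

/-- The flow is constant along a path, away from the exceptional times of the path. -/
theorem IsField.hasDerivAt_comp_flow (hβ : IsField β B) {r : ℝ → ℝ} {U : Set ℝ} (hU : IsOpen U)
    (hr : ∀ τ ∈ U, HasDerivAt r (β τ (r τ)) τ) (h : ℝ → ℝ) (t : ℝ) {τ : ℝ} (hτ : τ ∈ U) :
    HasDerivAt (fun y => h (hβ.flow t y (r y))) 0 τ := by
  obtain ⟨ε, hε, hball⟩ := Metric.isOpen_iff.1 hU τ hτ
  obtain ⟨h1, h2⟩ := (hβ.exists_solution τ (r τ)).choose_spec
  set r' := (hβ.exists_solution τ (r τ)).choose with hr'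
  have hsub : Icc (τ - ε / 2) (τ + ε / 2) ⊆ U := fun y hy => hball (by
    rw [Metric.mem_ball, Real.dist_eq, abs_lt]
    constructor <;> linarith [hy.1, hy.2])
  have heq := hβ.eqOn (r₁ := r) (r₂ := r') (a := τ - ε / 2) (b := τ + ε / 2) (c := τ)
    (fun y hy => (hr y (hsub hy)).continuousAt.continuousWithinAt)
    (fun y hy => hr y (hsub (Ioo_subset_Icc_self hy)))
    (fun y _ => (h2 y).continuousAt.continuousWithinAt) (fun y _ => h2 y)
    ⟨by linarith, by linarith⟩ h1.symm
  refine (hasDerivAt_const τ (h (r' t))).congr_of_eventuallyEq ?_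
  filter_upwards [Icc_mem_nhds (show τ - ε / 2 < τ by linarith) (show τ < τ + ε / 2 by linarith)]
    with y hy
  rw [heq hy, hβ.flow_eq h2]

end Flow

section Markov

variable {β : ℝ → ℝ → ℝ} {γ : ℝ → ℝ → ℝ → ℝ} {t₀ T PL PR B K C : ℝ} {Ω : Type*}
  [mΩ : MeasurableSpace Ω] {μ : Measure Ω} {F : Filtration (Ico t₀ T) mΩ}
  {J : Ω → Finset ℝ} {m : ℝ → Ω → ℝ} {mL : Ω → ℝ → ℝ} [IsProbabilityMeasure μ]

/-- If `Y` is known at time `s` and orthogonal to all functions of `m s`, then `h (m t)` and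
`k (τ, m τ)`, `s ≤ τ ≤ t`, have the same covariances with `Y`, after integration over time, where
`k (τ, ·)` is the rate at which the jumps change `h` of the flow from `τ` to `t`. -/
theorem IsJumpProcess.integral_mul_comp_eq (hm : IsJumpProcess β γ t₀ T PL PR μ F J m mL)
    (hγ : IsIntensity γ PL PR C) (hP : PL ≤ PR) (hβ : IsField β B) (hK : 0 ≤ K)
    (hL : ∀ τ ρ ρ', |β τ ρ - β τ ρ'| ≤ K * |ρ - ρ'|) {s t : Ico t₀ T} (hst : s ≤ t)
    {Y : Ω → ℝ} (hY : StronglyMeasurable[F s] Y) {c : ℝ} (hc : ∀ w, |Y w| ≤ c)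
    (horth : ∀ h : ℝ → ℝ, Continuous h → (∃ d, ∀ r, |h r| ≤ d) → ∫ w, Y w * h (m s w) ∂μ = 0)
    {h : ℝ → ℝ} (hh : Continuous h) {d : ℝ} (hd : ∀ r, |h r| ≤ d) :
    ∃ k : ℝ → ℝ → ℝ, (∀ τ, Continuous (k τ)) ∧ (∀ τ ρ, |k τ ρ| ≤ 2 * d * C * (PR - PL)) ∧
      ∫ w, Y w * h (m t w) ∂μ = ∫ τ in s.1..t.1, ∫ w, Y w * k τ (m τ w) ∂μ := by
  have hYm := (hY.mono (F.le s)).aestronglyMeasurable (μ := μ)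
  set W : ℝ → ℝ → ℝ := fun τ ρ => h (hβ.flow t τ ρ) with hWdef
  have hW : Continuous fun z : ℝ × ℝ => W z.1 z.2 := hh.comp (hβ.continuous_flow hK hL t)
  have hWτ : ∀ τ, Continuous (W τ) := fun τ => hW.comp (by fun_prop : Continuous fun ρ => (τ, ρ))
  have hWd : ∀ τ ρ, |W τ ρ| ≤ d := fun _ _ => hd _
  have hkm := hγ.measurable_jumpRate hW.measurable
  have hkb : ∀ τ ρ, |jumpRate γ τ (W τ) ρ| ≤ 2 * d * C * (PR - PL) := fun τ ρ =>
    hγ.abs_jumpRate_le hP (hWd τ) τ ρ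
  refine ⟨fun τ => jumpRate γ τ (W τ), fun τ => hγ.continuous_jumpRate (hWτ τ) (hWd τ) τ, hkb, ?_⟩
  have h1 := hm.dynkin hγ hP hst hY hc hW hWd (D := fun _ _ => 0) measurable_const (e := 0)
    (by simp) fun w => by
      obtain ⟨E, hE, hder⟩ := (hm.path w).deriv
      exact ⟨E, hE, fun τ hτ => hβ.hasDerivAt_comp_flow (isOpen_Ioo.sdiff hE.isClosed) hder h t hτ⟩
  have hmul : ∀ {X : Ω → ℝ}, Integrable X μ → Integrable (fun w => Y w * X w) μ :=
    fun hX => hX.bdd_mul (c := c) hYm (Eventually.of_forall hc)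
  have hWi : ∀ τ : Ico t₀ T, Integrable (fun w => W τ (m τ w)) μ := fun τ =>
    integrable_of_abs_le ((hWτ τ).measurable.comp (hm.measurable τ.2)).aestronglyMeasurable
      fun w => hWd _ _
  simp only [zero_add, mul_sub] at h1
  rw [integral_sub (hmul (hWi t)) (hmul (hWi s)), horth (W s) (hWτ s) ⟨d, hWd s⟩, sub_zero] at h1
  have h2 : ∀ w, W t (m t w) = h (m t w) := fun w => by
    simp only [hWdef, hβ.flow_self]
  simp only [h2] at h1
  rw [h1]
  -- interchange of the expectation and of the integral over time
  have hM : Measurable fun z : ℝ × Ω => m (max s.1 (min z.1 t.1)) z.2 :=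
    measurable_uncurry_of_right_continuous hst
      (fun τ hτ => hm.measurable ⟨s.2.1.trans hτ.1, hτ.2.trans_lt t.2.2⟩)
      fun τ hτ w => (hm.path w).right τ ⟨s.2.1.trans hτ.1, hτ.2.trans t.2.2⟩
  have hclamp : ∀ τ ∈ Ioc s.1 t.1, max s.1 (min τ t.1) = τ := fun τ hτ =>
    clamp_eq (Ioc_subset_Icc_self hτ)
  have hZ : Measurable fun z : Ω × ℝ =>
      jumpRate γ z.2 (W z.2) (m (max s.1 (min z.2 t.1)) z.1) :=
    hkm.comp (measurable_snd.prodMk (hM.comp measurable_swap))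
  have hZi : Integrable (Function.uncurry fun (w : Ω) (τ : ℝ) =>
      Y w * jumpRate γ τ (W τ) (m (max s.1 (min τ t.1)) w))
      (μ.prod (volume.restrict (Ioc s.1 t.1))) := by
    refine integrable_of_abs_le (c := c * (2 * d * C * (PR - PL))) ?_ fun z => ?_
    · exact ((hY.mono (F.le s)).measurable.comp measurable_fst).mul hZ |>.aestronglyMeasurable
    · change |Y z.1 * _| ≤ _
      rw [abs_mul]
      exact mul_le_mul (hc _) (hkb _ _) (abs_nonneg _) ((abs_nonneg _).trans (hc z.1))
  have hswap := integral_integral_swap hZi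
  have e1 : ∀ w, Y w * (∫ τ in s.1..t.1, jumpRate γ τ (W τ) (m τ w))
      = ∫ τ in Ioc s.1 t.1, Y w * jumpRate γ τ (W τ) (m (max s.1 (min τ t.1)) w) := by
    intro w
    rw [intervalIntegral.integral_of_le hst, ← integral_const_mul]
    refine setIntegral_congr_fun measurableSet_Ioc fun τ hτ => ?_
    simp only [hclamp τ hτ]
  simp only [e1]
  rw [hswap, intervalIntegral.integral_of_le hst]
  refine setIntegral_congr_fun measurableSet_Ioc fun τ hτ => ?_
  simp only [hclamp τ hτ]

/-- The iteration of `IsJumpProcess.integral_mul_comp_eq` bounds the covariances by the terms of an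
exponential series. -/
theorem IsJumpProcess.abs_integral_mul_comp_le (hm : IsJumpProcess β γ t₀ T PL PR μ F J m mL)
    (hγ : IsIntensity γ PL PR C) (hP : PL ≤ PR) (hβ : IsField β B) (hK : 0 ≤ K)
    (hL : ∀ τ ρ ρ', |β τ ρ - β τ ρ'| ≤ K * |ρ - ρ'|) {s : Ico t₀ T}
    {Y : Ω → ℝ} (hY : StronglyMeasurable[F s] Y) {c : ℝ} (hc : ∀ w, |Y w| ≤ c)
    (horth : ∀ h : ℝ → ℝ, Continuous h → (∃ d, ∀ r, |h r| ≤ d) → ∫ w, Y w * h (m s w) ∂μ = 0)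
    (n : ℕ) : ∀ (t : Ico t₀ T), s ≤ t → ∀ (h : ℝ → ℝ), Continuous h → ∀ d, (∀ r, |h r| ≤ d) →
      |∫ w, Y w * h (m t w) ∂μ| ≤ c * d * ((2 * C * (PR - PL) * (t - s)) ^ n / n.factorial) := by
  induction n with
  | zero =>
    intro t hst h hh d hd
    have h1 := norm_integral_le_of_norm_le_const (μ := μ) (f := fun w => Y w * h (m t w))
      (C := c * d) (Eventually.of_forall fun w => by
        rw [norm_mul]
        exact mul_le_mul (hc w) (hd _) (norm_nonneg _) ((abs_nonneg _).trans (hc w)))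
    simpa using h1
  | succ n ih =>
    intro t hst h hh d hd
    obtain ⟨k, hkc, hkb, heq⟩ := hm.integral_mul_comp_eq hγ hP hβ hK hL hst hY hc horth hh hd
    set A : ℝ := 2 * C * (PR - PL) with hA
    rw [heq]
    have hb : ∀ τ ∈ Ioc s.1 t.1, ‖∫ w, Y w * k τ (m τ w) ∂μ‖
        ≤ c * d * A * ((A * (τ - s)) ^ n / n.factorial) := by
      intro τ hτ
      have := ih ⟨τ, s.2.1.trans hτ.1.le, hτ.2.trans_lt t.2.2⟩ hτ.1.le (k τ) (hkc τ) _ (hkb τ)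
      refine this.trans_eq ?_
      rw [hA]
      ring
    have hint : IntervalIntegrable (fun τ => c * d * A * ((A * (τ - s)) ^ n / n.factorial)) volume
        s t := (by fun_prop : Continuous fun τ : ℝ =>
          c * d * A * ((A * (τ - s.1)) ^ n / n.factorial)).intervalIntegrable _ _
    have h1 := intervalIntegral.norm_integral_le_of_norm_le hst
      (Eventually.of_forall hb) hint
    refine h1.trans_eq ?_
    have h2 : ∀ τ ∈ uIcc s.1 t.1, HasDerivAt
        (fun τ => c * d * ((A * (τ - s.1)) ^ (n + 1) / (n + 1).factorial))
        (c * d * A * ((A * (τ - s.1)) ^ n / n.factorial)) τ := by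
      intro τ _
      have h3 : HasDerivAt (fun τ => A * (τ - s.1)) (A * 1) τ :=
        ((hasDerivAt_id τ).sub_const s.1).const_mul A
      refine (((h3.pow (n + 1)).div_const ((n + 1).factorial : ℝ)).const_mul (c * d)).congr_deriv ?_
      rw [Nat.factorial_succ]
      push_cast
      have : (n.factorial : ℝ) ≠ 0 := by positivity
      field_simp
    rw [intervalIntegral.integral_eq_sub_of_hasDerivAt h2 hint]
    simp

theorem IsJumpProcess.integral_mul_comp_eq_zero (hm : IsJumpProcess β γ t₀ T PL PR μ F J m mL)
    (hγ : IsIntensity γ PL PR C) (hP : PL ≤ PR) (hβ : IsField β B) (hK : 0 ≤ K)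
    (hL : ∀ τ ρ ρ', |β τ ρ - β τ ρ'| ≤ K * |ρ - ρ'|) {s t : Ico t₀ T} (hst : s ≤ t)
    {Y : Ω → ℝ} (hY : StronglyMeasurable[F s] Y) {c : ℝ} (hc : ∀ w, |Y w| ≤ c)
    (horth : ∀ h : ℝ → ℝ, Continuous h → (∃ d, ∀ r, |h r| ≤ d) → ∫ w, Y w * h (m s w) ∂μ = 0)
    {h : ℝ → ℝ} (hh : Continuous h) {d : ℝ} (hd : ∀ r, |h r| ≤ d) :
    ∫ w, Y w * h (m t w) ∂μ = 0 := by
  have h1 := (FloorSemiring.tendsto_pow_div_factorial_atTop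
    (2 * C * (PR - PL) * (t.1 - s.1))).const_mul (c * d)
  rw [mul_zero] at h1
  exact abs_nonpos_iff.1 (ge_of_tendsto' h1 fun n =>
    hm.abs_integral_mul_comp_le hγ hP hβ hK hL hY hc horth n t hst h hh d hd)

end Markov

section MarkovProperty

variable {β : ℝ → ℝ → ℝ} {γ : ℝ → ℝ → ℝ → ℝ} {t₀ T PL PR B K C : ℝ} {Ω : Type*}
  [mΩ : MeasurableSpace Ω] {μ : Measure Ω} {F : Filtration (Ico t₀ T) mΩ}
  {J : Ω → Finset ℝ} {m : ℝ → Ω → ℝ} {mL : Ω → ℝ → ℝ} [IsProbabilityMeasure μ]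

/-- A variable `|Y| ≤ 1` which is orthogonal to the bounded continuous functions of `X` is orthogonal
to the events of `X`: the image measures of `(1 + Y) μ` and `μ` under `X` agree. -/
theorem integral_mul_indicator_eq_zero {Y X : Ω → ℝ} (hY : Measurable Y) (hY1 : ∀ w, |Y w| ≤ 1)
    (hX : Measurable X)
    (h0 : ∀ h : ℝ → ℝ, Continuous h → (∃ d, ∀ r, |h r| ≤ d) → ∫ w, Y w * h (X w) ∂μ = 0)
    {A : Set ℝ} (hA : MeasurableSet A) : ∫ w, Y w * A.indicator (1 : ℝ → ℝ) (X w) ∂μ = 0 := by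
  set f : Ω → NNReal := fun w => (1 + Y w).toNNReal with hf
  have hfm : Measurable f := (measurable_const.add hY).real_toNNReal
  have hfc : ∀ w, (f w : ℝ) = 1 + Y w := fun w =>
    Real.coe_toNNReal _ (by linarith [neg_abs_le (Y w), hY1 w])
  set ν : Measure Ω := μ.withDensity fun w => f w with hν
  have hfin : IsFiniteMeasure ν := by
    refine isFiniteMeasure_withDensity (ne_of_lt ?_)
    refine lt_of_le_of_lt (lintegral_mono (g := fun _ => ((2 : NNReal) : ENNReal)) fun w => ?_) ?_
    · refine ENNReal.coe_le_coe.2 (NNReal.coe_le_coe.1 ?_)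
      rw [hfc]
      push_cast
      linarith [le_abs_self (Y w), hY1 w]
    · simp
  have hint : ∀ {g : ℝ → ℝ}, Measurable g → ∀ {d : ℝ}, (∀ r, |g r| ≤ d) →
      ∫ x, g x ∂(ν.map X) = ∫ w, g (X w) ∂μ + ∫ w, Y w * g (X w) ∂μ := by
    intro g hg d hd
    have hgi : Integrable (fun w => g (X w)) μ :=
      integrable_of_abs_le (hg.comp hX).aestronglyMeasurable fun w => hd _
    rw [integral_map hX.aemeasurable hg.aestronglyMeasurable, hν,
      integral_withDensity_eq_integral_smul hfm, ← integral_add hgi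
        (hgi.bdd_mul (c := 1) hY.aestronglyMeasurable (Eventually.of_forall hY1))]
    refine integral_congr_ae (Eventually.of_forall fun w => ?_)
    simp only [NNReal.smul_def, hfc, smul_eq_mul]
    ring
  have hfinX : IsFiniteMeasure (ν.map X) := Measure.isFiniteMeasure_map ν X
  have hfinX' : IsFiniteMeasure (μ.map X) := Measure.isFiniteMeasure_map μ X
  have heq : ν.map X = μ.map X := by
    refine ext_of_forall_integral_eq_of_IsFiniteMeasure fun g => ?_
    have hb : ∀ r, |g r| ≤ ‖g‖ := fun r => g.norm_coe_le_norm r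
    rw [hint g.continuous.measurable hb, h0 g g.continuous ⟨_, hb⟩, add_zero,
      integral_map hX.aemeasurable g.continuous.measurable.aestronglyMeasurable]
  have hAm : Measurable (A.indicator (1 : ℝ → ℝ)) := measurable_one.indicator hA
  have h1 := hint hAm (d := 1) fun r => by by_cases h : r ∈ A <;> simp [h]
  rw [heq, integral_map hX.aemeasurable hAm.aestronglyMeasurable] at h1
  linarith

/-- A conditional expectation given the larger σ-algebra `G'` reduces to the one given `G` if `f` is
orthogonal to all `G'`-measurable `|Y| ≤ 1` which are orthogonal to the `G`-measurable variables.
It is tested with `Y = 1_A - E [1_A | G]`, `A ∈ G'`. -/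
theorem condExp_eq_condExp_of_orthogonal {Ω : Type*} {G G' mΩ : MeasurableSpace Ω} {μ : Measure Ω}
    [IsProbabilityMeasure μ] (hGF : G ≤ G') (hF : G' ≤ mΩ) {f : Ω → ℝ} (hfi : Integrable f μ)
    (hzero : ∀ Y : Ω → ℝ, StronglyMeasurable[G'] Y → (∀ w, |Y w| ≤ 1) →
      (∀ X : Ω → ℝ, StronglyMeasurable[G] X → Integrable X μ → ∫ w, Y w * X w ∂μ = 0) →
      ∫ w, Y w * f w ∂μ = 0) :
    μ[f | G'] =ᵐ[μ] μ[f | G] := by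
  have hGm : G ≤ mΩ := hGF.trans hF
  have hind1 : ∀ (A : Set Ω) w, |A.indicator (fun _ => (1 : ℝ)) w| ≤ 1 := fun A w => by
    by_cases h : w ∈ A <;> simp [h]
  set Q : Ω → ℝ := μ[f | G] with hQ
  have hQm : StronglyMeasurable[G] Q := stronglyMeasurable_condExp
  refine (ae_eq_condExp_of_forall_setIntegral_eq hF hfi
    (fun _ _ _ => integrable_condExp.integrableOn) (fun A hA _ => ?_)
    (hQm.mono hGF).aestronglyMeasurable).symm
  have hA' : MeasurableSet A := hF A hA
  set I : Ω → ℝ := A.indicator fun _ => (1 : ℝ) with hI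
  have hIi : Integrable I μ := (integrable_const _).indicator hA'
  set p : Ω → ℝ := fun w => max 0 (min ((μ[I | G]) w) 1) with hp
  have hpm : StronglyMeasurable[G] p :=
    (measurable_const.max ((stronglyMeasurable_condExp (m := G)).measurable.min
      measurable_const)).stronglyMeasurable
  have hp01 : ∀ w, p w ∈ Icc (0 : ℝ) 1 := fun w => clamp_mem zero_le_one _
  have hp1 : ∀ w, |p w| ≤ 1 := fun w => abs_le.2 ⟨by linarith [(hp01 w).1], (hp01 w).2⟩
  have hpI : p =ᵐ[μ] μ[I | G] := by
    have h0 : 0 ≤ᵐ[μ] μ[I | G] := condExp_nonneg (Eventually.of_forall fun w => by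
      by_cases h : w ∈ A <;> simp [hI, h])
    have h1 : μ[I | G] ≤ᵐ[μ] μ[fun _ => (1 : ℝ) | G] :=
      condExp_mono hIi (integrable_const _) (Eventually.of_forall fun w => le_of_abs_le (hind1 A w))
    rw [condExp_const hGm] at h1
    filter_upwards [h0, h1] with w hw0 hw1
    exact clamp_eq ⟨hw0, hw1⟩
  have hpull : ∀ X : Ω → ℝ, StronglyMeasurable[G] X → Integrable X μ →
      ∫ w, I w * X w ∂μ = ∫ w, p w * X w ∂μ := by
    intro X hX hXi
    have hIX : Integrable (I * X) μ :=
      hXi.bdd_mul (c := 1) hIi.aestronglyMeasurable (Eventually.of_forall (hind1 A))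
    have h1 := condExp_mul_of_stronglyMeasurable_right (m := G) hX hIX hIi
    have h2 : ∫ w, (I * X) w ∂μ = ∫ w, p w * X w ∂μ := by
      rw [← integral_condExp hGm]
      refine integral_congr_ae ?_
      filter_upwards [h1, hpI] with w hw hw'
      rw [hw, Pi.mul_apply, hw']
    exact h2
  have hpm' := (hpm.mono hGm).aestronglyMeasurable (μ := μ)
  have hpQ : ∫ w, p w * Q w ∂μ = ∫ w, p w * f w ∂μ := by
    have hpf : Integrable (p * f) μ := hfi.bdd_mul (c := 1) hpm' (Eventually.of_forall hp1)
    have h1 := condExp_mul_of_stronglyMeasurable_left (m := G) hpm hpf hfi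
    have h2 : ∫ w, (p * f) w ∂μ = ∫ w, p w * Q w ∂μ := by
      rw [← integral_condExp hGm]
      refine integral_congr_ae ?_
      filter_upwards [h1] with w hw
      rw [hw, Pi.mul_apply]
    exact h2.symm
  have hYF : StronglyMeasurable[G'] fun w => I w - p w :=
    (stronglyMeasurable_const.indicator hA).sub (hpm.mono hGF)
  have hY1 : ∀ w, |I w - p w| ≤ 1 := fun w => by
    have := hp01 w
    rw [abs_le]
    by_cases h : w ∈ A
    · simp only [hI, indicator_of_mem h]
      constructor <;> linarith [this.1, this.2]
    · simp only [hI, indicator_of_notMem h]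
      constructor <;> linarith [this.1, this.2]
  have hmulI : ∀ {X : Ω → ℝ}, Integrable X μ → Integrable (fun w => I w * X w) μ := fun hX =>
    hX.bdd_mul (c := 1) hIi.aestronglyMeasurable (Eventually.of_forall (hind1 A))
  have hmulp : ∀ {X : Ω → ℝ}, Integrable X μ → Integrable (fun w => p w * X w) μ := fun hX =>
    hX.bdd_mul (c := 1) hpm' (Eventually.of_forall hp1)
  have h0 := hzero _ hYF hY1 fun X hX hXi => by
    simp only [sub_mul]
    rw [integral_sub (hmulI hXi) (hmulp hXi), hpull _ hX hXi, sub_self]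
  simp only [sub_mul] at h0
  rw [integral_sub (hmulI hfi) (hmulp hfi)] at h0
  have hset : ∀ Z : Ω → ℝ, ∫ w in A, Z w ∂μ = ∫ w, I w * Z w ∂μ := by
    intro Z
    rw [← integral_indicator hA']
    refine integral_congr_ae (Eventually.of_forall fun w => ?_)
    by_cases h : w ∈ A <;> simp [hI, h]
  rw [hset, hset, hpull Q hQm integrable_condExp, hpQ]
  linarith

/-- A jump process is a Markov process. -/
theorem IsJumpProcess.markov (hm : IsJumpProcess β γ t₀ T PL PR μ F J m mL)
    (hγ : IsIntensity γ PL PR C) (hP : PL ≤ PR) (hβ : IsField β B) (hK : 0 ≤ K)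
    (hL : ∀ τ ρ ρ', |β τ ρ - β τ ρ'| ≤ K * |ρ - ρ'|) {s t : Ico t₀ T} (hst : s ≤ t)
    {E : Set ℝ} (hE : MeasurableSet E) :
    μ[(m t ⁻¹' E).indicator (fun _ => (1 : ℝ)) | F s] =ᵐ[μ]
      μ[(m t ⁻¹' E).indicator (fun _ => (1 : ℝ)) |
        MeasurableSpace.comap (m s) inferInstance] := by
  refine condExp_eq_condExp_of_orthogonal (hm.adapted s).comap_le (F.le s)
    ((integrable_const _).indicator ((hm.measurable t.2) hE)) fun Y hY hY1 horth => ?_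
  refine integral_mul_indicator_eq_zero (hY.mono (F.le s)).measurable hY1 (hm.measurable t.2)
    (fun h hh ⟨_, hd⟩ => hm.integral_mul_comp_eq_zero hγ hP hβ hK hL hst hY hY1 ?_ hh hd) hE
  rintro h hh ⟨d, hd⟩
  exact horth (fun w => h (m s w)) (hh.measurable.comp (comap_measurable (m s))).stronglyMeasurable
    (integrable_of_abs_le (hh.measurable.comp (hm.measurable s.2)).aestronglyMeasurable fun w => hd _)

end MarkovProperty

/-! ### The random particle system at the right end point -/

section ParticleProcess

variable {H b : ℝ → ℝ → ℝ → ℝ} {f : ℝ → ℝ → ℝ → ℝ → ℝ} {t₀ T PL PR aL aR : ℝ}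

/-- The drift `β (x, ·, ·)`, extended as a constant beyond the bounds of the slab. -/
noncomputable def clampedDrift (H b : ℝ → ℝ → ℝ → ℝ) (t₀ T PL PR x τ ρ : ℝ) : ℝ :=
  driftT H b x (max t₀ (min τ T)) (max PL (min ρ PR))

open Classical in
/-- The density of the entry rate `f²` at `x`, extended as a constant beyond the bounds of the slab.
The value on the diagonal `r = ρ` does not matter for integrals and is set to `0`. -/
noncomputable def clampedRate (H : ℝ → ℝ → ℝ → ℝ) (f : ℝ → ℝ → ℝ → ℝ → ℝ) (t₀ T PL PR x τ ρ r : ℝ) :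
    ℝ :=
  if max PL (min ρ PR) < r ∧ r ≤ PR then
    speed H x (max t₀ (min τ T)) (max PL (min ρ PR)) r
      * f x (max t₀ (min τ T)) (max PL (min ρ PR)) r
  else 0

theorem continuous_clampedDrift (hH : IsHamiltonian H t₀ T PL PR) (hb : IsDrift H b t₀ T PL PR)
    (x : ℝ) : Continuous fun z : ℝ × ℝ => clampedDrift H b t₀ T PL PR x z.1 z.2 :=
  (contDiff_unc_driftT hH hb).continuous.comp
    (by fun_prop : Continuous fun z : ℝ × ℝ => (x, max t₀ (min z.1 T), max PL (min z.2 PR)))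

theorem abs_clamp_sub_clamp_le (ρ ρ' : ℝ) :
    |max PL (min ρ PR) - max PL (min ρ' PR)| ≤ |ρ - ρ'| := by
  rw [max_comm PL, max_comm PL]
  refine (abs_max_sub_max_le_abs _ _ _).trans ((abs_min_sub_min_le_max _ _ _ _).trans ?_)
  simp

theorem exists_isField_clampedDrift (hH : IsHamiltonian H t₀ T PL PR)
    (hb : IsDrift H b t₀ T PL PR) (ht : t₀ ≤ T) (hP : PL ≤ PR) (x : ℝ) :
    ∃ B K, IsField (clampedDrift H b t₀ T PL PR x) B ∧ 0 ≤ K ∧ ∀ τ ρ ρ',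
      |clampedDrift H b t₀ T PL PR x τ ρ - clampedDrift H b t₀ T PL PR x τ ρ'| ≤ K * |ρ - ρ'| := by
  obtain ⟨B, -, hB⟩ := exists_box_bound (contDiff_unc_driftT hH hb).continuous x x t₀ T PL PR
  obtain ⟨K, hK, hL⟩ := exists_lipschitz_closedBall (contDiff_unc_driftT hH hb)
    (max |x| (max (max |t₀| |T|) (max |PL| |PR|)))
  have hin : ∀ τ ρ : ℝ, ‖((x, max t₀ (min τ T), max PL (min ρ PR)) : ℝ × ℝ × ℝ)‖
      ≤ max |x| (max (max |t₀| |T|) (max |PL| |PR|)) := fun τ ρ =>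
    max_le_max le_rfl (max_le_max
      (abs_le_max_abs_abs (clamp_mem ht τ).1 (clamp_mem ht τ).2)
      (abs_le_max_abs_abs (clamp_mem hP ρ).1 (clamp_mem hP ρ).2))
  have hlip : ∀ τ ρ ρ', |clampedDrift H b t₀ T PL PR x τ ρ - clampedDrift H b t₀ T PL PR x τ ρ'|
      ≤ K * |ρ - ρ'| := by
    intro τ ρ ρ'
    refine (hL _ _ (hin τ ρ) (hin τ ρ')).trans (mul_le_mul_of_nonneg_left ?_ hK)
    simp only [Prod.mk_sub_mk, sub_self, Prod.norm_def, norm_zero]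
    exact max_le (abs_nonneg _) (max_le (abs_nonneg _) (abs_clamp_sub_clamp_le ρ ρ'))
  exact ⟨B, K, ⟨continuous_clampedDrift hH hb x,
    fun τ ρ => hB x ⟨le_rfl, le_rfl⟩ _ (clamp_mem ht τ) _ (clamp_mem hP ρ),
    fun M => ⟨K, hK, fun τ ρ ρ' _ _ _ => hlip τ ρ ρ'⟩⟩, hK, hlip⟩

theorem exists_isIntensity_clampedRate (hH : IsHamiltonian H t₀ T PL PR)
    (hf : IsKernel f t₀ T PL PR) (ht : t₀ ≤ T) (hP : PL ≤ PR) (x : ℝ) :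
    ∃ C, IsIntensity (clampedRate H f t₀ T PL PR x) PL PR C := by
  classical
  -- a continuous version of the density above the diagonal
  set g : (ℝ × ℝ) × ℝ → ℝ := fun z => f x (max t₀ (min z.1.1 T)) (max PL (min z.1.2 PR))
    (max (max PL (min z.1.2 PR)) (min z.2 PR)) with hg
  have hgc : Continuous g := by
    refine hf.cont.comp_continuous (f := fun z : (ℝ × ℝ) × ℝ => (x, max t₀ (min z.1.1 T),
      max PL (min z.1.2 PR), max (max PL (min z.1.2 PR)) (min z.2 PR))) (by fun_prop) fun z => ?_
    exact ⟨clamp_mem ht _, (clamp_mem hP _).1, le_max_left _ _,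
      max_le (clamp_mem hP _).2 (min_le_right _ _)⟩
  set v : (ℝ × ℝ) × ℝ → ℝ := fun z => (H x (max t₀ (min z.1.1 T)) z.2
    - H x (max t₀ (min z.1.1 T)) (max PL (min z.1.2 PR))) with hv
  have hvc : Continuous v := by
    have h1 := hH.contDiff_one.continuous
    exact (h1.comp (by fun_prop : Continuous fun z : (ℝ × ℝ) × ℝ =>
      (x, max t₀ (min z.1.1 T), z.2))).sub (h1.comp (by fun_prop : Continuous fun z : (ℝ × ℝ) × ℝ =>
      (x, max t₀ (min z.1.1 T), max PL (min z.1.2 PR))))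
  have heq : ∀ z : (ℝ × ℝ) × ℝ, clampedRate H f t₀ T PL PR x z.1.1 z.1.2 z.2
      = if max PL (min z.1.2 PR) < z.2 ∧ z.2 ≤ PR then
        v z / (z.2 - max PL (min z.1.2 PR)) * g z else 0 := by
    intro z
    rw [clampedRate]
    refine if_ctx_congr Iff.rfl (fun h => ?_) fun _ => rfl
    have h1 : z.2 - max PL (min z.1.2 PR) ≠ 0 := (sub_pos.2 h.1).ne'
    have h2 : max (max PL (min z.1.2 PR)) (min z.2 PR) = z.2 := clamp_eq ⟨h.1.le, h.2⟩
    simp only [hg, hv, h2]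
    rw [← speed_mul_sub, mul_div_cancel_right₀ _ h1]
  obtain ⟨V, hV, hVb⟩ := exists_abs_speed_le hH x x
  obtain ⟨Cf, hCf, hCfb⟩ := exists_box_bound (Γ := fun z : ℝ × ℝ × ℝ => g ((z.2.1, z.1), z.2.2))
    (hgc.comp (by fun_prop)) PL PR t₀ T PL PR
  refine ⟨V * Cf, ?_, fun τ ρ r => ?_, fun τ ρ r hr => ?_, fun τ ρ => ?_⟩
  · simp only [heq]
    refine Measurable.ite ?_ ((hvc.measurable.div (by fun_prop)).mul hgc.measurable)
      measurable_const
    exact (measurableSet_lt (by fun_prop) measurable_snd).inter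
      (measurableSet_le measurable_snd measurable_const)
  · rw [clampedRate]
    split_ifs with h
    · have hρ := clamp_mem hP ρ
      have hr : r ∈ Icc PL PR := ⟨hρ.1.trans h.1.le, h.2⟩
      rw [abs_mul]
      refine mul_le_mul (hVb x ⟨le_rfl, le_rfl⟩ _ (clamp_mem ht τ) _ hρ _ hr h.1.ne) ?_
        (abs_nonneg _) hV
      have h1 := hCfb _ hρ _ (clamp_mem ht τ) _ hr
      simp only [hg, clamp_eq (clamp_mem ht τ), clamp_eq hρ,
        clamp_eq (show r ∈ Icc (max PL (min ρ PR)) PR from ⟨h.1.le, h.2⟩)] at h1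
      exact h1
    · simpa using mul_nonneg hV hCf
  · rw [clampedRate, if_neg]
    exact fun h => hr ⟨(clamp_mem hP ρ).1.trans h.1.le, h.2⟩
  · have hcl : Continuous fun ρ' : ℝ => max PL (min ρ' PR) := continuous_clamp PL PR
    filter_upwards [Measure.ae_ne volume (max PL (min ρ PR))] with r hr
    have heq' : ∀ ρ', clampedRate H f t₀ T PL PR x τ ρ' r = _ := fun ρ' => heq ((τ, ρ'), r)
    simp only [heq']
    rcases lt_or_gt_of_ne hr with h | h
    · refine continuousAt_const.congr (f := fun _ => (0 : ℝ)) ?_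
      filter_upwards [(hcl.tendsto ρ).eventually (lt_mem_nhds h)] with ρ' hρ'
      rw [if_neg fun h' => absurd h'.1 hρ'.not_gt]
    · by_cases hrP : r ≤ PR
      · have hc : ContinuousAt (fun ρ' => v ((τ, ρ'), r) / (r - max PL (min ρ' PR))
            * g ((τ, ρ'), r)) ρ := by
          have hpair : Continuous fun ρ' : ℝ => (((τ, ρ'), r) : (ℝ × ℝ) × ℝ) := by fun_prop
          exact ((hvc.comp hpair).continuousAt.div (continuous_const.sub hcl).continuousAt
            (sub_pos.2 h).ne').mul (hgc.comp hpair).continuousAt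
        refine hc.congr ?_
        filter_upwards [(hcl.tendsto ρ).eventually (gt_mem_nhds h)] with ρ' hρ'
        rw [if_pos ⟨hρ', hrP⟩]
      · simp only [hrP, and_false, if_false]
        exact continuousAt_const

theorem clampedDrift_eq {x τ ρ : ℝ} (hτ : τ ∈ Icc t₀ T) (hρ : ρ ∈ Icc PL PR) :
    clampedDrift H b t₀ T PL PR x τ ρ = driftT H b x τ ρ := by
  rw [clampedDrift, clamp_eq hτ, clamp_eq hρ]

theorem clampedRate_eq (hf : IsKernel f t₀ T PL PR) {x τ ρ r : ℝ} (hτ : τ ∈ Icc t₀ T)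
    (hρ : ρ ∈ Icc PL PR) (hr : r ≠ ρ) :
    clampedRate H f t₀ T PL PR x τ ρ r = speed H x τ ρ r * f x τ ρ r := by
  rw [clampedRate, clamp_eq hτ, clamp_eq hρ]
  split_ifs with h
  · rfl
  · rw [hf.support x τ hτ ρ r fun h' => h ⟨lt_of_le_of_ne h'.2.1 hr.symm, h'.2.2⟩, mul_zero]

/-- The operator `A²` in terms of the extended coefficients. -/
theorem genTwo_eq (hf : IsKernel f t₀ T PL PR) {x τ ρ : ℝ} (hτ : τ ∈ Icc t₀ T)
    (hρ : ρ ∈ Icc PL PR) (ψ : ℝ → ℝ) :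
    genTwo H b f x τ ψ ρ = clampedDrift H b t₀ T PL PR x τ ρ * deriv ψ ρ
      + jumpRate (clampedRate H f t₀ T PL PR x) τ ψ ρ := by
  rw [genTwo, clampedDrift_eq hτ hρ, jumpRate, ← integral_indicator measurableSet_Ioi]
  congr 1
  refine integral_congr_ae ?_
  filter_upwards [Measure.ae_ne volume ρ] with r hr
  rw [clampedRate_eq hf hτ hρ hr]
  by_cases h : ρ < r
  · rw [indicator_of_mem (show r ∈ Ioi ρ from h)]
    ring
  · rw [indicator_of_notMem (show r ∉ Ioi ρ from h),
      hf.support x τ hτ ρ r fun h' => h (lt_of_le_of_ne h'.2.1 hr.symm)]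
    ring

theorem measurable_profile (hb : IsDrift H b t₀ T PL PR) {t : ℝ} (ht : t ∈ Icc t₀ T) (x : ℝ) :
    Measurable fun q : Config => profile b q t x := by
  classical
  refine fun A hA => MeasurableSpace.measurableSet_iInf.2 fun n => ?_
  suffices h : Measurable fun c : Fin (n + 1) → ℝ × ℝ => profile b ⟨n, c⟩ t x from h hA
  have hc := continuous_driftFlow_fixed_time hb ht
  have hi : ∀ j, Measurable fun c : Fin (n + 1) → ℝ × ℝ => c j := fun j => measurable_pi_apply j
  change Measurable fun c : Fin (n + 1) → ℝ × ℝ => ∑ i : Fin (n + 1),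
    if (c i).1 ≤ x ∧ ∀ j, i < j → x < (c j).1 then driftFlow b t (c i).1 (c i).2 x else 0
  refine Finset.measurable_fun_sum _ fun i _ => ?_
  refine Measurable.ite (p := fun c : Fin (n + 1) → ℝ × ℝ => (c i).1 ≤ x ∧ ∀ j, i < j → x < (c j).1)
    ?_ ?_ measurable_const
  · refine MeasurableSet.inter (measurableSet_le (hi i).fst measurable_const) ?_
    have : {c : Fin (n + 1) → ℝ × ℝ | ∀ j, i < j → x < (c j).1}
        = ⋂ (j : Fin (n + 1)) (_ : i < j), {c | x < (c j).1} := by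
      ext c
      simp
    change MeasurableSet {c : Fin (n + 1) → ℝ × ℝ | ∀ j, i < j → x < (c j).1}
    rw [this]
    exact MeasurableSet.iInter fun j => MeasurableSet.iInter fun _ =>
      measurableSet_lt measurable_const (hi j).fst
  · exact hc.measurable.comp ((hi i).fst.prodMk
      ((hi i).snd.prodMk measurable_const))

theorem IsJumpPath.congr_field {β β' : ℝ → ℝ → ℝ} {J : Finset ℝ} {m mL : ℝ → ℝ}
    (h : IsJumpPath β t₀ T PL PR J m mL)
    (hβ : ∀ τ ∈ Icc t₀ T, ∀ ρ ∈ Icc PL PR, β' τ ρ = β τ ρ) : IsJumpPath β' t₀ T PL PR J m mL := by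
  refine ⟨h.range, h.jump_mem, h.right, h.left, h.left_eq, ?_⟩
  obtain ⟨E, hE, hd⟩ := h.deriv
  exact ⟨E, hE, fun t ht => (hd t ht).congr_deriv
    (hβ t (Ioo_subset_Icc_self ht.1) _ (h.range t (Ioo_subset_Ico_self ht.1))).symm⟩

/-- The value at `a₊` of the random particle system is a jump process. -/
theorem IsParticleProcess.exists_isJumpProcess (hH : IsHamiltonian H t₀ T PL PR)
    (hb : IsDrift H b t₀ T PL PR) (hf : IsKernel f t₀ T PL PR) (ha : aL < aR) {Ω : Type u}
    [mΩ : MeasurableSpace Ω] {μ : Measure Ω} {F : Filtration (Ico t₀ T) mΩ} {q : ℝ → Ω → Config}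
    (hq : IsParticleProcess H b f aL aR t₀ T PL PR μ F q) :
    ∃ J mL, IsJumpProcess (clampedDrift H b t₀ T PL PR aR) (clampedRate H f t₀ T PL PR aR)
      t₀ T PL PR μ F J (fun t w => profile b (q t w) t aR) mL := by
  choose J mL hJ hN using fun w => (hq.path w).exists_isJumpPath hH hb ha
  refine ⟨J, mL, fun t => (measurable_profile hb (Ico_subset_Icc_self t.2) aR).comp (hq.adapted t),
    fun w => (hJ w).congr_field fun τ hτ ρ hρ => clampedDrift_eq hτ hρ, fun B hB => ?_⟩
  refine (congrArg (fun X => Martingale X F μ) (funext fun t => funext fun w => ?_)).mpr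
    (hq.rate B hB)
  refine congrArg₂ (· - ·) ?_ ?_
  · rw [hN w B t t.2.2]
  · refine intervalIntegral.integral_congr fun s hs => ?_
    rw [uIcc_of_le t.2.1] at hs
    have hs' : s ∈ Ico t₀ T := ⟨hs.1, hs.2.trans_lt t.2.2⟩
    refine setIntegral_congr_ae hB ?_
    filter_upwards [Measure.ae_ne volume (profile b (q s w) s aR)] with r hr _
    exact clampedRate_eq hf (Ico_subset_Icc_self hs') ((hJ w).range s hs') hr

/-- The value at `a₊` of the random particle system is a Markov process with generator `A²`. -/
theorem IsParticleProcess.isMarkovWithGenerator (hH : IsHamiltonian H t₀ T PL PR)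
    (hb : IsDrift H b t₀ T PL PR) (hf : IsKernel f t₀ T PL PR) (ha : aL < aR) (ht : t₀ < T)
    (hP : PL ≤ PR) {Ω : Type u} [mΩ : MeasurableSpace Ω] {μ : Measure Ω} [IsProbabilityMeasure μ]
    {F : Filtration (Ico t₀ T) mΩ} {q : ℝ → Ω → Config}
    (hq : IsParticleProcess H b f aL aR t₀ T PL PR μ F q) :
    IsMarkovWithGenerator (fun t => genTwo H b f aR t) μ F
      (fun t w => profile b (q t w) t aR) := by
  obtain ⟨J, mL, hm⟩ := hq.exists_isJumpProcess hH hb hf ha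
  obtain ⟨B, K, hβ, hK, hL⟩ := exists_isField_clampedDrift hH hb ht.le hP aR
  obtain ⟨C, hγ⟩ := exists_isIntensity_clampedRate hH hf ht.le hP aR
  refine ⟨hm.adapted, fun s t hst A hA => hm.markov hγ hP hβ hK hL hst hA, fun ψ hψ hψc => ?_⟩
  refine (congrArg (fun X => Martingale X F μ) (funext fun t => funext fun w => ?_)).mpr
    (hm.martingale hγ hP hβ.cont hβ.bdd hψ hψc)
  refine congrArg (ψ (profile b (q t w) t aR) - ·) ?_
  refine intervalIntegral.integral_congr fun s hs => ?_
  rw [uIcc_of_le t.2.1] at hs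
  have hs' : s ∈ Ico t₀ T := ⟨hs.1, hs.2.trans_lt t.2.2⟩
  exact genTwo_eq hf (Ico_subset_Icc_self hs') ((hm.path w).range s hs') ψ

end ParticleProcess

end ShockParticles

theorem proposition2p1
    (H : ℝ → ℝ → ℝ → ℝ) (aL aR t₀ T PL PR : ℝ)
    (ha : aL < aR) (ht : t₀ < T) (hP : PL ≤ PR)
    (hH : ShockParticles.IsHamiltonian H t₀ T PL PR) :
    (∀ (b : ℝ → ℝ → ℝ → ℝ), ShockParticles.IsDrift H b t₀ T PL PR →
      ∀ q : ℝ → ShockParticles.Config,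
        ShockParticles.IsParticlePath H b aL aR t₀ T PL PR q →
        ShockParticles.IsEntropySolution H aL aR t₀ T PL PR
          (fun x t => ShockParticles.profile b (q t) t x)) ∧
    (∀ (b : ℝ → ℝ → ℝ → ℝ) (f : ℝ → ℝ → ℝ → ℝ → ℝ),
      ShockParticles.IsDrift H b t₀ T PL PR → ShockParticles.IsKernel f t₀ T PL PR →
      ∀ (Ω : Type u) [mΩ : MeasurableSpace Ω] (μ : Measure Ω) [IsProbabilityMeasure μ]
        (F : Filtration (Set.Ico t₀ T) mΩ) (q : ℝ → Ω → ShockParticles.Config),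
        ShockParticles.IsParticleProcess H b f aL aR t₀ T PL PR μ F q →
        ShockParticles.IsMarkovWithGenerator
          (fun t => ShockParticles.genTwo H b f aR t) μ F
          (fun t w => ShockParticles.profile b (q t w) t aR)) ∧
    (∀ ρ ρ' : ℝ → ℝ → ℝ,
      (∀ x ∈ Set.Icc aL aR, ∀ t ∈ Set.Ico t₀ T, ρ x t ∈ Set.Icc PL PR) →
      (∀ x ∈ Set.Icc aL aR, ∀ t ∈ Set.Ico t₀ T, ρ' x t ∈ Set.Icc PL PR) →
      ShockParticles.IsPiecewiseC1 aL aR t₀ T ρ →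
      ShockParticles.IsPiecewiseC1 aL aR t₀ T ρ' →
      ShockParticles.IsEntropySolution H aL aR t₀ T PL PR ρ →
      ShockParticles.IsEntropySolution H aL aR t₀ T PL PR ρ' →
      ∀ s t : ℝ, t₀ ≤ s → s ≤ t → t < T →
        ∫ x in aL..aR, |ρ' x t - ρ x t| ≤
          Real.exp (ShockParticles.stabConst H aL aR t₀ T PL PR * (t - s)) *
            (∫ x in aL..aR, |ρ' x s - ρ x s|) +
          Real.exp (ShockParticles.stabConst H aL aR t₀ T PL PR * (t - s)) *
            (∫ θ in s..t, |H aR θ (ρ' aR θ) - H aR θ (ρ aR θ)|)) := by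
  refine ⟨fun b hb q hq => ShockParticles.isEntropySolution_of_isParticlePath ha hH hb hq, ?_, ?_⟩
  · intro b f hb hf Ω mΩ μ _ F q hq
    exact hq.isMarkovWithGenerator hH hb hf ha ht hP
  · intro ρ ρ' hr hr' hp hp' he he' s t hs hst htT
    have hexp : 1 ≤ Real.exp (ShockParticles.stabConst H aL aR t₀ T PL PR * (t - s)) :=
      Real.one_le_exp (mul_nonneg ShockParticles.stabConst_nonneg (sub_nonneg.2 hst))
    have h1 : 0 ≤ ∫ x in aL..aR, |ρ' x s - ρ x s| :=
      intervalIntegral.integral_nonneg ha.le fun _ _ => abs_nonneg _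
    have h2 : 0 ≤ ∫ θ in s..t, |H aR θ (ρ' aR θ) - H aR θ (ρ aR θ)| :=
      intervalIntegral.integral_nonneg hst fun _ _ => abs_nonneg _
    refine le_trans ?_ (add_le_add (le_mul_of_one_le_left h1 hexp)
      (le_mul_of_one_le_left h2 hexp))
    rcases hst.eq_or_lt with h | h
    · subst h
      simp
    · exact ShockParticles.stability ha hP hH hr hr' hp hp' he he' hs h htT
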